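/- Let $d\ge 1$, let $\mathcal O\subset \mathbf R^d\times\mathbf R$ be open and connected and let $h>0$. Call $\eta\in W^{1,\infty}(\mathbf R^d;\mathbf R)$ (identified with its bounded Lipschitz representative) admissible if $\{(x,y): \eta(x)-h<y<\eta(x)\}\subset\mathcal O$, and put $\Omega_\eta=\{(x,y)\in\mathcal O: y<\eta(x)\}$. For $\eta$ admissible and $f\in H^{1/2}(\mathbf R^d)$ let $\phi$ be the variational solution of $\Delta_{x,y}\phi=0$ in $\Omega_\eta$, $\phi|_{y=\eta}=f$, $\partial_n\phi=0$ on the rest of $\partial\Omega_\eta$; that is, $\nabla_{x,y}\phi\in L^2(\Omega_\eta)$, $\phi$ has trace $f$ on $\{y=\eta(x)\}$, and $\int_{\Omega_\eta}\nabla\phi\cdot\nabla\theta=0$ for all $\theta$ with $\nabla\theta\in L^2(\Omega_\eta)$ and trace $0$ on $\{y=\eta(x)\}$. Let $G(\eta)f=\sqrt{1+|\nabla\eta|^2}\,\partial_n\phi|_{y=\eta}\in H^{-1/2}(\mathbf R^d)$, the normal derivative being taken in the weak sense $\langle G(\eta)f,\chi\rangle=\int_{\Omega_\eta}\nabla\phi\cdot\nabla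 w$ for every Schwartz function $\chi$ on $\mathbf R^d$ and every $w$ with $\nabla w\in L^2(\Omega_\eta)$ and trace $\chi$ on $\{y=\eta(x)\}$. Put $$B(\eta)\psi=\frac{G(\eta)\psi+\nabla\eta\cdot\nabla\psi}{1+|\nabla\eta|^2},\qquad V(\eta)\psi=\nabla\psi-(B(\eta)\psi)\nabla\eta ,$$ where the product of a function $a$ with $b\in H^{-1/2}(\mathbf R^d)$ is defined by $\langle ab,\chi\rangle=\langle b,a\chi\rangle$ (duality bracket of $H^{-1/2}$ and $H^{1/2}$). Then the following hold. (i) For every admissible $\eta$ and every $f\in H^{1/2}(\mathbf R^d)$, $G(\eta)f$ exists and is unique. (ii) There exists a non-decreasing function $\mathcal F\colon\mathbf R_+\to\mathbf R_+$ such that, for all admissible $\eta_1,\eta_2$ and all $f\in H^{1/2}(\mathbf R^d)$, $$\|(G(\eta_1)-G(\eta_2))f\|_{H^{-1/2}}\le \mathcal F\bigl(\|(\eta_1,\eta_2)\|_{W^{1,\infty}\times W^{1,\infty}}\bigr)\,\|\eta_1-\eta_2\|_{W^{1,\infty}}\,\|f\|_{H^{1/2}} .$$ (iii) Let $s>\frac12+\frac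 d2$, let $\eta,\psi\in H^{s+1/2}(\mathbf R^d)$, and let $(\eta_n)$, $(\psi_n)$ be bounded sequences in $H^{s+1/2}(\mathbf R^d)$, with $\eta$ and all $\eta_n$ admissible, such that $\eta_n\to\eta$ in $W^{1,\infty}(\mathbf R^d)$ and $\psi_n\to\psi$ in $H^{1/2}(\mathbf R^d)$. Then all the products in the definitions of $B(\eta)\psi$, $V(\eta)\psi$, $B(\eta_n)\psi_n$ and $V(\eta_n)\psi_n$ exist, and $G(\eta_n)\psi_n\to G(\eta)\psi$, $B(\eta_n)\psi_n\to B(\eta)\psi$ and $V(\eta_n)\psi_n\to V(\eta)\psi$ in $H^{-1/2}(\mathbf R^d)$. -/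

import Mathlib

open MeasureTheory Filter Topology TemperedDistribution
open scoped SchwartzMap LineDeriv ENNReal NNReal

namespace WaterWaves

/-- The horizontal space `ℝ^d` with its Euclidean norm. -/
abbrev Hor (d : ℕ) : Type := EuclideanSpace ℝ (Fin d)

/-- The space `L²(ℝ^d; ℂ)`. -/
abbrev L2 (d : ℕ) : Type := Lp ℂ 2 (volume : Measure (Hor d))

/-- The `i`-th vector of the canonical basis of `ℝ^d`. -/
noncomputable def basisVec {d : ℕ} (i : Fin d) : Hor d := EuclideanSpace.single i 1

/-! ### Norms -/

/-- The `H^s(ℝ^d)` norm of a tempered distribution `T`, namely the `L²` norm of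
`(1 + |D|²)^{s/2} T`; it is `∞` exactly when `T` is not in `H^s`. -/
noncomputable def hsENorm {d : ℕ} (s : ℝ) (T : 𝓢'(Hor d, ℂ)) : ℝ≥0∞ :=
  ⨅ (g : L2 d) (_ : besselPotential (Hor d) ℂ s T = (g : 𝓢'(Hor d, ℂ))), ‖g‖ₑ

/-- The `H^s(ℝ^d)` norm, `s ≥ 0`, of a real valued function; it is `∞` exactly when the function
is not in `H^s`. -/
noncomputable def hsENormFun {d : ℕ} (s : ℝ) (u : Hor d → ℝ) : ℝ≥0∞ :=
  ⨅ (v : L2 d) (_ : v =ᵐ[volume] fun x => (u x : ℂ)), hsENorm s (v : 𝓢'(Hor d, ℂ))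

/-- `W^{1,∞}(ℝ^d)`, through continuous representatives: the bounded Lipschitz functions. -/
def MemW1inf {d : ℕ} (η : Hor d → ℝ) : Prop :=
  (∃ C : ℝ, ∀ x, |η x| ≤ C) ∧ ∃ K : ℝ≥0, LipschitzWith K η

/-- The `W^{1,∞}` norm `‖η‖_{L^∞} + ‖∇η‖_{L^∞}`; a Lipschitz function is differentiable almost
everywhere, and its almost everywhere gradient is its weak gradient. -/
noncomputable def w1infNorm {d : ℕ} (η : Hor d → ℝ) : ℝ≥0 :=
  (eLpNorm η ⊤ volume + eLpNorm (fun x => fderiv ℝ η x) ⊤ volume).toNNReal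

/-! ### The fluid domain -/

/-- The fluid domain: the part of `O` below the graph of `η`. -/
def fluidDomain {d : ℕ} (O : Set (Hor d × ℝ)) (η : Hor d → ℝ) : Set (Hor d × ℝ) :=
  {z | z ∈ O ∧ z.2 < η z.1}

/-- The open strip of height `h` below the graph of `η`. -/
def stripBelow {d : ℕ} (η : Hor d → ℝ) (h : ℝ) : Set (Hor d × ℝ) :=
  {z | η z.1 - h < z.2 ∧ z.2 < η z.1}

/-! ### Functions of finite energy -/

/-- `p` is the weak derivative of `u` in the direction `v` on the open set `Ω`. -/
def HasWeakDeriv {d : ℕ} (Ω : Set (Hor d × ℝ)) (u : Hor d × ℝ → ℂ) (v : Hor d × ℝ)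
    (p : Hor d × ℝ → ℂ) : Prop :=
  LocallyIntegrableOn u Ω volume ∧ LocallyIntegrableOn p Ω volume ∧
  ∀ χ : Hor d × ℝ → ℝ, ContDiff ℝ ((⊤ : ℕ∞) : WithTop ℕ∞) χ → HasCompactSupport χ →
    tsupport χ ⊆ Ω →
    ∫ z in Ω, ((fderiv ℝ χ z v : ℝ) : ℂ) * u z = - ∫ z in Ω, ((χ z : ℝ) : ℂ) * p z

/-- Values of gradients: the horizontal part in `ℂ^d` and the vertical part in `ℂ`. -/
abbrev GradVal (d : ℕ) : Type := EuclideanSpace ℂ (Fin d) × ℂ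

/-- The (bilinear) dot product of two gradients. -/
noncomputable def gradDot {d : ℕ} (p q : GradVal d) : ℂ :=
  (∑ i, p.1 i * q.1 i) + p.2 * q.2

/-- `u` is a function of finite energy on `Ω`: it has the weak gradient
`U = (∇_x u, ∂_y u)`, and this gradient is square integrable on `Ω`. -/
def HasFiniteEnergyGrad {d : ℕ} (Ω : Set (Hor d × ℝ)) (u : Hor d × ℝ → ℂ)
    (U : Hor d × ℝ → GradVal d) : Prop :=
  (∀ i, HasWeakDeriv Ω u (basisVec i, 0) (fun z => (U z).1 i)) ∧
  HasWeakDeriv Ω u (0, 1) (fun z => (U z).2) ∧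
  MemLp U 2 (volume.restrict Ω)

/-- `u` has the trace `f` on the graph of `η`: the mean over `0 < t < ε` of the squared `L²(ℝ^d)`
distance between `x ↦ u (x, η x - t)` and `f` tends to `0` with `ε`. -/
def HasTrace {d : ℕ} (η : Hor d → ℝ) (u : Hor d × ℝ → ℂ) (f : Hor d → ℂ) : Prop :=
  Tendsto (fun ε : ℝ => (∫⁻ z in stripBelow η ε, ‖u z - f z.1‖ₑ ^ 2) / ENNReal.ofReal ε)
    (𝓝[>] 0) (𝓝 0)

/-! ### The Dirichlet-Neumann operator -/

/-- `φ`, of gradient `Φ`, is the variational solution of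
`Δ φ = 0` in `Ω`, `φ = f` on the free surface `y = η`, `∂_n φ = 0` on the rest of the boundary:
it has finite energy and trace `f`, and its gradient is orthogonal to the gradients of all
functions of finite energy that vanish on the free surface. -/
def IsVariationalSolution {d : ℕ} (O : Set (Hor d × ℝ)) (η : Hor d → ℝ) (f : Hor d → ℂ)
    (φ : Hor d × ℝ → ℂ) (Φ : Hor d × ℝ → GradVal d) : Prop :=
  HasFiniteEnergyGrad (fluidDomain O η) φ Φ ∧ HasTrace η φ f ∧
  ∀ θ Θ, HasFiniteEnergyGrad (fluidDomain O η) θ Θ → HasTrace η θ 0 →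
    ∫ z in fluidDomain O η, gradDot (Φ z) (Θ z) = 0

/-- `g` is `√(1 + |∇η|²) ∂_n φ` on the free surface, as an element of `H^{-1/2}(ℝ^d)`, where `φ` is
the variational solution with trace `f`. As the surface measure is `√(1 + |∇η|²) dx`, Green's
formula gives this normal derivative its usual weak meaning: `⟨g, χ⟩ = ∫_Ω ∇φ · ∇w` for every
test function `χ` and every function `w` of finite energy with trace `χ`. -/
def IsDirichletNeumann {d : ℕ} (O : Set (Hor d × ℝ)) (η : Hor d → ℝ) (f : L2 d)
    (g : 𝓢'(Hor d, ℂ)) : Prop :=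
  MemSobolev (-1 / 2) 2 g ∧
  ∃ φ Φ, IsVariationalSolution O η f φ Φ ∧
    ∀ (χ : 𝓢(Hor d, ℂ)) (w : Hor d × ℝ → ℂ) (W : Hor d × ℝ → GradVal d),
      HasFiniteEnergyGrad (fluidDomain O η) w W → HasTrace η w χ →
      g χ = ∫ z in fluidDomain O η, gradDot (Φ z) (W z)

open Classical in
/-- The Dirichlet-Neumann operator `G(η) f` of the domain below the graph of `η` in `O`. -/
noncomputable def dirichletNeumann {d : ℕ} (O : Set (Hor d × ℝ)) (η : Hor d → ℝ) (f : L2 d) :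
    𝓢'(Hor d, ℂ) :=
  if hg : ∃ g, IsDirichletNeumann O η f g then hg.choose else 0

/-! ### Products and the traces of the velocity -/

/-- `c` is the product of the function `a` with `b ∈ H^{-1/2}(ℝ^d)`, defined by duality:
`⟨c, χ⟩ = ⟨b, a χ⟩`, where `a χ ∈ H^{1/2}` and the duality bracket between `H^{-1/2}` and
`H^{1/2}` is `⟨b, v⟩ = ∫ (⟨D⟩^{-1/2} b) (⟨D⟩^{1/2} v) dx`. -/
def IsProduct {d : ℕ} (a : Hor d → ℝ) (b c : 𝓢'(Hor d, ℂ)) : Prop :=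
  ∀ χ : 𝓢(Hor d, ℂ), ∃ v v' b' : L2 d,
    (v =ᵐ[volume] fun x => (a x : ℂ) * χ x) ∧
    besselPotential (Hor d) ℂ (1 / 2) (v : 𝓢'(Hor d, ℂ)) = (v' : 𝓢'(Hor d, ℂ)) ∧
    besselPotential (Hor d) ℂ (-1 / 2) b = (b' : 𝓢'(Hor d, ℂ)) ∧
    c χ = ∫ x, b' x * v' x

open Classical in
/-- The product of the function `a` with `b ∈ H^{-1/2}(ℝ^d)`. -/
noncomputable def mulDist {d : ℕ} (a : Hor d → ℝ) (b : 𝓢'(Hor d, ℂ)) : 𝓢'(Hor d, ℂ) :=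
  if hc : ∃ c, IsProduct a b c then hc.choose else 0

/-- The partial derivative `∂_i η`. -/
noncomputable def partialD {d : ℕ} (η : Hor d → ℝ) (i : Fin d) (x : Hor d) : ℝ :=
  fderiv ℝ η x (basisVec i)

/-- The function `1 / (1 + |∇η|²)`. -/
noncomputable def slopeWeight {d : ℕ} (η : Hor d → ℝ) (x : Hor d) : ℝ :=
  1 / (1 + ∑ i, partialD η i x ^ 2)

/-- The distribution `∂_i ψ`. -/
noncomputable def distD {d : ℕ} (ψ : L2 d) (i : Fin d) : 𝓢'(Hor d, ℂ) :=
  ∂_{basisVec i} (ψ : 𝓢'(Hor d, ℂ))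

/-- `G(η)ψ + ∇η · ∇ψ`. -/
noncomputable def numerB {d : ℕ} (O : Set (Hor d × ℝ)) (η : Hor d → ℝ) (ψ : L2 d) :
    𝓢'(Hor d, ℂ) :=
  dirichletNeumann O η ψ + ∑ i, mulDist (partialD η i) (distD ψ i)

/-- `B(η)ψ = (G(η)ψ + ∇η · ∇ψ) / (1 + |∇η|²)`. -/
noncomputable def traceB {d : ℕ} (O : Set (Hor d × ℝ)) (η : Hor d → ℝ) (ψ : L2 d) :
    𝓢'(Hor d, ℂ) :=
  mulDist (slopeWeight η) (numerB O η ψ)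

/-- The `i`-th component of `V(η)ψ = ∇ψ - (B(η)ψ) ∇η`. -/
noncomputable def traceV {d : ℕ} (O : Set (Hor d × ℝ)) (η : Hor d → ℝ) (ψ : L2 d) (i : Fin d) :
    𝓢'(Hor d, ℂ) :=
  distD ψ i - mulDist (partialD η i) (traceB O η ψ)

/-- All the products that enter `B(η)ψ` and `V(η)ψ` exist, as products of functions with elements
of `H^{-1/2}(ℝ^d)`. -/
def ProductsExist {d : ℕ} (O : Set (Hor d × ℝ)) (η : Hor d → ℝ) (ψ : L2 d) : Prop :=
  (∀ i, ∃ c, IsProduct (partialD η i) (distD ψ i) c) ∧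
  (∃ c, IsProduct (slopeWeight η) (numerB O η ψ) c) ∧
  ∀ i, ∃ c, IsProduct (partialD η i) (traceB O η ψ) c

end WaterWaves

open WaterWaves

namespace WaterWaves

/-! ### Weak derivatives -/

instance isAddHaarMeasure_volume_prod (d : ℕ) :
    (volume : Measure (Hor d × ℝ)).IsAddHaarMeasure :=
  inferInstanceAs ((volume : Measure (Hor d)).prod (volume : Measure ℝ)).IsAddHaarMeasure

section General

variable {E : Type*} [NormedAddCommGroup E] [MeasurableSpace E] {μ : Measure E}

lemma sq_lintegral_le {α : Type*} [MeasurableSpace α] {ν : Measure α} {f : α → ℝ≥0∞}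
    (hf : AEMeasurable f ν) : (∫⁻ a, f a ∂ν) ^ 2 ≤ ν Set.univ * ∫⁻ a, f a ^ 2 ∂ν := by
  have h := ENNReal.lintegral_mul_le_Lp_mul_Lq ν (Real.HolderConjugate.two_two)
    (aemeasurable_const (b := (1 : ℝ≥0∞))) hf
  simp only [Pi.mul_apply, one_mul, ENNReal.one_rpow, lintegral_const] at h
  have key : ∀ a : ℝ≥0∞, (a ^ (1 / (2 : ℝ))) ^ 2 = a := fun a => by
    rw [← ENNReal.rpow_natCast, ← ENNReal.rpow_mul]; norm_num
  calc (∫⁻ a, f a ∂ν) ^ 2 ≤ _ := pow_le_pow_left' h 2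
    _ = _ := by rw [mul_pow, key, key]; norm_num

lemma sq_enorm_integral_le {α F : Type*} [MeasurableSpace α] {ν : Measure α}
    [NormedAddCommGroup F] [NormedSpace ℝ F] {f : α → F}
    (hf : AEStronglyMeasurable f ν) :
    ‖∫ a, f a ∂ν‖ₑ ^ 2 ≤ ν Set.univ * ∫⁻ a, ‖f a‖ₑ ^ 2 ∂ν :=
  (pow_le_pow_left' (enorm_integral_le_lintegral_enorm f) 2).trans (sq_lintegral_le hf.enorm)

lemma enorm_add_sq_le {F : Type*} [NormedAddCommGroup F] (a b : F) :
    ‖a + b‖ₑ ^ 2 ≤ 2 * ‖a‖ₑ ^ 2 + 2 * ‖b‖ₑ ^ 2 := by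
  have h : ‖a + b‖ ^ 2 ≤ 2 * ‖a‖ ^ 2 + 2 * ‖b‖ ^ 2 := by
    have := norm_add_le a b
    nlinarith [norm_nonneg (a + b), norm_nonneg a, norm_nonneg b, sq_nonneg (‖a‖ - ‖b‖)]
  have h' := ENNReal.ofReal_le_ofReal h
  rw [ENNReal.ofReal_add (by positivity) (by positivity), ENNReal.ofReal_mul (by norm_num),
    ENNReal.ofReal_mul (by norm_num), ENNReal.ofReal_pow (norm_nonneg _),
    ENNReal.ofReal_pow (norm_nonneg _), ENNReal.ofReal_pow (norm_nonneg _), ofReal_norm,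
    ofReal_norm, ofReal_norm] at h'
  simpa using h'

lemma enorm_sub_sq_le {F : Type*} [NormedAddCommGroup F] (a b : F) :
    ‖a - b‖ₑ ^ 2 ≤ 2 * ‖a‖ₑ ^ 2 + 2 * ‖b‖ₑ ^ 2 := by
  simpa [sub_eq_add_neg] using enorm_add_sq_le a (-b)

/-- A bounded function supported in a compact subset of `Ω` times a locally integrable function
on `Ω` is integrable. -/
lemma integrable_mul_of_support {Ω K : Set E} (hK : IsCompact K) (hKΩ : K ⊆ Ω) {u : E → ℂ}
    (hu : LocallyIntegrableOn u Ω μ) {c : E → ℝ} (hc : AEStronglyMeasurable c μ) {C : ℝ}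
    (hC : ∀ z, |c z| ≤ C) (hs : ∀ z, z ∉ K → c z = 0) :
    Integrable (fun z => (c z : ℂ) * u z) μ := by
  have h1 : IntegrableOn u K μ := hu.integrableOn_compact_subset hKΩ hK
  have h2 : IntegrableOn (fun z => (c z : ℂ) * u z) K μ := by
    refine Integrable.bdd_mul (c := C) h1 ?_ ?_
    · exact (Complex.continuous_ofReal.comp_aestronglyMeasurable hc).restrict
    · exact ae_of_all _ fun z => by simpa using hC z
  refine (integrableOn_iff_integrable_of_support_subset ?_).1 h2
  intro z hz
  by_contra hzK
  exact hz (by simp [hs z hzK])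

lemma integrable_mul_of_tsupport [BorelSpace E] {Ω : Set E} {u : E → ℂ}
    (hu : LocallyIntegrableOn u Ω μ) {c : E → ℝ} (hc : Continuous c)
    (hcs : HasCompactSupport c) (hs : tsupport c ⊆ Ω) :
    Integrable (fun z => (c z : ℂ) * u z) μ := by
  obtain ⟨C, hC⟩ := hcs.exists_bound_of_continuous hc
  exact integrable_mul_of_support hcs hs hu hc.aestronglyMeasurable hC
    fun z hz => image_eq_zero_of_notMem_tsupport hz

lemma setIntegral_mul_eq {Ω : Set E} {u : E → ℂ} {c : E → ℝ} (hs : tsupport c ⊆ Ω) :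
    ∫ z in Ω, (c z : ℂ) * u z ∂μ = ∫ z, (c z : ℂ) * u z ∂μ :=
  setIntegral_eq_integral_of_forall_compl_eq_zero fun z hz => by
    simp [image_eq_zero_of_notMem_tsupport fun h => hz (hs h)]

end General

variable {d : ℕ}

lemma tsupport_fderiv_apply_subset' {E : Type*} [NormedAddCommGroup E] [NormedSpace ℝ E]
    (χ : E → ℝ) (v : E) : tsupport (fun z => fderiv ℝ χ z v) ⊆ tsupport χ :=
  (closure_mono fun z hz => by
    by_contra h
    exact hz (by simp [Function.notMem_support.1 h])).trans (tsupport_fderiv_subset ℝ)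

lemma continuous_fderiv_apply' {E : Type*} [NormedAddCommGroup E] [NormedSpace ℝ E]
    {χ : E → ℝ} (h : ContDiff ℝ ((⊤ : ℕ∞) : WithTop ℕ∞) χ) (v : E) :
    Continuous fun z => fderiv ℝ χ z v :=
  (h.continuous_fderiv (by simp)).clm_apply continuous_const

lemma hasCompactSupport_fderiv_apply' {E : Type*} [NormedAddCommGroup E] [NormedSpace ℝ E]
    {χ : E → ℝ} (h : HasCompactSupport χ) (v : E) :
    HasCompactSupport fun z => fderiv ℝ χ z v :=
  h.of_isClosed_subset (isClosed_tsupport _) (tsupport_fderiv_apply_subset' χ v)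

lemma hasWeakDeriv_iff {Ω : Set (Hor d × ℝ)} {u p : Hor d × ℝ → ℂ} {v : Hor d × ℝ} :
    HasWeakDeriv Ω u v p ↔ LocallyIntegrableOn u Ω volume ∧ LocallyIntegrableOn p Ω volume ∧
      ∀ χ : Hor d × ℝ → ℝ, ContDiff ℝ ((⊤ : ℕ∞) : WithTop ℕ∞) χ → HasCompactSupport χ →
        tsupport χ ⊆ Ω →
        ∫ z, ((fderiv ℝ χ z v : ℝ) : ℂ) * u z = - ∫ z, ((χ z : ℝ) : ℂ) * p z := by
  refine and_congr_right fun _ => and_congr_right fun _ => forall_congr' fun χ =>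
    forall_congr' fun h1 => forall_congr' fun h2 => forall_congr' fun h3 => ?_
  rw [setIntegral_mul_eq h3, setIntegral_mul_eq ((tsupport_fderiv_apply_subset' χ v).trans h3)]

namespace HasWeakDeriv

variable {Ω : Set (Hor d × ℝ)} {u u' p p' : Hor d × ℝ → ℂ} {v v' : Hor d × ℝ}

lemma integrable_test (h : HasWeakDeriv Ω u v p) {χ : Hor d × ℝ → ℝ}
    (h1 : ContDiff ℝ ((⊤ : ℕ∞) : WithTop ℕ∞) χ) (h2 : HasCompactSupport χ) (h3 : tsupport χ ⊆ Ω)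
    (w : Hor d × ℝ) :
    Integrable (fun z => ((fderiv ℝ χ z w : ℝ) : ℂ) * u z) ∧
      Integrable fun z => ((χ z : ℝ) : ℂ) * p z :=
  ⟨integrable_mul_of_tsupport h.1 (continuous_fderiv_apply' h1 w)
    (hasCompactSupport_fderiv_apply' h2 w) ((tsupport_fderiv_apply_subset' χ w).trans h3),
   integrable_mul_of_tsupport h.2.1 h1.continuous h2 h3⟩

lemma add (h : HasWeakDeriv Ω u v p) (h' : HasWeakDeriv Ω u' v p') :
    HasWeakDeriv Ω (u + u') v (p + p') := by
  refine hasWeakDeriv_iff.2 ⟨h.1.add h'.1, h.2.1.add h'.2.1, fun χ h1 h2 h3 => ?_⟩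
  have e := (hasWeakDeriv_iff.1 h).2.2 χ h1 h2 h3
  have e' := (hasWeakDeriv_iff.1 h').2.2 χ h1 h2 h3
  have i := h.integrable_test h1 h2 h3 v
  have i' := h'.integrable_test h1 h2 h3 v
  simp only [Pi.add_apply, mul_add]
  rw [integral_add i.1 i'.1, integral_add i.2 i'.2, e, e']
  ring

lemma smul (h : HasWeakDeriv Ω u v p) (c : ℂ) : HasWeakDeriv Ω (c • u) v (c • p) := by
  refine hasWeakDeriv_iff.2 ⟨h.1.smul c, h.2.1.smul c, fun χ h1 h2 h3 => ?_⟩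
  have e := (hasWeakDeriv_iff.1 h).2.2 χ h1 h2 h3
  simp only [Pi.smul_apply, smul_eq_mul, mul_left_comm _ c]
  rw [integral_const_mul, integral_const_mul, e, mul_neg]

lemma neg (h : HasWeakDeriv Ω u v p) : HasWeakDeriv Ω (-u) v (-p) := by
  simpa using h.smul (-1)

lemma sub (h : HasWeakDeriv Ω u v p) (h' : HasWeakDeriv Ω u' v p') :
    HasWeakDeriv Ω (u - u') v (p - p') := by
  simpa [sub_eq_add_neg] using h.add h'.neg

lemma conj (h : HasWeakDeriv Ω u v p) :
    HasWeakDeriv Ω (fun z => (starRingEnd ℂ) (u z)) v (fun z => (starRingEnd ℂ) (p z)) := by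
  have hc : ∀ {q : Hor d × ℝ → ℂ}, LocallyIntegrableOn q Ω volume →
      LocallyIntegrableOn (fun z => (starRingEnd ℂ) (q z)) Ω volume := by
    intro q hq z hz
    obtain ⟨s, hs, hi⟩ := hq z hz
    exact ⟨s, hs, (Complex.conjCLE.toContinuousLinearMap).integrable_comp hi⟩
  refine hasWeakDeriv_iff.2 ⟨hc h.1, hc h.2.1, fun χ h1 h2 h3 => ?_⟩
  have e := congrArg (starRingEnd ℂ) ((hasWeakDeriv_iff.1 h).2.2 χ h1 h2 h3)
  rw [map_neg, ← integral_conj, ← integral_conj] at e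
  simpa using e

lemma mono {Ω' : Set (Hor d × ℝ)} (h : HasWeakDeriv Ω u v p) (hs : Ω' ⊆ Ω) :
    HasWeakDeriv Ω' u v p := by
  rw [hasWeakDeriv_iff] at h ⊢
  exact ⟨h.1.mono_set hs, h.2.1.mono_set hs, fun χ h1 h2 h3 => h.2.2 χ h1 h2 (h3.trans hs)⟩

lemma dir_add (h : HasWeakDeriv Ω u v p) (h' : HasWeakDeriv Ω u v' p') :
    HasWeakDeriv Ω u (v + v') (p + p') := by
  refine hasWeakDeriv_iff.2 ⟨h.1, h.2.1.add h'.2.1, fun χ h1 h2 h3 => ?_⟩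
  have e := (hasWeakDeriv_iff.1 h).2.2 χ h1 h2 h3
  have e' := (hasWeakDeriv_iff.1 h').2.2 χ h1 h2 h3
  have i := h.integrable_test h1 h2 h3 v
  have i' := h'.integrable_test h1 h2 h3 v'
  simp only [Pi.add_apply, mul_add, map_add, Complex.ofReal_add, add_mul]
  rw [integral_add i.1 i'.1, integral_add i.2 i'.2, e, e']
  ring

lemma dir_smul (h : HasWeakDeriv Ω u v p) (c : ℝ) :
    HasWeakDeriv Ω u (c • v) (fun z => (c : ℂ) * p z) := by
  refine hasWeakDeriv_iff.2 ⟨h.1, h.2.1.smul (c : ℂ), fun χ h1 h2 h3 => ?_⟩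
  have e := (hasWeakDeriv_iff.1 h).2.2 χ h1 h2 h3
  simp only [map_smul, smul_eq_mul, Complex.ofReal_mul, mul_assoc, mul_left_comm _ (c : ℂ)]
  rw [integral_const_mul, integral_const_mul, e, mul_neg]

lemma dir_zero (h : LocallyIntegrableOn u Ω volume) : HasWeakDeriv Ω u 0 0 := by
  refine hasWeakDeriv_iff.2 ⟨h, (locallyIntegrable_zero).locallyIntegrableOn _, ?_⟩
  intro χ _ _ _
  simp

lemma dir_sum {ι : Type*} (s : Finset ι) {v : ι → Hor d × ℝ} {p : ι → Hor d × ℝ → ℂ}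
    (h0 : LocallyIntegrableOn u Ω volume)
    (h : ∀ i ∈ s, HasWeakDeriv Ω u (v i) (p i)) :
    HasWeakDeriv Ω u (∑ i ∈ s, v i) (∑ i ∈ s, p i) := by
  classical
  induction s using Finset.induction_on with
  | empty => simpa using dir_zero h0
  | insert a s ha ih =>
    rw [Finset.sum_insert ha, Finset.sum_insert ha]
    exact (h a (by simp)).dir_add (ih fun i hi => h i (by simp [hi]))

lemma congr_ae (hΩ : IsOpen Ω) (h : HasWeakDeriv Ω u v p) (hu : u =ᵐ[volume.restrict Ω] u')
    (hp : p =ᵐ[volume.restrict Ω] p') : HasWeakDeriv Ω u' v p' := by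
  have hl : ∀ {q q' : Hor d × ℝ → ℂ}, q =ᵐ[volume.restrict Ω] q' →
      LocallyIntegrableOn q Ω volume → LocallyIntegrableOn q' Ω volume := by
    intro q q' hqq hq
    rw [locallyIntegrableOn_iff hΩ.isLocallyClosed] at hq ⊢
    exact fun K hK hKc => (hq K hK hKc).congr_fun_ae (ae_restrict_of_ae_restrict_of_subset hK hqq)
  refine ⟨hl hu h.1, hl hp h.2.1, fun χ h1 h2 h3 => ?_⟩
  have e := h.2.2 χ h1 h2 h3
  rw [integral_congr_ae (f := fun z => ((fderiv ℝ χ z v : ℝ) : ℂ) * u z)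
      (g := fun z => ((fderiv ℝ χ z v : ℝ) : ℂ) * u' z),
    integral_congr_ae (f := fun z => ((χ z : ℝ) : ℂ) * p z)
      (g := fun z => ((χ z : ℝ) : ℂ) * p' z)] at e
  · exact e
  · filter_upwards [hp] with z hz; rw [hz]
  · filter_upwards [hu] with z hz; rw [hz]

end HasWeakDeriv

end WaterWaves

namespace WaterWaves

variable {d : ℕ}

/-! ### Translations along segments -/

lemma isOpen_segment_set {Ω : Set (Hor d × ℝ)} (hΩ : IsOpen Ω) (v : Hor d × ℝ) :
    IsOpen {z | ∀ s ∈ Set.Icc (0 : ℝ) 1, z + s • v ∈ Ω} := by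
  rw [isOpen_iff_eventually]
  intro z hz
  refine isCompact_Icc.eventually_forall_of_forall_eventually fun s hs => ?_
  have hc : Continuous fun q : (Hor d × ℝ) × ℝ => q.1 + q.2 • v := by fun_prop
  exact hc.continuousAt.eventually (hΩ.mem_nhds (hz s hs))

lemma isCompact_segment_image {K : Set (Hor d × ℝ)} (hK : IsCompact K) (v : Hor d × ℝ) :
    IsCompact ((fun q : (Hor d × ℝ) × ℝ => q.1 + q.2 • v) '' (K ×ˢ Set.Icc (0 : ℝ) 1)) :=
  (hK.prod isCompact_Icc).image (by fun_prop)

lemma integrable_segment {p : Hor d × ℝ → ℂ} (hp : Measurable p) (v : Hor d × ℝ)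
    {K : Set (Hor d × ℝ)} (hK : MeasurableSet K) {L : Set (Hor d × ℝ)}
    (hKL : ∀ z ∈ K, ∀ s ∈ Set.Icc (0 : ℝ) 1, z + s • v ∈ L) (hL : IntegrableOn p L volume) :
    Integrable (fun q : (Hor d × ℝ) × ℝ => p (q.1 + q.2 • v))
      ((volume.restrict K).prod (volume.restrict (Set.Ioc (0 : ℝ) 1))) := by
  have hm : Measurable fun q : (Hor d × ℝ) × ℝ => p (q.1 + q.2 • v) :=
    hp.comp (by fun_prop)
  refine ⟨hm.aestronglyMeasurable, ?_⟩
  rw [HasFiniteIntegral, lintegral_prod_symm _ hm.enorm.aemeasurable]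
  have key : ∀ s ∈ Set.Ioc (0 : ℝ) 1, ∫⁻ z in K, ‖p (z + s • v)‖ₑ ≤ ∫⁻ z in L, ‖p z‖ₑ := by
    intro s hs
    calc ∫⁻ z in K, ‖p (z + s • v)‖ₑ
        ≤ ∫⁻ z, L.indicator (fun z => ‖p z‖ₑ) (z + s • v) := by
          rw [← lintegral_indicator hK]
          refine lintegral_mono fun z => ?_
          by_cases hz : z ∈ K
          · rw [Set.indicator_of_mem hz, Set.indicator_of_mem (hKL z hz s ⟨hs.1.le, hs.2⟩)]
          · simp [Set.indicator_of_notMem hz]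
      _ = ∫⁻ z, L.indicator (fun z => ‖p z‖ₑ) z := lintegral_add_right_eq_self _ _
      _ ≤ _ := lintegral_indicator_le _ _
  calc ∫⁻ s in Set.Ioc (0 : ℝ) 1, ∫⁻ z in K, ‖p (z + s • v)‖ₑ
      ≤ ∫⁻ s in Set.Ioc (0 : ℝ) 1, ∫⁻ z in L, ‖p z‖ₑ :=
        setLIntegral_mono' measurableSet_Ioc key
    _ < ⊤ := by
        rw [setLIntegral_const, Real.volume_Ioc]
        have := hL.hasFiniteIntegral
        rw [HasFiniteIntegral] at this
        simpa using this

lemma HasWeakDeriv.ae_translate {Ω : Set (Hor d × ℝ)} (hΩ : IsOpen Ω) {u p : Hor d × ℝ → ℂ}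
    {v : Hor d × ℝ} (h : HasWeakDeriv Ω u v p) (hp : Measurable p) :
    ∀ᵐ z, (∀ s ∈ Set.Icc (0 : ℝ) 1, z + s • v ∈ Ω) →
      u (z + v) - u z - ∫ s in Set.Ioc (0 : ℝ) 1, p (z + s • v) = 0 := by
  have hΩ' := isOpen_segment_set hΩ v
  set Ω' := {z | ∀ s ∈ Set.Icc (0 : ℝ) 1, z + s • v ∈ Ω} with hΩ'def
  have hsub : ∀ {K : Set (Hor d × ℝ)}, K ⊆ Ω' →
      (fun q : (Hor d × ℝ) × ℝ => q.1 + q.2 • v) '' (K ×ˢ Set.Icc (0 : ℝ) 1) ⊆ Ω := by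
    rintro K hK _ ⟨⟨z, s⟩, ⟨hz, hs⟩, rfl⟩
    exact hK hz s hs
  have hq : LocallyIntegrableOn (fun z => ∫ s in Set.Ioc (0 : ℝ) 1, p (z + s • v)) Ω' volume := by
    rw [locallyIntegrableOn_iff hΩ'.isLocallyClosed]
    intro K hK hKc
    refine (integrable_segment hp v hKc.measurableSet
      (L := (fun q : (Hor d × ℝ) × ℝ => q.1 + q.2 • v) '' (K ×ˢ Set.Icc (0 : ℝ) 1)) ?_
      (h.2.1.integrableOn_compact_subset (hsub hK) (isCompact_segment_image hKc v))).integral_prod_left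
    exact fun z hz s hs => ⟨(z, s), ⟨hz, hs⟩, rfl⟩
  have hu0 : LocallyIntegrableOn u Ω' volume :=
    h.1.mono_set fun z hz => by simpa using hz 0 (by simp)
  have hu1 : LocallyIntegrableOn (fun z => u (z + v)) Ω' volume := by
    rw [locallyIntegrableOn_iff hΩ'.isLocallyClosed]
    intro K hK hKc
    have hK1 : IntegrableOn u ((fun z => z + v) '' K) volume := by
      refine h.1.integrableOn_compact_subset ?_ (hKc.image (by fun_prop))
      rintro _ ⟨z, hz, rfl⟩
      simpa using hK hz 1 (by simp)
    have he : MeasurableEmbedding fun z : Hor d × ℝ => z + v := measurableEmbedding_addRight v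
    have hmp : MeasurePreserving (fun z : Hor d × ℝ => z + v) volume volume :=
      measurePreserving_add_right volume v
    have := (hmp.integrableOn_image he).1 hK1
    exact this
  refine hΩ'.ae_eq_zero_of_integral_contDiff_smul_eq_zero ((hu1.sub hu0).sub hq) ?_
  intro g h1 h2 h3
  set K := tsupport g with hK
  set L := (fun q : (Hor d × ℝ) × ℝ => q.1 + q.2 • v) '' (K ×ˢ Set.Icc (0 : ℝ) 1) with hL
  have hLc : IsCompact L := isCompact_segment_image h2 v
  have hLΩ : L ⊆ Ω := hsub h3
  have hshift : ∀ s ∈ Set.Icc (0 : ℝ) 1, ∀ z, z ∉ L → z - s • v ∉ K := by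
    intro s hs z hz hzK
    exact hz ⟨(z - s • v, s), ⟨hzK, hs⟩, by simp⟩
  have hLu : IntegrableOn u L volume := h.1.integrableOn_compact_subset hLΩ hLc
  have hLp : IntegrableOn p L volume := h.2.1.integrableOn_compact_subset hLΩ hLc
  -- the derivative of the pairing with a translated test function
  have hgs : ∀ s ∈ Set.Icc (0 : ℝ) 1,
      ∫ z, ((fderiv ℝ g (z - s • v) v : ℝ) : ℂ) * u z = - ∫ z, (g (z - s • v) : ℂ) * p z := by
    intro s hs
    have hsupp : tsupport (fun z => g (z - s • v)) ⊆ L := by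
      refine closure_minimal (fun z hz => ?_) hLc.isClosed
      by_contra hzL
      exact hshift s hs z hzL (subset_tsupport _ hz)
    have := (hasWeakDeriv_iff.1 h).2.2 (fun z => g (z - s • v)) (h1.comp (by fun_prop))
      (hLc.of_isClosed_subset (isClosed_tsupport _) hsupp) (hsupp.trans hLΩ)
    rw [← this]
    congr 1
    ext z
    rw [fderiv_comp_sub]
  have hftc : ∀ z, g (z - v) - g z = - ∫ s in Set.Ioc (0 : ℝ) 1, fderiv ℝ g (z - s • v) v := by
    intro z
    have hd : ∀ s ∈ Set.uIcc (0 : ℝ) 1,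
        HasDerivAt (fun s : ℝ => g (z - s • v)) (-fderiv ℝ g (z - s • v) v) s := by
      intro s _
      have h0 : HasDerivAt (fun s : ℝ => z - s • v) (-((1 : ℝ) • v)) s :=
        ((hasDerivAt_id s).smul_const v).const_sub z
      have := ((h1.differentiable (by simp) (z - s • v)).hasFDerivAt).comp_hasDerivAt s h0
      rw [one_smul, map_neg] at this
      exact this
    have hcont : Continuous fun s : ℝ => -fderiv ℝ g (z - s • v) v :=
      ((continuous_fderiv_apply' h1 v).comp (by fun_prop)).neg
    have := intervalIntegral.integral_eq_sub_of_hasDerivAt hd (hcont.intervalIntegrable _ _)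
    rw [intervalIntegral.integral_of_le zero_le_one, integral_neg] at this
    simpa using this.symm
  -- first Fubini
  have i1 : Integrable (fun q : (Hor d × ℝ) × ℝ =>
      ((fderiv ℝ g (q.1 - q.2 • v) v : ℝ) : ℂ) * L.indicator u q.1)
      (volume.prod (volume.restrict (Set.Ioc (0 : ℝ) 1))) := by
    obtain ⟨C, hC⟩ := (hasCompactSupport_fderiv_apply' h2 v).exists_bound_of_continuous
      (continuous_fderiv_apply' h1 v)
    refine Integrable.bdd_mul (c := C) ((hLu.integrable_indicator hLc.measurableSet).comp_fst _) ?_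
      (ae_of_all _ fun q => ?_)
    · exact (Complex.continuous_ofReal.comp
        ((continuous_fderiv_apply' h1 v).comp (by fun_prop))).aestronglyMeasurable
    · simpa using hC (q.1 - q.2 • v)
  have i2 : Integrable (fun q : (Hor d × ℝ) × ℝ => (g q.1 : ℂ) * p (q.1 + q.2 • v))
      (volume.prod (volume.restrict (Set.Ioc (0 : ℝ) 1))) := by
    obtain ⟨C, hC⟩ := h2.exists_bound_of_continuous h1.continuous
    have h0 := integrable_segment hp v (K := K) (L := L) h2.measurableSet
      (fun z hz s hs => ⟨(z, s), ⟨hz, hs⟩, rfl⟩) hLp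
    have h0' : Integrable (fun q : (Hor d × ℝ) × ℝ => (g q.1 : ℂ) * p (q.1 + q.2 • v))
      ((volume.restrict K).prod (volume.restrict (Set.Ioc (0 : ℝ) 1))) := by
      refine Integrable.bdd_mul (c := C) h0 ?_ (ae_of_all _ fun q => ?_)
      · exact (Complex.continuous_ofReal.comp (h1.continuous.comp continuous_fst)).aestronglyMeasurable
      · simpa using hC q.1
    have e : (volume.restrict K).prod (volume.restrict (Set.Ioc (0 : ℝ) 1))
        = ((volume : Measure (Hor d × ℝ)).prod (volume.restrict (Set.Ioc (0 : ℝ) 1))).restrict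
          (K ×ˢ Set.univ) := by
      rw [← Measure.prod_restrict, Measure.restrict_univ]
    rw [e] at h0'
    refine (integrableOn_iff_integrable_of_support_subset ?_).1 h0'
    intro q hq
    refine ⟨?_, trivial⟩
    by_contra hqK
    exact hq (by simp [image_eq_zero_of_notMem_tsupport hqK])
  have A : ∫ z, (((g (z - v) - g z : ℝ)) : ℂ) * u z
      = ∫ z, (g z : ℂ) * ∫ s in Set.Ioc (0 : ℝ) 1, p (z + s • v) := by
    calc ∫ z, (((g (z - v) - g z : ℝ)) : ℂ) * u z
        = ∫ z, ∫ s in Set.Ioc (0 : ℝ) 1,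
            -(((fderiv ℝ g (z - s • v) v : ℝ) : ℂ) * L.indicator u z) := by
          congr 1; ext z
          rw [hftc z]
          by_cases hz : z ∈ L
          · rw [Set.indicator_of_mem hz, integral_neg, integral_mul_const, integral_complex_ofReal]
            push_cast; ring
          · rw [← hftc z, image_eq_zero_of_notMem_tsupport (f := g),
              image_eq_zero_of_notMem_tsupport (f := g)]
            · simp [Set.indicator_of_notMem hz]
            · simpa using hshift 0 (by simp) z hz
            · simpa using hshift 1 (by simp) z hz
      _ = ∫ s in Set.Ioc (0 : ℝ) 1, ∫ z,
            -(((fderiv ℝ g (z - s • v) v : ℝ) : ℂ) * L.indicator u z) :=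
          integral_integral_swap i1.neg
      _ = ∫ s in Set.Ioc (0 : ℝ) 1, ∫ z, (g z : ℂ) * p (z + s • v) := by
          refine setIntegral_congr_fun measurableSet_Ioc fun s hs => ?_
          have hs' : s ∈ Set.Icc (0 : ℝ) 1 := ⟨hs.1.le, hs.2⟩
          have e1 : ∀ z, ((fderiv ℝ g (z - s • v) v : ℝ) : ℂ) * L.indicator u z
              = ((fderiv ℝ g (z - s • v) v : ℝ) : ℂ) * u z := by
            intro z
            by_cases hz : z ∈ L
            · rw [Set.indicator_of_mem hz]
            · have : fderiv ℝ g (z - s • v) v = 0 := by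
                have := fun hmem => hshift s hs' z hz (tsupport_fderiv_apply_subset' g v hmem)
                exact image_eq_zero_of_notMem_tsupport (f := fun z => fderiv ℝ g z v) this
              simp [this]
          simp only [integral_neg, e1]
          rw [hgs s hs', neg_neg, ← integral_add_right_eq_self _ (s • v)]
          simp
      _ = ∫ z, ∫ s in Set.Ioc (0 : ℝ) 1, (g z : ℂ) * p (z + s • v) :=
          (integral_integral_swap i2).symm
      _ = _ := by simp only [integral_const_mul]
  have j0 := integrable_mul_of_tsupport hu0 h1.continuous h2 h3
  have j1 := integrable_mul_of_tsupport hu1 h1.continuous h2 h3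
  have j2 := integrable_mul_of_tsupport hq h1.continuous h2 h3
  have j1' : Integrable (fun z => (g (z - v) : ℂ) * u z) := by
    have := j1.comp_sub_right v
    simpa using this
  have e1 : ∫ z, (g z : ℂ) * u (z + v) = ∫ z, (g (z - v) : ℂ) * u z := by
    rw [← integral_sub_right_eq_self _ v]; simp
  have j10 : Integrable (fun z => (g z : ℂ) * u (z + v) - (g z : ℂ) * u z) := j1.sub j0
  simp only [Complex.real_smul, mul_sub]
  rw [integral_sub j10 j2, integral_sub j1 j0, e1, ← integral_sub j1' j0, ← A, sub_eq_zero]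
  congr 1; ext z; push_cast; ring

lemma HasWeakDeriv.exists_measurable {Ω : Set (Hor d × ℝ)} (hΩ : IsOpen Ω)
    {u p : Hor d × ℝ → ℂ} {v : Hor d × ℝ} (h : HasWeakDeriv Ω u v p) :
    ∃ p₀, Measurable p₀ ∧ p =ᵐ[volume.restrict Ω] p₀ ∧ HasWeakDeriv Ω u v p₀ := by
  have hm := h.2.1.aestronglyMeasurable
  exact ⟨hm.mk p, hm.stronglyMeasurable_mk.measurable, hm.ae_eq_mk,
    h.congr_ae hΩ (ae_eq_refl u) hm.ae_eq_mk⟩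

/-- The `L²` norm of a finite difference is controlled by that of the weak derivative. -/
lemma HasWeakDeriv.lintegral_translate_le {Ω : Set (Hor d × ℝ)} (hΩ : IsOpen Ω)
    {u p : Hor d × ℝ → ℂ} {v : Hor d × ℝ} (h : HasWeakDeriv Ω u v p) (hp : Measurable p)
    {B : Set (Hor d × ℝ)} (hB : MeasurableSet B)
    (hseg : ∀ z ∈ B, ∀ s ∈ Set.Icc (0 : ℝ) 1, z + s • v ∈ Ω) :
    ∫⁻ z in B, ‖u (z + v) - u z‖ₑ ^ 2
      ≤ ∫⁻ s in Set.Ioc (0 : ℝ) 1, ∫⁻ z in B, ‖p (z + s • v)‖ₑ ^ 2 := by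
  have hm : Measurable fun q : (Hor d × ℝ) × ℝ => ‖p (q.1 + q.2 • v)‖ₑ ^ 2 :=
    ((hp.comp (by fun_prop : Measurable fun q : (Hor d × ℝ) × ℝ => q.1 + q.2 • v)).enorm).pow_const 2
  rw [← lintegral_lintegral_swap (f := fun z s => ‖p (z + s • v)‖ₑ ^ 2) hm.aemeasurable]
  refine lintegral_mono_ae ?_
  filter_upwards [ae_restrict_mem hB, ae_restrict_of_ae (h.ae_translate hΩ hp)] with z hz hz'
  rw [sub_eq_zero.1 (hz' (hseg z hz))]
  refine (sq_enorm_integral_le ?_).trans ?_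
  · exact (hp.comp (by fun_prop)).aestronglyMeasurable
  · simp

/-! ### The Poincaré inequality below the graph -/

lemma isOpen_stripBelow {η : Hor d → ℝ} (hη : Continuous η) (h : ℝ) :
    IsOpen (stripBelow η h) := by
  have h1 : Continuous fun z : Hor d × ℝ => η z.1 := hη.comp continuous_fst
  exact (isOpen_lt (h1.sub continuous_const) continuous_snd).inter (isOpen_lt continuous_snd h1)

lemma measurableSet_stripBelow {η : Hor d → ℝ} (hη : Continuous η) (h : ℝ) :
    MeasurableSet (stripBelow η h) := (isOpen_stripBelow hη h).measurableSet

lemma stripBelow_mono (η : Hor d → ℝ) {h h' : ℝ} (hh : h ≤ h') :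
    stripBelow η h ⊆ stripBelow η h' := fun _ hz => ⟨by linarith [hz.1], hz.2⟩

lemma HasWeakDeriv.lintegral_layer_le {Ω : Set (Hor d × ℝ)} (hΩ : IsOpen Ω)
    {u p : Hor d × ℝ → ℂ} (h : HasWeakDeriv Ω u (0, 1) p) (hp : Measurable p)
    {η : Hor d → ℝ} (hη : Continuous η) {ε δ : ℝ} (hδ : 0 < δ)
    (hS : stripBelow η ε ⊆ Ω) (j : ℕ) (hj : (j + 1) * δ ≤ ε) :
    ∫⁻ z in stripBelow η ε ∩ {z | η z.1 - (j + 1) * δ ≤ z.2 ∧ z.2 < η z.1 - j * δ}, ‖u z‖ₑ ^ 2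
      ≤ 2 * (∫⁻ z in stripBelow η (2 * δ), ‖u z‖ₑ ^ 2)
        + 2 * (ENNReal.ofReal (ε * δ) * ∫⁻ z in stripBelow η ε, ‖p z‖ₑ ^ 2) := by
  set D := stripBelow η ε ∩ {z | η z.1 - (j + 1) * δ ≤ z.2 ∧ z.2 < η z.1 - j * δ} with hD
  have hDm : MeasurableSet D := by
    have h1 : Continuous fun z : Hor d × ℝ => η z.1 := hη.comp continuous_fst
    exact (measurableSet_stripBelow hη ε).inter
      ((isClosed_le (h1.sub continuous_const) continuous_snd).measurableSet.inter
        (isOpen_lt continuous_snd (h1.sub continuous_const)).measurableSet)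
  set v : Hor d × ℝ := (j * δ : ℝ) • (0, 1) with hv
  have hv1 : ∀ (z : Hor d × ℝ) (s : ℝ), (z + s • v).1 = z.1 := by intro z s; simp [hv]
  have hv2 : ∀ (z : Hor d × ℝ) (s : ℝ), (z + s • v).2 = z.2 + s * (j * δ) := by
    intro z s; simp [hv]
  have hjδ : 0 ≤ j * δ := by positivity
  have hup : ∀ z ∈ D, ∀ s ∈ Set.Icc (0 : ℝ) 1, z + s • v ∈ stripBelow η ε := by
    intro z hz s hs
    have h1 : s * (j * δ) ≤ j * δ := mul_le_of_le_one_left hjδ hs.2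
    have h2 : 0 ≤ s * (j * δ) := mul_nonneg hs.1 hjδ
    refine ⟨?_, ?_⟩ <;> rw [hv1, hv2]
    · linarith [hz.1.1]
    · linarith [hz.2.2]
  have hT := (h.dir_smul (j * δ : ℝ)).lintegral_translate_le hΩ (by fun_prop) hDm
    fun z hz s hs => hS (hup z hz s hs)
  have hfirst : ∫⁻ z in D, ‖u (z + v)‖ₑ ^ 2 ≤ ∫⁻ z in stripBelow η (2 * δ), ‖u z‖ₑ ^ 2 := by
    rw [← lintegral_indicator hDm, ← lintegral_indicator (measurableSet_stripBelow hη _),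
      ← lintegral_add_right_eq_self ((stripBelow η (2 * δ)).indicator fun z => ‖u z‖ₑ ^ 2) v]
    refine lintegral_mono fun z => ?_
    by_cases hz : z ∈ D
    · have : z + v ∈ stripBelow η (2 * δ) := by
        have h1 := hv1 z 1
        have h2 := hv2 z 1
        rw [one_smul] at h1 h2
        refine ⟨?_, ?_⟩ <;> rw [h1, h2] <;> nlinarith [hz.2.1, hz.2.2]
      rw [Set.indicator_of_mem hz, Set.indicator_of_mem this]
    · simp [Set.indicator_of_notMem hz]
  have hsecond : ∫⁻ s in Set.Ioc (0 : ℝ) 1, ∫⁻ z in D, ‖((j * δ : ℝ) : ℂ) * p (z + s • v)‖ₑ ^ 2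
      ≤ ENNReal.ofReal (ε * δ) * ∫⁻ z in stripBelow η ε, ‖p z‖ₑ ^ 2 := by
    have hm : Measurable fun q : ℝ × (Hor d × ℝ) =>
        D.indicator (fun _ => (1 : ℝ≥0∞)) (q.2 - q.1 • v) :=
      (measurable_const.indicator hDm).comp (by fun_prop)
    have hpm : Measurable fun z => ‖((j * δ : ℝ) : ℂ) * p z‖ₑ ^ 2 :=
      (hp.const_mul _).enorm.pow_const 2
    have e1 : ∀ s : ℝ, ∫⁻ z in D, ‖((j * δ : ℝ) : ℂ) * p (z + s • v)‖ₑ ^ 2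
        = ∫⁻ z, D.indicator (fun _ => (1 : ℝ≥0∞)) (z - s • v) *
            ‖((j * δ : ℝ) : ℂ) * p z‖ₑ ^ 2 := by
      intro s
      rw [← lintegral_add_right_eq_self (fun z => D.indicator (fun _ => (1 : ℝ≥0∞)) (z - s • v) *
            ‖((j * δ : ℝ) : ℂ) * p z‖ₑ ^ 2) (s • v), ← lintegral_indicator hDm]
      congr 1; ext z
      by_cases hz : z ∈ D <;> simp [hz]
    simp_rw [e1]
    rw [lintegral_lintegral_swap
      (f := fun s z => D.indicator (fun _ => (1 : ℝ≥0∞)) (z - s • v) *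
        ‖((j * δ : ℝ) : ℂ) * p z‖ₑ ^ 2)
      (hm.mul (hpm.comp measurable_snd)).aemeasurable]
    rw [← lintegral_const_mul' _ _ ENNReal.ofReal_ne_top,
      ← lintegral_indicator (measurableSet_stripBelow hη _)]
    refine lintegral_mono fun z => ?_
    have hmz : Measurable fun s : ℝ => D.indicator (fun _ => (1 : ℝ≥0∞)) (z - s • v) :=
      hm.comp (by fun_prop : Measurable fun s : ℝ => (s, z))
    rw [lintegral_mul_const _ hmz]
    by_cases hz : z ∈ stripBelow η ε
    · rw [Set.indicator_of_mem hz, enorm_mul, mul_pow, ← mul_assoc]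
      refine mul_le_mul_left ?_ _
      rcases Nat.eq_zero_or_pos j with rfl | hjpos
      · simp
      have hjp : (0 : ℝ) < j := by exact_mod_cast hjpos
      have hjd : 0 < j * δ := by positivity
      have e2 : ∫⁻ s in Set.Ioc (0 : ℝ) 1, D.indicator (fun _ => (1 : ℝ≥0∞)) (z - s • v)
          ≤ ENNReal.ofReal (1 / j) := by
        set a := (z.2 - (η z.1 - j * δ)) / (j * δ) with ha
        calc ∫⁻ s in Set.Ioc (0 : ℝ) 1, D.indicator (fun _ => (1 : ℝ≥0∞)) (z - s • v)
            ≤ ∫⁻ s, D.indicator (fun _ => (1 : ℝ≥0∞)) (z - s • v) := setLIntegral_le_lintegral _ _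
          _ ≤ ∫⁻ s, (Set.Icc a (a + 1 / j)).indicator (fun _ => (1 : ℝ≥0∞)) s := by
              refine lintegral_mono fun s => ?_
              by_cases hs : z - s • v ∈ D
              · have h1 := hs.2.1
                have h2 := hs.2.2
                have h3 : (z - s • v).1 = z.1 := by simp [hv]
                have h4 : (z - s • v).2 = z.2 - s * (j * δ) := by simp [hv]
                rw [h3, h4] at h1 h2
                have : s ∈ Set.Icc a (a + 1 / j) := by
                  constructor
                  · rw [ha, div_le_iff₀ hjd]; linarith
                  · have : a + 1 / j = (z.2 - (η z.1 - j * δ) + δ) / (j * δ) := by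
                      rw [ha]; field_simp
                    rw [this, le_div_iff₀ hjd]; linarith
                rw [Set.indicator_of_mem this, Set.indicator_of_mem hs]
              · simp [hs]
          _ = ENNReal.ofReal (1 / j) := by
              rw [lintegral_indicator_const measurableSet_Icc, Real.volume_Icc]; simp
      calc (∫⁻ s in Set.Ioc (0 : ℝ) 1, D.indicator (fun _ => (1 : ℝ≥0∞)) (z - s • v)) *
            ‖((j * δ : ℝ) : ℂ)‖ₑ ^ 2
          ≤ ENNReal.ofReal (1 / j) * ENNReal.ofReal ((j * δ) ^ 2) := by
            refine mul_le_mul' e2 (le_of_eq ?_)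
            rw [← ofReal_norm, Complex.norm_real, Real.norm_eq_abs, abs_of_pos hjd,
              ENNReal.ofReal_pow hjd.le]
        _ ≤ ENNReal.ofReal (ε * δ) := by
            rw [← ENNReal.ofReal_mul (by positivity)]
            refine ENNReal.ofReal_le_ofReal ?_
            have : 1 / j * (j * δ) ^ 2 = (j * δ) * δ := by field_simp
            rw [this]
            nlinarith
    · rw [Set.indicator_of_notMem hz]
      have : ∫⁻ s in Set.Ioc (0 : ℝ) 1, D.indicator (fun _ => (1 : ℝ≥0∞)) (z - s • v) = 0 := by
        rw [setLIntegral_congr_fun (g := fun _ => 0) measurableSet_Ioc, lintegral_zero]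
        intro s hs
        refine Set.indicator_of_notMem (fun hmem => hz ?_) _
        simpa using hup _ hmem s ⟨hs.1.le, hs.2⟩
      simp [this]
  calc ∫⁻ z in D, ‖u z‖ₑ ^ 2
      ≤ ∫⁻ z in D, (2 * ‖u (z + v)‖ₑ ^ 2 + 2 * ‖u (z + v) - u z‖ₑ ^ 2) := by
        refine lintegral_mono fun z => ?_
        have := enorm_sub_sq_le (u (z + v)) (u (z + v) - u z)
        simpa using this
    _ = 2 * (∫⁻ z in D, ‖u (z + v)‖ₑ ^ 2) + 2 * ∫⁻ z in D, ‖u (z + v) - u z‖ₑ ^ 2 := by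
        have hum : AEMeasurable (fun z => u (z + v)) (volume.restrict D) := by
          have := ((h.1.mono_set hS).aestronglyMeasurable).aemeasurable
          refine this.comp_quasiMeasurePreserving (f := fun z => z + v) ⟨by fun_prop, ?_⟩
          refine Measure.AbsolutelyContinuous.mk fun s hs h0 => ?_
          rw [Measure.map_apply (by fun_prop) hs]
          rw [Measure.restrict_apply hs] at h0
          rw [Measure.restrict_apply (hs.preimage (by fun_prop))]
          have : (fun z => z + v) ⁻¹' s ∩ D ⊆ (fun z => z + v) ⁻¹' (s ∩ stripBelow η ε) :=
            fun z hz => ⟨hz.1, by simpa using hup z hz.2 1 (by simp)⟩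
          refine measure_mono_null this ?_
          rw [measure_preimage_add_right, h0]
        rw [lintegral_add_left' ((hum.enorm.pow_const 2).const_mul 2),
          lintegral_const_mul' _ _ (by simp), lintegral_const_mul' _ _ (by simp)]
    _ ≤ _ := by gcongr; exact hT.trans hsecond

/-- Functions of finite energy that vanish on the graph satisfy a Poincaré inequality on thin
strips below the graph. -/
lemma HasWeakDeriv.poincare {Ω : Set (Hor d × ℝ)} (hΩ : IsOpen Ω)
    {u p : Hor d × ℝ → ℂ} (h : HasWeakDeriv Ω u (0, 1) p)
    {η : Hor d → ℝ} (hη : Continuous η) (htr : HasTrace η u 0) {ε : ℝ} (hε : 0 < ε)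
    (hS : stripBelow η ε ⊆ Ω) :
    ∫⁻ z in stripBelow η ε, ‖u z‖ₑ ^ 2
      ≤ ENNReal.ofReal (2 * ε ^ 2) * ∫⁻ z in stripBelow η ε, ‖p z‖ₑ ^ 2 := by
  obtain ⟨p₀, hp₀, hpp, h₀⟩ := h.exists_measurable hΩ
  have hpe : ∫⁻ z in stripBelow η ε, ‖p z‖ₑ ^ 2 = ∫⁻ z in stripBelow η ε, ‖p₀ z‖ₑ ^ 2 :=
    lintegral_congr_ae ((ae_restrict_of_ae_restrict_of_subset hS hpp).mono fun z hz => by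
      simp only [hz])
  rw [hpe]
  set X := ∫⁻ z in stripBelow η ε, ‖p₀ z‖ₑ ^ 2
  set T : ℝ → ℝ≥0∞ := fun ε => (∫⁻ z in stripBelow η ε, ‖u z‖ₑ ^ 2) / ENNReal.ofReal ε with hT
  have hT0 : Tendsto T (𝓝[>] 0) (𝓝 0) := by simpa [HasTrace] using htr
  have hbound : ∀ k : ℕ, ∫⁻ z in stripBelow η ε, ‖u z‖ₑ ^ 2
      ≤ ENNReal.ofReal (4 * ε) * T (2 * (ε / (k + 1))) + ENNReal.ofReal (2 * ε ^ 2) * X := by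
    intro k
    set δ := ε / (k + 1) with hδdef
    have hk : (0 : ℝ) < k + 1 := by positivity
    have hδ : 0 < δ := by positivity
    have hcover : stripBelow η ε ⊆ ⋃ j : Fin (k + 1), stripBelow η ε ∩
        {z | η z.1 - ((j : ℕ) + 1) * δ ≤ z.2 ∧ z.2 < η z.1 - (j : ℕ) * δ} := by
      intro z hz
      have hr : 0 < (η z.1 - z.2) / δ := div_pos (by linarith [hz.2]) hδ
      obtain ⟨n, hn⟩ : ∃ n : ℕ, ⌈(η z.1 - z.2) / δ⌉₊ = n + 1 :=
        Nat.exists_eq_succ_of_ne_zero (Nat.ceil_pos.2 hr).ne'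
      have h1 := Nat.le_ceil ((η z.1 - z.2) / δ)
      have h2 := Nat.ceil_lt_add_one hr.le
      rw [hn, div_le_iff₀ hδ] at h1
      rw [hn] at h2
      push_cast at h1 h2
      have h3 : (n : ℝ) * δ < η z.1 - z.2 := by
        rw [← lt_div_iff₀ hδ]; linarith
      have h4 : n < k + 1 := by
        have : (n : ℝ) * δ < (k + 1) * δ := by
          have : (k + 1 : ℝ) * δ = ε := by rw [hδdef]; field_simp
          rw [this]; linarith [hz.1]
        exact_mod_cast lt_of_mul_lt_mul_right this hδ.le
      refine Set.mem_iUnion.2 ⟨⟨n, h4⟩, hz, ?_, ?_⟩ <;> simp only <;> linarith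
    calc ∫⁻ z in stripBelow η ε, ‖u z‖ₑ ^ 2
        ≤ ∑ j : Fin (k + 1), ∫⁻ z in stripBelow η ε ∩
          {z | η z.1 - ((j : ℕ) + 1) * δ ≤ z.2 ∧ z.2 < η z.1 - (j : ℕ) * δ}, ‖u z‖ₑ ^ 2 := by
          refine (lintegral_mono_set hcover).trans ((lintegral_iUnion_le _ _).trans ?_)
          rw [tsum_fintype]
      _ ≤ ∑ j : Fin (k + 1), (2 * (∫⁻ z in stripBelow η (2 * δ), ‖u z‖ₑ ^ 2)
          + 2 * (ENNReal.ofReal (ε * δ) * X)) := by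
          refine Finset.sum_le_sum fun j _ => ?_
          refine h₀.lintegral_layer_le hΩ hp₀ hη hδ hS j ?_
          have : ((j : ℕ) : ℝ) + 1 ≤ k + 1 := by exact_mod_cast j.2
          calc (((j : ℕ) : ℝ) + 1) * δ ≤ (k + 1) * δ := by gcongr
            _ = ε := by rw [hδdef]; field_simp
      _ = _ := by
          rw [Finset.sum_const, Finset.card_univ, Fintype.card_fin, nsmul_eq_mul, mul_add]
          have hc : ((k + 1 : ℕ) : ℝ≥0∞) = ENNReal.ofReal (k + 1) := by
            rw [← ENNReal.ofReal_natCast]; push_cast; rfl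
          have h2 : (2 : ℝ≥0∞) = ENNReal.ofReal 2 := by simp
          have hI : (∫⁻ z in stripBelow η (2 * δ), ‖u z‖ₑ ^ 2)
              = ENNReal.ofReal (2 * δ) * T (2 * δ) := by
            rw [hT]; simp only
            rw [ENNReal.mul_div_cancel (by simpa using hδ) ENNReal.ofReal_ne_top]
          rw [hI, hc, h2, ← mul_assoc, ← mul_assoc, ← mul_assoc, ← mul_assoc,
            ← ENNReal.ofReal_mul (by positivity), ← ENNReal.ofReal_mul (by positivity),
            ← ENNReal.ofReal_mul (by positivity)]
          congr 3 <;> rw [hδdef] <;> field_simp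
          norm_num
  have hlim : Tendsto (fun k : ℕ => ENNReal.ofReal (4 * ε) * T (2 * (ε / (k + 1)))
      + ENNReal.ofReal (2 * ε ^ 2) * X) atTop
      (𝓝 (ENNReal.ofReal (4 * ε) * 0 + ENNReal.ofReal (2 * ε ^ 2) * X)) := by
    refine Tendsto.add (ENNReal.Tendsto.const_mul (hT0.comp ?_)
      (Or.inr ENNReal.ofReal_ne_top)) tendsto_const_nhds
    refine tendsto_nhdsWithin_iff.2 ⟨?_, Eventually.of_forall fun k => by
      simp only [Set.mem_Ioi]; positivity⟩
    have := (tendsto_one_div_add_atTop_nhds_zero_nat (𝕜 := ℝ)).const_mul (2 * ε)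
    simp only [mul_zero] at this
    refine this.congr fun k => by ring
  have := ge_of_tendsto' hlim hbound
  simpa using this

end WaterWaves

open scoped Convolution

namespace WaterWaves

variable {d : ℕ}

/-! ### Mollification of Lipschitz functions -/

/-- A sequence of bump functions shrinking to the origin. -/
noncomputable def shrinkingBump (d : ℕ) (n : ℕ) : ContDiffBump (0 : Hor d × ℝ) where
  rIn := 1 / (n + 1)
  rOut := 2 / (n + 1)
  rIn_pos := by positivity
  rIn_lt_rOut := by gcongr; norm_num

/-- Mollification at scale `2 / (n + 1)`. -/
noncomputable def mollify (g : Hor d × ℝ → ℝ) (n : ℕ) : Hor d × ℝ → ℝ :=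
  (shrinkingBump d n).normed volume ⋆[ContinuousLinearMap.lsmul ℝ ℝ, volume] g

lemma tendsto_shrinkingBump_rOut (d : ℕ) :
    Tendsto (fun n => (shrinkingBump d n).rOut) atTop (𝓝 0) := by
  have := (tendsto_one_div_add_atTop_nhds_zero_nat (𝕜 := ℝ)).const_mul 2
  simp only [mul_zero] at this
  exact this.congr fun n => by simp [shrinkingBump]; ring

lemma contDiff_mollify {g : Hor d × ℝ → ℝ} (hg : Continuous g) (n : ℕ) :
    ContDiff ℝ ((⊤ : ℕ∞) : WithTop ℕ∞) (mollify g n) :=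
  (shrinkingBump d n).hasCompactSupport_normed.contDiff_convolution_left _
    (shrinkingBump d n).contDiff_normed hg.locallyIntegrable

lemma mollify_apply (g : Hor d × ℝ → ℝ) (n : ℕ) (z : Hor d × ℝ) :
    mollify g n z = ∫ w, g w * (shrinkingBump d n).normed volume (z - w) := by
  rw [mollify, convolution_eq_swap]
  simp [mul_comm]

lemma abs_mollify_sub_le {g : Hor d × ℝ → ℝ} {C : ℝ≥0} (hg : LipschitzWith C g) (n : ℕ)
    (z : Hor d × ℝ) : |mollify g n z - g z| ≤ C * (2 / (n + 1)) := by
  refine (shrinkingBump d n).dist_normed_convolution_le hg.continuous.aestronglyMeasurable ?_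
  intro x hx
  refine (hg.dist_le_mul x z).trans ?_
  gcongr
  exact (Metric.mem_ball.1 hx).le

lemma mollify_eq_zero {g : Hor d × ℝ → ℝ} {n : ℕ} {z : Hor d × ℝ}
    (h : ∀ w ∈ Metric.ball z (2 / (n + 1)), g w = 0) : mollify g n z = 0 := by
  have h0 := h z (Metric.mem_ball_self (by positivity))
  have := (shrinkingBump d n).normed_convolution_eq_right (μ := volume) (g := g) (x₀ := z)
    fun x hx => by rw [h x hx, h0]
  rw [mollify, this, h0]

lemma fderiv_mollify {g : Hor d × ℝ → ℝ} {C : ℝ≥0} (hg : LipschitzWith C g) (n : ℕ)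
    (z v : Hor d × ℝ) :
    fderiv ℝ (mollify g n) z v = ∫ w, lineDeriv ℝ g w v *
      (shrinkingBump d n).normed volume (z - w) := by
  have hd := ((contDiff_mollify hg.continuous n).differentiable (by simp) z).hasFDerivAt.hasLineDerivAt v
  have h1 := hd.tendsto_slope_zero_right
  have hφc : HasCompactSupport fun w => (shrinkingBump d n).normed volume (z - w) :=
    (shrinkingBump d n).hasCompactSupport_normed.comp_homeomorph (Homeomorph.subLeft z)
  have hφ : Continuous fun w => (shrinkingBump d n).normed volume (z - w) :=
    (shrinkingBump d n).continuous_normed.comp (by fun_prop)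
  have h2 := hg.integral_inv_smul_sub_mul_tendsto_integral_lineDeriv_mul (μ := volume)
    (hφ.integrable_of_hasCompactSupport hφc) v
  refine tendsto_nhds_unique h1 (h2.congr fun t => ?_)
  have i1 : Integrable fun w => g w * (shrinkingBump d n).normed volume (z - w) :=
    (hg.continuous.mul hφ).integrable_of_hasCompactSupport hφc.mul_left
  have i2 : Integrable fun w => g (w + t • v) * (shrinkingBump d n).normed volume (z - w) :=
    ((hg.continuous.comp (by fun_prop)).mul hφ).integrable_of_hasCompactSupport hφc.mul_left
  rw [mollify_apply, mollify_apply,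
    ← integral_add_right_eq_self (fun w => g w * (shrinkingBump d n).normed volume _) (t • v)]
  simp only [smul_eq_mul, mul_assoc]
  rw [integral_const_mul]
  congr 1
  simp only [sub_mul]
  simp only [add_sub_add_right_eq_sub]
  exact integral_sub i2 i1

lemma tendsto_fderiv_mollify {g : Hor d × ℝ → ℝ} {C : ℝ≥0} (hg : LipschitzWith C g)
    (v : Hor d × ℝ) :
    ∀ᵐ z, Tendsto (fun n => fderiv ℝ (mollify g n) z v) atTop (𝓝 (lineDeriv ℝ g z v)) := by
  have := ContDiffBump.ae_convolution_tendsto_right_of_locallyIntegrable (μ := volume) (K := 2)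
    (tendsto_shrinkingBump_rOut d) (Eventually.of_forall fun n => by
      simp only [shrinkingBump]; apply le_of_eq; ring) (hg.locallyIntegrable_lineDeriv (μ := volume) v)
  filter_upwards [this] with z hz
  refine hz.congr fun n => ?_
  rw [fderiv_mollify hg, convolution_eq_swap]
  simp [mul_comm]

lemma abs_lineDeriv_le {g : Hor d × ℝ → ℝ} {C : ℝ≥0} (hg : LipschitzWith C g)
    (z v : Hor d × ℝ) : |lineDeriv ℝ g z v| ≤ C * ‖v‖ :=
  norm_lineDeriv_le_of_lipschitz ℝ hg

lemma abs_fderiv_mollify_le_of_ae {g : Hor d × ℝ → ℝ} {C : ℝ≥0} (hg : LipschitzWith C g) {M : ℝ}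
    {v : Hor d × ℝ} (hM : ∀ᵐ w, |lineDeriv ℝ g w v| ≤ M) (n : ℕ) (z : Hor d × ℝ) :
    |fderiv ℝ (mollify g n) z v| ≤ M := by
  rw [fderiv_mollify hg, ← Real.norm_eq_abs]
  have hφc : HasCompactSupport fun w => (shrinkingBump d n).normed volume (z - w) :=
    (shrinkingBump d n).hasCompactSupport_normed.comp_homeomorph (Homeomorph.subLeft z)
  have hφ : Continuous fun w => (shrinkingBump d n).normed volume (z - w) :=
    (shrinkingBump d n).continuous_normed.comp (by fun_prop)
  have i := (hφ.integrable_of_hasCompactSupport hφc (μ := volume)).const_mul M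
  refine (norm_integral_le_of_norm_le i ?_).trans (le_of_eq ?_)
  · filter_upwards [hM] with w hw
    rw [norm_mul]
    have h0 := (shrinkingBump d n).nonneg_normed (μ := volume) (z - w)
    rw [Real.norm_of_nonneg h0]
    gcongr
    exact hw
  · rw [integral_const_mul, integral_sub_left_eq_self (fun w => (shrinkingBump d n).normed volume w),
      (shrinkingBump d n).integral_normed, mul_one]

lemma abs_fderiv_mollify_le {g : Hor d × ℝ → ℝ} {C : ℝ≥0} (hg : LipschitzWith C g) (n : ℕ)
    (z v : Hor d × ℝ) : |fderiv ℝ (mollify g n) z v| ≤ C * ‖v‖ :=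
  abs_fderiv_mollify_le_of_ae hg (ae_of_all _ fun w => abs_lineDeriv_le hg w v) n z

lemma tendsto_mollify {g : Hor d × ℝ → ℝ} (hg : Continuous g) (z : Hor d × ℝ) :
    Tendsto (fun n => mollify g n z) atTop (𝓝 (g z)) :=
  ContDiffBump.convolution_tendsto_right_of_continuous (tendsto_shrinkingBump_rOut d) hg z

/-! ### Lipschitz test functions and the Jacobian identity -/

lemma tendsto_integral_mul {Ω K : Set (Hor d × ℝ)} (hK : IsCompact K) (hKΩ : K ⊆ Ω)
    {u : Hor d × ℝ → ℂ} (hu : LocallyIntegrableOn u Ω volume) {c : ℕ → Hor d × ℝ → ℝ}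
    {c₀ : Hor d × ℝ → ℝ} (hc : ∀ n, Continuous (c n)) {M : ℝ} (hM : ∀ n z, |c n z| ≤ M)
    (hs : ∀ᶠ n in atTop, ∀ z, z ∉ K → c n z = 0)
    (hlim : ∀ᵐ z, Tendsto (fun n => c n z) atTop (𝓝 (c₀ z))) :
    Tendsto (fun n => ∫ z, (c n z : ℂ) * u z) atTop (𝓝 (∫ z, (c₀ z : ℂ) * u z)) := by
  have hi : Integrable (K.indicator u) volume :=
    (hu.integrableOn_compact_subset hKΩ hK).integrable_indicator hK.measurableSet
  have hlim' : Tendsto (fun n => ∫ z, (c n z : ℂ) * K.indicator u z) atTop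
      (𝓝 (∫ z, (c₀ z : ℂ) * K.indicator u z)) := by
    refine tendsto_integral_of_dominated_convergence (fun z => M * ‖K.indicator u z‖)
      (fun n => ?_) (hi.norm.const_mul M) (fun n => ae_of_all _ fun z => ?_) ?_
    · exact (Complex.continuous_ofReal.comp (hc n)).aestronglyMeasurable.mul hi.aestronglyMeasurable
    · rw [norm_mul]
      gcongr
      simpa using hM n z
    · filter_upwards [hlim] with z hz
      exact ((Complex.continuous_ofReal.tendsto _).comp hz).mul_const _
  have h0 : (fun z => (c₀ z : ℂ) * K.indicator u z) =ᵐ[volume] fun z => (c₀ z : ℂ) * u z := by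
    filter_upwards [hlim] with z hz
    by_cases hzK : z ∈ K
    · simp [hzK]
    · have : c₀ z = 0 := tendsto_nhds_unique hz
        (tendsto_const_nhds.congr' (hs.mono fun n hn => (hn z hzK).symm))
      simp [this]
  rw [integral_congr_ae h0] at hlim'
  refine hlim'.congr' (hs.mono fun n hn => integral_congr_ae (ae_of_all _ fun z => ?_))
  by_cases hzK : z ∈ K
  · simp [hzK]
  · simp [hn z hzK]

lemma exists_compact_mollify_support {Ω : Set (Hor d × ℝ)} (hΩ : IsOpen Ω) {g : Hor d × ℝ → ℝ}
    (hgc : HasCompactSupport g) (hgΩ : tsupport g ⊆ Ω) :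
    ∃ K, IsCompact K ∧ K ⊆ Ω ∧ ∀ᶠ n in atTop, tsupport (mollify g n) ⊆ K := by
  obtain ⟨r, hr, hrΩ⟩ := hgc.exists_cthickening_subset_open hΩ hgΩ
  refine ⟨Metric.cthickening r (tsupport g), IsCompact.cthickening hgc, hrΩ, ?_⟩
  have := (tendsto_shrinkingBump_rOut d).eventually (gt_mem_nhds hr)
  filter_upwards [this] with n hn
  refine closure_minimal (fun z hz => ?_) Metric.isClosed_cthickening
  by_contra hzK
  refine hz (mollify_eq_zero fun w hw => image_eq_zero_of_notMem_tsupport fun hwK => hzK ?_)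
  refine Metric.mem_cthickening_of_dist_le z w r _ hwK ?_
  have := Metric.mem_ball.1 hw
  rw [dist_comm]
  simp only [shrinkingBump] at hn
  linarith

lemma HasCompactSupport.exists_bound' {g : Hor d × ℝ → ℝ} {C : ℝ≥0} (hg : LipschitzWith C g)
    (hgc : HasCompactSupport g) : ∃ M, 0 ≤ M ∧ ∀ n z, |mollify g n z| ≤ M := by
  obtain ⟨B, hB⟩ := hgc.exists_bound_of_continuous hg.continuous
  refine ⟨B + C * 2, ?_, fun n z => ?_⟩
  · have := (norm_nonneg _).trans (hB 0)
    positivity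
  · have h1 := abs_mollify_sub_le hg n z
    have h2 : (C : ℝ) * (2 / (n + 1)) ≤ C * 2 := by
      gcongr
      exact div_le_self (by norm_num) (by linarith [(Nat.cast_nonneg n : (0 : ℝ) ≤ n)])
    have h3 := hB z
    rw [Real.norm_eq_abs] at h3
    have := abs_sub_abs_le_abs_sub (mollify g n z) (g z)
    linarith

/-- Weak derivatives may be tested against Lipschitz functions. -/
lemma HasWeakDeriv.integral_lipschitz {Ω : Set (Hor d × ℝ)} (hΩ : IsOpen Ω)
    {u p : Hor d × ℝ → ℂ} {v : Hor d × ℝ} (h : HasWeakDeriv Ω u v p) {g : Hor d × ℝ → ℝ} {C : ℝ≥0}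
    (hg : LipschitzWith C g) (hgc : HasCompactSupport g) (hgΩ : tsupport g ⊆ Ω) :
    ∫ z, ((lineDeriv ℝ g z v : ℝ) : ℂ) * u z = - ∫ z, (g z : ℂ) * p z := by
  obtain ⟨K, hK, hKΩ, hn⟩ := exists_compact_mollify_support hΩ hgc hgΩ
  obtain ⟨M, _, hM⟩ := HasCompactSupport.exists_bound' hg hgc
  have hsm := fun n => contDiff_mollify hg.continuous n
  have h1 := tendsto_integral_mul hK hKΩ h.1
    (fun n => continuous_fderiv_apply' (hsm n) v) (fun n z => abs_fderiv_mollify_le hg n z v)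
    (hn.mono fun n hn z hz => image_eq_zero_of_notMem_tsupport
      (f := fun z => fderiv ℝ _ z v)
      fun hz' => hz (hn (tsupport_fderiv_apply_subset' _ v hz'))) (tendsto_fderiv_mollify hg v)
  have h2 := tendsto_integral_mul hK hKΩ h.2.1 (fun n => (hsm n).continuous) hM
    (hn.mono fun n hn z hz => image_eq_zero_of_notMem_tsupport fun hz' => hz (hn hz'))
    (ae_of_all _ fun z => tendsto_mollify hg.continuous z)
  refine tendsto_nhds_unique h1 (h2.neg.congr' (hn.mono fun n hn => ?_))
  exact ((hasWeakDeriv_iff.1 h).2.2 _ (hsm n)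
    (hK.of_isClosed_subset (isClosed_tsupport _) hn) (hn.trans hKΩ)).symm

/-- The weak form of the fact that a Jacobian determinant is a divergence. -/
lemma HasWeakDeriv.integral_jacobian {Ω : Set (Hor d × ℝ)} (hΩ : IsOpen Ω)
    {u p q : Hor d × ℝ → ℂ} {v w : Hor d × ℝ} (hv : HasWeakDeriv Ω u v p)
    (hw : HasWeakDeriv Ω u w q) {g l : Hor d × ℝ → ℝ} {C D : ℝ≥0}
    (hg : LipschitzWith C g) (hgc : HasCompactSupport g) (hgΩ : tsupport g ⊆ Ω)
    (hl : LipschitzWith D l) :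
    ∫ z, ((lineDeriv ℝ l z w * lineDeriv ℝ g z v - lineDeriv ℝ l z v * lineDeriv ℝ g z w : ℝ) : ℂ)
        * u z
      = - (∫ z, ((g z * lineDeriv ℝ l z w : ℝ) : ℂ) * p z)
        + ∫ z, ((g z * lineDeriv ℝ l z v : ℝ) : ℂ) * q z := by
  obtain ⟨K, hK, hKΩ, hn⟩ := exists_compact_mollify_support hΩ hgc hgΩ
  obtain ⟨M, hM0, hM⟩ := HasCompactSupport.exists_bound' hg hgc
  have hsm := fun n => contDiff_mollify hg.continuous n
  have hsl := fun n => contDiff_mollify hl.continuous n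
  have hz0 : ∀ᶠ n in atTop, ∀ z, z ∉ K → mollify g n z = 0 :=
    hn.mono fun n hn z hz => image_eq_zero_of_notMem_tsupport fun hz' => hz (hn hz')
  have hz1 : ∀ᶠ n in atTop, ∀ z v, z ∉ K → fderiv ℝ (mollify g n) z v = 0 :=
    hn.mono fun n hn z v hz => image_eq_zero_of_notMem_tsupport (f := fun z => fderiv ℝ _ z v)
      fun hz' => hz (hn (tsupport_fderiv_apply_subset' _ v hz'))
  have hcg := fun n v => continuous_fderiv_apply' (hsm n) v
  have hcl := fun n v => continuous_fderiv_apply' (hsl n) v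
  have hbg := fun n z v => abs_fderiv_mollify_le hg n z v
  have hbl := fun n z v => abs_fderiv_mollify_le hl n z v
  have h1 := tendsto_integral_mul hK hKΩ hv.1 (M := (D * ‖w‖) * (C * ‖v‖) + (D * ‖v‖) * (C * ‖w‖))
    (c := fun n z => fderiv ℝ (mollify l n) z w * fderiv ℝ (mollify g n) z v
      - fderiv ℝ (mollify l n) z v * fderiv ℝ (mollify g n) z w)
    (fun n => ((hcl n w).mul (hcg n v)).sub ((hcl n v).mul (hcg n w)))
    (fun n z => by
      refine (abs_sub _ _).trans ?_
      rw [abs_mul, abs_mul]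
      gcongr <;> first | exact hbl _ _ _ | exact hbg _ _ _)
    (hz1.mono fun n hn z hz => by rw [hn z v hz, hn z w hz]; ring)
    (c₀ := fun z => lineDeriv ℝ l z w * lineDeriv ℝ g z v - lineDeriv ℝ l z v * lineDeriv ℝ g z w)
    (by
      filter_upwards [tendsto_fderiv_mollify hl w, tendsto_fderiv_mollify hl v,
        tendsto_fderiv_mollify hg w, tendsto_fderiv_mollify hg v] with z a b c d
      exact (a.mul d).sub (b.mul c))
  have h2 : ∀ (v : Hor d × ℝ) {p : Hor d × ℝ → ℂ}, LocallyIntegrableOn p Ω volume →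
      Tendsto (fun n => ∫ z, ((mollify g n z * fderiv ℝ (mollify l n) z v : ℝ) : ℂ) * p z) atTop
        (𝓝 (∫ z, ((g z * lineDeriv ℝ l z v : ℝ) : ℂ) * p z)) := by
    intro v p hp
    refine tendsto_integral_mul hK hKΩ hp (M := M * (D * ‖v‖))
      (c := fun n z => mollify g n z * fderiv ℝ (mollify l n) z v)
      (c₀ := fun z => g z * lineDeriv ℝ l z v) (fun n => (hsm n).continuous.mul (hcl n v))
      (fun n z => ?_) (hz0.mono fun n hn z hz => by rw [hn z hz, zero_mul]) ?_
    · rw [abs_mul]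
      gcongr
      exacts [hM _ _, hbl _ _ _]
    · filter_upwards [tendsto_fderiv_mollify hl v] with z a
      exact (tendsto_mollify hg.continuous z).mul a
  refine tendsto_nhds_unique h1 (((h2 w hv.2.1).neg.add (h2 v hw.2.1)).congr' (hn.mono fun n hn => ?_))
  -- the identity for smooth functions
  have hsd : ∀ v, ContDiff ℝ ((⊤ : ℕ∞) : WithTop ℕ∞) fun z => fderiv ℝ (mollify l n) z v :=
    fun v => ((hsl n).fderiv_right (m := ((⊤ : ℕ∞) : WithTop ℕ∞)) (by simp)).clm_apply contDiff_const
  have hcs : HasCompactSupport (mollify g n) := hK.of_isClosed_subset (isClosed_tsupport _) hn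
  have ts : ∀ v, tsupport (fun z => mollify g n z * fderiv ℝ (mollify l n) z v) ⊆ Ω :=
    fun v => tsupport_mul_subset_left.trans (hn.trans hKΩ)
  have cs : ∀ v, HasCompactSupport (fun z => mollify g n z * fderiv ℝ (mollify l n) z v) :=
    fun v => hcs.mul_right
  have e1 := (hasWeakDeriv_iff.1 hv).2.2 _ ((hsm n).mul (hsd w)) (cs w) (ts w)
  have e2 := (hasWeakDeriv_iff.1 hw).2.2 _ ((hsm n).mul (hsd v)) (cs v) (ts v)
  have i1 := (hv.integrable_test ((hsm n).mul (hsd w)) (cs w) (ts w) v).1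
  have i2 := (hw.integrable_test ((hsm n).mul (hsd v)) (cs v) (ts v) w).1
  rw [← e1, ← neg_neg (∫ z, ((mollify g n z * fderiv ℝ (mollify l n) z v : ℝ) : ℂ) * q z), ← e2,
    ← sub_eq_add_neg, ← integral_sub i1 i2]
  congr 1; ext z
  have hsym : fderiv ℝ (fun z => fderiv ℝ (mollify l n) z w) z v
      = fderiv ℝ (fun z => fderiv ℝ (mollify l n) z v) z w := by
    have hd : DifferentiableAt ℝ (fderiv ℝ (mollify l n)) z :=
      ((hsl n).fderiv_right (m := ((⊤ : ℕ∞) : WithTop ℕ∞)) (by simp)).differentiable (by simp) z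
    have hsy : IsSymmSndFDerivAt ℝ (mollify l n) z :=
      ((hsl n).contDiffAt).isSymmSndFDerivAt (by
        rw [minSmoothness_of_isRCLikeNormedField]; exact WithTop.coe_le_coe.2 le_top)
    rw [fderiv_clm_apply hd (by fun_prop), fderiv_clm_apply hd (by fun_prop)]
    simpa using hsy v w
  have hdg := (hsm n).differentiable (by simp) z
  rw [fderiv_fun_mul hdg ((hsd w).differentiable (by simp) z),
    fderiv_fun_mul hdg ((hsd v).differentiable (by simp) z)]
  simp only [add_apply, smul_apply, smul_eq_mul, hsym]
  push_cast
  ring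

end WaterWaves

namespace WaterWaves

variable {d : ℕ}

/-! ### Vertical shears -/

/-- The map `(x, y) ↦ (x, l (x, y))`. -/
def shearMap (l : Hor d × ℝ → ℝ) (z : Hor d × ℝ) : Hor d × ℝ := (z.1, l z)

/-- `l` and `k` are Lipschitz, the maps `(x, y) ↦ (x, l (x, y))` and `(x, y) ↦ (x, k (x, y))` are
inverse to each other, and both are increasing and differentiable in `y`. -/
structure VertShear (l k : Hor d × ℝ → ℝ) : Prop where
  lip_l : ∃ C, LipschitzWith C l
  lip_k : ∃ C, LipschitzWith C k
  kl : ∀ z : Hor d × ℝ, k (z.1, l z) = z.2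
  lk : ∀ z : Hor d × ℝ, l (z.1, k z) = z.2
  dl : ∀ z : Hor d × ℝ, 0 < lineDeriv ℝ l z (0, 1) ∧ LineDifferentiableAt ℝ l z (0, 1)
  dk : ∀ z : Hor d × ℝ, 0 < lineDeriv ℝ k z (0, 1) ∧ LineDifferentiableAt ℝ k z (0, 1)

namespace VertShear

variable {l k : Hor d × ℝ → ℝ}

lemma symm (h : VertShear l k) : VertShear k l := ⟨h.lip_k, h.lip_l, h.lk, h.kl, h.dk, h.dl⟩

lemma left_inv (h : VertShear l k) (z : Hor d × ℝ) : shearMap k (shearMap l z) = z :=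
  Prod.ext rfl (h.kl z)

lemma right_inv (h : VertShear l k) (z : Hor d × ℝ) : shearMap l (shearMap k z) = z :=
  h.symm.left_inv z

lemma continuous_l (h : VertShear l k) : Continuous l := h.lip_l.choose_spec.continuous

lemma continuous_shear (h : VertShear l k) : Continuous (shearMap l) :=
  continuous_fst.prodMk h.continuous_l

/-- A vertical shear as a homeomorphism. -/
def homeo (h : VertShear l k) : (Hor d × ℝ) ≃ₜ (Hor d × ℝ) where
  toFun := shearMap l
  invFun := shearMap k
  left_inv := h.left_inv
  right_inv := h.right_inv
  continuous_toFun := h.continuous_shear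
  continuous_invFun := h.symm.continuous_shear

lemma measurableEmbedding (h : VertShear l k) : MeasurableEmbedding (shearMap l) :=
  h.homeo.measurableEmbedding

lemma measurable_dl (h : VertShear l k) (v : Hor d × ℝ) :
    Measurable fun z => lineDeriv ℝ l z v :=
  measurable_lineDeriv h.continuous_l

lemma hasDerivAt (h : VertShear l k) (x : Hor d) (y : ℝ) :
    HasDerivAt (fun s => l (x, s)) (lineDeriv ℝ l (x, y) (0, 1)) y := by
  have h1 := (h.dl (x, y)).2.hasLineDerivAt
  have h2 : HasDerivAt (fun t => l ((x, y) + t • (0, 1))) (lineDeriv ℝ l (x, y) (0, 1)) (y - y) := by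
    rw [sub_self]; exact h1
  have h3 := h2.comp_sub_const y y
  refine h3.congr_of_eventuallyEq (Eventually.of_forall fun s => ?_)
  simp

/-- The Jacobian measure of a shear. -/
noncomputable def jac (l : Hor d × ℝ → ℝ) : Measure (Hor d × ℝ) :=
  volume.withDensity fun z => ENNReal.ofReal (lineDeriv ℝ l z (0, 1))

lemma measurePreserving (h : VertShear l k) :
    MeasurePreserving (shearMap l) (jac l) volume := by
  refine ⟨h.continuous_shear.measurable, ?_⟩
  ext s hs
  have hpre : MeasurableSet (shearMap l ⁻¹' s) := hs.preimage h.continuous_shear.measurable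
  have hm : Measurable fun z => ENNReal.ofReal (lineDeriv ℝ l z (0, 1)) :=
    (h.measurable_dl _).ennreal_ofReal
  rw [Measure.map_apply h.continuous_shear.measurable hs, jac, withDensity_apply _ hpre,
    ← lintegral_indicator hpre, ← lintegral_indicator_one hs, Measure.volume_eq_prod,
    lintegral_prod _ (hm.indicator hpre).aemeasurable,
    lintegral_prod _ ((measurable_one.indicator hs).aemeasurable)]
  congr 1; ext x
  have hinj : Set.InjOn (fun y => l (x, y)) Set.univ := by
    intro a _ b _ hab
    have := congrArg (fun y => k (x, y)) hab
    simpa [h.kl (x, a), h.kl (x, b)] using this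
  have himg : (fun y => l (x, y)) '' Set.univ = Set.univ := by
    rw [Set.image_univ, Set.range_eq_univ]
    exact fun y => ⟨k (x, y), h.lk (x, y)⟩
  have := lintegral_image_eq_lintegral_abs_deriv_mul MeasurableSet.univ
    (fun y _ => (h.hasDerivAt x y).hasDerivWithinAt) hinj
    (fun y => s.indicator (fun _ => (1 : ℝ≥0∞)) (x, y))
  rw [himg, setLIntegral_univ, setLIntegral_univ] at this
  refine Eq.trans ?_ this.symm
  congr 1; ext y
  rw [abs_of_pos (h.dl (x, y)).1]
  by_cases hy : (x, l (x, y)) ∈ s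
  · have : (x, y) ∈ shearMap l ⁻¹' s := hy
    simp [this, hy]
  · have : (x, y) ∉ shearMap l ⁻¹' s := hy
    simp [this, hy]

lemma absolutelyContinuous_jac (h : VertShear l k) :
    (volume : Measure (Hor d × ℝ)) ≪ jac l :=
  withDensity_absolutelyContinuous' (h.measurable_dl _).ennreal_ofReal.aemeasurable
    (ae_of_all _ fun z => by simpa using (h.dl z).1)

lemma quasiMeasurePreserving (h : VertShear l k) :
    Measure.QuasiMeasurePreserving (shearMap l) volume volume :=
  h.measurePreserving.quasiMeasurePreserving.mono_left h.absolutelyContinuous_jac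

lemma integral_comp (h : VertShear l k) (F : Hor d × ℝ → ℂ) :
    ∫ z, ((lineDeriv ℝ l z (0, 1) : ℝ) : ℂ) * F (shearMap l z) = ∫ z, F z := by
  rw [← h.measurePreserving.integral_comp h.measurableEmbedding F, jac,
    integral_withDensity_eq_integral_toReal_smul (h.measurable_dl _).ennreal_ofReal
      (ae_of_all _ fun z => ENNReal.ofReal_lt_top)]
  congr 1; ext z
  rw [ENNReal.toReal_ofReal (h.dl z).1.le, Complex.real_smul]

lemma setIntegral_comp (h : VertShear l k) (F : Hor d × ℝ → ℂ) {s : Set (Hor d × ℝ)}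
    (hs : MeasurableSet s) :
    ∫ z in shearMap l ⁻¹' s, ((lineDeriv ℝ l z (0, 1) : ℝ) : ℂ) * F (shearMap l z)
      = ∫ z in s, F z := by
  rw [← integral_indicator hs, ← h.integral_comp,
    ← integral_indicator (hs.preimage h.continuous_shear.measurable)]
  congr 1; ext z
  by_cases hz : shearMap l z ∈ s
  · have : z ∈ shearMap l ⁻¹' s := hz
    rw [Set.indicator_of_mem this, Set.indicator_of_mem hz]
  · have : z ∉ shearMap l ⁻¹' s := hz
    rw [Set.indicator_of_notMem this, Set.indicator_of_notMem hz, mul_zero]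

lemma ae_differentiable (h : VertShear l k) :
    ∀ᵐ z, DifferentiableAt ℝ l z ∧ DifferentiableAt ℝ k (shearMap l z) := by
  obtain ⟨C, hC⟩ := h.lip_l
  obtain ⟨D, hD⟩ := h.lip_k
  filter_upwards [hC.ae_differentiableAt (μ := volume),
    h.quasiMeasurePreserving.ae (hD.ae_differentiableAt (μ := volume))] with z h1 h2
  exact ⟨h1, h2⟩

lemma relation (h : VertShear l k) (v : Hor d × ℝ) :
    ∀ᵐ z, lineDeriv ℝ k (shearMap l z) (v.1, 0)
      + lineDeriv ℝ k (shearMap l z) (0, 1) * lineDeriv ℝ l z v = v.2 := by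
  filter_upwards [h.ae_differentiable] with z ⟨h1, h2⟩
  have e1 : HasFDerivAt (fun z => k (shearMap l z)) ((fderiv ℝ k (shearMap l z)).comp
      ((ContinuousLinearMap.fst ℝ (Hor d) ℝ).prod (fderiv ℝ l z))) z :=
    h2.hasFDerivAt.comp z (hasFDerivAt_fst.prodMk h1.hasFDerivAt)
  have e2 : HasFDerivAt (fun z => k (shearMap l z)) (ContinuousLinearMap.snd ℝ (Hor d) ℝ) z := by
    have : (fun z => k (shearMap l z)) = Prod.snd := by ext z; exact h.kl z
    rw [this]; exact hasFDerivAt_snd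
  have e3 := congrArg (fun L => L v) (e1.unique e2)
  simp only [ContinuousLinearMap.coe_comp, Function.comp_apply, ContinuousLinearMap.prod_apply,
    ContinuousLinearMap.coe_fst', ContinuousLinearMap.coe_snd'] at e3
  rw [h2.lineDeriv_eq_fderiv, h2.lineDeriv_eq_fderiv, h1.lineDeriv_eq_fderiv, ← e3]
  have : (v.1, fderiv ℝ l z v) = (v.1, (0 : ℝ)) + (fderiv ℝ l z v) • ((0 : Hor d), (1 : ℝ)) := by
    simp
  rw [this, map_add, map_smul, smul_eq_mul]
  ring

lemma relation_vert (h : VertShear l k) :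
    ∀ᵐ z, lineDeriv ℝ k (shearMap l z) (0, 1) * lineDeriv ℝ l z (0, 1) = 1 := by
  filter_upwards [h.relation (0, 1)] with z hz
  have h0 : lineDeriv ℝ k (shearMap l z) ((0 : Hor d), (0 : ℝ)) = 0 := lineDeriv_zero
  simpa [h0] using hz

lemma volume_le_jac (h : VertShear l k) {D : ℝ≥0} (hD : LipschitzWith D k) :
    (volume : Measure (Hor d × ℝ)) ≤ (D : ℝ≥0∞) • jac l := by
  refine Measure.le_iff.2 fun s hs => ?_
  rw [Measure.smul_apply, jac, withDensity_apply _ hs, smul_eq_mul,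
    ← lintegral_const_mul _ (h.measurable_dl _).ennreal_ofReal, ← setLIntegral_one]
  refine lintegral_mono_ae (ae_restrict_of_ae ?_)
  filter_upwards [h.relation_vert] with z hz
  have h1 : lineDeriv ℝ k (shearMap l z) (0, 1) ≤ D := by
    have := abs_lineDeriv_le hD (shearMap l z) (0, 1)
    have h2 : ‖((0 : Hor d), (1 : ℝ))‖ = 1 := by simp [Prod.norm_def]
    rw [h2, mul_one] at this
    exact (le_abs_self _).trans this
  have h3 : (1 : ℝ) ≤ D * lineDeriv ℝ l z (0, 1) := by
    have := mul_le_mul_of_nonneg_right h1 (h.dl z).1.le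
    rwa [hz] at this
  calc (1 : ℝ≥0∞) = ENNReal.ofReal 1 := by simp
    _ ≤ ENNReal.ofReal (D * lineDeriv ℝ l z (0, 1)) := ENNReal.ofReal_le_ofReal h3
    _ = _ := by rw [ENNReal.ofReal_mul (NNReal.coe_nonneg D), ENNReal.ofReal_coe_nnreal]

lemma integrableOn_comp (h : VertShear l k) {u : Hor d × ℝ → ℂ} {s : Set (Hor d × ℝ)}
    (hu : IntegrableOn u s volume) :
    IntegrableOn (fun z => u (shearMap l z)) (shearMap l ⁻¹' s) volume := by
  obtain ⟨D, hD⟩ := h.lip_k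
  have h1 : IntegrableOn (fun z => u (shearMap l z)) (shearMap l ⁻¹' s) (jac l) :=
    (h.measurePreserving.integrableOn_comp_preimage h.measurableEmbedding).2 hu
  have h2 : IntegrableOn (fun z => u (shearMap l z)) (shearMap l ⁻¹' s) ((D : ℝ≥0∞) • jac l) := by
    rw [IntegrableOn, Measure.restrict_smul]
    exact h1.integrable.smul_measure ENNReal.coe_ne_top
  exact IntegrableOn.mono_measure h2 (h.volume_le_jac hD)

lemma setLIntegral_comp_le (h : VertShear l k) {c : ℝ}
    (hc : ∀ᵐ z, 1 ≤ c * lineDeriv ℝ l z (0, 1)) (f : Hor d × ℝ → ℝ≥0∞) (s : Set (Hor d × ℝ)) :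
    ∫⁻ z in shearMap l ⁻¹' s, f (shearMap l z) ≤ ENNReal.ofReal c * ∫⁻ z in s, f z := by
  have hle : (volume : Measure (Hor d × ℝ)) ≤ ENNReal.ofReal c • jac l := by
    refine Measure.le_iff.2 fun s hs => ?_
    rw [Measure.smul_apply, jac, withDensity_apply _ hs, smul_eq_mul,
      ← lintegral_const_mul _ (h.measurable_dl _).ennreal_ofReal, ← setLIntegral_one]
    refine lintegral_mono_ae (ae_restrict_of_ae ?_)
    filter_upwards [hc] with z hz
    rw [← ENNReal.ofReal_mul' (h.dl z).1.le]
    simpa using ENNReal.ofReal_le_ofReal hz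
  rw [← h.measurePreserving.setLIntegral_comp_preimage_emb h.measurableEmbedding f s,
    ← smul_eq_mul, ← lintegral_smul_measure, ← Measure.restrict_smul]
  exact lintegral_mono' (Measure.restrict_mono le_rfl hle) le_rfl

lemma locallyIntegrableOn_comp (h : VertShear l k) {u : Hor d × ℝ → ℂ} {s : Set (Hor d × ℝ)}
    (hs : IsOpen s) (hu : LocallyIntegrableOn u s volume) :
    LocallyIntegrableOn (fun z => u (shearMap l z)) (shearMap l ⁻¹' s) volume := by
  rw [locallyIntegrableOn_iff (hs.preimage h.continuous_shear).isLocallyClosed]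
  intro K hK hKc
  have h1 : IntegrableOn u (shearMap l '' K) volume :=
    hu.integrableOn_compact_subset (Set.image_subset_iff.2 hK) (hKc.image h.continuous_shear)
  exact (h.integrableOn_comp h1).mono_set (Set.subset_preimage_image _ _)

end VertShear

/-- The chain rule for weak derivatives under a vertical shear. -/
lemma HasWeakDeriv.comp_shear {l k : Hor d × ℝ → ℝ} (h : VertShear l k) {Ω : Set (Hor d × ℝ)}
    (hΩ : IsOpen Ω) {u p q : Hor d × ℝ → ℂ} {a : Hor d} (hp : HasWeakDeriv Ω u (a, 0) p)
    (hq : HasWeakDeriv Ω u (0, 1) q) :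
    HasWeakDeriv (shearMap l ⁻¹' Ω) (fun z => u (shearMap l z)) (a, 0)
        (fun z => p (shearMap l z) + ((lineDeriv ℝ l z (a, 0) : ℝ) : ℂ) * q (shearMap l z)) ∧
      HasWeakDeriv (shearMap l ⁻¹' Ω) (fun z => u (shearMap l z)) (0, 1)
        (fun z => ((lineDeriv ℝ l z (0, 1) : ℝ) : ℂ) * q (shearMap l z)) := by
  obtain ⟨C, hC⟩ := h.lip_l
  obtain ⟨D, hD⟩ := h.lip_k
  have hΩ' : IsOpen (shearMap l ⁻¹' Ω) := hΩ.preimage h.continuous_shear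
  have hu' := h.locallyIntegrableOn_comp hΩ hp.1
  have hp' := h.locallyIntegrableOn_comp hΩ hp.2.1
  have hq' : ∀ v, LocallyIntegrableOn (fun z => ((lineDeriv ℝ l z v : ℝ) : ℂ) * q (shearMap l z))
      (shearMap l ⁻¹' Ω) volume := by
    intro v
    have h0 := h.locallyIntegrableOn_comp hΩ hq.2.1
    rw [locallyIntegrableOn_iff hΩ'.isLocallyClosed] at h0 ⊢
    intro K hK hKc
    refine Integrable.bdd_mul (c := C * ‖v‖) (h0 K hK hKc) ?_ (ae_of_all _ fun z => ?_)
    · exact (Complex.measurable_ofReal.comp (h.measurable_dl v)).aestronglyMeasurable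
    · simpa using abs_lineDeriv_le hC z v
  -- transported test functions
  have test : ∀ χ : Hor d × ℝ → ℝ, ContDiff ℝ ((⊤ : ℕ∞) : WithTop ℕ∞) χ → HasCompactSupport χ →
      tsupport χ ⊆ shearMap l ⁻¹' Ω → (∃ B, LipschitzWith B fun z => χ (shearMap k z)) ∧
        HasCompactSupport (fun z => χ (shearMap k z)) ∧
        tsupport (fun z => χ (shearMap k z)) ⊆ Ω := by
    intro χ h1 h2 h3
    have hts : tsupport (fun z => χ (shearMap k z)) = shearMap k ⁻¹' (tsupport χ) :=
      tsupport_comp_eq_preimage χ h.symm.homeo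
    refine ⟨?_, h2.comp_homeomorph h.symm.homeo, ?_⟩
    · obtain ⟨A, hA⟩ := ContDiff.lipschitzWith_of_hasCompactSupport h2 h1 (by simp)
      exact ⟨_, hA.comp ((LipschitzWith.prod_fst).prodMk hD)⟩
    · rw [hts]
      intro z hz
      have := h3 hz
      rwa [Set.mem_preimage, h.right_inv] at this
  have hder : ∀ χ : Hor d × ℝ → ℝ, ContDiff ℝ ((⊤ : ℕ∞) : WithTop ℕ∞) χ → ∀ z,
      DifferentiableAt ℝ k z → ∀ v, lineDeriv ℝ (fun z => χ (shearMap k z)) z v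
        = fderiv ℝ χ (shearMap k z) (v.1, lineDeriv ℝ k z v) := by
    intro χ h1 z hz v
    have e : HasFDerivAt (fun z => χ (shearMap k z)) ((fderiv ℝ χ (shearMap k z)).comp
        ((ContinuousLinearMap.fst ℝ (Hor d) ℝ).prod (fderiv ℝ k z))) z :=
      ((h1.differentiable (by simp)) _).hasFDerivAt.comp z (hasFDerivAt_fst.prodMk hz.hasFDerivAt)
    rw [(e.hasLineDerivAt v).lineDeriv, hz.lineDeriv_eq_fderiv]
    simp
  constructor
  · refine hasWeakDeriv_iff.2 ⟨hu', hp'.add (hq' _), fun χ h1 h2 h3 => ?_⟩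
    obtain ⟨⟨B, hB⟩, hcs, hts⟩ := test χ h1 h2 h3
    have J := hp.integral_jacobian hΩ hq hB hcs hts hD
    rw [← h.symm.integral_comp (fun z => ((fderiv ℝ χ z (a, 0) : ℝ) : ℂ) * u (shearMap l z)),
      ← h.symm.integral_comp (fun z => (χ z : ℂ) * (p (shearMap l z)
        + ((lineDeriv ℝ l z (a, 0) : ℝ) : ℂ) * q (shearMap l z)))]
    simp only [h.right_inv]
    have eL : ∫ z, ((lineDeriv ℝ k z (0, 1) : ℝ) : ℂ) *
          (((fderiv ℝ χ (shearMap k z) (a, 0) : ℝ) : ℂ) * u z)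
        = ∫ z, ((lineDeriv ℝ k z (0, 1) * lineDeriv ℝ (fun z => χ (shearMap k z)) z (a, 0)
          - lineDeriv ℝ k z (a, 0) * lineDeriv ℝ (fun z => χ (shearMap k z)) z (0, 1) : ℝ) : ℂ)
            * u z := by
      refine integral_congr_ae ?_
      filter_upwards [hD.ae_differentiableAt (μ := volume)] with z hz
      rw [hder χ h1 z hz, hder χ h1 z hz, ← mul_assoc, ← Complex.ofReal_mul]
      congr 2
      have e1 : (a, lineDeriv ℝ k z (a, 0)) = (a, (0 : ℝ)) +
        (lineDeriv ℝ k z (a, 0)) • ((0 : Hor d), (1 : ℝ)) := by simp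
      have e2 : ((0 : Hor d), lineDeriv ℝ k z (0, 1)) =
        (lineDeriv ℝ k z (0, 1)) • ((0 : Hor d), (1 : ℝ)) := by simp
      simp only
      rw [e1, e2, map_add, map_smul, map_smul]
      simp only [smul_eq_mul]
      ring
    have bk : ∀ v, ∃ M, ∀ z, |χ (shearMap k z) * lineDeriv ℝ k z v| ≤ M := by
      intro v
      obtain ⟨M, hM⟩ := h2.exists_bound_of_continuous h1.continuous
      refine ⟨M * (D * ‖v‖), fun z => ?_⟩
      rw [abs_mul]
      have h0 := hM (shearMap k z)
      rw [Real.norm_eq_abs] at h0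
      exact mul_le_mul h0 (abs_lineDeriv_le hD z v) (abs_nonneg _) ((abs_nonneg _).trans h0)
    have ik : ∀ v {r : Hor d × ℝ → ℂ}, LocallyIntegrableOn r Ω volume →
        Integrable fun z => ((χ (shearMap k z) * lineDeriv ℝ k z v : ℝ) : ℂ) * r z := by
      intro v r hr
      obtain ⟨M, hM⟩ := bk v
      refine integrable_mul_of_support hcs hts hr (c := fun z => χ (shearMap k z) * lineDeriv ℝ k z v)
        ?_ hM fun z hz => ?_
      · exact (hB.continuous.measurable.mul (h.symm.measurable_dl v)).aestronglyMeasurable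
      · rw [image_eq_zero_of_notMem_tsupport hz, zero_mul]
    rw [eL, J, ← integral_neg, ← integral_neg]
    refine (integral_add (ik (0, 1) hp.2.1).neg (ik (a, 0) hq.2.1)).symm.trans ?_
    refine integral_congr_ae ?_
    filter_upwards [h.symm.relation (a, 0), h.symm.relation_vert] with z hz hz'
    have e : lineDeriv ℝ k z (0, 1) * lineDeriv ℝ l (shearMap k z) (a, 0)
        = - lineDeriv ℝ k z (a, 0) := by
      have : lineDeriv ℝ l (shearMap k z) (a, 0)
        = - (lineDeriv ℝ l (shearMap k z) (0, 1) * lineDeriv ℝ k z (a, 0)) := by linarith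
      rw [this]
      linear_combination (- lineDeriv ℝ k z (a, 0)) * hz'
    have e' : ((lineDeriv ℝ k z (0, 1) : ℝ) : ℂ) * ((lineDeriv ℝ l (shearMap k z) (a, 0) : ℝ) : ℂ)
        = - ((lineDeriv ℝ k z (a, 0) : ℝ) : ℂ) := by exact_mod_cast congrArg Complex.ofReal e
    simp only [Pi.neg_apply]
    push_cast
    linear_combination (χ (shearMap k z) : ℂ) * q z * e'
  · refine hasWeakDeriv_iff.2 ⟨hu', hq' _, fun χ h1 h2 h3 => ?_⟩
    obtain ⟨⟨B, hB⟩, hcs, hts⟩ := test χ h1 h2 h3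
    have J := hq.integral_lipschitz hΩ hB hcs hts
    rw [← h.symm.integral_comp (fun z => ((fderiv ℝ χ z (0, 1) : ℝ) : ℂ) * u (shearMap l z)),
      ← h.symm.integral_comp (fun z => (χ z : ℂ) * (((lineDeriv ℝ l z (0, 1) : ℝ) : ℂ)
        * q (shearMap l z)))]
    simp only [h.right_inv]
    have eL : ∫ z, ((lineDeriv ℝ k z (0, 1) : ℝ) : ℂ) *
          (((fderiv ℝ χ (shearMap k z) (0, 1) : ℝ) : ℂ) * u z)
        = ∫ z, ((lineDeriv ℝ (fun z => χ (shearMap k z)) z (0, 1) : ℝ) : ℂ) * u z := by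
      refine integral_congr_ae ?_
      filter_upwards [hD.ae_differentiableAt (μ := volume)] with z hz
      rw [hder χ h1 z hz, ← mul_assoc, ← Complex.ofReal_mul]
      have e2 : ((0 : Hor d), lineDeriv ℝ k z (0, 1)) =
        (lineDeriv ℝ k z (0, 1)) • ((0 : Hor d), (1 : ℝ)) := by simp
      simp only
      rw [e2, map_smul, smul_eq_mul]
    rw [eL, J, neg_inj]
    refine integral_congr_ae ?_
    filter_upwards [h.symm.relation_vert] with z hz
    have e' : ((lineDeriv ℝ l (shearMap k z) (0, 1) : ℝ) : ℂ) * ((lineDeriv ℝ k z (0, 1) : ℝ) : ℂ)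
        = 1 := by exact_mod_cast congrArg Complex.ofReal hz
    linear_combination (- (χ (shearMap k z) : ℂ) * q z) * e'

end WaterWaves

namespace WaterWaves

variable {d : ℕ}

/-! ### Square integrable functions -/

lemma eLpNorm_two_sq {α F : Type*} [MeasurableSpace α] [NormedAddCommGroup F] (μ : Measure α)
    (f : α → F) : eLpNorm f 2 μ ^ 2 = ∫⁻ x, ‖f x‖ₑ ^ 2 ∂μ := by
  rw [eLpNorm_eq_lintegral_rpow_enorm_toReal two_ne_zero ENNReal.ofNat_ne_top, ← ENNReal.rpow_two,
    ← ENNReal.rpow_mul]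
  simp

lemma memLp_two_iff {α F : Type*} [MeasurableSpace α] [NormedAddCommGroup F] {μ : Measure α}
    {f : α → F} : MemLp f 2 μ ↔ AEStronglyMeasurable f μ ∧ ∫⁻ x, ‖f x‖ₑ ^ 2 ∂μ < ⊤ := by
  rw [MemLp, ← eLpNorm_two_sq]
  refine and_congr_right fun _ => ?_
  simp [lt_top_iff_ne_top]

lemma eLpNorm_two_le_iff {α F : Type*} [MeasurableSpace α] [NormedAddCommGroup F] {μ : Measure α}
    {f : α → F} {c : ℝ≥0∞} : eLpNorm f 2 μ ≤ c ↔ ∫⁻ x, ‖f x‖ₑ ^ 2 ∂μ ≤ c ^ 2 := by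
  rw [← eLpNorm_two_sq]
  exact (ENNReal.pow_le_pow_left_iff two_ne_zero).symm

/-- The `L²` norm as a real number. -/
noncomputable def l2norm {α F : Type*} [MeasurableSpace α] [NormedAddCommGroup F]
    (μ : Measure α) (f : α → F) : ℝ := (eLpNorm f 2 μ).toReal

lemma l2norm_nonneg {α F : Type*} [MeasurableSpace α] [NormedAddCommGroup F]
    (μ : Measure α) (f : α → F) : 0 ≤ l2norm μ f := ENNReal.toReal_nonneg

/-! ### Algebra of gradients -/

/-- The complex conjugate of a gradient. -/
noncomputable def conjGrad (p : GradVal d) : GradVal d :=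
  (WithLp.toLp 2 fun i => (starRingEnd ℂ) (p.1 i), (starRingEnd ℂ) p.2)

lemma norm_conjGrad (p : GradVal d) : ‖conjGrad p‖ = ‖p‖ := by
  simp [conjGrad, Prod.norm_def, EuclideanSpace.norm_eq]

lemma continuous_conjGrad : Continuous (conjGrad : GradVal d → GradVal d) := by
  unfold conjGrad; fun_prop

lemma gradDot_add_left (p p' q : GradVal d) : gradDot (p + p') q = gradDot p q + gradDot p' q := by
  simp [gradDot, add_mul, Finset.sum_add_distrib]; ring

lemma gradDot_comm (p q : GradVal d) : gradDot p q = gradDot q p := by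
  simp [gradDot, mul_comm]

lemma gradDot_add_right (p q q' : GradVal d) : gradDot p (q + q') = gradDot p q + gradDot p q' := by
  rw [gradDot_comm, gradDot_add_left, gradDot_comm, gradDot_comm q']

lemma gradDot_smul_left (c : ℂ) (p q : GradVal d) : gradDot (c • p) q = c * gradDot p q := by
  simp [gradDot, Finset.mul_sum, mul_add, mul_assoc]

lemma gradDot_smul_right (c : ℂ) (p q : GradVal d) : gradDot p (c • q) = c * gradDot p q := by
  rw [gradDot_comm, gradDot_smul_left, gradDot_comm]

lemma gradDot_neg_left (p q : GradVal d) : gradDot (-p) q = - gradDot p q := by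
  simpa using gradDot_smul_left (-1) p q

lemma gradDot_sub_left (p p' q : GradVal d) : gradDot (p - p') q = gradDot p q - gradDot p' q := by
  rw [sub_eq_add_neg, gradDot_add_left, gradDot_neg_left, sub_eq_add_neg]

lemma gradDot_sub_right (p q q' : GradVal d) : gradDot p (q - q') = gradDot p q - gradDot p q' := by
  rw [gradDot_comm, gradDot_sub_left, gradDot_comm, gradDot_comm q']

lemma norm_horizontal_le (p : GradVal d) (i : Fin d) : ‖p.1 i‖ ≤ ‖p‖ :=
  (PiLp.norm_apply_le p.1 i).trans (norm_fst_le p)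

lemma norm_gradDot_le (p q : GradVal d) : ‖gradDot p q‖ ≤ (d + 1) * ‖p‖ * ‖q‖ := by
  have h1 : ‖∑ i, p.1 i * q.1 i‖ ≤ d * (‖p‖ * ‖q‖) := by
    refine (norm_sum_le_of_le _ (f := fun i => p.1 i * q.1 i) (n := fun _ => ‖p‖ * ‖q‖)
      fun i _ => ?_).trans (by simp)
    rw [norm_mul]
    exact mul_le_mul (norm_horizontal_le p i) (norm_horizontal_le q i) (norm_nonneg _)
      (norm_nonneg _)
  have h2 : ‖p.2 * q.2‖ ≤ ‖p‖ * ‖q‖ := by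
    rw [norm_mul]
    exact mul_le_mul (norm_snd_le p) (norm_snd_le q) (norm_nonneg _) (norm_nonneg _)
  calc _ ≤ _ := norm_add_le _ _
    _ ≤ d * (‖p‖ * ‖q‖) + ‖p‖ * ‖q‖ := add_le_add h1 h2
    _ = _ := by ring

lemma gradDot_conjGrad_self (p : GradVal d) :
    gradDot p (conjGrad p) = ((‖p.1‖ ^ 2 + ‖p.2‖ ^ 2 : ℝ) : ℂ) := by
  simp only [gradDot, conjGrad, Complex.mul_conj, EuclideanSpace.norm_sq_eq, Complex.normSq_eq_norm_sq]
  push_cast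
  rfl

lemma norm_sq_le_gradDot (p : GradVal d) : ‖p‖ ^ 2 ≤ (gradDot p (conjGrad p)).re := by
  rw [gradDot_conjGrad_self, Complex.ofReal_re]
  rcases max_choice ‖p.1‖ ‖p.2‖ with h | h <;> rw [Prod.norm_def, h] <;> nlinarith [sq_nonneg ‖p.1‖, sq_nonneg ‖p.2‖]

lemma continuous_gradDot : Continuous fun q : GradVal d × GradVal d => gradDot q.1 q.2 := by
  unfold gradDot; fun_prop

section Integrals

variable {α : Type*} [MeasurableSpace α] {μ : Measure α} {U V : α → GradVal d}

lemma memLp_conjGrad (hU : MemLp U 2 μ) : MemLp (fun z => conjGrad (U z)) 2 μ :=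
  hU.of_le (continuous_conjGrad.comp_aestronglyMeasurable hU.1)
    (ae_of_all _ fun _ => (norm_conjGrad _).le)

lemma eLpNorm_gradDot_le (hU : MemLp U 2 μ) (hV : MemLp V 2 μ) :
    eLpNorm (fun z => gradDot (U z) (V z)) 1 μ
      ≤ ((d + 1 : ℝ≥0) : ℝ≥0∞) * eLpNorm U 2 μ * eLpNorm V 2 μ :=
  eLpNorm_le_eLpNorm_mul_eLpNorm_of_nnnorm hU.1 hV.1 gradDot (d + 1)
    (ae_of_all _ fun _ => by exact_mod_cast norm_gradDot_le _ _)

lemma integrable_gradDot (hU : MemLp U 2 μ) (hV : MemLp V 2 μ) :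
    Integrable (fun z => gradDot (U z) (V z)) μ := by
  rw [← memLp_one_iff_integrable]
  have h0 : AEStronglyMeasurable (fun z => gradDot (U z) (V z)) μ := by
    have := continuous_gradDot.comp_aestronglyMeasurable (hU.1.prodMk hV.1)
    exact this
  refine ⟨h0, lt_of_le_of_lt (eLpNorm_gradDot_le hU hV) ?_⟩
  have h1 : eLpNorm U 2 μ < ⊤ := hU.2
  have h2 : eLpNorm V 2 μ < ⊤ := hV.2
  generalize eLpNorm U 2 μ = a at h1
  generalize eLpNorm V 2 μ = b at h2
  exact ENNReal.mul_lt_top (ENNReal.mul_lt_top ENNReal.coe_lt_top h1) h2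

lemma norm_integral_gradDot_le (hU : MemLp U 2 μ) (hV : MemLp V 2 μ) :
    ‖∫ z, gradDot (U z) (V z) ∂μ‖ ≤ (d + 1) * l2norm μ U * l2norm μ V := by
  have h1 : ‖∫ z, gradDot (U z) (V z) ∂μ‖ₑ ≤ eLpNorm (fun z => gradDot (U z) (V z)) 1 μ := by
    rw [eLpNorm_one_eq_lintegral_enorm]; exact enorm_integral_le_lintegral_enorm _
  have h2 := ENNReal.toReal_mono
    ((ENNReal.mul_lt_top (ENNReal.mul_lt_top ENNReal.coe_lt_top hU.2) hV.2).ne)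
    (h1.trans (eLpNorm_gradDot_le hU hV))
  rw [ENNReal.toReal_mul, ENNReal.toReal_mul, ENNReal.coe_toReal, toReal_enorm] at h2
  push_cast at h2
  exact h2

lemma sq_l2norm_le (hU : MemLp U 2 μ) :
    l2norm μ U ^ 2 ≤ (∫ z, gradDot (U z) (conjGrad (U z)) ∂μ).re := by
  have hi := integrable_gradDot hU (memLp_conjGrad hU)
  have h0 : (∫ z, gradDot (U z) (conjGrad (U z)) ∂μ).re
      = ∫ z, (gradDot (U z) (conjGrad (U z))).re ∂μ := (integral_re hi).symm
  rw [h0, l2norm, ← ENNReal.toReal_pow, eLpNorm_two_sq]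
  refine ENNReal.toReal_le_of_le_ofReal (integral_nonneg fun z => ?_) ?_
  · exact (sq_nonneg _).trans (norm_sq_le_gradDot (U z))
  · have h1 := ofReal_integral_eq_lintegral_ofReal hi.re
      (ae_of_all _ fun z => (sq_nonneg _).trans (norm_sq_le_gradDot (U z)))
    simp only [RCLike.re_to_complex] at h1
    rw [h1]
    refine lintegral_mono fun z => ?_
    rw [← ofReal_norm, ← ENNReal.ofReal_pow (norm_nonneg _)]
    exact ENNReal.ofReal_le_ofReal (norm_sq_le_gradDot (U z))

lemma l2norm_add_le {F : Type*} [NormedAddCommGroup F] {f g : α → F} (hf : MemLp f 2 μ)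
    (hg : MemLp g 2 μ) : l2norm μ (f + g) ≤ l2norm μ f + l2norm μ g := by
  rw [l2norm, l2norm, l2norm, ← ENNReal.toReal_add hf.2.ne hg.2.ne]
  exact ENNReal.toReal_mono (ENNReal.add_ne_top.2 ⟨hf.2.ne, hg.2.ne⟩)
    (eLpNorm_add_le hf.1 hg.1 (by norm_num))

lemma l2norm_conjGrad : l2norm μ (fun z => conjGrad (U z)) = l2norm μ U := by
  rw [l2norm, l2norm]
  congr 1
  exact eLpNorm_congr_norm_ae (ae_of_all _ fun z => norm_conjGrad _)

end Integrals

/-! ### Functions of finite energy -/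

namespace HasFiniteEnergyGrad

variable {Ω : Set (Hor d × ℝ)} {u u' : Hor d × ℝ → ℂ} {U U' : Hor d × ℝ → GradVal d}

lemma add (h : HasFiniteEnergyGrad Ω u U) (h' : HasFiniteEnergyGrad Ω u' U') :
    HasFiniteEnergyGrad Ω (u + u') (U + U') :=
  ⟨fun i => (h.1 i).add (h'.1 i), h.2.1.add h'.2.1, h.2.2.add h'.2.2⟩

lemma smul (h : HasFiniteEnergyGrad Ω u U) (c : ℂ) : HasFiniteEnergyGrad Ω (c • u) (c • U) :=
  ⟨fun i => (h.1 i).smul c, h.2.1.smul c, h.2.2.const_smul c⟩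

lemma sub (h : HasFiniteEnergyGrad Ω u U) (h' : HasFiniteEnergyGrad Ω u' U') :
    HasFiniteEnergyGrad Ω (u - u') (U - U') :=
  ⟨fun i => (h.1 i).sub (h'.1 i), h.2.1.sub h'.2.1, h.2.2.sub h'.2.2⟩

lemma conj (h : HasFiniteEnergyGrad Ω u U) :
    HasFiniteEnergyGrad Ω (fun z => (starRingEnd ℂ) (u z)) (fun z => conjGrad (U z)) :=
  ⟨fun i => (h.1 i).conj, h.2.1.conj, memLp_conjGrad h.2.2⟩

lemma congr_ae (hΩ : IsOpen Ω) (h : HasFiniteEnergyGrad Ω u U)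
    (hu : u =ᵐ[volume.restrict Ω] u') (hU : U =ᵐ[volume.restrict Ω] U') :
    HasFiniteEnergyGrad Ω u' U' :=
  ⟨fun i => (h.1 i).congr_ae hΩ hu (hU.mono fun z hz => by simp only [hz]),
    h.2.1.congr_ae hΩ hu (hU.mono fun z hz => by simp only [hz]), h.2.2.ae_eq hU⟩

lemma aestronglyMeasurable (h : HasFiniteEnergyGrad Ω u U) :
    AEStronglyMeasurable u (volume.restrict Ω) := h.2.1.1.aestronglyMeasurable

end HasFiniteEnergyGrad

/-! ### Traces -/

namespace HasTrace

variable {η : Hor d → ℝ} {u v : Hor d × ℝ → ℂ} {f g : Hor d → ℂ}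

lemma of_le {C h : ℝ} {a : Hor d × ℝ → ℝ≥0∞} (hh : 0 < h)
    (ha : Tendsto (fun ε : ℝ => (∫⁻ z in stripBelow η ε, a z) / ENNReal.ofReal ε) (𝓝[>] 0) (𝓝 0))
    (hle : ∀ ε, 0 < ε → ε ≤ h → ∫⁻ z in stripBelow η ε, ‖u z - f z.1‖ₑ ^ 2
      ≤ ENNReal.ofReal C * ∫⁻ z in stripBelow η ε, a z) : HasTrace η u f := by
  have h0 : Tendsto (fun ε : ℝ => ENNReal.ofReal C *
      ((∫⁻ z in stripBelow η ε, a z) / ENNReal.ofReal ε)) (𝓝[>] 0) (𝓝 0) := by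
    simpa using ENNReal.Tendsto.const_mul ha (Or.inr ENNReal.ofReal_ne_top)
  refine tendsto_of_tendsto_of_tendsto_of_le_of_le' tendsto_const_nhds h0
    (Eventually.of_forall fun _ => zero_le) ?_
  filter_upwards [Ioc_mem_nhdsGT hh] with ε hε
  rw [← mul_div_assoc]
  gcongr
  exact hle ε hε.1 hε.2

lemma smul (h : HasTrace η u f) (c : ℂ) : HasTrace η (c • u) (c • f) := by
  refine of_le (C := ‖c‖ ^ 2) one_pos h fun ε _ _ => ?_
  rw [← lintegral_const_mul' _ _ ENNReal.ofReal_ne_top]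
  refine lintegral_mono fun z => ?_
  simp only [Pi.smul_apply, ← smul_sub, enorm_smul, mul_pow]
  rw [← ofReal_norm c, ENNReal.ofReal_pow (norm_nonneg _)]

lemma add {h : ℝ} (hh : 0 < h)
    (hu : AEStronglyMeasurable u (volume.restrict (stripBelow η h)))
    (hf : AEStronglyMeasurable f volume)
    (h1 : HasTrace η u f) (h2 : HasTrace η v g) : HasTrace η (u + v) (f + g) := by
  have hsum : Tendsto (fun ε : ℝ => (∫⁻ z in stripBelow η ε, ‖u z - f z.1‖ₑ ^ 2) / ENNReal.ofReal ε
      + (∫⁻ z in stripBelow η ε, ‖v z - g z.1‖ₑ ^ 2) / ENNReal.ofReal ε) (𝓝[>] 0) (𝓝 0) := by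
    simpa using Tendsto.add h1 h2
  have h0 : Tendsto (fun ε : ℝ => 2 * ((∫⁻ z in stripBelow η ε, ‖u z - f z.1‖ₑ ^ 2) / ENNReal.ofReal ε
      + (∫⁻ z in stripBelow η ε, ‖v z - g z.1‖ₑ ^ 2) / ENNReal.ofReal ε)) (𝓝[>] 0) (𝓝 0) := by
    simpa using ENNReal.Tendsto.const_mul hsum (Or.inr (ENNReal.ofNat_ne_top (n := 2)))
  refine tendsto_of_tendsto_of_tendsto_of_le_of_le' tendsto_const_nhds h0
    (Eventually.of_forall fun _ => zero_le) ?_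
  filter_upwards [Ioc_mem_nhdsGT hh] with ε hε
  rw [← ENNReal.add_div, ← mul_div_assoc]
  gcongr
  have hm : AEMeasurable (fun z : Hor d × ℝ => ‖u z - f z.1‖ₑ ^ 2)
      (volume.restrict (stripBelow η ε)) := by
    have h3 : AEStronglyMeasurable u (volume.restrict (stripBelow η ε)) :=
      hu.mono_measure (Measure.restrict_mono (stripBelow_mono η hε.2) le_rfl)
    have h4 : AEStronglyMeasurable (fun z : Hor d × ℝ => f z.1) (volume.restrict (stripBelow η ε)) :=
      (hf.comp_quasiMeasurePreserving Measure.quasiMeasurePreserving_fst).mono_measure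
        Measure.restrict_le_self
    exact (h3.sub h4).enorm.pow_const 2
  rw [← lintegral_add_left' hm, ← lintegral_const_mul' _ _ (by simp)]
  refine lintegral_mono fun z => ?_
  have e : (u + v) z - (f + g) z.1 = (u z - f z.1) + (v z - g z.1) := by
    simp only [Pi.add_apply]; ring
  rw [e]
  exact (enorm_add_sq_le _ _).trans_eq (by ring)

lemma sub {h : ℝ} (hh : 0 < h)
    (hu : AEStronglyMeasurable u (volume.restrict (stripBelow η h)))
    (hf : AEStronglyMeasurable f volume)
    (h1 : HasTrace η u f) (h2 : HasTrace η v g) : HasTrace η (u - v) (f - g) := by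
  have := add hh hu hf h1 (h2.smul (-1))
  simpa [sub_eq_add_neg] using this

lemma congr_ae {h : ℝ} (hh : 0 < h)
    (huv : u =ᵐ[volume.restrict (stripBelow η h)] v) (hfg : f =ᵐ[volume] g)
    (h1 : HasTrace η u f) : HasTrace η v g := by
  refine of_le (C := 1) hh h1 fun ε _ hε => ?_
  rw [ENNReal.ofReal_one, one_mul]
  have h2 : ∀ᵐ z : Hor d × ℝ, f z.1 = g z.1 :=
    Measure.quasiMeasurePreserving_fst.ae hfg
  refine lintegral_mono_ae ?_
  filter_upwards [ae_restrict_of_ae h2,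
    ae_restrict_of_ae_restrict_of_subset (stripBelow_mono η hε) huv] with z h3 h4
  rw [h3, h4]

lemma conj (h1 : HasTrace η u f) :
    HasTrace η (fun z => (starRingEnd ℂ) (u z)) (fun x => (starRingEnd ℂ) (f x)) := by
  refine of_le (C := 1) one_pos h1 fun ε _ _ => ?_
  rw [ENNReal.ofReal_one, one_mul]
  refine lintegral_mono fun z => ?_
  rw [← map_sub, ← ofReal_norm, Complex.norm_conj, ofReal_norm]

end HasTrace

/-! ### Transport by a vertical shear -/

/-- The gradient of `u ∘ shearMap l` in terms of the gradient `U` of `u`. -/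
noncomputable def pullGrad (l : Hor d × ℝ → ℝ) (U : Hor d × ℝ → GradVal d) (z : Hor d × ℝ) :
    GradVal d :=
  (WithLp.toLp 2 fun i => (U (shearMap l z)).1 i
      + ((lineDeriv ℝ l z (basisVec i, 0) : ℝ) : ℂ) * (U (shearMap l z)).2,
    ((lineDeriv ℝ l z (0, 1) : ℝ) : ℂ) * (U (shearMap l z)).2)

lemma norm_toLp_le_sum (f : Fin d → ℂ) : ‖(WithLp.toLp 2 f : EuclideanSpace ℂ (Fin d))‖ ≤ ∑ i, ‖f i‖ := by
  have : (WithLp.toLp 2 f : EuclideanSpace ℂ (Fin d)) = ∑ i, EuclideanSpace.single i (f i) := by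
    ext j
    simp [Finset.sum_apply, Pi.single_apply]
  rw [this]
  refine (norm_sum_le _ _).trans_eq ?_
  simp

lemma norm_basisVec_prod (i : Fin d) : ‖((basisVec i, 0) : Hor d × ℝ)‖ = 1 := by
  simp [basisVec, Prod.norm_def]

lemma norm_vertical : ‖((0, 1) : Hor d × ℝ)‖ = 1 := by simp [Prod.norm_def]

lemma norm_pullGrad_le {l : Hor d × ℝ → ℝ} {C : ℝ≥0} (hC : LipschitzWith C l)
    (U : Hor d × ℝ → GradVal d) (z : Hor d × ℝ) :
    ‖pullGrad l U z‖ ≤ (1 + (d + 1) * C) * ‖U (shearMap l z)‖ := by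
  set p := U (shearMap l z)
  have hi : ∀ i, |lineDeriv ℝ l z (basisVec i, 0)| ≤ C := fun i => by
    simpa only [norm_basisVec_prod, mul_one] using abs_lineDeriv_le hC z (basisVec i, 0)
  have hy : |lineDeriv ℝ l z (0, 1)| ≤ C := by
    simpa only [norm_vertical, mul_one] using abs_lineDeriv_le hC z (0, 1)
  have hp := norm_snd_le p
  have hC0 := C.2
  rw [Prod.norm_def]
  refine max_le ?_ ?_
  · have e : (pullGrad l U z).1 = p.1 + WithLp.toLp 2 fun i =>
        ((lineDeriv ℝ l z (basisVec i, 0) : ℝ) : ℂ) * p.2 := by ext i; rfl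
    rw [e]
    calc _ ≤ ‖p.1‖ + _ := norm_add_le _ _
      _ ≤ ‖p‖ + ∑ i : Fin d, C * ‖p‖ := by
        refine add_le_add (norm_fst_le p) ((norm_toLp_le_sum _).trans (Finset.sum_le_sum fun i _ => ?_))
        rw [norm_mul, Complex.norm_real, Real.norm_eq_abs]
        exact mul_le_mul (hi i) hp (norm_nonneg _) hC0
      _ ≤ _ := by
        simp only [Finset.sum_const, Finset.card_univ, Fintype.card_fin, nsmul_eq_mul]
        have h1 : 0 ≤ (C : ℝ) * ‖p‖ := mul_nonneg hC0 (norm_nonneg p)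
        linarith
  · have e : (pullGrad l U z).2 = ((lineDeriv ℝ l z (0, 1) : ℝ) : ℂ) * p.2 := rfl
    rw [e, norm_mul, Complex.norm_real, Real.norm_eq_abs]
    calc _ ≤ C * ‖p‖ := mul_le_mul hy hp (norm_nonneg _) hC0
      _ ≤ _ := by
        have h1 := mul_nonneg hC0 (norm_nonneg p)
        have h2 : 0 ≤ (d : ℝ) * (C * ‖p‖) := mul_nonneg (Nat.cast_nonneg d) h1
        change (C : ℝ) * ‖p‖ ≤ (1 + (d + 1) * C) * ‖p‖
        linarith [norm_nonneg p]

namespace VertShear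

variable {l k : Hor d × ℝ → ℝ}

lemma one_le_mul_dl (h : VertShear l k) {D : ℝ≥0} (hD : LipschitzWith D k) :
    ∀ᵐ z, 1 ≤ (D : ℝ) * lineDeriv ℝ l z (0, 1) := by
  filter_upwards [h.relation_vert] with z hz
  have h1 : lineDeriv ℝ k (shearMap l z) (0, 1) ≤ D := by
    have := abs_lineDeriv_le hD (shearMap l z) (0, 1)
    rw [norm_vertical, mul_one] at this
    exact (le_abs_self _).trans this
  have := mul_le_mul_of_nonneg_right h1 (h.dl z).1.le
  rwa [hz] at this

lemma aestronglyMeasurable_comp {F : Type*} [TopologicalSpace F] (h : VertShear l k)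
    {u : Hor d × ℝ → F} {s : Set (Hor d × ℝ)}
    (hu : AEStronglyMeasurable u (volume.restrict s)) :
    AEStronglyMeasurable (fun z => u (shearMap l z)) (volume.restrict (shearMap l ⁻¹' s)) := by
  have hq : Measure.QuasiMeasurePreserving (shearMap l) (volume.restrict (shearMap l ⁻¹' s))
      (volume.restrict s) := by
    refine ⟨h.continuous_shear.measurable, ?_⟩
    refine Measure.AbsolutelyContinuous.mk fun t ht h0 => ?_
    rw [Measure.map_apply h.continuous_shear.measurable ht,
      Measure.restrict_apply (ht.preimage h.continuous_shear.measurable)]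
    rw [Measure.restrict_apply ht] at h0
    exact h.quasiMeasurePreserving.preimage_null h0
  exact hu.comp_quasiMeasurePreserving hq

lemma memLp_comp {F : Type*} [NormedAddCommGroup F] (h : VertShear l k)
    {U : Hor d × ℝ → F} {s : Set (Hor d × ℝ)}
    (hU : MemLp U 2 (volume.restrict s)) :
    MemLp (fun z => U (shearMap l z)) 2 (volume.restrict (shearMap l ⁻¹' s)) := by
  obtain ⟨D, hD⟩ := h.lip_k
  rw [memLp_two_iff] at hU ⊢
  refine ⟨h.aestronglyMeasurable_comp hU.1, ?_⟩
  exact (h.setLIntegral_comp_le (h.one_le_mul_dl hD) _ s).trans_lt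
    (ENNReal.mul_lt_top ENNReal.ofReal_lt_top hU.2)

lemma l2norm_comp_le {F : Type*} [NormedAddCommGroup F] (h : VertShear l k) {D : ℝ≥0}
    (hD : LipschitzWith D k)
    {U : Hor d × ℝ → F} {s : Set (Hor d × ℝ)} (hU : MemLp U 2 (volume.restrict s)) :
    l2norm (volume.restrict (shearMap l ⁻¹' s)) (fun z => U (shearMap l z))
      ≤ (1 + D) * l2norm (volume.restrict s) U := by
  have h1 := h.setLIntegral_comp_le (h.one_le_mul_dl hD) (fun z => ‖U z‖ₑ ^ 2) s
  have h2 : eLpNorm (fun z => U (shearMap l z)) 2 (volume.restrict (shearMap l ⁻¹' s))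
      ≤ ((1 + D : ℝ≥0) : ℝ≥0∞) * eLpNorm U 2 (volume.restrict s) := by
    rw [eLpNorm_two_le_iff, mul_pow, eLpNorm_two_sq]
    refine h1.trans ?_
    gcongr
    rw [ENNReal.ofReal_coe_nnreal]
    norm_cast
    have := D.2
    exact_mod_cast (by nlinarith : (D : ℝ) ≤ (1 + D) ^ 2)
  have h3 := ENNReal.toReal_mono (ENNReal.mul_lt_top ENNReal.coe_lt_top hU.2).ne h2
  rw [ENNReal.toReal_mul, ENNReal.coe_toReal] at h3
  push_cast at h3
  exact h3

lemma strictMono (h : VertShear l k) (x : Hor d) : StrictMono fun y => l (x, y) :=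
  strictMono_of_hasDerivAt_pos (fun y => h.hasDerivAt x y) fun y => (h.dl (x, y)).1

end VertShear

lemma aestronglyMeasurable_pullGrad {l k : Hor d × ℝ → ℝ} (h : VertShear l k)
    {U : Hor d × ℝ → GradVal d} {s : Set (Hor d × ℝ)}
    (hU : AEStronglyMeasurable U (volume.restrict s)) :
    AEStronglyMeasurable (pullGrad l U) (volume.restrict (shearMap l ⁻¹' s)) := by
  have h1 := h.aestronglyMeasurable_comp hU
  have h2 : ∀ v, AEStronglyMeasurable (fun z => ((lineDeriv ℝ l z v : ℝ) : ℂ))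
      (volume.restrict (shearMap l ⁻¹' s)) := fun v =>
    (Complex.measurable_ofReal.comp (h.measurable_dl v)).aestronglyMeasurable
  have hy : AEStronglyMeasurable (fun z => (U (shearMap l z)).2)
      (volume.restrict (shearMap l ⁻¹' s)) := continuous_snd.comp_aestronglyMeasurable h1
  refine AEStronglyMeasurable.prodMk ?_ ((h2 _).mul hy)
  refine (PiLp.continuous_toLp 2 (fun _ : Fin d => ℂ)).comp_aestronglyMeasurable ?_
  refine AEMeasurable.aestronglyMeasurable (aemeasurable_pi_lambda _ fun i => ?_)
  refine AEMeasurable.add ?_ ((h2 _).mul hy).aemeasurable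
  exact ((by fun_prop : Continuous fun p : GradVal d => p.1 i).comp_aestronglyMeasurable
    h1).aemeasurable

lemma memLp_pullGrad {l k : Hor d × ℝ → ℝ} (h : VertShear l k)
    {U : Hor d × ℝ → GradVal d} {s : Set (Hor d × ℝ)}
    (hU : MemLp U 2 (volume.restrict s)) :
    MemLp (pullGrad l U) 2 (volume.restrict (shearMap l ⁻¹' s)) := by
  obtain ⟨C, hC⟩ := h.lip_l
  exact (h.memLp_comp hU).of_le_mul (aestronglyMeasurable_pullGrad h hU.1)
    (ae_of_all _ fun z => norm_pullGrad_le hC U z)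

lemma l2norm_le_of_le_mul {α F F' : Type*} [MeasurableSpace α] [NormedAddCommGroup F]
    [NormedAddCommGroup F'] {μ : Measure α} {f : α → F} {g : α → F'} {c : ℝ} (hc : 0 ≤ c)
    (hg : MemLp g 2 μ) (hle : ∀ᵐ z ∂μ, ‖f z‖ ≤ c * ‖g z‖) : l2norm μ f ≤ c * l2norm μ g := by
  have h1 := eLpNorm_le_mul_eLpNorm_of_ae_le_mul hle 2
  have h2 := ENNReal.toReal_mono (ENNReal.mul_lt_top ENNReal.ofReal_lt_top hg.2).ne h1
  rwa [ENNReal.toReal_mul, ENNReal.toReal_ofReal hc] at h2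

lemma l2norm_pullGrad_le {l k : Hor d × ℝ → ℝ} (h : VertShear l k) {C D : ℝ≥0}
    (hC : LipschitzWith C l) (hD : LipschitzWith D k)
    {U : Hor d × ℝ → GradVal d} {s : Set (Hor d × ℝ)}
    (hU : MemLp U 2 (volume.restrict s)) :
    l2norm (volume.restrict (shearMap l ⁻¹' s)) (pullGrad l U)
      ≤ (1 + (d + 1) * C) * ((1 + D) * l2norm (volume.restrict s) U) := by
  have hc : (0 : ℝ) ≤ 1 + (d + 1) * C := by positivity
  refine (l2norm_le_of_le_mul hc (h.memLp_comp hU)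
    (ae_of_all _ fun z => norm_pullGrad_le hC U z)).trans ?_
  exact mul_le_mul_of_nonneg_left (h.l2norm_comp_le hD hU) hc

lemma HasFiniteEnergyGrad.comp_shear {l k : Hor d × ℝ → ℝ} (h : VertShear l k)
    {Ω : Set (Hor d × ℝ)} (hΩ : IsOpen Ω) {u : Hor d × ℝ → ℂ} {U : Hor d × ℝ → GradVal d}
    (hU : HasFiniteEnergyGrad Ω u U) :
    HasFiniteEnergyGrad (shearMap l ⁻¹' Ω) (fun z => u (shearMap l z)) (pullGrad l U) := by
  refine ⟨fun i => ((hU.1 i).comp_shear h hΩ hU.2.1).1, ?_, memLp_pullGrad h hU.2.2⟩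
  exact ((HasWeakDeriv.dir_zero hU.2.1.1 : HasWeakDeriv Ω u (0, 0) 0).comp_shear h hΩ hU.2.1).2

lemma HasTrace.comp_shear {l k : Hor d × ℝ → ℝ} (h : VertShear l k) {η₁ η₂ : Hor d → ℝ}
    (hl : ∀ x, l (x, η₂ x) = η₁ x) {u : Hor d × ℝ → ℂ} {f : Hor d → ℂ}
    (hu : HasTrace η₁ u f) : HasTrace η₂ (fun z => u (shearMap l z)) f := by
  obtain ⟨C₀, hC₀⟩ := h.lip_l
  obtain ⟨D, hD⟩ := h.lip_k
  set C : ℝ := C₀ + 1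
  have hCpos : 0 < C := by positivity
  have hsub : ∀ ε, stripBelow η₂ ε ⊆ shearMap l ⁻¹' stripBelow η₁ (C * ε) := by
    rintro ε ⟨x, y⟩ ⟨h1, h2⟩
    simp only at h1 h2
    have h3 : l (x, y) < η₁ x := by rw [← hl x]; exact h.strictMono x h2
    refine ⟨?_, h3⟩
    have h4 := hC₀.dist_le_mul (x, η₂ x) (x, y)
    rw [hl x, Real.dist_eq, abs_of_pos (by simpa [shearMap] using h3), Prod.dist_eq, dist_self,
      Real.dist_eq, abs_of_pos (by linarith : 0 < η₂ x - y), max_eq_right (by linarith)] at h4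
    have h5 : (C₀ : ℝ) * (η₂ x - y) ≤ C₀ * ε := by gcongr; linarith
    have : C * ε = C₀ * ε + ε := by ring
    change η₁ x - C * ε < l (x, y)
    linarith
  have hC' : Tendsto (fun ε : ℝ => C * ε) (𝓝[>] 0) (𝓝[>] 0) := by
    refine tendsto_nhdsWithin_iff.2 ⟨?_, ?_⟩
    · have : Tendsto (fun ε : ℝ => C * ε) (𝓝 0) (𝓝 (C * 0)) := (continuous_const.mul continuous_id).tendsto 0
      rw [mul_zero] at this
      exact this.mono_left nhdsWithin_le_nhds
    · filter_upwards [self_mem_nhdsWithin] with ε hε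
      exact mul_pos hCpos hε
  have h1 := hu.comp hC'
  have h2 : Tendsto (fun ε : ℝ => ENNReal.ofReal (D * C) *
      ((∫⁻ z in stripBelow η₁ (C * ε), ‖u z - f z.1‖ₑ ^ 2) / ENNReal.ofReal (C * ε)))
      (𝓝[>] 0) (𝓝 0) := by
    have := ENNReal.Tendsto.const_mul (a := ENNReal.ofReal (D * C)) h1 (Or.inr ENNReal.ofReal_ne_top)
    rwa [mul_zero] at this
  refine tendsto_of_tendsto_of_tendsto_of_le_of_le' tendsto_const_nhds h2
    (Eventually.of_forall fun _ => zero_le) ?_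
  filter_upwards [self_mem_nhdsWithin] with ε hε
  have hε : 0 < ε := hε
  have h3 : ∫⁻ z in stripBelow η₂ ε, ‖u (shearMap l z) - f z.1‖ₑ ^ 2
      ≤ ENNReal.ofReal D * ∫⁻ z in stripBelow η₁ (C * ε), ‖u z - f z.1‖ₑ ^ 2 :=
    (lintegral_mono_set (hsub ε)).trans
      (h.setLIntegral_comp_le (h.one_le_mul_dl hD) (fun z => ‖u z - f z.1‖ₑ ^ 2) _)
  calc _ ≤ (ENNReal.ofReal D * ∫⁻ z in stripBelow η₁ (C * ε), ‖u z - f z.1‖ₑ ^ 2)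
        / ENNReal.ofReal ε := by gcongr
    _ = _ := by
      rw [ENNReal.ofReal_mul (NNReal.coe_nonneg D), ENNReal.ofReal_mul hCpos.le, mul_assoc, mul_div_assoc]
      congr 1
      rw [← mul_div_assoc, ENNReal.mul_div_mul_left _ _ (by simpa using hCpos) ENNReal.ofReal_ne_top]

end WaterWaves

namespace WaterWaves

variable {d : ℕ}

/-! ### Local bounds for functions that vanish on the graph -/

/-- Near `z`, functions of finite energy that vanish on the graph of `η` are controlled by their
energy. -/
def LocalBound (Ω : Set (Hor d × ℝ)) (η : Hor d → ℝ) (z : Hor d × ℝ) : Prop :=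
  ∃ r > 0, ∃ K : ℝ≥0, Metric.ball z r ⊆ Ω ∧ ∀ θ Θ, HasFiniteEnergyGrad Ω θ Θ → HasTrace η θ 0 →
    ∫⁻ z in Metric.ball z r, ‖θ z‖ₑ ^ 2 ≤ K * ∫⁻ z in Ω, ‖Θ z‖ₑ ^ 2

lemma setLIntegral_add_right_le {B Ω : Set (Hor d × ℝ)} (w : Hor d × ℝ)
    (hsub : ∀ z ∈ B, z + w ∈ Ω) (F : Hor d × ℝ → ℝ≥0∞) :
    ∫⁻ z in B, F (z + w) ≤ ∫⁻ z in Ω, F z := by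
  rw [← (measurePreserving_add_right volume w).setLIntegral_comp_preimage_emb
    (measurableEmbedding_addRight w) F Ω]
  exact lintegral_mono_set hsub

lemma eq_sum_basisVec (v : Hor d × ℝ) :
    v = (∑ i, v.1 i • ((basisVec i, 0) : Hor d × ℝ)) + v.2 • (0, 1) := by
  refine Prod.ext ?_ ?_
  · rw [Prod.fst_add, Prod.fst_sum]
    ext j
    simp [basisVec, Pi.single_apply]
  · rw [Prod.snd_add, Prod.snd_sum]
    simp

lemma HasFiniteEnergyGrad.hasWeakDeriv {Ω : Set (Hor d × ℝ)} {u : Hor d × ℝ → ℂ}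
    {U : Hor d × ℝ → GradVal d} (h : HasFiniteEnergyGrad Ω u U) (v : Hor d × ℝ) :
    HasWeakDeriv Ω u v (fun z => (∑ i, (v.1 i : ℂ) * (U z).1 i) + (v.2 : ℂ) * (U z).2) := by
  have h1 := HasWeakDeriv.dir_sum Finset.univ h.2.1.1 fun i _ => (h.1 i).dir_smul (v.1 i)
  have h2 := h1.dir_add (h.2.1.dir_smul v.2)
  rw [← eq_sum_basisVec] at h2
  convert h2 using 1
  ext z
  simp

lemma enorm_directional_le (v : Hor d × ℝ) (p : GradVal d) :
    ‖(∑ i, (v.1 i : ℂ) * p.1 i) + (v.2 : ℂ) * p.2‖ₑ ^ 2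
      ≤ (‖((d + 1) * ‖v‖ : ℝ)‖ₑ) ^ 2 * ‖p‖ₑ ^ 2 := by
  rw [← mul_pow]
  gcongr
  have : ‖(∑ i, (v.1 i : ℂ) * p.1 i) + (v.2 : ℂ) * p.2‖ ≤ (d + 1) * ‖v‖ * ‖p‖ := by
    have h1 : ‖∑ i, (v.1 i : ℂ) * p.1 i‖ ≤ d * (‖v‖ * ‖p‖) := by
      refine (norm_sum_le_of_le _ (f := fun i => (v.1 i : ℂ) * p.1 i) (n := fun _ => ‖v‖ * ‖p‖)
        fun i _ => ?_).trans (by simp)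
      rw [norm_mul, Complex.norm_real]
      exact mul_le_mul ((PiLp.norm_apply_le v.1 i).trans (norm_fst_le v)) (norm_horizontal_le p i)
        (norm_nonneg _) (norm_nonneg _)
    have h2 : ‖(v.2 : ℂ) * p.2‖ ≤ ‖v‖ * ‖p‖ := by
      rw [norm_mul, Complex.norm_real]
      exact mul_le_mul (norm_snd_le v) (norm_snd_le p) (norm_nonneg _) (norm_nonneg _)
    calc _ ≤ _ := norm_add_le _ _
      _ ≤ d * (‖v‖ * ‖p‖) + ‖v‖ * ‖p‖ := add_le_add h1 h2
      _ = _ := by ring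
  rw [← ofReal_norm, ← ofReal_norm, ← ofReal_norm, ← ENNReal.ofReal_mul (norm_nonneg _),
    Real.norm_of_nonneg (by positivity)]
  exact ENNReal.ofReal_le_ofReal this

lemma localBound_of_mem_strip {Ω : Set (Hor d × ℝ)} (hΩ : IsOpen Ω) {η : Hor d → ℝ}
    (hη : Continuous η) {h : ℝ} (hh : 0 < h) (hS : stripBelow η h ⊆ Ω) {z : Hor d × ℝ}
    (hz : z ∈ stripBelow η h) : LocalBound Ω η z := by
  obtain ⟨r, hr, hb⟩ := Metric.isOpen_iff.1 (isOpen_stripBelow hη h) z hz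
  refine ⟨r, hr, (2 * h ^ 2).toNNReal, hb.trans hS, fun θ Θ hθ htr => ?_⟩
  refine (lintegral_mono_set hb).trans ((hθ.2.1.poincare hΩ hη htr hh hS).trans ?_)
  gcongr ?_ * ?_
  · exact le_rfl
  · refine (lintegral_mono_set hS).trans (lintegral_mono fun z => ?_)
    gcongr
    simpa only [enorm_le_iff_norm_le] using norm_snd_le (Θ z)

lemma LocalBound.translate {Ω : Set (Hor d × ℝ)} (hΩ : IsOpen Ω) {η : Hor d → ℝ}
    {z₀ z₁ : Hor d × ℝ} {R : ℝ} (hR : Metric.ball z₀ R ⊆ Ω) (hz : z₁ ∈ Metric.ball z₀ R)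
    (h1 : LocalBound Ω η z₁) : LocalBound Ω η z₀ := by
  obtain ⟨r, hr, K, hb, hK⟩ := h1
  set v := z₁ - z₀ with hv
  have hvR : ‖v‖ < R := by rwa [mem_ball_iff_norm] at hz
  set ρ := min (R - ‖v‖) r
  have hρ : 0 < ρ := lt_min (by linarith) hr
  have hseg : ∀ z ∈ Metric.ball z₀ ρ, ∀ s ∈ Set.Icc (0 : ℝ) 1, z + s • v ∈ Ω := by
    intro z hzB s hs
    apply hR
    rw [mem_ball_iff_norm] at hzB ⊢
    have e : z + s • v - z₀ = (z - z₀) + s • v := by abel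
    have h2 : ‖s • v‖ ≤ ‖v‖ := by
      rw [norm_smul, Real.norm_of_nonneg hs.1]
      exact mul_le_of_le_one_left (norm_nonneg _) hs.2
    have h3 : ρ ≤ R - ‖v‖ := min_le_left _ _
    rw [e]
    linarith [norm_add_le (z - z₀) (s • v)]
  set M : ℝ≥0 := ‖((d + 1) * ‖v‖ : ℝ)‖₊ ^ 2
  refine ⟨ρ, hρ, 2 * K + 2 * M, ?_, fun θ Θ hθ htr => ?_⟩
  · exact (Metric.ball_subset_ball ((min_le_left _ _).trans (by linarith [norm_nonneg v]))).trans hR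
  obtain ⟨p, hp, hpe, hD⟩ := (hθ.hasWeakDeriv v).exists_measurable hΩ
  have hT := hD.lintegral_translate_le hΩ hp Metric.isOpen_ball.measurableSet hseg
  set E := ∫⁻ z in Ω, ‖Θ z‖ₑ ^ 2
  have hpE : ∫⁻ z in Ω, ‖p z‖ₑ ^ 2 ≤ M * E := by
    rw [← lintegral_const_mul' _ _ ENNReal.coe_ne_top]
    refine lintegral_mono_ae ?_
    filter_upwards [hpe] with z hz
    rw [← hz]
    have hM : (M : ℝ≥0∞) = ‖((d + 1) * ‖v‖ : ℝ)‖ₑ ^ 2 := by simp [M, enorm]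
    rw [hM]
    exact enorm_directional_le v (Θ z)
  have hsecond : ∫⁻ z in Metric.ball z₀ ρ, ‖θ (z + v) - θ z‖ₑ ^ 2 ≤ M * E := by
    refine hT.trans ?_
    calc _ ≤ ∫⁻ s in Set.Ioc (0 : ℝ) 1, M * E := by
          refine setLIntegral_mono measurable_const fun s hs => ?_
          exact (setLIntegral_add_right_le (s • v) (fun z hz => hseg z hz s ⟨hs.1.le, hs.2⟩)
            fun z => ‖p z‖ₑ ^ 2).trans hpE
      _ = _ := by simp
  have hfirst : ∫⁻ z in Metric.ball z₀ ρ, ‖θ (z + v)‖ₑ ^ 2 ≤ K * E := by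
    refine (setLIntegral_add_right_le (Ω := Metric.ball z₁ r) v (fun z hzB => ?_)
      fun z => ‖θ z‖ₑ ^ 2).trans (hK θ Θ hθ htr)
    rw [mem_ball_iff_norm] at hzB ⊢
    have e : z + v - z₁ = z - z₀ := by rw [hv]; abel
    rw [e]
    exact hzB.trans_le (min_le_right _ _)
  have hmeas : AEMeasurable (fun z => ‖θ (z + v)‖ₑ ^ 2)
      (volume.restrict (Metric.ball z₀ ρ)) := by
    have hsub : ∀ z ∈ Metric.ball z₀ ρ, z + v ∈ Ω := fun z hz => by
      simpa using hseg z hz 1 (by simp)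
    have hq : Measure.QuasiMeasurePreserving (fun z : Hor d × ℝ => z + v)
        (volume.restrict (Metric.ball z₀ ρ)) (volume.restrict Ω) := by
      refine ⟨measurable_add_const v, Measure.AbsolutelyContinuous.mk fun t ht h0 => ?_⟩
      rw [Measure.map_apply (measurable_add_const v) ht,
        Measure.restrict_apply (ht.preimage (measurable_add_const v))]
      rw [Measure.restrict_apply ht] at h0
      have := (measurePreserving_add_right volume v).quasiMeasurePreserving.preimage_null h0
      exact measure_mono_null (show _ ⊆ (fun z : Hor d × ℝ => z + v) ⁻¹' (t ∩ Ω) from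
        fun z hz => ⟨hz.1, hsub z hz.2⟩) this
    exact ((hθ.aestronglyMeasurable.comp_quasiMeasurePreserving hq).enorm.pow_const 2)
  calc ∫⁻ z in Metric.ball z₀ ρ, ‖θ z‖ₑ ^ 2
      ≤ ∫⁻ z in Metric.ball z₀ ρ, (2 * ‖θ (z + v)‖ₑ ^ 2 + 2 * ‖θ (z + v) - θ z‖ₑ ^ 2) := by
        refine lintegral_mono fun z => ?_
        have := enorm_sub_sq_le (θ (z + v)) (θ (z + v) - θ z)
        rw [sub_sub_cancel] at this
        exact this
    _ = 2 * (∫⁻ z in Metric.ball z₀ ρ, ‖θ (z + v)‖ₑ ^ 2)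
        + 2 * ∫⁻ z in Metric.ball z₀ ρ, ‖θ (z + v) - θ z‖ₑ ^ 2 := by
        rw [lintegral_add_left' (hmeas.const_mul 2), lintegral_const_mul' _ _ (by simp),
          lintegral_const_mul' _ _ (by simp)]
    _ ≤ 2 * (K * E) + 2 * (M * E) := by gcongr
    _ = _ := by push_cast; ring

lemma isOpen_fluidDomain {O : Set (Hor d × ℝ)} (hO : IsOpen O) {η : Hor d → ℝ}
    (hη : Continuous η) : IsOpen (fluidDomain O η) :=
  hO.inter (isOpen_lt continuous_snd (hη.comp continuous_fst))

lemma stripBelow_subset_fluidDomain {O : Set (Hor d × ℝ)} {η : Hor d → ℝ} {h : ℝ}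
    (hS : stripBelow η h ⊆ O) : stripBelow η h ⊆ fluidDomain O η :=
  fun _ hz => ⟨hS hz, hz.2⟩

/-- As `O` is connected, the local bound propagates from the strip to the whole fluid domain. -/
lemma localBound_of_mem {O : Set (Hor d × ℝ)} (hO : IsOpen O) (hconn : IsPreconnected O)
    {η : Hor d → ℝ} (hη : Continuous η) {h : ℝ} (hh : 0 < h) (hS : stripBelow η h ⊆ O)
    {z : Hor d × ℝ} (hz : z ∈ fluidDomain O η) : LocalBound (fluidDomain O η) η z := by
  set Ω := fluidDomain O η
  have hΩ : IsOpen Ω := isOpen_fluidDomain hO hη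
  by_contra hcon
  have hstrip : ∀ z ∈ stripBelow η h, LocalBound Ω η z := fun z hz =>
    localBound_of_mem_strip hΩ hη hh (stripBelow_subset_fluidDomain hS) hz
  have hA : IsOpen {z | LocalBound Ω η z} := by
    rw [Metric.isOpen_iff]
    rintro z ⟨r, hr, K, hb, hK⟩
    refine ⟨r, hr, fun z' hz' => ?_⟩
    obtain ⟨r', hr', hb'⟩ := Metric.isOpen_iff.1 Metric.isOpen_ball z' hz'
    exact ⟨r', hr', K, hb'.trans hb, fun θ Θ h1 h2 => (lintegral_mono_set hb').trans (hK θ Θ h1 h2)⟩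
  have hv : IsOpen {z | z ∈ Ω ∧ ¬ LocalBound Ω η z} := by
    rw [Metric.isOpen_iff]
    rintro z ⟨hzΩ, hzn⟩
    obtain ⟨R, hR, hb⟩ := Metric.isOpen_iff.1 hΩ z hzΩ
    exact ⟨R, hR, fun z' hz' => ⟨hb hz', fun h' => hzn (h'.translate hΩ hb hz')⟩⟩
  have hu : IsOpen ({z | LocalBound Ω η z} ∪ (O ∩ {z | η z.1 - h < z.2})) :=
    hA.union (hO.inter (isOpen_lt ((hη.comp continuous_fst).sub continuous_const) continuous_snd))
  have hmem : ((0, η 0 - h / 2) : Hor d × ℝ) ∈ stripBelow η h :=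
    ⟨by simp only; linarith, by simp only; linarith⟩
  have hcov : O ⊆ ({z | LocalBound Ω η z} ∪ (O ∩ {z | η z.1 - h < z.2}))
      ∪ {z | z ∈ Ω ∧ ¬ LocalBound Ω η z} := by
    intro w hw
    by_cases h1 : w.2 < η w.1
    · by_cases h2 : LocalBound Ω η w
      · exact Or.inl (Or.inl h2)
      · exact Or.inr ⟨⟨hw, h1⟩, h2⟩
    · refine Or.inl (Or.inr ⟨hw, ?_⟩)
      simp only [Set.mem_ofPred_eq]
      linarith
  obtain ⟨w, -, hw1, hw2⟩ := hconn _ _ hu hv hcov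
    ⟨_, hS hmem, Or.inl (hstrip _ hmem)⟩ ⟨z, hz.1, hz, hcon⟩
  rcases hw1 with hw1 | hw1
  · exact hw2.2 hw1
  · exact hw2.2 (hstrip w ⟨hw1.2, hw2.1.2⟩)

/-! ### Limits of functions of finite energy -/

lemma HasWeakDeriv.of_tendsto {Ω : Set (Hor d × ℝ)} {u p : Hor d × ℝ → ℂ}
    {un pn : ℕ → Hor d × ℝ → ℂ} {v : Hor d × ℝ}
    (hu : LocallyIntegrableOn u Ω volume) (hp : LocallyIntegrableOn p Ω volume)
    (h : ∀ n, HasWeakDeriv Ω (un n) v (pn n))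
    (cu : ∀ K ⊆ Ω, IsCompact K → Tendsto (fun n => ∫⁻ z in K, ‖un n z - u z‖ₑ) atTop (𝓝 0))
    (cp : ∀ K ⊆ Ω, IsCompact K → Tendsto (fun n => ∫⁻ z in K, ‖pn n z - p z‖ₑ) atTop (𝓝 0)) :
    HasWeakDeriv Ω u v p := by
  refine hasWeakDeriv_iff.2 ⟨hu, hp, fun χ h1 h2 h3 => ?_⟩
  have key : ∀ (c : Hor d × ℝ → ℝ), Continuous c → HasCompactSupport c → tsupport c ⊆ Ω →
      ∀ (q : Hor d × ℝ → ℂ) (qn : ℕ → Hor d × ℝ → ℂ), LocallyIntegrableOn q Ω volume →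
      (∀ n, LocallyIntegrableOn (qn n) Ω volume) →
      (∀ K ⊆ Ω, IsCompact K → Tendsto (fun n => ∫⁻ z in K, ‖qn n z - q z‖ₑ) atTop (𝓝 0)) →
      Tendsto (fun n => ∫ z, (c z : ℂ) * qn n z) atTop (𝓝 (∫ z, (c z : ℂ) * q z)) := by
    intro c hc hcs hts q qn hq hqn hlim
    obtain ⟨M, hM⟩ := hcs.exists_bound_of_continuous hc
    refine tendsto_integral_of_L1' _ (integrable_mul_of_tsupport hq hc hcs hts).aestronglyMeasurable
      (Eventually.of_forall fun n => integrable_mul_of_tsupport (hqn n) hc hcs hts) ?_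
    have h0 : Tendsto (fun n => ENNReal.ofReal M * ∫⁻ z in tsupport c, ‖qn n z - q z‖ₑ) atTop
        (𝓝 0) := by
      have := ENNReal.Tendsto.const_mul (a := ENNReal.ofReal M) (hlim _ hts hcs)
        (Or.inr ENNReal.ofReal_ne_top)
      rwa [mul_zero] at this
    refine tendsto_of_tendsto_of_tendsto_of_le_of_le tendsto_const_nhds h0 (fun _ => zero_le)
      fun n => ?_
    rw [eLpNorm_one_eq_lintegral_enorm, ← lintegral_const_mul' _ _ ENNReal.ofReal_ne_top,
      ← lintegral_indicator (isClosed_tsupport c).measurableSet]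
    refine lintegral_mono fun z => ?_
    by_cases hz : z ∈ tsupport c
    · rw [Set.indicator_of_mem hz, Pi.sub_apply, ← mul_sub, enorm_mul]
      gcongr
      rw [← ofReal_norm, Complex.norm_real]
      exact ENNReal.ofReal_le_ofReal (hM z)
    · simp [image_eq_zero_of_notMem_tsupport hz]
  have k1 := key (fun z => fderiv ℝ χ z v) (continuous_fderiv_apply' h1 v)
    (hasCompactSupport_fderiv_apply' h2 v) ((tsupport_fderiv_apply_subset' χ v).trans h3) u un hu
    (fun n => (h n).1) cu
  have k2 := key χ h1.continuous h2 h3 p pn hp (fun n => (h n).2.1) cp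
  refine tendsto_nhds_unique k1 (k2.neg.congr fun n => ?_)
  exact ((hasWeakDeriv_iff.1 (h n)).2.2 χ h1 h2 h3).symm

end WaterWaves

namespace WaterWaves

variable {d : ℕ}

/-! ### The space of functions vanishing on the graph is closed for the energy -/

/-- Local bounds give a weight on `Ω` for which functions vanishing on the graph are controlled by
their energy. -/
lemma exists_weight {Ω : Set (Hor d × ℝ)} {η : Hor d → ℝ}
    (hloc : ∀ z ∈ Ω, LocalBound Ω η z) :
    ∃ μ : Measure (Hor d × ℝ), volume.restrict Ω ≪ μ ∧ μ ≪ volume.restrict Ω ∧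
      (∀ z ∈ Ω, ∃ r > 0, ∃ c : ℝ≥0, volume.restrict (Metric.ball z r) ≤ (c : ℝ≥0∞) • μ) ∧
      ∀ θ Θ, HasFiniteEnergyGrad Ω θ Θ → HasTrace η θ 0 →
        ∫⁻ z, ‖θ z‖ₑ ^ 2 ∂μ ≤ ∫⁻ z in Ω, ‖Θ z‖ₑ ^ 2 := by
  choose r hr K hb hK using fun z : Ω => hloc z z.2
  obtain ⟨T, hT, hTc⟩ := TopologicalSpace.isOpen_iUnion_countable
    (fun z : Ω => Metric.ball (z : Hor d × ℝ) (r z)) fun _ => Metric.isOpen_ball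
  have hcov : ∀ z ∈ Ω, ∃ t ∈ T, z ∈ Metric.ball (t : Hor d × ℝ) (r t) := by
    intro z hz
    have : z ∈ ⋃ i ∈ T, Metric.ball (i : Hor d × ℝ) (r i) := by
      rw [hTc]
      exact Set.mem_iUnion.2 ⟨⟨z, hz⟩, Metric.mem_ball_self (hr _)⟩
    simpa using this
  have : Countable T := hT.to_subtype
  obtain ⟨δ, hδ, hsum⟩ := ENNReal.exists_pos_tsum_mul_lt_of_countable one_ne_zero
    (fun t : T => (K t : ℝ≥0∞)) fun _ => ENNReal.coe_ne_top
  set ν : T → Measure (Hor d × ℝ) := fun t => (δ t : ℝ≥0∞) •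
    volume.restrict (Metric.ball ((t : Ω) : Hor d × ℝ) (r t)) with hν
  have hle : ∀ t : T, volume.restrict (Metric.ball ((t : Ω) : Hor d × ℝ) (r t))
      ≤ (((δ t)⁻¹ : ℝ≥0) : ℝ≥0∞) • Measure.sum ν := by
    intro t
    calc _ = (((δ t)⁻¹ : ℝ≥0) : ℝ≥0∞) • ν t := by
          rw [hν, smul_smul, ← ENNReal.coe_mul, inv_mul_cancel₀ (hδ t).ne', ENNReal.coe_one,
            one_smul]
      _ ≤ _ := Measure.le_iff'.2 fun s => by
          rw [Measure.smul_apply, Measure.smul_apply]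
          exact mul_le_mul_right (Measure.le_iff'.1 (Measure.le_sum ν t) s) _
  refine ⟨Measure.sum ν, ?_, ?_, ?_, ?_⟩
  · refine Measure.AbsolutelyContinuous.mk fun s hs h0 => ?_
    have h1 : ∀ t : T, volume (s ∩ Metric.ball ((t : Ω) : Hor d × ℝ) (r t)) = 0 := by
      intro t
      have := (Measure.le_iff'.1 (hle t) s)
      rw [Measure.smul_apply, h0, smul_zero, Measure.restrict_apply hs] at this
      exact le_antisymm this zero_le
    rw [Measure.restrict_apply hs]
    refine measure_mono_null (fun z hz => ?_) (measure_iUnion_null h1)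
    obtain ⟨t, ht, hzt⟩ := hcov z hz.2
    exact Set.mem_iUnion.2 ⟨⟨t, ht⟩, hz.1, hzt⟩
  · refine Measure.absolutelyContinuous_sum_left fun t => ?_
    refine Measure.AbsolutelyContinuous.trans (Measure.smul_absolutelyContinuous) ?_
    exact Measure.absolutelyContinuous_of_le (Measure.restrict_mono (hb t) le_rfl)
  · intro z hz
    obtain ⟨t, ht, hzt⟩ := hcov z hz
    obtain ⟨ρ, hρ, hsub⟩ := Metric.isOpen_iff.1 Metric.isOpen_ball z hzt
    exact ⟨ρ, hρ, (δ ⟨t, ht⟩)⁻¹, (Measure.restrict_mono hsub le_rfl).trans (hle ⟨t, ht⟩)⟩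
  · intro θ Θ hθ htr
    rw [lintegral_sum_measure]
    set E := ∫⁻ z in Ω, ‖Θ z‖ₑ ^ 2
    calc _ ≤ ∑' t : T, (K t : ℝ≥0∞) * δ t * E := by
          refine ENNReal.tsum_le_tsum fun t => ?_
          rw [hν, lintegral_smul_measure, smul_eq_mul, mul_comm (K t : ℝ≥0∞), mul_assoc]
          gcongr
          exact hK t θ Θ hθ htr
      _ = (∑' t : T, (K t : ℝ≥0∞) * δ t) * E := ENNReal.tsum_mul_right
      _ ≤ 1 * E := by gcongr
      _ = E := one_mul E

lemma tendsto_lintegral_compact {Ω : Set (Hor d × ℝ)} {F : Type*} [NormedAddCommGroup F]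
    {μ : Measure (Hor d × ℝ)}
    (hμ : ∀ z ∈ Ω, ∃ r > 0, ∃ c : ℝ≥0, volume.restrict (Metric.ball z r) ≤ (c : ℝ≥0∞) • μ)
    {f : ℕ → Hor d × ℝ → F} (hf : ∀ n, AEStronglyMeasurable (f n) μ)
    (hlim : Tendsto (fun n => eLpNorm (f n) 2 μ) atTop (𝓝 0)) {K : Set (Hor d × ℝ)}
    (hK : K ⊆ Ω) (hKc : IsCompact K) :
    Tendsto (fun n => ∫⁻ z in K, ‖f n z‖ₑ) atTop (𝓝 0) := by
  have hball : ∀ z ∈ Ω, ∃ r > 0,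
      Tendsto (fun n => ∫⁻ z in Metric.ball z r, ‖f n z‖ₑ) atTop (𝓝 0) := by
    intro z hz
    obtain ⟨r, hr, c, hc⟩ := hμ z hz
    refine ⟨r, hr, ?_⟩
    set V := volume.restrict (Metric.ball z r) Set.univ ^ (1 / (1 : ℝ≥0∞).toReal - 1 / (2 : ℝ≥0∞).toReal)
    have hV : V ≠ ⊤ := by
      refine ENNReal.rpow_ne_top_of_nonneg (by norm_num) ?_
      rw [Measure.restrict_apply_univ]
      exact measure_ball_lt_top.ne
    have h0 : Tendsto (fun n => (c : ℝ≥0∞) ^ (1 / (2 : ℝ≥0∞)).toReal * eLpNorm (f n) 2 μ * V) atTop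
        (𝓝 0) := by
      have := ENNReal.Tendsto.mul_const (b := V) (ENNReal.Tendsto.const_mul
        (a := (c : ℝ≥0∞) ^ (1 / (2 : ℝ≥0∞)).toReal) hlim
        (Or.inr (ENNReal.rpow_ne_top_of_nonneg ENNReal.toReal_nonneg ENNReal.coe_ne_top)))
        (Or.inr hV)
      simpa using this
    refine tendsto_of_tendsto_of_tendsto_of_le_of_le tendsto_const_nhds h0 (fun _ => zero_le)
      fun n => ?_
    have hm : AEStronglyMeasurable (f n) (volume.restrict (Metric.ball z r)) :=
      (hf n).mono_ac ((Measure.absolutelyContinuous_of_le hc).trans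
        Measure.smul_absolutelyContinuous)
    have h1 := eLpNorm_le_eLpNorm_mul_rpow_measure_univ (p := 1) (q := 2) (by norm_num) hm
    rw [eLpNorm_one_eq_lintegral_enorm] at h1
    refine h1.trans ?_
    gcongr
    refine (eLpNorm_mono_measure _ hc).trans_eq ?_
    rw [eLpNorm_smul_measure_of_ne_top (by simp), smul_eq_mul]
  refine hKc.induction_on (p := fun s => Tendsto (fun n => ∫⁻ z in s, ‖f n z‖ₑ) atTop (𝓝 0))
    ?_ ?_ ?_ ?_
  · simp
  · intro s t hst ht
    exact tendsto_of_tendsto_of_tendsto_of_le_of_le tendsto_const_nhds ht (fun _ => zero_le)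
      fun n => lintegral_mono_set hst
  · intro s t hs ht
    have := hs.add ht
    rw [add_zero] at this
    exact tendsto_of_tendsto_of_tendsto_of_le_of_le tendsto_const_nhds this (fun _ => zero_le)
      fun n => lintegral_union_le _ _ _
  · intro z hz
    obtain ⟨r, hr, h1⟩ := hball z (hK hz)
    exact ⟨_, mem_nhdsWithin_of_mem_nhds (Metric.ball_mem_nhds z hr), h1⟩

/-- A limit of gradients of functions vanishing on the graph is again such a gradient. -/
lemma exists_of_tendsto_grad {Ω : Set (Hor d × ℝ)} (hΩ : IsOpen Ω) {η : Hor d → ℝ}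
    (hη : Continuous η) {h : ℝ} (hh : 0 < h) (hS : stripBelow η h ⊆ Ω)
    (hloc : ∀ z ∈ Ω, LocalBound Ω η z) {θ : ℕ → Hor d × ℝ → ℂ} {Θ : ℕ → Hor d × ℝ → GradVal d}
    (hθ : ∀ n, HasFiniteEnergyGrad Ω (θ n) (Θ n)) (htr : ∀ n, HasTrace η (θ n) 0)
    {Ψ : Hor d × ℝ → GradVal d} (hΨ : MemLp Ψ 2 (volume.restrict Ω))
    (hlim : Tendsto (fun n => eLpNorm (Θ n - Ψ) 2 (volume.restrict Ω)) atTop (𝓝 0)) :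
    ∃ ψ, HasFiniteEnergyGrad Ω ψ Ψ ∧ HasTrace η ψ 0 := by
  obtain ⟨μ, hac, hac', hμ, hμE⟩ := exists_weight hloc
  have hmem : ∀ n, MemLp (θ n) 2 μ := fun n => memLp_two_iff.2
    ⟨(hθ n).aestronglyMeasurable.mono_ac hac',
      (hμE _ _ (hθ n) (htr n)).trans_lt (memLp_two_iff.1 (hθ n).2.2).2⟩
  have htr' : ∀ n m, HasTrace η (θ n - θ m) 0 := fun n m => by
    have h1 := (hθ n).aestronglyMeasurable.mono_measure (Measure.restrict_mono hS le_rfl)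
    have h2 := HasTrace.sub (f := 0) (g := 0) hh h1 (aestronglyMeasurable_const (b := (0 : ℂ)))
      (htr n) (htr m)
    rwa [sub_zero] at h2
  have hle : ∀ n m, eLpNorm (θ n - θ m) 2 μ ≤ eLpNorm (Θ n - Θ m) 2 (volume.restrict Ω) := by
    intro n m
    rw [eLpNorm_two_le_iff, eLpNorm_two_sq]
    exact hμE _ _ ((hθ n).sub (hθ m)) (htr' n m)
  have hcΘ : CauchySeq fun n => MemLp.toLp (Θ n) (hθ n).2.2 :=
    ((Lp.tendsto_Lp_iff_tendsto_eLpNorm'' Θ (fun n => (hθ n).2.2) Ψ hΨ).2 hlim).cauchySeq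
  have hcθ : CauchySeq fun n => MemLp.toLp (θ n) (hmem n) := by
    rw [EMetric.cauchySeq_iff] at hcΘ ⊢
    intro ε hε
    obtain ⟨N, hN⟩ := hcΘ ε hε
    refine ⟨N, fun m hm n hn => lt_of_le_of_lt ?_ (hN m hm n hn)⟩
    rw [Lp.edist_toLp_toLp, Lp.edist_toLp_toLp]
    exact hle m n
  obtain ⟨g, hg⟩ := cauchySeq_tendsto_of_complete hcθ
  have hgm : MemLp g 2 μ := Lp.memLp g
  have hglim : Tendsto (fun n => eLpNorm (θ n - (g : Hor d × ℝ → ℂ)) 2 μ) atTop (𝓝 0) := by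
    have : g = MemLp.toLp g hgm := (Lp.toLp_coeFn g hgm).symm
    rw [this] at hg
    exact (Lp.tendsto_Lp_iff_tendsto_eLpNorm'' θ hmem g hgm).1 hg
  have hloci : ∀ {F : Type} [NormedAddCommGroup F] {q : Hor d × ℝ → F} {κ : Measure (Hor d × ℝ)},
      (∀ z ∈ Ω, ∃ r > 0, ∃ c : ℝ≥0, volume.restrict (Metric.ball z r) ≤ (c : ℝ≥0∞) • κ) →
      MemLp q 2 κ → LocallyIntegrableOn q Ω volume := by
    intro F _ q κ hκ hq z hz
    obtain ⟨r, hr, c, hc⟩ := hκ z hz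
    refine ⟨_, mem_nhdsWithin_of_mem_nhds (Metric.ball_mem_nhds z hr), ?_⟩
    have h1 := hq.of_measure_le_smul ENNReal.coe_ne_top hc
    have : IsFiniteMeasure (volume.restrict (Metric.ball z r)) :=
      ⟨by rw [Measure.restrict_apply_univ]; exact measure_ball_lt_top⟩
    exact h1.integrable (by norm_num)
  have hvol : ∀ z ∈ Ω, ∃ r > 0, ∃ c : ℝ≥0,
      volume.restrict (Metric.ball z r) ≤ (c : ℝ≥0∞) • volume.restrict Ω := by
    intro z hz
    obtain ⟨r, hr, hb⟩ := Metric.isOpen_iff.1 hΩ z hz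
    exact ⟨r, hr, 1, by simpa using Measure.restrict_mono hb le_rfl⟩
  have hgl : LocallyIntegrableOn g Ω volume := hloci hμ hgm
  have cu : ∀ K ⊆ Ω, IsCompact K → Tendsto (fun n => ∫⁻ z in K, ‖θ n z - g z‖ₑ) atTop (𝓝 0) :=
    fun K hK hKc => tendsto_lintegral_compact hμ (f := fun n => θ n - (g : Hor d × ℝ → ℂ))
      (fun n => (hmem n).1.sub hgm.1) hglim hK hKc
  have cΘ : ∀ K ⊆ Ω, IsCompact K → Tendsto (fun n => ∫⁻ z in K, ‖Θ n z - Ψ z‖ₑ) atTop (𝓝 0) :=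
    fun K hK hKc => tendsto_lintegral_compact hvol (f := fun n => Θ n - Ψ)
      (fun n => (hθ n).2.2.1.sub hΨ.1) hlim hK hKc
  have cp : ∀ (L : GradVal d → ℂ), (∀ p q, ‖L p - L q‖ ≤ ‖p - q‖) → ∀ K ⊆ Ω, IsCompact K →
      Tendsto (fun n => ∫⁻ z in K, ‖L (Θ n z) - L (Ψ z)‖ₑ) atTop (𝓝 0) := by
    intro L hL K hK hKc
    refine tendsto_of_tendsto_of_tendsto_of_le_of_le tendsto_const_nhds (cΘ K hK hKc)
      (fun _ => zero_le) fun n => lintegral_mono fun z => ?_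
    exact enorm_le_iff_norm_le.2 (hL _ _)
  refine ⟨g, ⟨fun i => ?_, ?_, hΨ⟩, ?_⟩
  · refine HasWeakDeriv.of_tendsto hgl (hloci hvol (hΨ.of_le ?_ (ae_of_all _ fun z =>
      norm_horizontal_le (Ψ z) i))) (fun n => (hθ n).1 i) cu (cp (fun p => p.1 i) ?_)
    · exact (by fun_prop : Continuous fun p : GradVal d => p.1 i).comp_aestronglyMeasurable hΨ.1
    · intro p q
      simpa using norm_horizontal_le (p - q) i
  · refine HasWeakDeriv.of_tendsto hgl (hloci hvol (hΨ.of_le ?_ (ae_of_all _ fun z =>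
      norm_snd_le (Ψ z)))) (fun n => (hθ n).2.1) cu (cp (fun p => p.2) ?_)
    · exact continuous_snd.comp_aestronglyMeasurable hΨ.1
    · intro p q
      simpa using norm_snd_le (p - q)
  -- the trace of the limit
  obtain ⟨ns, hns, hae⟩ := (tendstoInMeasure_of_tendsto_eLpNorm two_ne_zero
    (fun n => (hmem n).1) hgm.1 hglim).exists_seq_tendsto_ae
  have hbdd : ∃ C : ℝ≥0, ∀ n, ∫⁻ z in Ω, ‖Θ n z‖ₑ ^ 2 ≤ C := by
    obtain ⟨R, -, hR⟩ := cauchySeq_bdd hcΘ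
    refine ⟨((‖MemLp.toLp (Θ 0) (hθ 0).2.2‖ + R) ^ 2).toNNReal, fun n => ?_⟩
    have h1 : ‖MemLp.toLp (Θ n) (hθ n).2.2‖ ≤ ‖MemLp.toLp (Θ 0) (hθ 0).2.2‖ + R := by
      have := (hR n 0).le
      rw [dist_eq_norm] at this
      calc _ = ‖MemLp.toLp (Θ 0) (hθ 0).2.2
            + (MemLp.toLp (Θ n) (hθ n).2.2 - MemLp.toLp (Θ 0) (hθ 0).2.2)‖ := by
            rw [add_sub_cancel]
        _ ≤ _ := norm_add_le _ _
        _ ≤ _ := by gcongr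
    rw [← eLpNorm_two_sq]
    have h2 : eLpNorm (Θ n) 2 (volume.restrict Ω) = ENNReal.ofReal ‖MemLp.toLp (Θ n) (hθ n).2.2‖ := by
      rw [Lp.norm_toLp, ENNReal.ofReal_toReal (hθ n).2.2.2.ne]
    rw [h2, ← ENNReal.ofReal_pow (norm_nonneg _)]
    exact ENNReal.ofReal_le_ofReal (pow_le_pow_left₀ (norm_nonneg _) h1 2)
  obtain ⟨C, hC⟩ := hbdd
  have hpoin : ∀ ε, 0 < ε → ε ≤ h →
      ∫⁻ z in stripBelow η ε, ‖g z‖ₑ ^ 2 ≤ ENNReal.ofReal (2 * ε ^ 2) * C := by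
    intro ε hε hεh
    have hSε : stripBelow η ε ⊆ Ω := (stripBelow_mono η hεh).trans hS
    have hle : ∀ n, ∫⁻ z in stripBelow η ε, ‖θ n z‖ₑ ^ 2 ≤ ENNReal.ofReal (2 * ε ^ 2) * C := by
      intro n
      refine ((hθ n).2.1.poincare hΩ hη (htr n) hε hSε).trans ?_
      gcongr
      refine (lintegral_mono_set hSε).trans ((lintegral_mono fun z => ?_).trans (hC n))
      gcongr
      exact enorm_le_iff_norm_le.2 (norm_snd_le _)
    calc ∫⁻ z in stripBelow η ε, ‖g z‖ₑ ^ 2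
        ≤ ∫⁻ z in stripBelow η ε, liminf (fun n => ‖θ (ns n) z‖ₑ ^ 2) atTop := by
          refine lintegral_mono_ae ?_
          filter_upwards [ae_restrict_of_ae_restrict_of_subset hSε (hac.ae_le hae)] with z hz
          have : Tendsto (fun n => ‖θ (ns n) z‖ₑ ^ 2) atTop (𝓝 (‖g z‖ₑ ^ 2)) :=
            (ENNReal.continuous_pow 2).continuousAt.tendsto.comp (hz.enorm)
          exact this.liminf_eq.ge
      _ ≤ liminf (fun n => ∫⁻ z in stripBelow η ε, ‖θ (ns n) z‖ₑ ^ 2) atTop := by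
          refine lintegral_liminf_le' fun n => ?_
          exact ((hθ (ns n)).aestronglyMeasurable.mono_measure
            (Measure.restrict_mono hSε le_rfl)).enorm.pow_const 2
      _ ≤ liminf (fun _ : ℕ => ENNReal.ofReal (2 * ε ^ 2) * C) atTop :=
          liminf_le_liminf (Eventually.of_forall fun n => hle (ns n))
      _ = _ := by simp
  have h0 : Tendsto (fun ε : ℝ => ENNReal.ofReal (2 * ε) * C) (𝓝[>] 0) (𝓝 0) := by
    have h1 : Tendsto (fun ε : ℝ => ENNReal.ofReal (2 * ε)) (𝓝[>] 0) (𝓝 (ENNReal.ofReal (2 * 0))) :=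
      ((ENNReal.continuous_ofReal.comp (continuous_const.mul continuous_id)).tendsto 0).mono_left
        nhdsWithin_le_nhds
    have := ENNReal.Tendsto.mul_const (b := (C : ℝ≥0∞)) h1 (Or.inr ENNReal.coe_ne_top)
    simpa using this
  refine tendsto_of_tendsto_of_tendsto_of_le_of_le' tendsto_const_nhds h0
    (Eventually.of_forall fun _ => zero_le) ?_
  filter_upwards [Ioc_mem_nhdsGT hh] with ε hε
  have hε0 : ENNReal.ofReal ε ≠ 0 := by simpa using hε.1
  refine ENNReal.div_le_of_le_mul ?_
  simp only [Pi.zero_apply, sub_zero]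
  refine (hpoin ε hε.1 hε.2).trans_eq ?_
  rw [show 2 * ε ^ 2 = 2 * ε * ε by ring, ENNReal.ofReal_mul (by linarith [hε.1])]
  ring

/-! ### The variational solution -/

/-- Values of gradients with their Hilbert norm. -/
abbrev HilbertGrad (d : ℕ) : Type := WithLp 2 (EuclideanSpace ℂ (Fin d) × ℂ)

lemma memLp_toLp_iff {α : Type*} [MeasurableSpace α] {μ : Measure α} {U : α → GradVal d} :
    MemLp (fun z => (WithLp.toLp 2 (U z) : HilbertGrad d)) 2 μ ↔ MemLp U 2 μ := by
  set e := WithLp.prodContinuousLinearEquiv 2 ℂ (EuclideanSpace ℂ (Fin d)) ℂ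
  constructor
  · intro h
    exact (e : HilbertGrad d →L[ℂ] GradVal d).comp_memLp' h
  · intro h
    exact (e.symm : GradVal d →L[ℂ] HilbertGrad d).comp_memLp' h

lemma inner_toLp (p q : GradVal d) :
    inner ℂ (WithLp.toLp 2 p : HilbertGrad d) (WithLp.toLp 2 q) = gradDot (conjGrad p) q := by
  rw [WithLp.prod_inner_apply]
  simp only [gradDot, conjGrad, PiLp.inner_apply, RCLike.inner_apply, mul_comm]

lemma norm_ofLp_le (x : HilbertGrad d) : ‖x.ofLp‖ ≤ ‖x‖ := by
  have h1 := (WithLp.prod_lipschitzWith_ofLp 2 (EuclideanSpace ℂ (Fin d)) ℂ).dist_le_mul x 0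
  simpa using h1

/-- The gradients of functions of finite energy on `Ω` that vanish on the graph of `η`. -/
noncomputable def gradSubmodule {Ω : Set (Hor d × ℝ)} (hΩ : IsOpen Ω) (η : Hor d → ℝ) {h : ℝ}
    (hh : 0 < h) (hS : stripBelow η h ⊆ Ω) :
    Submodule ℂ (Lp (HilbertGrad d) 2 (volume.restrict Ω)) where
  carrier := {Θ | ∃ θ, HasFiniteEnergyGrad Ω θ (fun z => (Θ z).ofLp) ∧ HasTrace η θ 0}
  add_mem' := by
    rintro Θ Θ' ⟨θ, h1, h2⟩ ⟨θ', h1', h2'⟩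
    refine ⟨θ + θ', (h1.add h1').congr_ae hΩ (ae_eq_refl _) ?_, ?_⟩
    · filter_upwards [Lp.coeFn_add Θ Θ'] with z hz
      rw [hz]; rfl
    · have h3 := h1.aestronglyMeasurable.mono_measure (Measure.restrict_mono hS le_rfl)
      have h4 := HasTrace.add (f := 0) (g := 0) hh h3 (aestronglyMeasurable_const (b := (0 : ℂ)))
        h2 h2'
      rwa [add_zero] at h4
  zero_mem' := by
    have hz : LocallyIntegrableOn (0 : Hor d × ℝ → ℂ) Ω volume :=
      (locallyIntegrable_zero).locallyIntegrableOn _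
    have h0 : ∀ v, HasWeakDeriv Ω 0 v 0 := fun v =>
      hasWeakDeriv_iff.2 ⟨hz, hz, fun χ _ _ _ => by simp⟩
    have h1 : HasFiniteEnergyGrad Ω 0 (0 : Hor d × ℝ → GradVal d) :=
      ⟨fun i => h0 _, h0 _, MemLp.zero⟩
    refine ⟨0, h1.congr_ae hΩ (ae_eq_refl _) ?_, by simp [HasTrace]⟩
    filter_upwards [Lp.coeFn_zero (HilbertGrad d) 2 (volume.restrict Ω)] with z hz
    rw [hz]; rfl
  smul_mem' := by
    rintro c Θ ⟨θ, h1, h2⟩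
    refine ⟨c • θ, (h1.smul c).congr_ae hΩ (ae_eq_refl _) ?_, ?_⟩
    · filter_upwards [Lp.coeFn_smul c Θ] with z hz
      rw [hz]; rfl
    · have h4 := h2.smul c
      rwa [smul_zero] at h4

lemma isClosed_gradSubmodule {Ω : Set (Hor d × ℝ)} (hΩ : IsOpen Ω) {η : Hor d → ℝ}
    (hη : Continuous η) {h : ℝ} (hh : 0 < h) (hS : stripBelow η h ⊆ Ω)
    (hloc : ∀ z ∈ Ω, LocalBound Ω η z) :
    IsClosed (gradSubmodule hΩ η hh hS : Set (Lp (HilbertGrad d) 2 (volume.restrict Ω))) := by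
  refine IsSeqClosed.isClosed fun Θ Ψ hΘ hlim => ?_
  choose θ hθ htr using hΘ
  refine exists_of_tendsto_grad hΩ hη hh hS hloc hθ htr (memLp_toLp_iff.1 (Lp.memLp Ψ)) ?_
  rw [Lp.tendsto_Lp_iff_tendsto_eLpNorm'] at hlim
  refine tendsto_of_tendsto_of_tendsto_of_le_of_le tendsto_const_nhds hlim (fun _ => zero_le)
    fun n => eLpNorm_mono fun z => ?_
  exact norm_ofLp_le (Θ n z - Ψ z)

section Solution

variable {O : Set (Hor d × ℝ)} {η : Hor d → ℝ} {f : Hor d → ℂ}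
  {w : Hor d × ℝ → ℂ} {W : Hor d × ℝ → GradVal d} {h : ℝ}

/-- There is a variational solution with trace `f` as soon as there is a function of finite energy
with trace `f`. -/
lemma exists_variationalSolution (hO : IsOpen O) (hconn : IsPreconnected O) (hη : Continuous η)
    (hh : 0 < h) (hS : stripBelow η h ⊆ O) (hf : AEStronglyMeasurable f volume)
    (hw : HasFiniteEnergyGrad (fluidDomain O η) w W) (htr : HasTrace η w f) :
    ∃ φ Φ, IsVariationalSolution O η f φ Φ := by
  set Ω := fluidDomain O η
  have hΩ : IsOpen Ω := isOpen_fluidDomain hO hη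
  have hSΩ : stripBelow η h ⊆ Ω := stripBelow_subset_fluidDomain hS
  set S := gradSubmodule hΩ η hh hSΩ
  have hSc : IsClosed (S : Set (Lp (HilbertGrad d) 2 (volume.restrict Ω))) :=
    isClosed_gradSubmodule hΩ hη hh hSΩ fun z hz => localBound_of_mem hO hconn hη hh hS hz
  have : CompleteSpace S := hSc.completeSpace_coe
  set W' := MemLp.toLp _ (memLp_toLp_iff.2 hw.2.2)
  set P := S.starProjection W'
  obtain ⟨θ, hθ, hθtr⟩ : P ∈ S := Submodule.starProjection_apply_mem S W'
  have hW' : W =ᵐ[volume.restrict Ω] fun z => (W' z).ofLp := by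
    filter_upwards [MemLp.coeFn_toLp (memLp_toLp_iff.2 hw.2.2)] with z hz
    rw [hz]
  have hsub := hw.sub hθ
  refine ⟨w - θ, _, hsub, ?_, fun τ T hT hTtr => ?_⟩
  · have h3 := hw.aestronglyMeasurable.mono_measure (Measure.restrict_mono hSΩ le_rfl)
    have h4 := HasTrace.sub hh h3 hf htr hθtr
    rwa [sub_zero] at h4
  · set T' := MemLp.toLp _ (memLp_toLp_iff.2 hT.conj.2.2)
    have hT' : (fun z => conjGrad (T z)) =ᵐ[volume.restrict Ω] fun z => (T' z).ofLp := by
      filter_upwards [MemLp.coeFn_toLp (memLp_toLp_iff.2 hT.conj.2.2)] with z hz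
      rw [hz]
    have hTS : T' ∈ S := by
      refine ⟨_, hT.conj.congr_ae hΩ (ae_eq_refl _) hT', ?_⟩
      have h5 := hTtr.conj
      simp only [Pi.zero_apply, map_zero] at h5
      exact h5
    have h0 := Submodule.starProjection_inner_eq_zero W' T' hTS
    rw [← inner_conj_symm, map_eq_zero, L2.inner_def] at h0
    rw [← h0]
    refine integral_congr_ae ?_
    filter_upwards [hT', hW', Lp.coeFn_sub W' P] with z h1 h2 h3
    have e1 : (T' z) = WithLp.toLp 2 (conjGrad (T z)) := by rw [h1]
    have e2 : (W' - P : Lp (HilbertGrad d) 2 (volume.restrict Ω)) z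
        = WithLp.toLp 2 (W z - (P z).ofLp) := by rw [h3, h2]; rfl
    rw [e1, e2, inner_toLp, gradDot_comm]
    congr 1
    simp [conjGrad]

end Solution

end WaterWaves

namespace WaterWaves

variable {d : ℕ}

namespace IsVariationalSolution

variable {O : Set (Hor d × ℝ)} {η : Hor d → ℝ} {f : Hor d → ℂ} {h : ℝ}
  {φ φ' : Hor d × ℝ → ℂ} {Φ Φ' : Hor d × ℝ → GradVal d}

lemma integral_eq (hs : IsVariationalSolution O η f φ Φ) (hh : 0 < h) (hS : stripBelow η h ⊆ O)
    {χ : Hor d → ℂ} (hχ : AEStronglyMeasurable χ volume) {w w' : Hor d × ℝ → ℂ}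
    {W W' : Hor d × ℝ → GradVal d} (hw : HasFiniteEnergyGrad (fluidDomain O η) w W)
    (hw' : HasFiniteEnergyGrad (fluidDomain O η) w' W') (htr : HasTrace η w χ)
    (htr' : HasTrace η w' χ) :
    ∫ z in fluidDomain O η, gradDot (Φ z) (W z) = ∫ z in fluidDomain O η, gradDot (Φ z) (W' z) := by
  have h3 := hw.aestronglyMeasurable.mono_measure
    (Measure.restrict_mono (stripBelow_subset_fluidDomain hS) le_rfl)
  have h4 := HasTrace.sub hh h3 hχ htr htr'
  rw [sub_self] at h4
  have h5 := hs.2.2 _ _ (hw.sub hw') h4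
  simp only [Pi.sub_apply, gradDot_sub_right] at h5
  rw [integral_sub (integrable_gradDot hs.1.2.2 hw.2.2) (integrable_gradDot hs.1.2.2 hw'.2.2),
    sub_eq_zero] at h5
  exact h5

lemma l2norm_le (hs : IsVariationalSolution O η f φ Φ) (hh : 0 < h) (hS : stripBelow η h ⊆ O)
    (hf : AEStronglyMeasurable f volume) {w : Hor d × ℝ → ℂ} {W : Hor d × ℝ → GradVal d}
    (hw : HasFiniteEnergyGrad (fluidDomain O η) w W) (htr : HasTrace η w f) :
    l2norm (volume.restrict (fluidDomain O η)) Φ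
      ≤ (d + 1) * l2norm (volume.restrict (fluidDomain O η)) W := by
  set μ := volume.restrict (fluidDomain O η)
  have e := hs.integral_eq hh hS (hf.star) hs.1.conj hw.conj hs.2.1.conj htr.conj
  have h1 := sq_l2norm_le hs.1.2.2
  rw [e] at h1
  have h2 := norm_integral_gradDot_le hs.1.2.2 (memLp_conjGrad hw.2.2)
  rw [l2norm_conjGrad] at h2
  have h3 := (h1.trans (Complex.re_le_norm _)).trans h2
  have h4 := l2norm_nonneg μ Φ
  have h5 := l2norm_nonneg μ W
  rcases h4.eq_or_lt with h6 | h6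
  · rw [← h6]; positivity
  · refine le_of_mul_le_mul_left ?_ h6
    calc _ = l2norm μ Φ ^ 2 := by ring
      _ ≤ _ := h3
      _ = _ := by ring

lemma unique (hs : IsVariationalSolution O η f φ Φ) (hs' : IsVariationalSolution O η f φ' Φ')
    (hh : 0 < h) (hS : stripBelow η h ⊆ O) (hf : AEStronglyMeasurable f volume) :
    Φ =ᵐ[volume.restrict (fluidDomain O η)] Φ' := by
  set μ := volume.restrict (fluidDomain O η)
  have h3 := hs.1.aestronglyMeasurable.mono_measure
    (Measure.restrict_mono (stripBelow_subset_fluidDomain hS) le_rfl)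
  have h4 := HasTrace.sub hh h3 hf hs.2.1 hs'.2.1
  rw [sub_self] at h4
  have hD := (hs.1.sub hs'.1)
  have h4c := h4.conj
  simp only [Pi.zero_apply, map_zero] at h4c
  have h5 := hs.2.2 _ _ hD.conj h4c
  have h6 := hs'.2.2 _ _ hD.conj h4c
  have h7 := sq_l2norm_le hD.2.2
  simp only [Pi.sub_apply, gradDot_sub_left] at h7 h5 h6
  have h8 := integral_sub (integrable_gradDot hs.1.2.2 hD.conj.2.2)
    (integrable_gradDot hs'.1.2.2 hD.conj.2.2)
  simp only [Pi.sub_apply] at h8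
  rw [h8, h5, h6, sub_zero, Complex.zero_re] at h7
  have h9 : l2norm μ (Φ - Φ') = 0 := by
    have := le_antisymm h7 (sq_nonneg _)
    exact pow_eq_zero_iff two_ne_zero |>.1 this
  rw [l2norm, ENNReal.toReal_eq_zero_iff] at h9
  rcases h9 with h9 | h9
  · rw [eLpNorm_eq_zero_iff hD.2.2.1 two_ne_zero] at h9
    filter_upwards [h9] with z hz
    exact sub_eq_zero.1 hz
  · exact absurd h9 hD.2.2.2.ne

end IsVariationalSolution

/-! ### Comparison of two domains -/

lemma norm_gradDot_sub_le_of_close {p p' q q' : GradVal d} {c ε : ℝ} (hε : 0 ≤ ε)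
    (hp : ‖p' - p‖ ≤ ε * ‖p‖) (hq : ‖q' - q‖ ≤ ε * ‖q‖) (hc : |c - 1| ≤ ε) :
    ‖gradDot p' q' - c * gradDot p q‖ ≤ (d + 1) * (ε * (3 + ε)) * (‖p‖ * ‖q‖) ∧
    ‖gradDot p' q - c * gradDot p q'‖ ≤ (d + 1) * (ε * (3 + ε)) * (‖p‖ * ‖q‖) := by
  have hq1 : ‖q'‖ ≤ (1 + ε) * ‖q‖ := by
    calc ‖q'‖ = ‖q + (q' - q)‖ := by rw [add_sub_cancel]
      _ ≤ ‖q‖ + ε * ‖q‖ := (norm_add_le _ _).trans (by gcongr)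
      _ = _ := by ring
  have hc' : ‖((1 - c : ℝ) : ℂ)‖ ≤ ε := by
    rw [Complex.norm_real, Real.norm_eq_abs, abs_sub_comm]; exact hc
  have b1 : ∀ r : GradVal d, ‖gradDot (p' - p) r‖ ≤ (d + 1) * (ε * ‖p‖) * ‖r‖ := fun r =>
    (norm_gradDot_le _ _).trans (by gcongr)
  have b2 : ‖gradDot p (q' - q)‖ ≤ (d + 1) * ‖p‖ * (ε * ‖q‖) :=
    (norm_gradDot_le _ _).trans (by gcongr)
  have b3 : ∀ r : GradVal d, ‖((1 - c : ℝ) : ℂ) * gradDot p r‖ ≤ ε * ((d + 1) * ‖p‖ * ‖r‖) :=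
    fun r => by
      rw [norm_mul]
      exact mul_le_mul hc' (norm_gradDot_le _ _) (norm_nonneg _) hε
  have hd : (0 : ℝ) ≤ d + 1 := by positivity
  constructor
  · have e : gradDot p' q' - c * gradDot p q
        = gradDot (p' - p) q' + gradDot p (q' - q) + ((1 - c : ℝ) : ℂ) * gradDot p q := by
      rw [gradDot_sub_left, gradDot_sub_right]; push_cast; ring
    rw [e]
    calc _ ≤ (d + 1) * (ε * ‖p‖) * ‖q'‖ + (d + 1) * ‖p‖ * (ε * ‖q‖)
          + ε * ((d + 1) * ‖p‖ * ‖q‖) :=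
          (norm_add_le _ _).trans (add_le_add ((norm_add_le _ _).trans (add_le_add (b1 _) b2))
            (b3 _))
      _ ≤ (d + 1) * (ε * ‖p‖) * ((1 + ε) * ‖q‖) + (d + 1) * ‖p‖ * (ε * ‖q‖)
          + ε * ((d + 1) * ‖p‖ * ‖q‖) := by gcongr
      _ = _ := by ring
  · have e : gradDot p' q - c * gradDot p q'
        = gradDot (p' - p) q - gradDot p (q' - q) + ((1 - c : ℝ) : ℂ) * gradDot p q' := by
      rw [gradDot_sub_left, gradDot_sub_right]; push_cast; ring
    rw [e]
    calc _ ≤ (d + 1) * (ε * ‖p‖) * ‖q‖ + (d + 1) * ‖p‖ * (ε * ‖q‖)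
          + ε * ((d + 1) * ‖p‖ * ‖q'‖) :=
          (norm_add_le _ _).trans (add_le_add ((norm_sub_le _ _).trans (add_le_add (b1 _) b2))
            (b3 _))
      _ ≤ (d + 1) * (ε * ‖p‖) * ‖q‖ + (d + 1) * ‖p‖ * (ε * ‖q‖)
          + ε * ((d + 1) * ‖p‖ * ((1 + ε) * ‖q‖)) := by gcongr
      _ = _ := by ring

lemma integral_norm_mul_norm_le {α F G : Type*} [MeasurableSpace α] [NormedAddCommGroup F]
    [NormedAddCommGroup G] {μ : Measure α} {U : α → F} {V : α → G} (hU : MemLp U 2 μ)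
    (hV : MemLp V 2 μ) :
    Integrable (fun z => ‖U z‖ * ‖V z‖) μ ∧
      ∫ z, ‖U z‖ * ‖V z‖ ∂μ ≤ l2norm μ U * l2norm μ V := by
  have h1 := eLpNorm_le_eLpNorm_mul_eLpNorm_of_nnnorm (p := 2) (q := 2) (r := 1) hU.1.norm hV.1.norm
    (fun a b : ℝ => a * b) 1 (ae_of_all _ fun z => by simp [nnnorm_mul])
  simp only [ENNReal.coe_one, one_mul, eLpNorm_norm] at h1
  have hi : Integrable (fun z => ‖U z‖ * ‖V z‖) μ := by
    rw [← memLp_one_iff_integrable]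
    exact ⟨hU.1.norm.mul hV.1.norm, h1.trans_lt (ENNReal.mul_lt_top hU.2 hV.2)⟩
  refine ⟨hi, ?_⟩
  have h2 := ENNReal.toReal_mono (ENNReal.mul_lt_top hU.2 hV.2).ne h1
  rw [ENNReal.toReal_mul, eLpNorm_one_eq_lintegral_enorm, ← integral_norm_eq_lintegral_enorm hi.1] at h2
  simpa [l2norm] using h2

/-- A vertical shear and its inverse that are within `δ ≤ 1 / 2` of the identity, in the sense of
Lipschitz functions. -/
structure NearId (δ : ℝ≥0) (l k : Hor d × ℝ → ℝ) : Prop where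
  shear : VertShear l k
  hl : LipschitzWith δ fun z => l z - z.2
  hk : LipschitzWith δ fun z => k z - z.2

namespace NearId

variable {δ : ℝ≥0} {l k : Hor d × ℝ → ℝ}

lemma symm (h : NearId δ l k) : NearId δ k l := ⟨h.shear.symm, h.hk, h.hl⟩

lemma lipschitz (h : NearId δ l k) : LipschitzWith (δ + 1) l := by
  have := h.hl.add (LipschitzWith.prod_snd (α := Hor d) (β := ℝ))
  simpa using this

lemma lineDeriv_eq (h : NearId δ l k) {z : Hor d × ℝ} (v : Hor d × ℝ)
    (hz : LineDifferentiableAt ℝ l z v) : |lineDeriv ℝ l z v - v.2| ≤ δ * ‖v‖ := by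
  have h1 : HasLineDerivAt ℝ (fun z : Hor d × ℝ => l z - z.2) (lineDeriv ℝ l z v - v.2) z v := by
    have h2 : HasLineDerivAt ℝ (fun z : Hor d × ℝ => z.2) v.2 z v :=
      (hasFDerivAt_snd (𝕜 := ℝ) (E := Hor d) (F := ℝ) (p := z)).hasLineDerivAt v
    exact HasDerivAt.sub hz.hasLineDerivAt h2
  rw [← h1.lineDeriv]
  exact abs_lineDeriv_le h.hl z v

lemma norm_pullGrad_sub_le (h : NearId δ l k) (U : Hor d × ℝ → GradVal d) :
    ∀ᵐ z, ‖pullGrad l U z - U (shearMap l z)‖ ≤ (d + 1) * δ * ‖U (shearMap l z)‖ := by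
  filter_upwards [h.lipschitz.ae_differentiableAt (μ := volume)] with z hz
  set p := U (shearMap l z)
  have hi : ∀ i, |lineDeriv ℝ l z (basisVec i, 0)| ≤ δ := fun i => by
    simpa only [norm_basisVec_prod, mul_one, sub_zero] using
      h.lineDeriv_eq (basisVec i, 0) hz.lineDifferentiableAt
  have hy : |lineDeriv ℝ l z (0, 1) - 1| ≤ δ := by
    simpa only [norm_vertical, mul_one] using h.lineDeriv_eq (0, 1) hz.lineDifferentiableAt
  have hp := norm_snd_le p
  have h0 : 0 ≤ (δ : ℝ) * ‖p‖ := by positivity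
  have h0' : 0 ≤ (d : ℝ) * (δ * ‖p‖) := by positivity
  refine max_le ?_ ?_
  · have e : (pullGrad l U z - p).1 = WithLp.toLp 2 fun i =>
        ((lineDeriv ℝ l z (basisVec i, 0) : ℝ) : ℂ) * p.2 := by
      ext i
      simp [pullGrad, p]
    rw [e]
    calc _ ≤ ∑ i : Fin d, (δ : ℝ) * ‖p‖ := by
          refine (norm_toLp_le_sum _).trans (Finset.sum_le_sum fun i _ => ?_)
          rw [norm_mul, Complex.norm_real, Real.norm_eq_abs]
          exact mul_le_mul (hi i) hp (norm_nonneg _) δ.2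
      _ ≤ _ := by
        simp only [Finset.sum_const, Finset.card_univ, Fintype.card_fin, nsmul_eq_mul]
        linarith
  · have e : (pullGrad l U z - p).2 = ((lineDeriv ℝ l z (0, 1) - 1 : ℝ) : ℂ) * p.2 := by
      simp [pullGrad, p, sub_mul]
    rw [e, norm_mul, Complex.norm_real, Real.norm_eq_abs]
    calc _ ≤ δ * ‖p‖ := mul_le_mul hy hp (norm_nonneg _) δ.2
      _ ≤ _ := by linarith

end NearId

/-- The constant in the comparison of bilinear forms. -/
noncomputable def compConst (d : ℕ) : ℝ := 9 * ((d + 1) * ((d + 1) * (d + 4)))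

lemma compConst_nonneg (d : ℕ) : 0 ≤ compConst d := by unfold compConst; positivity

section Compare

variable {δ : ℝ≥0} {l k : Hor d × ℝ → ℝ} {Ω₁ Ω₂ : Set (Hor d × ℝ)}

lemma NearId.preimage_eq (h : NearId δ l k) (hΩ : shearMap l ⁻¹' Ω₁ = Ω₂) :
    shearMap k ⁻¹' Ω₂ = Ω₁ := by
  ext z
  rw [← hΩ, Set.mem_preimage, Set.mem_preimage, h.shear.right_inv]

/-- Both ways of transporting one gradient in the Dirichlet form cost a factor `δ`. -/
lemma NearId.compare_forms (h : NearId δ l k) (hδ : δ ≤ 1) (hm : MeasurableSet Ω₂)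
    (hΩ : shearMap l ⁻¹' Ω₁ = Ω₂) {U : Hor d × ℝ → GradVal d}
    (hU : MemLp U 2 (volume.restrict Ω₂)) :
    (∀ W : Hor d × ℝ → GradVal d, MemLp W 2 (volume.restrict Ω₂) →
      ‖(∫ z in Ω₁, gradDot (pullGrad k U z) (pullGrad k W z)) - ∫ z in Ω₂, gradDot (U z) (W z)‖
        ≤ compConst d * δ * l2norm (volume.restrict Ω₂) U * l2norm (volume.restrict Ω₂) W) ∧
    ∀ S : Hor d × ℝ → GradVal d, MemLp S 2 (volume.restrict Ω₁) →
      ‖(∫ z in Ω₁, gradDot (pullGrad k U z) (S z)) - ∫ z in Ω₂, gradDot (U z) (pullGrad l S z)‖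
        ≤ compConst d * δ * l2norm (volume.restrict Ω₂) U * l2norm (volume.restrict Ω₁) S := by
  have hΩ' := h.preimage_eq hΩ
  have hδ' : (δ : ℝ) ≤ 1 := hδ
  have hUk : MemLp (fun z => U (shearMap k z)) 2 (volume.restrict Ω₁) := by
    have := h.symm.shear.memLp_comp hU
    rwa [hΩ'] at this
  have hKU : MemLp (pullGrad k U) 2 (volume.restrict Ω₁) := by
    have := memLp_pullGrad h.symm.shear hU
    rwa [hΩ'] at this
  have nk : ∀ V : Hor d × ℝ → GradVal d, MemLp V 2 (volume.restrict Ω₂) →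
      l2norm (volume.restrict Ω₁) (fun z => V (shearMap k z))
        ≤ 3 * l2norm (volume.restrict Ω₂) V := by
    intro V hV
    have h1 := h.symm.shear.l2norm_comp_le h.lipschitz hV
    rw [hΩ'] at h1
    refine h1.trans (mul_le_mul_of_nonneg_right ?_ (l2norm_nonneg _ _))
    push_cast; linarith
  have hdk : ∀ᵐ z, |lineDeriv ℝ k z (0, 1) - 1| ≤ (d + 1) * δ := ae_of_all _ fun z => by
    have h1 := h.symm.lineDeriv_eq (0, 1) (h.shear.dk z).2
    rw [norm_vertical, mul_one] at h1
    have : 0 ≤ (d : ℝ) * δ := by positivity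
    linarith
  set ε : ℝ := (d + 1) * δ with hε
  have hε0 : 0 ≤ ε := by positivity
  have hconst : ((d : ℝ) + 1) * (ε * (3 + ε)) ≤ (d + 1) * ((d + 1) * (d + 4)) * δ := by
    have : 3 + ε ≤ d + 4 := by
      have : ((d : ℝ) + 1) * δ ≤ (d + 1) * 1 := by gcongr
      linarith
    calc _ ≤ ((d : ℝ) + 1) * (ε * (d + 4)) := by gcongr
      _ = _ := by rw [hε]; ring
  set M : ℝ := (d + 1) * ((d + 1) * (d + 4)) * δ with hM
  have hM0 : 0 ≤ M := by positivity
  refine ⟨fun W hW => ?_, fun S hS => ?_⟩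
  · have hWk : MemLp (fun z => W (shearMap k z)) 2 (volume.restrict Ω₁) := by
      have := h.symm.shear.memLp_comp hW
      rwa [hΩ'] at this
    have hKW : MemLp (pullGrad k W) 2 (volume.restrict Ω₁) := by
      have := memLp_pullGrad h.symm.shear hW
      rwa [hΩ'] at this
    have e := h.symm.shear.setIntegral_comp (fun z => gradDot (U z) (W z)) hm
    rw [hΩ'] at e
    have hi : Integrable (fun z => ((lineDeriv ℝ k z (0, 1) : ℝ) : ℂ) *
        gradDot (U (shearMap k z)) (W (shearMap k z))) (volume.restrict Ω₁) := by
      refine (integrable_gradDot hUk hWk).bdd_mul (c := 2) ?_ (ae_of_all _ fun z => ?_)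
      · exact (Complex.measurable_ofReal.comp (h.symm.shear.measurable_dl _)).aestronglyMeasurable
      · have := abs_lineDeriv_le h.symm.lipschitz z (0, 1)
        rw [norm_vertical, mul_one] at this
        rw [Complex.norm_real, Real.norm_eq_abs]
        refine this.trans ?_
        push_cast; linarith
    rw [← e, ← integral_sub (integrable_gradDot hKU hKW) hi]
    obtain ⟨hint, hle⟩ := integral_norm_mul_norm_le hUk hWk
    have h3 : ‖∫ z in Ω₁, (gradDot (pullGrad k U z) (pullGrad k W z) -
        ((lineDeriv ℝ k z (0, 1) : ℝ) : ℂ) * gradDot (U (shearMap k z)) (W (shearMap k z)))‖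
        ≤ ∫ z in Ω₁, M * (‖U (shearMap k z)‖ * ‖W (shearMap k z)‖) := by
      refine norm_integral_le_of_norm_le (hint.const_mul M) ?_
      filter_upwards [ae_restrict_of_ae (h.symm.norm_pullGrad_sub_le U),
        ae_restrict_of_ae (h.symm.norm_pullGrad_sub_le W), ae_restrict_of_ae hdk] with z h1 h2 h3
      refine (norm_gradDot_sub_le_of_close hε0 h1 h2 h3).1.trans ?_
      gcongr
    refine h3.trans ?_
    rw [integral_const_mul]
    calc _ ≤ M * ((3 * l2norm (volume.restrict Ω₂) U) * (3 * l2norm (volume.restrict Ω₂) W)) := by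
          refine mul_le_mul_of_nonneg_left (hle.trans ?_) hM0
          exact mul_le_mul (nk U hU) (nk W hW) (l2norm_nonneg _ _)
            (mul_nonneg (by norm_num) (l2norm_nonneg _ _))
      _ = _ := by rw [hM, compConst]; ring
  · have hLS : MemLp (pullGrad l S) 2 (volume.restrict Ω₂) := by
      have := memLp_pullGrad h.shear hS
      rwa [hΩ] at this
    have hLSk : MemLp (fun z => pullGrad l S (shearMap k z)) 2 (volume.restrict Ω₁) := by
      have := h.symm.shear.memLp_comp hLS
      rwa [hΩ'] at this
    have e := h.symm.shear.setIntegral_comp (fun z => gradDot (U z) (pullGrad l S z)) hm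
    rw [hΩ'] at e
    have hi : Integrable (fun z => ((lineDeriv ℝ k z (0, 1) : ℝ) : ℂ) *
        gradDot (U (shearMap k z)) (pullGrad l S (shearMap k z))) (volume.restrict Ω₁) := by
      refine (integrable_gradDot hUk hLSk).bdd_mul (c := 2) ?_ (ae_of_all _ fun z => ?_)
      · exact (Complex.measurable_ofReal.comp (h.symm.shear.measurable_dl _)).aestronglyMeasurable
      · have := abs_lineDeriv_le h.symm.lipschitz z (0, 1)
        rw [norm_vertical, mul_one] at this
        rw [Complex.norm_real, Real.norm_eq_abs]
        refine this.trans ?_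
        push_cast; linarith
    rw [← e, ← integral_sub (integrable_gradDot hKU hS) hi]
    obtain ⟨hint, hle⟩ := integral_norm_mul_norm_le hUk hS
    have hq := h.symm.shear.quasiMeasurePreserving.ae (h.norm_pullGrad_sub_le S)
    have h3 : ‖∫ z in Ω₁, (gradDot (pullGrad k U z) (S z) -
        ((lineDeriv ℝ k z (0, 1) : ℝ) : ℂ) * gradDot (U (shearMap k z))
          (pullGrad l S (shearMap k z)))‖
        ≤ ∫ z in Ω₁, M * (‖U (shearMap k z)‖ * ‖S z‖) := by
      refine norm_integral_le_of_norm_le (hint.const_mul M) ?_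
      filter_upwards [ae_restrict_of_ae (h.symm.norm_pullGrad_sub_le U),
        ae_restrict_of_ae hq, ae_restrict_of_ae hdk] with z h1 h2 h3
      rw [h.shear.right_inv] at h2
      refine (norm_gradDot_sub_le_of_close hε0 h1 h2 h3).2.trans ?_
      gcongr
    refine h3.trans ?_
    rw [integral_const_mul]
    calc _ ≤ M * ((3 * l2norm (volume.restrict Ω₂) U) * (3 * l2norm (volume.restrict Ω₁) S)) := by
          refine mul_le_mul_of_nonneg_left (hle.trans ?_) hM0
          have h0 := l2norm_nonneg (volume.restrict Ω₁) S
          exact mul_le_mul (nk U hU) (by linarith) h0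
            (mul_nonneg (by norm_num) (l2norm_nonneg _ _))
      _ = _ := by rw [hM, compConst]; ring

end Compare

/-- Comparison of the Dirichlet forms of the variational solutions of two nearby domains. -/
lemma compare_solutions {δ : ℝ≥0} {l k : Hor d × ℝ → ℝ} (hn : NearId δ l k) (hδ : δ ≤ 1)
    {O : Set (Hor d × ℝ)} (hO : IsOpen O) {η₁ η₂ : Hor d → ℝ} (hη₁ : Continuous η₁)
    (hη₂ : Continuous η₂) {h : ℝ} (hh : 0 < h) (hS₁ : stripBelow η₁ h ⊆ O)
    (hΩ : shearMap l ⁻¹' fluidDomain O η₁ = fluidDomain O η₂) (hgr : ∀ x, l (x, η₂ x) = η₁ x)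
    {f : Hor d → ℂ} (hf : AEStronglyMeasurable f volume) {φ₁ φ₂ : Hor d × ℝ → ℂ}
    {Φ₁ Φ₂ : Hor d × ℝ → GradVal d} (h₁ : IsVariationalSolution O η₁ f φ₁ Φ₁)
    (h₂ : IsVariationalSolution O η₂ f φ₂ Φ₂) {χ : Hor d → ℂ}
    (hχ : AEStronglyMeasurable χ volume) {w₁ w₂ : Hor d × ℝ → ℂ} {W₁ W₂ : Hor d × ℝ → GradVal d}
    (hw₁ : HasFiniteEnergyGrad (fluidDomain O η₁) w₁ W₁) (ht₁ : HasTrace η₁ w₁ χ)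
    (hw₂ : HasFiniteEnergyGrad (fluidDomain O η₂) w₂ W₂) (ht₂ : HasTrace η₂ w₂ χ) :
    ‖(∫ z in fluidDomain O η₁, gradDot (Φ₁ z) (W₁ z))
      - ∫ z in fluidDomain O η₂, gradDot (Φ₂ z) (W₂ z)‖
      ≤ 10 * (d + 3) ^ 2 * compConst d * δ * l2norm (volume.restrict (fluidDomain O η₂)) Φ₂
        * l2norm (volume.restrict (fluidDomain O η₂)) W₂ := by
  have hδ' : (δ : ℝ) ≤ 1 := hδ
  set Ω₁ := fluidDomain O η₁
  set Ω₂ := fluidDomain O η₂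
  have hΩ₁ : IsOpen Ω₁ := isOpen_fluidDomain hO hη₁
  have hΩ₂ : IsOpen Ω₂ := isOpen_fluidDomain hO hη₂
  have hΩ' : shearMap k ⁻¹' Ω₂ = Ω₁ := hn.preimage_eq hΩ
  have hgr' : ∀ x, k (x, η₁ x) = η₂ x := fun x => by rw [← hgr x]; exact hn.shear.kl (x, η₂ x)
  have hKw := hw₂.comp_shear hn.symm.shear hΩ₂
  have hKφ := h₂.1.comp_shear hn.symm.shear hΩ₂
  rw [hΩ'] at hKw hKφ
  have htK := ht₂.comp_shear hn.symm.shear hgr'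
  have htφ := h₂.2.1.comp_shear hn.symm.shear hgr'
  have hR := h₁.1.sub hKφ
  have hSΩ : stripBelow η₁ h ⊆ Ω₁ := stripBelow_subset_fluidDomain hS₁
  have htR := HasTrace.sub hh (h₁.1.aestronglyMeasurable.mono_measure
    (Measure.restrict_mono hSΩ le_rfl)) hf h₁.2.1 htφ
  rw [sub_self] at htR
  have htRc := htR.conj
  simp only [Pi.zero_apply, map_zero] at htRc
  set R := Φ₁ - pullGrad k Φ₂ with hRdef
  obtain ⟨cA, cB⟩ := hn.compare_forms hδ hΩ₂.measurableSet hΩ h₂.1.2.2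
  set μ₁ := volume.restrict Ω₁
  set μ₂ := volume.restrict Ω₂
  set a := l2norm μ₂ Φ₂ with ha
  have ha0 : 0 ≤ a := l2norm_nonneg _ _
  have hC0 := compConst_nonneg d
  -- the norm of the difference
  have hRle : l2norm μ₁ R ≤ compConst d * δ * a := by
    have h1 := sq_l2norm_le hR.2.2
    have hLR := hR.conj.comp_shear hn.shear hΩ₁
    rw [hΩ] at hLR
    have e1 := h₁.2.2 _ _ hR.conj htRc
    have e2 := h₂.2.2 _ _ hLR (htRc.comp_shear hn.shear hgr)
    have h2 := cB _ hR.conj.2.2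
    rw [e2, sub_zero, l2norm_conjGrad] at h2
    have e3 : ∫ z in Ω₁, gradDot (R z) (conjGrad (R z))
        = - ∫ z in Ω₁, gradDot (pullGrad k Φ₂ z) (conjGrad (R z)) := by
      have e4 := integral_sub (integrable_gradDot h₁.1.2.2 hR.conj.2.2)
        (integrable_gradDot hKφ.2.2 hR.conj.2.2)
      rw [e1, zero_sub] at e4
      rw [← e4]
      congr 1; ext z
      rw [← gradDot_sub_left]; rfl
    rw [e3] at h1
    have h3 := (h1.trans (Complex.re_le_norm _))
    rw [norm_neg] at h3
    have h4 := h3.trans h2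
    rcases (l2norm_nonneg μ₁ R).eq_or_lt with h6 | h6
    · rw [← h6]; positivity
    · refine le_of_mul_le_mul_right ?_ h6
      calc _ = l2norm μ₁ R ^ 2 := by ring
        _ ≤ _ := h4
  have hKW : l2norm μ₁ (pullGrad k W₂) ≤ (9 * (d + 2)) * l2norm μ₂ W₂ := by
    have h1 := l2norm_pullGrad_le hn.symm.shear hn.symm.lipschitz hn.lipschitz hw₂.2.2
    rw [hΩ'] at h1
    refine h1.trans ?_
    have h0 := l2norm_nonneg μ₂ W₂
    rw [← mul_assoc]
    refine mul_le_mul_of_nonneg_right ?_ h0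
    push_cast
    have : (1 + ((d : ℝ) + 1) * (δ + 1)) ≤ 1 + (d + 1) * (1 + 1) := by gcongr
    have h5 : 1 + ((δ : ℝ) + 1) ≤ 3 := by linarith
    calc _ ≤ (1 + ((d : ℝ) + 1) * (1 + 1)) * 3 := by gcongr
      _ ≤ _ := by
        have : (0 : ℝ) ≤ d := Nat.cast_nonneg d
        linarith
  have e5 := h₁.integral_eq hh hS₁ hχ hw₁ hKw ht₁ htK
  have e6 := integral_add (integrable_gradDot hR.2.2 hKw.2.2) (integrable_gradDot hKφ.2.2 hKw.2.2)
  have e7 : ∫ z in Ω₁, gradDot (Φ₁ z) (pullGrad k W₂ z)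
      = (∫ z in Ω₁, gradDot (R z) (pullGrad k W₂ z))
        + ∫ z in Ω₁, gradDot (pullGrad k Φ₂ z) (pullGrad k W₂ z) := by
    rw [← e6]
    congr 1; ext z
    rw [← gradDot_add_left, hRdef, Pi.sub_apply, sub_add_cancel]
  rw [e5, e7, add_sub_assoc]
  have hb := l2norm_nonneg μ₂ W₂
  calc _ ≤ (d + 1) * l2norm μ₁ R * l2norm μ₁ (pullGrad k W₂)
        + compConst d * δ * a * l2norm μ₂ W₂ :=
        (norm_add_le _ _).trans (add_le_add (norm_integral_gradDot_le hR.2.2 hKw.2.2)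
          (cA _ hw₂.2.2))
    _ ≤ (d + 1) * (compConst d * δ * a) * ((9 * (d + 2)) * l2norm μ₂ W₂)
        + compConst d * δ * a * l2norm μ₂ W₂ := by
        gcongr
        exact l2norm_nonneg _ _
    _ = (9 * (d + 1) * (d + 2) + 1) * (compConst d * δ * a * l2norm μ₂ W₂) := by ring
    _ ≤ (10 * (d + 3) ^ 2) * (compConst d * δ * a * l2norm μ₂ W₂) := by
        gcongr
        have : (0 : ℝ) ≤ d := Nat.cast_nonneg d
        nlinarith
    _ = _ := by ring

end WaterWaves

namespace WaterWaves

variable {d : ℕ}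

/-! ### The `W^{1,∞}` norm -/

lemma lipschitzWith_of_ae_fderiv_le {η : Hor d → ℝ} {K : ℝ≥0} (hη : LipschitzWith K η) {M : ℝ≥0}
    (hM : ∀ᵐ x, ‖fderiv ℝ η x‖ ≤ M) : LipschitzWith M η := by
  set g : Hor d × ℝ → ℝ := fun z => η z.1 with hg
  have hgL : LipschitzWith K g := by
    have := hη.comp (LipschitzWith.prod_fst (α := Hor d) (β := ℝ))
    rwa [mul_one] at this
  refine LipschitzWith.of_dist_le_mul fun x y => ?_
  set v : Hor d × ℝ := (x - y, 0) with hv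
  have hae : ∀ᵐ w, |lineDeriv ℝ g w v| ≤ M * ‖x - y‖ := by
    have h1 : ∀ᵐ w : Hor d × ℝ, DifferentiableAt ℝ η w.1 ∧ ‖fderiv ℝ η w.1‖ ≤ M :=
      Measure.quasiMeasurePreserving_fst.ae ((hη.ae_differentiableAt).and hM)
    filter_upwards [h1] with w ⟨hw1, hw2⟩
    have e : HasFDerivAt g ((fderiv ℝ η w.1).comp (ContinuousLinearMap.fst ℝ (Hor d) ℝ)) w :=
      hw1.hasFDerivAt.comp w hasFDerivAt_fst
    rw [(e.hasLineDerivAt v).lineDeriv]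
    exact ((fderiv ℝ η w.1).le_opNorm (x - y)).trans (by gcongr)
  have hseg : ∀ n, |mollify g n (x, 0) - mollify g n (y, 0)| ≤ M * ‖x - y‖ := by
    intro n
    have hd := (contDiff_mollify hgL.continuous n).differentiable (by simp)
    have hder : ∀ t : ℝ, HasDerivAt (fun t : ℝ => mollify g n ((y, 0) + t • v))
        (fderiv ℝ (mollify g n) ((y, 0) + t • v) v) t := by
      intro t
      have h2 : HasDerivAt (fun t : ℝ => ((y, 0) : Hor d × ℝ) + t • v) v t := by
        simpa using ((hasDerivAt_id t).smul_const v).const_add ((y, 0) : Hor d × ℝ)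
      exact (hd _).hasFDerivAt.comp_hasDerivAt t h2
    have h3 := (convex_univ (𝕜 := ℝ) (E := ℝ)).norm_image_sub_le_of_norm_hasDerivWithin_le
      (C := M * ‖x - y‖) (fun t _ => (hder t).hasDerivWithinAt)
      (fun t _ => abs_fderiv_mollify_le_of_ae hgL hae n _) (Set.mem_univ (0 : ℝ)) (Set.mem_univ 1)
    simpa [hv] using h3
  have h4 : Tendsto (fun n => |mollify g n (x, 0) - mollify g n (y, 0)|) atTop
      (𝓝 |g (x, 0) - g (y, 0)|) :=
    ((tendsto_mollify hgL.continuous _).sub (tendsto_mollify hgL.continuous _)).abs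
  rw [Real.dist_eq, dist_eq_norm]
  exact le_of_tendsto h4 (Eventually.of_forall hseg)

lemma eLpNorm_w1inf_lt_top {η : Hor d → ℝ} (hη : MemW1inf η) :
    eLpNorm η ⊤ volume < ⊤ ∧ eLpNorm (fun x => fderiv ℝ η x) ⊤ volume < ⊤ := by
  obtain ⟨⟨C, hC⟩, K, hK⟩ := hη
  refine ⟨?_, ?_⟩
  · rw [eLpNorm_exponent_top]
    exact eLpNormEssSup_lt_top_of_ae_bound (C := C) (ae_of_all _ hC)
  · rw [eLpNorm_exponent_top]
    exact eLpNormEssSup_lt_top_of_ae_bound (C := K)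
      (ae_of_all _ fun x => norm_fderiv_le_of_lipschitz ℝ hK)

lemma ae_norm_le_w1infNorm {η : Hor d → ℝ} (hη : MemW1inf η) :
    (∀ᵐ x, ‖η x‖ ≤ w1infNorm η) ∧ ∀ᵐ x, ‖fderiv ℝ η x‖ ≤ w1infNorm η := by
  obtain ⟨h1, h2⟩ := eLpNorm_w1inf_lt_top hη
  have hs : (w1infNorm η : ℝ≥0∞) = eLpNorm η ⊤ volume + eLpNorm (fun x => fderiv ℝ η x) ⊤ volume :=
    ENNReal.coe_toNNReal (ENNReal.add_lt_top.2 ⟨h1, h2⟩).ne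
  constructor
  · filter_upwards [ae_le_eLpNormEssSup (f := η) (μ := volume)] with x hx
    have : ‖η x‖ₑ ≤ w1infNorm η := by
      rw [hs]; exact hx.trans (by rw [eLpNorm_exponent_top]; exact le_self_add)
    rw [enorm_eq_nnnorm] at this
    exact_mod_cast this
  · filter_upwards [ae_le_eLpNormEssSup (f := fun x => fderiv ℝ η x) (μ := volume)] with x hx
    have : ‖fderiv ℝ η x‖ₑ ≤ w1infNorm η := by
      rw [hs]; exact hx.trans (by rw [eLpNorm_exponent_top]; exact le_add_self)
    rw [enorm_eq_nnnorm] at this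
    exact_mod_cast this

lemma MemW1inf.continuous {η : Hor d → ℝ} (hη : MemW1inf η) : Continuous η :=
  hη.2.choose_spec.continuous

lemma MemW1inf.lipschitzWith {η : Hor d → ℝ} (hη : MemW1inf η) :
    LipschitzWith (w1infNorm η) η :=
  lipschitzWith_of_ae_fderiv_le hη.2.choose_spec (ae_norm_le_w1infNorm hη).2

lemma MemW1inf.abs_le {η : Hor d → ℝ} (hη : MemW1inf η) (x : Hor d) : |η x| ≤ w1infNorm η := by
  have hc : IsClosed {x | ‖η x‖ ≤ w1infNorm η} := isClosed_le hη.continuous.norm continuous_const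
  have hd := Measure.dense_of_ae (ae_norm_le_w1infNorm hη).1
  have := hd x
  rwa [hc.closure_eq] at this

lemma MemW1inf.sub {η₁ η₂ : Hor d → ℝ} (h₁ : MemW1inf η₁) (h₂ : MemW1inf η₂) :
    MemW1inf (η₁ - η₂) := by
  obtain ⟨⟨C, hC⟩, K, hK⟩ := h₁
  obtain ⟨⟨C', hC'⟩, K', hK'⟩ := h₂
  exact ⟨⟨C + C', fun x => (abs_sub _ _).trans (add_le_add (hC x) (hC' x))⟩, K + K', hK.sub hK'⟩

/-! ### Construction of shears -/

/-- A small perturbation of the vertical coordinate defines a shear close to the identity. -/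
lemma exists_nearId {m : Hor d × ℝ → ℝ} {δ : ℝ≥0} (hm : LipschitzWith δ m) (hδ : δ ≤ 1 / 2)
    (hd : ∀ z, LineDifferentiableAt ℝ m z (0, 1)) :
    ∃ k, NearId (2 * δ) (fun z => z.2 + m z) k := by
  have hδ' : (δ : ℝ) ≤ 1 / 2 := by exact_mod_cast hδ
  have hL : ∀ (x : Hor d) (y y' : ℝ), |m (x, y) - m (x, y')| ≤ δ * |y - y'| := by
    intro x y y'
    have := hm.dist_le_mul (x, y) (x, y')
    rwa [Real.dist_eq, Prod.dist_eq, dist_self, max_eq_right dist_nonneg, Real.dist_eq] at this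
  have hcont : ∀ x : Hor d, Continuous fun y => y + m (x, y) := fun x =>
    continuous_id.add (hm.continuous.comp (by fun_prop))
  have hmono : ∀ (x : Hor d) (y y' : ℝ), y ≤ y' →
      (y' - y) / 2 ≤ (y' + m (x, y')) - (y + m (x, y)) := by
    intro x y y' hyy
    have h1 := (abs_le.1 (hL x y' y)).1
    rw [abs_of_nonneg (by linarith)] at h1
    nlinarith
  have hsurj : ∀ x : Hor d, Function.Surjective fun y => y + m (x, y) := by
    intro x
    refine (hcont x).surjective ?_ ?_
    · refine tendsto_atTop_mono' atTop (f₁ := fun y : ℝ => y / 2 + m (x, 0)) ?_ ?_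
      · filter_upwards [eventually_ge_atTop 0] with y hy
        have := hmono x 0 y hy
        linarith
      · exact tendsto_atTop_add_const_right _ _ (tendsto_id.atTop_div_const (by norm_num))
    · refine tendsto_atBot_mono' atBot (f₁ := fun y : ℝ => y / 2 + m (x, 0)) ?_ ?_
      · filter_upwards [eventually_le_atBot 0] with y hy
        have := hmono x y 0 hy
        linarith
      · exact tendsto_atBot_add_const_right _ _ (tendsto_id.atBot_div_const (by norm_num))
  have hinj : ∀ (x : Hor d) (y y' : ℝ), y + m (x, y) = y' + m (x, y') → y = y' := by
    intro x y y' hyy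
    rcases le_total y y' with h | h
    · have := hmono x y y' h; linarith
    · have := hmono x y' y h; linarith
  choose K hK using hsurj
  set k : Hor d × ℝ → ℝ := fun z => K z.1 z.2 with hk
  have hlk : ∀ z : Hor d × ℝ, k z + m (z.1, k z) = z.2 := fun z => hK z.1 z.2
  have hkl : ∀ z : Hor d × ℝ, k (z.1, z.2 + m z) = z.2 := fun z =>
    hinj z.1 _ _ (hlk (z.1, z.2 + m z))
  have hkL : LipschitzWith (2 * δ) fun z => k z - z.2 := by
    refine LipschitzWith.of_dist_le_mul fun z z' => ?_
    have h1 := hlk z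
    have h2 := hlk z'
    set D := |k z - z.2 - (k z' - z'.2)| with hD
    have h3 : D = |m (z.1, k z) - m (z'.1, k z')| := by
      rw [hD, abs_sub_comm]; congr 1; linarith
    have h4 := hm.dist_le_mul (z.1, k z) (z'.1, k z')
    rw [Real.dist_eq, ← h3, Prod.dist_eq] at h4
    have h5 : dist z.1 z'.1 ≤ dist z z' + D :=
      (le_max_left _ _).trans (le_add_of_nonneg_right (abs_nonneg _))
    have h6 : dist (k z) (k z') ≤ dist z z' + D := by
      have h7 : |z.2 - z'.2| ≤ dist z z' := le_max_right _ _
      rw [Real.dist_eq]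
      have e : k z - k z' = (z.2 - z'.2) + (k z - z.2 - (k z' - z'.2)) := by ring
      rw [e]
      exact (abs_add_le _ _).trans (by gcongr)
    have h8 : D ≤ δ * (dist z z' + D) := h4.trans (by gcongr; exact max_le h5 h6)
    have h9 : 0 ≤ D := abs_nonneg _
    rw [Real.dist_eq, ← hD]
    push_cast
    nlinarith [mul_le_mul_of_nonneg_right hδ' h9]
  have hkc : Continuous k := by
    have : k = fun z => (k z - z.2) + z.2 := by ext z; ring
    rw [this]
    exact hkL.continuous.add continuous_snd
  have hder : ∀ (x : Hor d) (y : ℝ), HasDerivAt (fun s => s + m (x, s))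
      (1 + lineDeriv ℝ m (x, y) (0, 1)) y := by
    intro x y
    have h1 := (hd (x, y)).hasLineDerivAt
    have h2 : HasDerivAt (fun t => m ((x, y) + t • (0, 1))) (lineDeriv ℝ m (x, y) (0, 1)) (y - y) := by
      rw [sub_self]; exact h1
    refine (hasDerivAt_id y).add ((h2.comp_sub_const y y).congr_of_eventuallyEq
      (Eventually.of_forall fun s => ?_))
    simp
  have hpos : ∀ z : Hor d × ℝ, 0 < 1 + lineDeriv ℝ m z (0, 1) := by
    intro z
    have := (abs_le.1 (abs_lineDeriv_le hm z (0, 1))).1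
    rw [norm_vertical, mul_one] at this
    linarith
  have hline : ∀ {q : Hor d × ℝ → ℝ} {c : ℝ} {x : Hor d} {y : ℝ},
      HasDerivAt (fun s => q (x, s)) c y → HasLineDerivAt ℝ q c (x, y) (0, 1) := by
    intro q c x y hq
    have h2 : HasDerivAt (fun t : ℝ => y + t) 1 0 := by
      simpa using (hasDerivAt_id (0 : ℝ)).const_add y
    have hq' : HasDerivAt (fun s => q (x, s)) c (y + 0) := by rwa [add_zero]
    have h3 := hq'.comp (0 : ℝ) h2
    rw [mul_one] at h3
    refine HasDerivAt.congr_of_eventuallyEq h3 (Eventually.of_forall fun s => ?_)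
    simp
  have hlL : ∃ C, LipschitzWith C fun z : Hor d × ℝ => z.2 + m z :=
    ⟨_, (LipschitzWith.prod_snd).add hm⟩
  have hkL' : ∃ C, LipschitzWith C k := by
    have : k = fun z => (k z - z.2) + z.2 := by ext z; ring
    rw [this]
    exact ⟨_, hkL.add LipschitzWith.prod_snd⟩
  refine ⟨k, ⟨hlL, hkL', hkl, hlk, fun ⟨x, y⟩ => ?_, fun ⟨x, y⟩ => ?_⟩, ?_, hkL⟩
  · have h1 := hline (q := fun z => z.2 + m z) (hder x y)
    exact ⟨by rw [h1.lineDeriv]; exact hpos _, h1.lineDifferentiableAt⟩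
  · have h1 : HasDerivAt (fun s => k (x, s)) (1 + lineDeriv ℝ m (x, k (x, y)) (0, 1))⁻¹ y :=
      HasDerivAt.of_local_left_inverse (f := fun s => s + m (x, s))
        (hkc.comp (by fun_prop : Continuous fun s : ℝ => (x, s))).continuousAt (hder x _)
        (hpos _).ne' (Eventually.of_forall fun s => hlk (x, s))
    have h2 := hline (q := k) h1
    exact ⟨by rw [h2.lineDeriv]; exact inv_pos.2 (hpos _), h2.lineDifferentiableAt⟩
  · have : (fun z : Hor d × ℝ => z.2 + m z - z.2) = m := by ext z; ring
    rw [this]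
    exact hm.weaken (le_mul_of_one_le_left δ.2 (by norm_num))

/-- A cutoff of the vertical variable, equal to `1` near the origin and supported in
`(-h / 2, h / 2)`. -/
noncomputable def vertCutoff {h : ℝ} (hh : 0 < h) : ContDiffBump (0 : ℝ) where
  rIn := h / 8
  rOut := h / 4
  rIn_pos := by positivity
  rIn_lt_rOut := by linarith

lemma exists_lipschitz_vertCutoff {h : ℝ} (hh : 0 < h) :
    ∃ C : ℝ≥0, LipschitzWith C (vertCutoff hh) :=
  ContDiff.lipschitzWith_of_hasCompactSupport (vertCutoff hh).hasCompactSupport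
    ((vertCutoff hh).contDiff (n := 1)) one_ne_zero

lemma vertCutoff_eq_zero {h : ℝ} (hh : 0 < h) {t : ℝ} (ht : h / 4 ≤ |t|) : vertCutoff hh t = 0 := by
  refine (vertCutoff hh).zero_of_le_dist ?_
  rw [Real.dist_eq, sub_zero]; exact ht

/-- If `η₁ - η₂` is small, a shear close to the identity maps the fluid domain of `η₂` to that of
`η₁`. -/
lemma exists_shear_fluidDomain {h : ℝ} (hh : 0 < h) {C : ℝ≥0} (hC : LipschitzWith C (vertCutoff hh))
    {O : Set (Hor d × ℝ)} {η₁ η₂ : Hor d → ℝ} (h₁ : MemW1inf η₁) (h₂ : MemW1inf η₂)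
    (hS₁ : stripBelow η₁ h ⊆ O) (hS₂ : stripBelow η₂ h ⊆ O) {δ : ℝ≥0}
    (hδ : δ = w1infNorm (η₁ - η₂) * (1 + C * (1 + w1infNorm η₂))) (hδ' : δ ≤ 1 / 2)
    (hsmall : w1infNorm (η₁ - η₂) ≤ h / 2) :
    ∃ l k, NearId (2 * δ) l k ∧ shearMap l ⁻¹' fluidDomain O η₁ = fluidDomain O η₂ ∧
      ∀ x, l (x, η₂ x) = η₁ x := by
  set a := η₁ - η₂ with ha
  set ζ := vertCutoff hh
  have h₁₂ : MemW1inf a := h₁.sub h₂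
  set m : Hor d × ℝ → ℝ := fun z => a z.1 * ζ (z.2 - η₂ z.1) with hm
  have hζ1 : ∀ t, |ζ t| ≤ 1 := fun t => by
    rw [abs_of_nonneg (ζ.nonneg)]; exact ζ.le_one
  have hmL : LipschitzWith δ m := by
    refine LipschitzWith.of_dist_le_mul fun z z' => ?_
    rw [Real.dist_eq]
    have e : m z - m z' = (a z.1 - a z'.1) * ζ (z.2 - η₂ z.1)
        + a z'.1 * (ζ (z.2 - η₂ z.1) - ζ (z'.2 - η₂ z'.1)) := by simp only [hm]; ring
    have d1 : dist z.1 z'.1 ≤ dist z z' := le_max_left _ _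
    have d2 : |z.2 - z'.2| ≤ dist z z' := le_max_right _ _
    have b1 : |a z.1 - a z'.1| ≤ w1infNorm a * dist z z' := by
      have := h₁₂.lipschitzWith.dist_le_mul z.1 z'.1
      rw [Real.dist_eq] at this
      exact this.trans (by gcongr)
    have b2 : |η₂ z.1 - η₂ z'.1| ≤ w1infNorm η₂ * dist z z' := by
      have := h₂.lipschitzWith.dist_le_mul z.1 z'.1
      rw [Real.dist_eq] at this
      exact this.trans (by gcongr)
    have b3 : |ζ (z.2 - η₂ z.1) - ζ (z'.2 - η₂ z'.1)| ≤ C * ((1 + w1infNorm η₂) * dist z z') := by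
      have := hC.dist_le_mul (z.2 - η₂ z.1) (z'.2 - η₂ z'.1)
      rw [Real.dist_eq, Real.dist_eq] at this
      refine this.trans ?_
      gcongr
      have e2 : z.2 - η₂ z.1 - (z'.2 - η₂ z'.1) = (z.2 - z'.2) - (η₂ z.1 - η₂ z'.1) := by ring
      rw [e2]
      refine (abs_sub _ _).trans ?_
      rw [add_mul, one_mul]
      exact add_le_add d2 b2
    rw [e]
    calc _ ≤ |a z.1 - a z'.1| * |ζ (z.2 - η₂ z.1)|
          + |a z'.1| * |ζ (z.2 - η₂ z.1) - ζ (z'.2 - η₂ z'.1)| := by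
          rw [← abs_mul, ← abs_mul]; exact abs_add_le _ _
      _ ≤ (w1infNorm a * dist z z') * 1
          + w1infNorm a * (C * ((1 + w1infNorm η₂) * dist z z')) := by
          gcongr
          · exact hζ1 _
          · exact h₁₂.abs_le _
      _ = _ := by rw [hδ]; push_cast; ring
  have hmd : ∀ z, LineDifferentiableAt ℝ m z (0, 1) := by
    intro z
    have h1 : DifferentiableAt ℝ (fun t : ℝ => a z.1 * ζ (z.2 + t - η₂ z.1)) 0 := by
      have h2 : DifferentiableAt ℝ ζ (z.2 + 0 - η₂ z.1) :=
        (ζ.contDiff (n := 1)).differentiable one_ne_zero _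
      exact (h2.comp (0 : ℝ) (by fun_prop : DifferentiableAt ℝ (fun t : ℝ => z.2 + t - η₂ z.1) 0)).const_mul _
    refine DifferentiableAt.congr_of_eventuallyEq h1 (Eventually.of_forall fun t => ?_)
    simp [hm]
  obtain ⟨k, hk⟩ := exists_nearId hmL hδ' hmd
  have hgr : ∀ x, η₂ x + m (x, η₂ x) = η₁ x := by
    intro x
    have : ζ 0 = 1 := ζ.one_of_mem_closedBall (Metric.mem_closedBall_self ζ.rIn_pos.le)
    simp [hm, ha, this]
  refine ⟨_, k, hk, ?_, hgr⟩
  ext ⟨x, y⟩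
  have hmono := hk.shear.strictMono x
  have hlt : y + m (x, y) < η₁ x ↔ y < η₂ x := by
    rw [← hgr x]
    exact hmono.lt_iff_lt (a := y) (b := η₂ x)
  have hax := (abs_le.1 ((h₁₂.abs_le x).trans hsmall))
  simp only [ha, Pi.sub_apply] at hax
  change ((x, y + m (x, y)) ∈ O ∧ y + m (x, y) < η₁ x) ↔ ((x, y) ∈ O ∧ y < η₂ x)
  rw [hlt]
  refine and_congr_left fun hy => ?_
  by_cases hyh : y ≤ η₂ x - h / 2
  · have : m (x, y) = 0 := by
      simp only [hm]
      rw [vertCutoff_eq_zero hh, mul_zero]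
      rw [abs_of_neg (by linarith)]; linarith
    rw [this, add_zero]
  · push Not at hyh
    refine iff_of_true (hS₁ ⟨?_, hlt.2 hy⟩) (hS₂ ⟨?_, hy⟩)
    · have h3 : m (x, η₂ x - h / 2) = 0 := by
        simp only [hm]
        rw [vertCutoff_eq_zero hh, mul_zero]
        rw [abs_of_neg (by linarith)]; linarith
      have h4 := hmono hyh
      simp only at h4
      rw [h3] at h4
      simp only
      linarith
    · simp only; linarith

end WaterWaves

namespace WaterWaves

variable {d : ℕ}

open scoped FourierTransform

/-! ### The weights `(1 + |ξ|²)^{s/2}` -/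

/-- The weight `(1 + |ξ|²)^{s/2}`. -/
noncomputable def jw (s : ℝ) (ξ : Hor d) : ℝ := (1 + ‖ξ‖ ^ 2) ^ (s / 2)

lemma jw_pos (s : ℝ) (ξ : Hor d) : 0 < jw s ξ := by unfold jw; positivity

lemma jw_add (s t : ℝ) (ξ : Hor d) : jw (s + t) ξ = jw s ξ * jw t ξ := by
  rw [jw, jw, jw, ← Real.rpow_add (by positivity)]; ring_nf

lemma jw_zero (ξ : Hor d) : jw 0 ξ = 1 := by simp [jw]

lemma jw_neg_mul (s : ℝ) (ξ : Hor d) : jw (-s) ξ * jw s ξ = 1 := by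
  rw [← jw_add, neg_add_cancel, jw_zero]

lemma jw_mono {s t : ℝ} (h : s ≤ t) (ξ : Hor d) : jw s ξ ≤ jw t ξ :=
  Real.rpow_le_rpow_of_exponent_le (by nlinarith [sq_nonneg ‖ξ‖]) (by linarith)

lemma jw_le_one {s : ℝ} (h : s ≤ 0) (ξ : Hor d) : jw s ξ ≤ 1 := by
  simpa [jw_zero] using jw_mono h ξ

lemma jw_two (ξ : Hor d) : jw 2 ξ = 1 + ‖ξ‖ ^ 2 := by simp [jw]

lemma jw_comp_neg (s : ℝ) (ξ : Hor d) : jw s (-ξ) = jw s ξ := by simp [jw]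

lemma continuous_jw (s : ℝ) : Continuous (jw s : Hor d → ℝ) := by
  unfold jw
  exact (by fun_prop : Continuous fun ξ : Hor d => 1 + ‖ξ‖ ^ 2).rpow_const fun ξ =>
    Or.inl (by positivity)

lemma measurable_jw (s : ℝ) : Measurable (jw s : Hor d → ℝ) := (continuous_jw s).measurable

lemma hasTemperateGrowth_jw (s : ℝ) : (fun ξ : Hor d => (jw s ξ : ℂ)).HasTemperateGrowth := by
  unfold jw; fun_prop

/-! ### Testing against Schwartz functions -/

lemma ae_eq_of_schwartz {u v : Hor d → ℂ} (hu : LocallyIntegrable u volume)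
    (hv : LocallyIntegrable v volume)
    (h : ∀ χ : 𝓢(Hor d, ℂ), HasCompactSupport χ → ∫ x, χ x * u x = ∫ x, χ x * v x) :
    u =ᵐ[volume] v := by
  refine ae_eq_of_integral_contDiff_smul_eq hu hv fun g hg hgc => ?_
  have hg₁ : HasCompactSupport (Complex.ofRealCLM ∘ g) := hgc.comp_left rfl
  have hg₂ : ContDiff ℝ ((⊤ : ℕ∞) : WithTop ℕ∞) (Complex.ofRealCLM ∘ g) := by fun_prop
  have := h (hg₁.toSchwartzMap hg₂) hg₁
  simpa using this

lemma L2.locallyIntegrable (f : L2 d) : LocallyIntegrable f volume :=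
  (Lp.memLp f).locallyIntegrable (by norm_num)

lemma LocallyIntegrable.continuous_mul {u : Hor d → ℂ} (hu : LocallyIntegrable u volume)
    {m : Hor d → ℝ} (hm : Continuous m) : LocallyIntegrable (fun x => (m x : ℂ) * u x) volume := by
  rw [← locallyIntegrableOn_univ] at hu ⊢
  exact hu.continuousOn_smul (g := fun z => (m z : ℂ)) isOpen_univ.isLocallyClosed
    (Complex.continuous_ofReal.comp hm).continuousOn

lemma toDist_injective : Function.Injective fun f : L2 d => (f : 𝓢'(Hor d, ℂ)) := by
  have := Lp.ker_toTemperedDistributionCLM_eq_bot (F := ℂ) (μ := (volume : Measure (Hor d))) (p := 2)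
  exact LinearMap.ker_eq_bot.1 this

lemma smulLeftCLM_jw_apply (s : ℝ) (F : L2 d) (χ : 𝓢(Hor d, ℂ)) :
    smulLeftCLM ℂ (fun x : Hor d => ((1 + ‖x‖ ^ 2) ^ (s / 2) : ℝ)) (F : 𝓢'(Hor d, ℂ)) χ
      = ∫ ξ, χ ξ * ((jw s ξ : ℂ) * F ξ) := by
  rw [smulLeftCLM_apply_apply, Lp.toTemperedDistribution_apply]
  congr 1; ext ξ
  have : SchwartzMap.smulLeftCLM ℂ (fun x : Hor d => (((1 + ‖x‖ ^ 2) ^ (s / 2) : ℝ) : ℂ)) χ ξ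
      = (jw s ξ : ℂ) • χ ξ := SchwartzMap.smulLeftCLM_apply_apply (hasTemperateGrowth_jw s) χ ξ
  rw [this]
  simp only [smul_eq_mul]
  ring

/-- Bessel potentials of `L²` functions on the Fourier side. -/
lemma besselPotential_eq_iff (s : ℝ) (f g : L2 d) :
    besselPotential (Hor d) ℂ s (f : 𝓢'(Hor d, ℂ)) = (g : 𝓢'(Hor d, ℂ)) ↔
      (𝓕 g : L2 d) =ᵐ[volume] fun ξ => (jw s ξ : ℂ) * (𝓕 f : L2 d) ξ := by
  have h1 : besselPotential (Hor d) ℂ s (f : 𝓢'(Hor d, ℂ)) = (g : 𝓢'(Hor d, ℂ)) ↔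
      smulLeftCLM ℂ (fun x : Hor d => ((1 + ‖x‖ ^ 2) ^ (s / 2) : ℝ)) ((𝓕 f : L2 d) : 𝓢'(Hor d, ℂ))
        = ((𝓕 g : L2 d) : 𝓢'(Hor d, ℂ)) := by
    rw [← Lp.fourier_toTemperedDistribution_eq, ← Lp.fourier_toTemperedDistribution_eq,
      ← fourier_besselPotential_eq_smulLeftCLM_fourier_apply]
    constructor
    · intro h; rw [h]
    · intro h
      have := congrArg (fun T : 𝓢'(Hor d, ℂ) => 𝓕⁻ T) h
      rwa [FourierTransform.fourierInv_fourier_eq, FourierTransform.fourierInv_fourier_eq] at this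
  rw [h1]
  constructor
  · intro h
    symm
    refine ae_eq_of_schwartz (LocallyIntegrable.continuous_mul (L2.locallyIntegrable _)
      (continuous_jw s)) (L2.locallyIntegrable _) fun χ _ => ?_
    rw [← smulLeftCLM_jw_apply, h, Lp.toTemperedDistribution_apply]
    simp
  · intro h
    ext χ
    rw [smulLeftCLM_jw_apply, Lp.toTemperedDistribution_apply]
    refine integral_congr_ae ?_
    filter_upwards [h] with ξ hξ
    rw [hξ]; rfl

/-! ### Bounded multipliers on `L²` -/

lemma memLp_bdd_mul {m : Hor d → ℂ} (hm : AEStronglyMeasurable m volume) {C : ℝ}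
    (hC : ∀ᵐ x, ‖m x‖ ≤ C) (f : L2 d) : MemLp (fun x => m x * f x) 2 volume := by
  refine (Lp.memLp f).of_le_mul (c := C) (hm.mul (Lp.aestronglyMeasurable f)) ?_
  filter_upwards [hC] with x hx
  rw [norm_mul]
  gcongr

/-- Multiplication by a bounded function on `L²`. -/
noncomputable def mulL2 {m : Hor d → ℂ} (hm : AEStronglyMeasurable m volume) {C : ℝ}
    (hC : ∀ᵐ x, ‖m x‖ ≤ C) : L2 d →L[ℂ] L2 d :=
  LinearMap.mkContinuous
    { toFun := fun f => MemLp.toLp _ (memLp_bdd_mul hm hC f)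
      map_add' := fun f g => by
        rw [← MemLp.toLp_add]
        refine MemLp.toLp_congr _ _ ?_
        filter_upwards [Lp.coeFn_add f g] with x hx
        simp only [hx, Pi.add_apply, mul_add]
      map_smul' := fun c f => by
        rw [RingHom.id_apply, ← MemLp.toLp_const_smul]
        refine MemLp.toLp_congr _ _ ?_
        filter_upwards [Lp.coeFn_smul c f] with x hx
        simp only [hx, Pi.smul_apply, smul_eq_mul, mul_left_comm] }
    C fun f => by
      refine Lp.norm_le_mul_norm_of_ae_le_mul ?_
      filter_upwards [MemLp.coeFn_toLp (memLp_bdd_mul hm hC f), hC] with x hx hx'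
      simp only [LinearMap.coe_mk, AddHom.coe_mk]
      rw [hx, norm_mul]
      gcongr

lemma coeFn_mulL2 {m : Hor d → ℂ} (hm : AEStronglyMeasurable m volume) {C : ℝ}
    (hC : ∀ᵐ x, ‖m x‖ ≤ C) (f : L2 d) : mulL2 hm hC f =ᵐ[volume] fun x => m x * f x :=
  MemLp.coeFn_toLp (memLp_bdd_mul hm hC f)

lemma norm_mulL2_le {m : Hor d → ℂ} (hm : AEStronglyMeasurable m volume) {C : ℝ}
    (hC : ∀ᵐ x, ‖m x‖ ≤ C) (f : L2 d) : ‖mulL2 hm hC f‖ ≤ C * ‖f‖ := by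
  refine Lp.norm_le_mul_norm_of_ae_le_mul ?_
  filter_upwards [coeFn_mulL2 hm hC f, hC] with x hx hx'
  rw [hx, norm_mul]
  gcongr

lemma ae_norm_jw_le {s : ℝ} (hs : s ≤ 0) : ∀ᵐ ξ : Hor d, ‖(jw s ξ : ℂ)‖ ≤ 1 :=
  ae_of_all _ fun ξ => by
    rw [Complex.norm_real, Real.norm_of_nonneg (jw_pos s ξ).le]
    exact jw_le_one hs ξ

lemma aestronglyMeasurable_jw (s : ℝ) :
    AEStronglyMeasurable (fun ξ : Hor d => (jw s ξ : ℂ)) volume :=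
  (Complex.continuous_ofReal.comp (continuous_jw s)).aestronglyMeasurable

/-- The operator `(1 + |D|²)^{-s/2}` on `L²`. -/
noncomputable def bessel {s : ℝ} (hs : -s ≤ 0) : L2 d →L[ℂ] L2 d :=
  ((Lp.fourierTransformₗᵢ (Hor d) ℂ).symm.toContinuousLinearEquiv : L2 d →L[ℂ] L2 d).comp
    ((mulL2 (aestronglyMeasurable_jw (-s)) (ae_norm_jw_le hs)).comp
      ((Lp.fourierTransformₗᵢ (Hor d) ℂ).toContinuousLinearEquiv : L2 d →L[ℂ] L2 d))

lemma fourier_bessel {s : ℝ} (hs : -s ≤ 0) (g : L2 d) :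
    (𝓕 (bessel hs g) : L2 d) =ᵐ[volume] fun ξ => (jw (-s) ξ : ℂ) * (𝓕 g : L2 d) ξ := by
  have : 𝓕 (bessel hs g) = mulL2 (aestronglyMeasurable_jw (-s)) (ae_norm_jw_le hs) (𝓕 g) :=
    (Lp.fourierTransformₗᵢ (Hor d) ℂ).apply_symm_apply _
  rw [this]
  exact coeFn_mulL2 _ _ _

lemma norm_bessel_le {s : ℝ} (hs : -s ≤ 0) (g : L2 d) : ‖bessel hs g‖ ≤ ‖g‖ := by
  have h1 := norm_mulL2_le (aestronglyMeasurable_jw (-s)) (ae_norm_jw_le hs) (𝓕 g : L2 d)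
  rw [one_mul, Lp.norm_fourier_eq] at h1
  have h2 : ‖bessel hs g‖ = ‖mulL2 (aestronglyMeasurable_jw (-s)) (ae_norm_jw_le hs) (𝓕 g : L2 d)‖ :=
    (Lp.fourierTransformₗᵢ (Hor d) ℂ).symm.norm_map _
  rw [h2]; exact h1

lemma besselPotential_bessel {s : ℝ} (hs : -s ≤ 0) (g : L2 d) :
    besselPotential (Hor d) ℂ s (bessel hs g : 𝓢'(Hor d, ℂ)) = (g : 𝓢'(Hor d, ℂ)) := by
  rw [besselPotential_eq_iff]
  filter_upwards [fourier_bessel hs g] with ξ hξ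
  rw [hξ, ← mul_assoc, ← Complex.ofReal_mul, mul_comm (jw s ξ), jw_neg_mul]
  simp

lemma besselPotential_eq_iff_bessel {s : ℝ} (hs : -s ≤ 0) (f g : L2 d) :
    besselPotential (Hor d) ℂ s (f : 𝓢'(Hor d, ℂ)) = (g : 𝓢'(Hor d, ℂ)) ↔ f = bessel hs g := by
  constructor
  · intro h
    apply toDist_injective
    have h1 := congrArg (besselPotential (Hor d) ℂ (-s)) (h.trans (besselPotential_bessel hs g).symm)
    simpa using h1
  · rintro rfl
    exact besselPotential_bessel hs g

lemma hsENorm_of_eq {s : ℝ} {T : 𝓢'(Hor d, ℂ)} {g : L2 d}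
    (h : besselPotential (Hor d) ℂ s T = (g : 𝓢'(Hor d, ℂ))) : hsENorm s T = ‖g‖ₑ := by
  refine le_antisymm (iInf₂_le g h) (le_iInf₂ fun g' hg' => ?_)
  have : g = g' := toDist_injective (h.symm.trans hg')
  rw [this]

lemma memSobolev_of_hsENorm_lt_top {s : ℝ} {T : 𝓢'(Hor d, ℂ)} (h : hsENorm s T < ⊤) :
    MemSobolev s 2 T := by
  by_contra hcon
  rw [hsENorm, iInf_lt_iff] at h
  obtain ⟨g, hg⟩ := h
  rw [iInf_lt_iff] at hg
  obtain ⟨hg, -⟩ := hg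
  exact hcon ⟨g, hg⟩

/-! ### The spaces `H^{1/2}` and `H^{-1/2}` -/

lemma neg_half_nonpos : -(1 / 2 : ℝ) ≤ 0 := by norm_num

/-- The isomorphism `(1 + |D|²)^{-1/4}` from `L²` to `H^{1/2}`. -/
noncomputable def toHalf : L2 d →L[ℂ] L2 d := bessel neg_half_nonpos

/-- The isomorphism `(1 + |D|²)^{1/4}` from `L²` to `H^{-1/2}`. -/
noncomputable def toNegHalf (b : L2 d) : 𝓢'(Hor d, ℂ) :=
  besselPotential (Hor d) ℂ (1 / 2) (b : 𝓢'(Hor d, ℂ))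

lemma norm_toHalf_le (g : L2 d) : ‖toHalf g‖ ≤ ‖g‖ := norm_bessel_le _ g

lemma besselPotential_half_eq_iff (f g : L2 d) :
    besselPotential (Hor d) ℂ (1 / 2) (f : 𝓢'(Hor d, ℂ)) = (g : 𝓢'(Hor d, ℂ)) ↔ f = toHalf g :=
  besselPotential_eq_iff_bessel _ f g

lemma toHalf_injective : Function.Injective (toHalf : L2 d → L2 d) := by
  intro g g' h
  apply toDist_injective
  have h1 := (besselPotential_half_eq_iff _ g).2 rfl
  have h2 := (besselPotential_half_eq_iff _ g').2 rfl
  rw [h] at h1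
  exact h1.symm.trans h2

lemma memSobolev_half_iff (f : L2 d) :
    MemSobolev (1 / 2) 2 (f : 𝓢'(Hor d, ℂ)) ↔ ∃ g, f = toHalf g :=
  exists_congr fun g => besselPotential_half_eq_iff f g

lemma hsENorm_toHalf (g : L2 d) : hsENorm (1 / 2) (toHalf g : 𝓢'(Hor d, ℂ)) = ‖g‖ₑ :=
  hsENorm_of_eq ((besselPotential_half_eq_iff _ g).2 rfl)

lemma besselPotential_neg_half_eq_iff (b : 𝓢'(Hor d, ℂ)) (b' : L2 d) :
    besselPotential (Hor d) ℂ (-1 / 2) b = (b' : 𝓢'(Hor d, ℂ)) ↔ b = toNegHalf b' := by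
  rw [show (-1 / 2 : ℝ) = -(1 / 2) by norm_num, besselPotential_neg_apply_eq_iff, toNegHalf]
  exact eq_comm

lemma memSobolev_neg_half_iff (b : 𝓢'(Hor d, ℂ)) :
    MemSobolev (-1 / 2) 2 b ↔ ∃ b', b = toNegHalf b' :=
  exists_congr fun b' => besselPotential_neg_half_eq_iff b b'

lemma hsENorm_toNegHalf (b : L2 d) : hsENorm (-1 / 2) (toNegHalf b) = ‖b‖ₑ :=
  hsENorm_of_eq ((besselPotential_neg_half_eq_iff _ b).2 rfl)

lemma toNegHalf_add (b b' : L2 d) : toNegHalf (b + b') = toNegHalf b + toNegHalf b' := by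
  rw [toNegHalf, ← Lp.toTemperedDistributionCLM_apply, map_add, map_add]; rfl

lemma toNegHalf_sub (b b' : L2 d) : toNegHalf (b - b') = toNegHalf b - toNegHalf b' := by
  rw [toNegHalf, ← Lp.toTemperedDistributionCLM_apply, map_sub, map_sub]; rfl

lemma toNegHalf_sum {ι : Type*} (s : Finset ι) (b : ι → L2 d) :
    toNegHalf (∑ i ∈ s, b i) = ∑ i ∈ s, toNegHalf (b i) := by
  rw [toNegHalf, ← Lp.toTemperedDistributionCLM_apply, map_sum, map_sum]; rfl

lemma toNegHalf_injective : Function.Injective (toNegHalf : L2 d → 𝓢'(Hor d, ℂ)) := by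
  intro b b' h
  apply toDist_injective
  have h1 := (besselPotential_neg_half_eq_iff _ b).2 rfl
  have h2 := (besselPotential_neg_half_eq_iff _ b').2 rfl
  rw [h] at h1
  exact h1.symm.trans h2

/-- The bilinear pairing of `L²`. -/
noncomputable def pair (b g : L2 d) : ℂ := ∫ x, b x * g x

/-- `⟨D⟩^{1/2} χ` for a Schwartz function `χ`. -/
noncomputable def halfDeriv (χ : 𝓢(Hor d, ℂ)) : L2 d :=
  (SchwartzMap.fourierMultiplierCLM ℂ (fun ξ : Hor d => (jw (1 / 2) ξ : ℂ)) χ).toLp 2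

lemma toHalf_halfDeriv (χ : 𝓢(Hor d, ℂ)) : toHalf (halfDeriv χ) = χ.toLp 2 := by
  symm
  rw [← besselPotential_half_eq_iff, besselPotential, halfDeriv, Lp.toTemperedDistribution_toLp_eq,
    Lp.toTemperedDistribution_toLp_eq]
  exact fourierMultiplierCLM_toTemperedDistributionCLM_eq (hasTemperateGrowth_jw (1 / 2)) χ

lemma fourierMultiplier_jw_eq (s : ℝ) (χ : 𝓢(Hor d, ℂ)) :
    SchwartzMap.fourierMultiplierCLM ℂ (fun ξ : Hor d => (jw s ξ : ℂ)) χ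
      = 𝓕 (SchwartzMap.smulLeftCLM ℂ (fun ξ : Hor d => (jw s ξ : ℂ)) (𝓕⁻ χ)) := by
  symm
  rw [SchwartzMap.fourierMultiplierCLM_apply]
  ext x
  rw [SchwartzMap.fourier_coe, SchwartzMap.fourierInv_coe, Real.fourierInv_eq_fourier_comp_neg]
  refine congrFun (congrArg _ (funext fun ξ => ?_)) x
  rw [SchwartzMap.smulLeftCLM_apply_apply (hasTemperateGrowth_jw _),
    SchwartzMap.smulLeftCLM_apply_apply (hasTemperateGrowth_jw _), jw_comp_neg,
    SchwartzMap.fourier_coe, SchwartzMap.fourierInv_coe, Real.fourierInv_eq_fourier_neg]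

lemma toNegHalf_apply (b : L2 d) (χ : 𝓢(Hor d, ℂ)) : toNegHalf b χ = pair b (halfDeriv χ) := by
  rw [toNegHalf, besselPotential, fourierMultiplierCLM_apply_apply]
  have : (fun x : Hor d => (((1 + ‖x‖ ^ 2) ^ ((1 / 2 : ℝ) / 2) : ℝ) : ℂ))
    = fun ξ : Hor d => (jw (1 / 2) ξ : ℂ) := rfl
  rw [this, ← fourierMultiplier_jw_eq, Lp.toTemperedDistribution_apply, pair]
  refine integral_congr_ae ?_
  filter_upwards [SchwartzMap.coeFn_toLp (SchwartzMap.fourierMultiplierCLM ℂ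
    (fun ξ : Hor d => (jw (1 / 2) ξ : ℂ)) χ) 2 volume] with x hx
  rw [halfDeriv, hx, smul_eq_mul, mul_comm]

/-! ### The bilinear Riesz representation -/

/-- Complex conjugation on `L²`. -/
noncomputable def conjL2 (f : L2 d) : L2 d := MemLp.toLp _ (Lp.memLp f).star

lemma coeFn_conjL2 (f : L2 d) : conjL2 f =ᵐ[volume] fun x => (starRingEnd ℂ) (f x) :=
  MemLp.coeFn_toLp (Lp.memLp f).star

lemma norm_conjL2 (f : L2 d) : ‖conjL2 f‖ = ‖f‖ := by
  rw [Lp.norm_def, Lp.norm_def]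
  congr 1
  refine eLpNorm_congr_norm_ae ?_
  filter_upwards [coeFn_conjL2 f] with x hx
  rw [hx, RCLike.norm_conj]

lemma pair_conjL2 (y g : L2 d) : pair (conjL2 y) g = inner ℂ y g := by
  rw [L2.inner_def, pair]
  refine integral_congr_ae ?_
  filter_upwards [coeFn_conjL2 y] with x hx
  rw [hx, RCLike.inner_apply, mul_comm]

lemma conjL2_conjL2 (f : L2 d) : conjL2 (conjL2 f) = f := by
  refine Lp.ext ?_
  filter_upwards [coeFn_conjL2 (conjL2 f), coeFn_conjL2 f] with x h1 h2
  rw [h1, h2, RCLike.conj_conj]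

lemma pair_eq_inner (b g : L2 d) : pair b g = inner ℂ (conjL2 b) g := by
  rw [← pair_conjL2, conjL2_conjL2]

lemma norm_pair_le (b g : L2 d) : ‖pair b g‖ ≤ ‖b‖ * ‖g‖ := by
  rw [pair_eq_inner, ← norm_conjL2 b]
  exact norm_inner_le_norm _ _

lemma pair_comm (b g : L2 d) : pair b g = pair g b := by
  unfold pair; congr 1; ext x; ring

lemma pair_sub_right (b g g' : L2 d) : pair b (g - g') = pair b g - pair b g' := by
  simp only [pair_eq_inner, inner_sub_right]

lemma pair_sub_left (b b' g : L2 d) : pair (b - b') g = pair b g - pair b' g := by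
  rw [pair_comm, pair_sub_right, pair_comm, pair_comm g]

lemma pair_conjL2_self (b : L2 d) : pair b (conjL2 b) = ((‖b‖ ^ 2 : ℝ) : ℂ) := by
  rw [pair_eq_inner, inner_self_eq_norm_sq_to_K, norm_conjL2]
  norm_cast

lemma norm_le_of_pair_le {b : L2 d} {C : ℝ} (h : ∀ g, ‖pair b g‖ ≤ C * ‖g‖) : ‖b‖ ≤ C := by
  have h1 := h (conjL2 b)
  rw [pair_conjL2_self, norm_conjL2, Complex.norm_real, Real.norm_of_nonneg (sq_nonneg _)] at h1
  rcases (norm_nonneg b).eq_or_lt with h0 | h0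
  · have h2 := (norm_nonneg _).trans (h (indicatorConstLp 2 (measurableSet_ball (x := (0 : Hor d)) (ε := 1))
      measure_ball_lt_top.ne (1 : ℂ)))
    rw [← h0]
    by_contra hC
    push Not at hC
    have h3 : ‖indicatorConstLp 2 (measurableSet_ball (x := (0 : Hor d)) (ε := 1))
      (measure_ball_lt_top (μ := volume)).ne (1 : ℂ)‖ = 0 := by
      by_contra hne
      have := mul_neg_of_neg_of_pos hC (lt_of_le_of_ne (norm_nonneg _) (Ne.symm hne))
      linarith
    rw [norm_indicatorConstLp (by norm_num) (by norm_num)] at h3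
    have h4 : 0 < (volume : Measure (Hor d)).real (Metric.ball 0 1) :=
      ENNReal.toReal_pos (Metric.measure_ball_pos volume 0 one_pos).ne' measure_ball_lt_top.ne
    have h5 := Real.rpow_pos_of_pos h4 (1 / (2 : ℝ≥0∞).toReal)
    simp only [norm_one, one_mul] at h3
    exact h5.ne' h3
  · exact le_of_mul_le_mul_right (by nlinarith) h0

lemma exists_pair_eq (ℓ : L2 d →L[ℂ] ℂ) : ∃ b : L2 d, ∀ g, pair b g = ℓ g := by
  refine ⟨conjL2 ((InnerProductSpace.toDual ℂ (L2 d)).symm ℓ), fun g => ?_⟩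
  rw [pair_conjL2, InnerProductSpace.toDual_symm_apply]

/-- The transpose of an operator for the bilinear pairing. -/
lemma exists_transpose (T : L2 d →L[ℂ] L2 d) :
    ∃ T' : L2 d → L2 d, ∀ b g, pair (T' b) g = pair b (T g) := by
  have : ∀ b, ∃ b', ∀ g, pair b' g = pair b (T g) := by
    intro b
    obtain ⟨b', hb'⟩ := exists_pair_eq (((InnerProductSpace.toDual ℂ (L2 d)) (conjL2 b)).comp T)
    refine ⟨b', fun g => ?_⟩
    rw [hb', pair_eq_inner]
    rfl
  choose T' hT' using this
  exact ⟨T', hT'⟩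

/-! ### Fourier integrals and the Fourier transform on `L²` -/

lemma fourierInv_toLp_ae_eq {F : Hor d → ℂ} (h1 : Integrable F volume) (h2 : MemLp F 2 volume) :
    (𝓕⁻ (h2.toLp F) : L2 d) =ᵐ[volume] 𝓕⁻ F := by
  refine ae_eq_of_schwartz (L2.locallyIntegrable _) ?_ fun χ _ => ?_
  · have : Continuous (𝓕⁻ F) := by
      rw [Real.fourierInv_eq_fourier_comp_neg]
      exact VectorFourier.fourierIntegral_continuous Real.continuous_fourierChar
        continuous_inner h1.comp_neg
    exact this.locallyIntegrable
  · have e1 := Lp.toTemperedDistribution_apply (𝓕⁻ (h2.toLp F) : L2 d) χ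
    simp only [smul_eq_mul] at e1
    rw [← e1, ← Lp.fourierInv_toTemperedDistribution_eq, TemperedDistribution.fourierInv_apply,
      Lp.toTemperedDistribution_apply]
    have e2 : ∫ x, (𝓕⁻ χ : 𝓢(Hor d, ℂ)) x • (h2.toLp F) x = ∫ x, (𝓕⁻ (χ : Hor d → ℂ)) x • F x := by
      refine integral_congr_ae ?_
      filter_upwards [MemLp.coeFn_toLp h2] with x hx
      rw [hx, SchwartzMap.fourierInv_coe]
    rw [e2]
    have e3 := VectorFourier.integral_fourierIntegral_smul_eq_flip (μ := volume) (ν := volume)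
      (e := Real.fourierChar) (L := -innerₗ (Hor d)) (f := χ) (g := F) Real.continuous_fourierChar
      (continuous_inner (𝕜 := ℝ) (E := Hor d)).neg χ.integrable h1
    have e4 : (-innerₗ (Hor d)).flip = -innerₗ (Hor d) := by
      ext x y
      simp [real_inner_comm]
    rw [e4] at e3
    exact e3

end WaterWaves

namespace WaterWaves

variable {d : ℕ}

open scoped FourierTransform RealInnerProductSpace

/-! ### The lift of a function of `H^{1/2}` to the half-space -/

/-- A continuous profile bounded by `M` and supported in `[-R, R]`. -/
structure Profile (ρ : ℝ → ℝ) (M R : ℝ) : Prop where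
  cont : Continuous ρ
  bound : ∀ s, |ρ s| ≤ M
  supp : ∀ s, R < |s| → ρ s = 0

/-- The plane wave of frequency `ξ`, damped by the profile `ρ` at the scale `1 / ⟨ξ⟩`. -/
noncomputable def wave (ρ : ℝ → ℝ) (ξ : Hor d) (z : Hor d × ℝ) : ℂ :=
  (Real.fourierChar ⟪ξ, z.1⟫ : ℂ) * (ρ (z.2 * jw 1 ξ) : ℂ)

/-- The symbol of the superposition of damped waves at height `t`. -/
noncomputable def waveSymbol (ρ : ℝ → ℝ) (q : Hor d → ℂ) (t : ℝ) (ξ : Hor d) : ℂ :=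
  ((ρ (t * jw 1 ξ) * jw (1 / 2) ξ : ℝ) : ℂ) * q ξ

/-- The superposition of damped waves with amplitude `⟨ξ⟩^{1/2} q(ξ)`. -/
noncomputable def waveExt (ρ : ℝ → ℝ) (q : Hor d → ℂ) (z : Hor d × ℝ) : ℂ :=
  ∫ ξ, wave ρ ξ z * (jw (1 / 2) ξ * q ξ)

lemma waveExt_eq (ρ : ℝ → ℝ) (q : Hor d → ℂ) (x : Hor d) (t : ℝ) :
    waveExt ρ q (x, t) = 𝓕⁻ (waveSymbol ρ q t) x := by
  rw [waveExt, Real.fourierInv_eq]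
  congr 1; ext ξ
  simp only [wave, waveSymbol, Circle.smul_def, smul_eq_mul, Complex.ofReal_mul]
  ring

lemma norm_wave (ρ : ℝ → ℝ) (ξ : Hor d) (z : Hor d × ℝ) :
    ‖wave ρ ξ z‖ = |ρ (z.2 * jw 1 ξ)| := by
  rw [wave, norm_mul, Circle.norm_coe, one_mul, Complex.norm_real, Real.norm_eq_abs]

lemma norm_le_jw_one (ξ : Hor d) : ‖ξ‖ ≤ jw 1 ξ := by
  refine le_of_sq_le_sq ?_ (jw_pos _ _).le
  rw [sq (jw 1 ξ), ← jw_add, show (1 : ℝ) + 1 = 2 by norm_num, jw_two]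
  linarith

section

variable {ρ ρ' : ℝ → ℝ} {M R M' : ℝ} {q q' : Hor d → ℂ}

lemma Profile.nonneg (h : Profile ρ M R) : 0 ≤ M := (abs_nonneg _).trans (h.bound 0)

/-- The amplitudes at height `|t| ≥ τ` are dominated by this function. -/
noncomputable def waveBound (M R τ : ℝ) (q : Hor d → ℂ) (ξ : Hor d) : ℝ :=
  M * (R / τ) * (Metric.closedBall (0 : Hor d) (R / τ)).indicator (fun ξ => ‖q ξ‖) ξ

lemma norm_waveSymbol_le (h : Profile ρ M R) {τ t : ℝ} (hτ : 0 < τ) (ht : τ ≤ |t|) (ξ : Hor d) :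
    |ρ (t * jw 1 ξ)| * (jw (1 / 2) ξ * ‖q ξ‖) ≤ waveBound M R τ q ξ := by
  have hM := h.nonneg
  have hj := jw_pos 1 ξ
  by_cases hR : R < |t * jw 1 ξ|
  · rw [h.supp _ hR, abs_zero, zero_mul, waveBound]
    have : 0 ≤ R / τ ∨ R / τ < 0 := le_or_gt _ _
    rcases this with h0 | h0
    · have : 0 ≤ (Metric.closedBall (0 : Hor d) (R / τ)).indicator (fun ξ => ‖q ξ‖) ξ :=
        Set.indicator_nonneg (fun _ _ => norm_nonneg _) _
      positivity
    · rw [Metric.closedBall_eq_empty.2 h0]; simp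
  · push Not at hR
    rw [abs_mul, abs_of_pos hj] at hR
    have h1 : jw 1 ξ ≤ R / τ := by
      rw [le_div_iff₀ hτ]
      nlinarith
    have h2 : jw (1 / 2) ξ ≤ R / τ := (jw_mono (by norm_num) ξ).trans h1
    have h3 : ξ ∈ Metric.closedBall (0 : Hor d) (R / τ) := by
      rw [mem_closedBall_zero_iff]; exact (norm_le_jw_one ξ).trans h1
    rw [waveBound, Set.indicator_of_mem h3, mul_assoc]
    have h4 := jw_pos (1 / 2) ξ
    gcongr
    exact h.bound _

lemma memLp_waveBound (hq : MemLp q 2 volume) (M R τ : ℝ) :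
    MemLp (waveBound M R τ q) 2 volume :=
  (hq.norm.indicator measurableSet_closedBall).const_mul _

lemma integrable_waveBound (hq : MemLp q 2 volume) (M R τ : ℝ) :
    Integrable (waveBound M R τ q) volume := by
  refine Integrable.const_mul ?_ _
  rw [integrable_indicator_iff measurableSet_closedBall]
  have : IsFiniteMeasure (volume.restrict (Metric.closedBall (0 : Hor d) (R / τ))) :=
    ⟨by rw [Measure.restrict_apply_univ]; exact measure_closedBall_lt_top⟩
  exact ((hq.norm.restrict _).mono_exponent (p := 1) (by norm_num)).integrable le_rfl

lemma continuous_wave (hρ : Continuous ρ) :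
    Continuous fun w : (Hor d × ℝ) × Hor d => wave ρ w.2 w.1 := by
  unfold wave
  refine Continuous.mul ?_ (Complex.continuous_ofReal.comp (hρ.comp ?_))
  · exact continuous_subtype_val.comp (Real.continuous_fourierChar.comp
      (by fun_prop))
  · exact (continuous_snd.comp continuous_fst).mul ((continuous_jw 1).comp continuous_snd)

lemma stronglyMeasurable_waveExt (hρ : Continuous ρ) (hq : StronglyMeasurable q) :
    StronglyMeasurable (waveExt ρ q) := by
  have : StronglyMeasurable fun w : (Hor d × ℝ) × Hor d =>
      wave ρ w.2 w.1 * (jw (1 / 2) w.2 * q w.2) :=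
    (continuous_wave hρ).stronglyMeasurable.mul
      (((Complex.continuous_ofReal.comp (continuous_jw _)).stronglyMeasurable.mul hq).comp_measurable
        measurable_snd)
  exact this.integral_prod_right

lemma stronglyMeasurable_waveSymbol (hρ : Continuous ρ) (hq : StronglyMeasurable q) (t : ℝ) :
    StronglyMeasurable (waveSymbol ρ q t) := by
  have : Continuous fun ξ : Hor d => ((ρ (t * jw 1 ξ) * jw (1 / 2) ξ : ℝ) : ℂ) :=
    Complex.continuous_ofReal.comp ((hρ.comp ((continuous_jw 1).const_mul _)).mul (continuous_jw _))
  exact this.stronglyMeasurable.mul hq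

lemma norm_waveSymbol (t : ℝ) (ξ : Hor d) :
    ‖waveSymbol ρ q t ξ‖ = |ρ (t * jw 1 ξ)| * (jw (1 / 2) ξ * ‖q ξ‖) := by
  rw [waveSymbol, norm_mul, Complex.norm_real, norm_mul, Real.norm_eq_abs, Real.norm_eq_abs,
    abs_of_pos (jw_pos _ _), mul_assoc]

lemma memLp_waveSymbol (h : Profile ρ M R) (hqm : StronglyMeasurable q) (hq : MemLp q 2 volume)
    {t : ℝ} (ht : t ≠ 0) : MemLp (waveSymbol ρ q t) 2 volume := by
  refine (memLp_waveBound hq M R |t|).mono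
    (stronglyMeasurable_waveSymbol h.cont hqm t).aestronglyMeasurable (ae_of_all _ fun ξ => ?_)
  rw [norm_waveSymbol]
  exact (norm_waveSymbol_le h (abs_pos.2 ht) le_rfl ξ).trans (le_abs_self _)

lemma integrable_waveSymbol (h : Profile ρ M R) (hqm : StronglyMeasurable q)
    (hq : MemLp q 2 volume) {t : ℝ} (ht : t ≠ 0) : Integrable (waveSymbol ρ q t) volume := by
  refine (integrable_waveBound hq M R |t|).mono'
    (stronglyMeasurable_waveSymbol h.cont hqm t).aestronglyMeasurable (ae_of_all _ fun ξ => ?_)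
  rw [norm_waveSymbol]
  exact norm_waveSymbol_le h (abs_pos.2 ht) le_rfl ξ

lemma Lp_enorm_sq (f : L2 d) : ‖f‖ₑ ^ 2 = ∫⁻ x, ‖f x‖ₑ ^ 2 := by
  rw [Lp.enorm_def, eLpNorm_two_sq]

lemma Lp.norm_fourierInv_eq' (f : L2 d) : ‖(𝓕⁻ f : L2 d)‖ = ‖f‖ :=
  (Lp.fourierTransformₗᵢ (Hor d) ℂ).symm.norm_map f

lemma lintegral_sub_waveExt (h : Profile ρ M R) (hqm : StronglyMeasurable q)
    (hq : MemLp q 2 volume) {t : ℝ} (ht : t ≠ 0) (f : L2 d) :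
    ∫⁻ x, ‖waveExt ρ q (x, t) - f x‖ₑ ^ 2
      = ∫⁻ ξ, ‖waveSymbol ρ q t ξ - (𝓕 f : L2 d) ξ‖ₑ ^ 2 := by
  have h1 := integrable_waveSymbol h hqm hq ht
  have h2 := memLp_waveSymbol h hqm hq ht
  have e1 : ∫⁻ x, ‖waveExt ρ q (x, t) - f x‖ₑ ^ 2
      = ‖(𝓕⁻ (h2.toLp _) : L2 d) - f‖ₑ ^ 2 := by
    rw [Lp_enorm_sq]
    refine lintegral_congr_ae ?_
    filter_upwards [fourierInv_toLp_ae_eq h1 h2, Lp.coeFn_sub (𝓕⁻ (h2.toLp _) : L2 d) f]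
      with x hx hx'
    rw [hx', Pi.sub_apply, hx, waveExt_eq]
  have e2 : ∫⁻ ξ, ‖waveSymbol ρ q t ξ - (𝓕 f : L2 d) ξ‖ₑ ^ 2
      = ‖h2.toLp _ - (𝓕 f : L2 d)‖ₑ ^ 2 := by
    rw [Lp_enorm_sq]
    refine lintegral_congr_ae ?_
    filter_upwards [MemLp.coeFn_toLp h2, Lp.coeFn_sub (h2.toLp _) (𝓕 f : L2 d)] with x hx hx'
    rw [hx', Pi.sub_apply, hx]
  have e3 : ‖(𝓕⁻ (h2.toLp _) : L2 d) - f‖ = ‖h2.toLp _ - (𝓕 f : L2 d)‖ := by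
    rw [← Lp.norm_fourier_eq]
    congr 1
    have : (𝓕 ((𝓕⁻ (h2.toLp _) : L2 d) - f) : L2 d) = 𝓕 (𝓕⁻ (h2.toLp _) : L2 d) - 𝓕 f :=
      map_sub (Lp.fourierTransformₗᵢ (Hor d) ℂ) _ _
    rw [this, FourierTransform.fourier_fourierInv_eq]
  rw [e1, e2, ← ofReal_norm, e3, ofReal_norm]

lemma lintegral_waveExt (h : Profile ρ M R) (hqm : StronglyMeasurable q)
    (hq : MemLp q 2 volume) {t : ℝ} (ht : t ≠ 0) :
    ∫⁻ x, ‖waveExt ρ q (x, t)‖ₑ ^ 2 = ∫⁻ ξ, ‖waveSymbol ρ q t ξ‖ₑ ^ 2 := by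
  have h1 := integrable_waveSymbol h hqm hq ht
  have h2 := memLp_waveSymbol h hqm hq ht
  have e1 : ∫⁻ x, ‖waveExt ρ q (x, t)‖ₑ ^ 2 = ‖(𝓕⁻ (h2.toLp _) : L2 d)‖ₑ ^ 2 := by
    rw [Lp_enorm_sq]
    refine lintegral_congr_ae ?_
    filter_upwards [fourierInv_toLp_ae_eq h1 h2] with x hx
    rw [hx, waveExt_eq]
  have e2 : ∫⁻ ξ, ‖waveSymbol ρ q t ξ‖ₑ ^ 2 = ‖h2.toLp _‖ₑ ^ 2 := by
    rw [Lp_enorm_sq]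
    refine lintegral_congr_ae ?_
    filter_upwards [MemLp.coeFn_toLp h2] with x hx
    rw [hx]
  rw [e1, e2, ← ofReal_norm, Lp.norm_fourierInv_eq', ofReal_norm]

/-- The open lower half-space. -/
def lowerHalf (d : ℕ) : Set (Hor d × ℝ) := {z | z.2 < 0}

lemma isOpen_lowerHalf : IsOpen (lowerHalf d) := isOpen_lt continuous_snd continuous_const

lemma setLIntegral_snd_eq {s : Set ℝ} {f : Hor d × ℝ → ℝ≥0∞}
    (hf : Measurable f) : ∫⁻ z in {z : Hor d × ℝ | z.2 ∈ s}, f z = ∫⁻ t in s, ∫⁻ x, f (x, t) := by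
  have : {z : Hor d × ℝ | z.2 ∈ s} = Set.univ ×ˢ s := by ext; simp
  rw [this, Measure.volume_eq_prod, ← Measure.prod_restrict, Measure.restrict_univ,
    lintegral_prod_symm _ hf.aemeasurable]

lemma lintegral_waveExt_le (h : Profile ρ M R) (hqm : StronglyMeasurable q)
    (hq : MemLp q 2 volume) :
    ∫⁻ z in lowerHalf d, ‖waveExt ρ q z‖ₑ ^ 2
      ≤ ENNReal.ofReal (M ^ 2 * R) * ∫⁻ ξ, ‖q ξ‖ₑ ^ 2 := by
  have hm : Measurable fun z => ‖waveExt ρ q z‖ₑ ^ 2 :=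
    (stronglyMeasurable_waveExt h.cont hqm).enorm.pow_const 2
  rw [show lowerHalf d = {z : Hor d × ℝ | z.2 ∈ Set.Iio 0} from rfl, setLIntegral_snd_eq hm]
  have e1 : ∫⁻ t in Set.Iio (0 : ℝ), ∫⁻ x, ‖waveExt ρ q (x, t)‖ₑ ^ 2
      = ∫⁻ t in Set.Iio (0 : ℝ), ∫⁻ ξ, ‖waveSymbol ρ q t ξ‖ₑ ^ 2 :=
    setLIntegral_congr_fun measurableSet_Iio fun t ht => lintegral_waveExt h hqm hq (ne_of_lt ht)
  have hm2 : Measurable fun w : ℝ × Hor d => ‖waveSymbol ρ q w.1 w.2‖ₑ ^ 2 := by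
    have hc : Continuous fun w : ℝ × Hor d => ((ρ (w.1 * jw 1 w.2) * jw (1 / 2) w.2 : ℝ) : ℂ) :=
      Complex.continuous_ofReal.comp ((h.cont.comp (continuous_fst.mul
        ((continuous_jw 1).comp continuous_snd))).mul ((continuous_jw _).comp continuous_snd))
    exact (hc.stronglyMeasurable.mul (hqm.comp_measurable measurable_snd)).enorm.pow_const 2
  rw [e1, lintegral_lintegral_swap hm2.aemeasurable, ← lintegral_const_mul' _ _ ENNReal.ofReal_ne_top]
  refine lintegral_mono fun ξ => ?_
  have hj := jw_pos 1 ξ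
  calc ∫⁻ t in Set.Iio (0 : ℝ), ‖waveSymbol ρ q t ξ‖ₑ ^ 2
      ≤ ∫⁻ t in Set.Iio (0 : ℝ), (Set.Icc (-(R / jw 1 ξ)) 0).indicator
          (fun _ => ENNReal.ofReal (M ^ 2 * jw 1 ξ) * ‖q ξ‖ₑ ^ 2) t := by
        refine setLIntegral_mono' measurableSet_Iio fun t ht => ?_
        by_cases htR : R < |t * jw 1 ξ|
        · have : waveSymbol ρ q t ξ = 0 := by rw [waveSymbol, h.supp _ htR]; simp
          simp [this]
        · push Not at htR
          rw [abs_mul, abs_of_pos hj, abs_of_neg ht] at htR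
          have : t ∈ Set.Icc (-(R / jw 1 ξ)) 0 := by
            refine ⟨?_, le_of_lt ht⟩
            rw [neg_le, le_div_iff₀ hj]
            exact htR
          rw [Set.indicator_of_mem this, ← ofReal_norm, ← ofReal_norm,
            ← ENNReal.ofReal_pow (norm_nonneg _), ← ENNReal.ofReal_pow (norm_nonneg _),
            ← ENNReal.ofReal_mul (by positivity), norm_waveSymbol]
          refine ENNReal.ofReal_le_ofReal ?_
          have e : jw 1 ξ = jw (1 / 2) ξ ^ 2 := by
            rw [sq, ← jw_add]; norm_num
          rw [mul_pow, mul_pow, e, mul_assoc]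
          gcongr
          exact h.bound _
    _ ≤ ∫⁻ t, (Set.Icc (-(R / jw 1 ξ)) 0).indicator
          (fun _ => ENNReal.ofReal (M ^ 2 * jw 1 ξ) * ‖q ξ‖ₑ ^ 2) t := setLIntegral_le_lintegral _ _
    _ = ENNReal.ofReal (M ^ 2 * R) * ‖q ξ‖ₑ ^ 2 := by
        rw [lintegral_indicator_const measurableSet_Icc, Real.volume_Icc, mul_right_comm,
          ← ENNReal.ofReal_mul (by positivity)]
        congr 2
        field_simp
        ring

lemma memLp_waveExt (h : Profile ρ M R) (hqm : StronglyMeasurable q)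
    (hq : MemLp q 2 volume) : MemLp (waveExt ρ q) 2 (volume.restrict (lowerHalf d)) :=
  memLp_two_iff.2 ⟨(stronglyMeasurable_waveExt h.cont hqm).aestronglyMeasurable,
    (lintegral_waveExt_le h hqm hq).trans_lt
      (ENNReal.mul_lt_top ENNReal.ofReal_lt_top (memLp_two_iff.1 hq).2)⟩

lemma integrable_mul_wave (h : Profile ρ M R) (hqm : StronglyMeasurable q)
    (hq : MemLp q 2 volume) {χ : Hor d × ℝ → ℝ} (hχ : Continuous χ) (hχc : HasCompactSupport χ)
    (hχs : tsupport χ ⊆ lowerHalf d) :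
    Integrable (fun w : (Hor d × ℝ) × Hor d =>
      (χ w.1 : ℂ) * (wave ρ w.2 w.1 * (jw (1 / 2) w.2 * q w.2))) (volume.prod volume) := by
  obtain ⟨τ, hτ, hτ'⟩ : ∃ τ : ℝ, 0 < τ ∧ ∀ z ∈ tsupport χ, τ ≤ -z.2 :=
    hχc.isCompact.exists_forall_le' (f := fun z : Hor d × ℝ => -z.2) (by fun_prop)
      fun z hz => by have := hχs hz; simp only [lowerHalf, Set.mem_ofPred_eq] at this; linarith
  have hi := (hχ.integrable_of_hasCompactSupport (μ := volume) hχc).norm.mul_prod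
    (integrable_waveBound (M := M) (R := R) (τ := τ) hq)
  refine hi.mono' ?_ (ae_of_all _ fun w => ?_)
  · exact ((Complex.continuous_ofReal.comp (hχ.comp continuous_fst)).stronglyMeasurable.mul
      ((continuous_wave h.cont).stronglyMeasurable.mul
      (((Complex.continuous_ofReal.comp (continuous_jw _)).stronglyMeasurable.mul hqm).comp_measurable
        measurable_snd))).aestronglyMeasurable
  · by_cases hw : w.1 ∈ tsupport χ
    · rw [norm_mul, norm_mul, norm_mul, norm_wave, Complex.norm_real, Complex.norm_real,
        Real.norm_of_nonneg (jw_pos _ _).le]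
      gcongr
      refine norm_waveSymbol_le h hτ ?_ w.2
      rw [← abs_neg]
      exact (hτ' _ hw).trans (le_abs_self _)
    · rw [image_eq_zero_of_notMem_tsupport hw]; simp

lemma hasWeakDeriv_waveExt (h : Profile ρ M R) (h' : Profile ρ' M' R)
    (hqm : StronglyMeasurable q) (hqm' : StronglyMeasurable q')
    (hq : MemLp q 2 volume) (hq' : MemLp q' 2 volume) {v : Hor d × ℝ}
    (hd : ∀ ξ : Hor d, ContDiff ℝ 1 (wave ρ ξ))
    (hv : ∀ (ξ : Hor d) z, fderiv ℝ (wave ρ ξ) z v * q ξ = wave ρ' ξ z * q' ξ) :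
    HasWeakDeriv (lowerHalf d) (waveExt ρ q) v (waveExt ρ' q') := by
  have hloc : ∀ {ρ : ℝ → ℝ} {M : ℝ} {q : Hor d → ℂ}, Profile ρ M R → StronglyMeasurable q →
      MemLp q 2 volume → LocallyIntegrableOn (waveExt ρ q) (lowerHalf d) volume :=
    fun h hqm hq => locallyIntegrableOn_of_locallyIntegrable_restrict
      ((memLp_waveExt h hqm hq).locallyIntegrable (by norm_num))
  refine hasWeakDeriv_iff.2 ⟨hloc h hqm hq, hloc h' hqm' hq', fun χ h1 h2 h3 => ?_⟩
  have hχ1 : Continuous fun z => fderiv ℝ χ z v :=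
    (h1.continuous_fderiv (by simp)).clm_apply continuous_const
  have hχ2 : HasCompactSupport fun z => fderiv ℝ χ z v := h2.fderiv_apply (𝕜 := ℝ) v
  have i1 := integrable_mul_wave h hqm hq hχ1 hχ2
    ((tsupport_fderiv_apply_subset ℝ v).trans h3)
  have i2 := integrable_mul_wave h' hqm' hq' h1.continuous h2 h3
  simp only [waveExt]
  simp only [← integral_const_mul]
  have s1 := integral_integral_swap (f := fun z ξ => (fderiv ℝ χ z v : ℂ) *
    (wave ρ ξ z * (jw (1 / 2) ξ * q ξ))) i1
  have s2 := integral_integral_swap (f := fun z ξ => (χ z : ℂ) *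
    (wave ρ' ξ z * (jw (1 / 2) ξ * q' ξ))) i2
  rw [s1, s2, ← integral_neg]
  congr 1; ext ξ
  have hdd : ∀ z, DifferentiableAt ℝ (fun z => (χ z : ℂ)) z := fun z =>
    Complex.ofRealCLM.differentiableAt.comp z (h1.differentiable (by simp) z)
  have hfd : ∀ z, fderiv ℝ (fun z => (χ z : ℂ)) z v = (fderiv ℝ χ z v : ℂ) := fun z => by
    have := (Complex.ofRealCLM.hasFDerivAt.comp z (h1.differentiable (by simp) z).hasFDerivAt)
    exact congrArg (fun L => L v) this.fderiv
  have hcc : HasCompactSupport fun z => (χ z : ℂ) := h2.comp_left (g := fun r : ℝ => (r : ℂ)) (by simp)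
  have hwc : Continuous fun z => fderiv ℝ (wave ρ ξ) z v :=
    ((hd ξ).continuous_fderiv one_ne_zero).clm_apply continuous_const
  have hcχ : Continuous fun z => (χ z : ℂ) := Complex.continuous_ofReal.comp h1.continuous
  have key := integral_mul_fderiv_eq_neg_fderiv_mul_of_integrable (𝕜 := ℂ)
    (μ := (volume : Measure (Hor d × ℝ))) (f := fun z => (χ z : ℂ)) (g := wave ρ ξ) (v := v)
    (by
      simp only [hfd]
      refine Continuous.integrable_of_hasCompactSupport ?_ ?_
      · exact (Complex.continuous_ofReal.comp hχ1).mul (hd ξ).continuous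
      · exact (hχ2.comp_left (g := fun r : ℝ => (r : ℂ)) (by simp)).mul_right)
    (Continuous.integrable_of_hasCompactSupport (hcχ.mul hwc) hcc.mul_right)
    (Continuous.integrable_of_hasCompactSupport (hcχ.mul (hd ξ).continuous) hcc.mul_right)
    (fun z _ => hdd z) (fun z _ => (hd ξ).differentiable one_ne_zero z)
  simp only [hfd] at key
  have e1 : ∫ z, (fderiv ℝ χ z v : ℂ) * (wave ρ ξ z * (jw (1 / 2) ξ * q ξ))
      = (∫ z, (fderiv ℝ χ z v : ℂ) * wave ρ ξ z) * (jw (1 / 2) ξ * q ξ) := by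
    rw [← integral_mul_const]; congr 1; ext z; ring
  have e2 : ∫ z, (χ z : ℂ) * (wave ρ' ξ z * (jw (1 / 2) ξ * q' ξ))
      = (∫ z, (χ z : ℂ) * fderiv ℝ (wave ρ ξ) z v) * (jw (1 / 2) ξ * q ξ) := by
    rw [← integral_mul_const]; congr 1; ext z
    linear_combination (-(χ z : ℂ) * jw (1 / 2) ξ) * hv ξ z
  rw [e1, e2, key]
  ring

end

end WaterWaves

namespace WaterWaves

variable {d : ℕ}

open scoped FourierTransform RealInnerProductSpace

lemma wave_apply (ρ : ℝ → ℝ) (ξ : Hor d) (z : Hor d × ℝ) :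
    wave ρ ξ z = Complex.exp (((2 * Real.pi * ⟪ξ, z.1⟫ : ℝ) : ℂ) * Complex.I)
      * (ρ (z.2 * jw 1 ξ) : ℂ) := by
  rw [wave, Real.fourierChar_apply]

lemma contDiff_wave {ρ : ℝ → ℝ} (hρ : ContDiff ℝ 1 ρ) (ξ : Hor d) : ContDiff ℝ 1 (wave ρ ξ) := by
  have : wave ρ ξ = fun z => Complex.exp (((2 * Real.pi * ⟪ξ, z.1⟫ : ℝ) : ℂ) * Complex.I)
      * (ρ (z.2 * jw 1 ξ) : ℂ) := funext (wave_apply ρ ξ)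
  rw [this]
  refine ContDiff.mul (ContDiff.cexp (ContDiff.mul (Complex.ofRealCLM.contDiff.comp ?_)
    contDiff_const)) (Complex.ofRealCLM.contDiff.comp (hρ.comp (contDiff_snd.mul contDiff_const)))
  exact contDiff_const.mul (contDiff_const.inner ℝ contDiff_fst)

lemma fderiv_wave_horizontal {ρ : ℝ → ℝ} (hρ : ContDiff ℝ 1 ρ) (ξ : Hor d) (z : Hor d × ℝ)
    (i : Fin d) :
    fderiv ℝ (wave ρ ξ) z (basisVec i, 0) = wave ρ ξ z * (2 * Real.pi * ξ i * Complex.I) := by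
  rw [← ((contDiff_wave hρ ξ).differentiable one_ne_zero z).lineDeriv_eq_fderiv, lineDeriv]
  have hi : ⟪ξ, basisVec i⟫ = ξ i := by
    rw [basisVec, EuclideanSpace.inner_single_right]; simp
  have e : (fun t : ℝ => wave ρ ξ (z + t • (basisVec i, (0 : ℝ)))) = fun t : ℝ =>
      Complex.exp (((2 * Real.pi * (⟪ξ, z.1⟫ + t * ξ i) : ℝ) : ℂ) * Complex.I)
        * (ρ (z.2 * jw 1 ξ) : ℂ) := by
    funext t
    rw [wave_apply]
    simp [inner_add_right, inner_smul_right, hi]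
  rw [e]
  have h1 : HasDerivAt (fun t : ℝ => 2 * Real.pi * (⟪ξ, z.1⟫ + t * ξ i)) (2 * Real.pi * ξ i) 0 := by
    simpa using (((hasDerivAt_id (0 : ℝ)).mul_const (ξ i)).const_add ⟪ξ, z.1⟫).const_mul
      (2 * Real.pi)
  have h2 := ((h1.ofReal_comp.mul_const Complex.I).cexp).mul_const (ρ (z.2 * jw 1 ξ) : ℂ)
  rw [h2.deriv, wave_apply]
  simp only [zero_mul, add_zero]
  push_cast
  ring

lemma fderiv_wave_vertical {ρ : ℝ → ℝ} (hρ : ContDiff ℝ 1 ρ) (ξ : Hor d) (z : Hor d × ℝ) :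
    fderiv ℝ (wave ρ ξ) z (0, 1) = wave (deriv ρ) ξ z * jw 1 ξ := by
  rw [← ((contDiff_wave hρ ξ).differentiable one_ne_zero z).lineDeriv_eq_fderiv, lineDeriv]
  have e : (fun t : ℝ => wave ρ ξ (z + t • ((0 : Hor d), (1 : ℝ)))) = fun t : ℝ =>
      (Real.fourierChar ⟪ξ, z.1⟫ : ℂ) * (ρ ((z.2 + t) * jw 1 ξ) : ℂ) := by
    funext t
    simp [wave]
  rw [e]
  have h1 : HasDerivAt (fun t : ℝ => (z.2 + t) * jw 1 ξ) (jw 1 ξ) 0 := by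
    simpa using ((hasDerivAt_id (0 : ℝ)).const_add z.2).mul_const (jw 1 ξ)
  have h2 : HasDerivAt ρ (deriv ρ ((z.2 + 0) * jw 1 ξ)) ((z.2 + 0) * jw 1 ξ) :=
    (hρ.differentiable one_ne_zero _).hasDerivAt
  have h3 := ((h2.comp (0 : ℝ) h1).ofReal_comp).const_mul (Real.fourierChar ⟪ξ, z.1⟫ : ℂ)
  have h4 : deriv (fun t : ℝ => (Real.fourierChar ⟪ξ, z.1⟫ : ℂ) * (ρ ((z.2 + t) * jw 1 ξ) : ℂ)) 0
      = _ := h3.deriv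
  rw [h4, wave]
  simp only [add_zero]
  push_cast
  ring

/-- The profile of the lift. -/
noncomputable def liftBump : ContDiffBump (0 : ℝ) := ⟨1, 2, one_pos, one_lt_two⟩

lemma profile_liftBump : Profile liftBump 1 2 where
  cont := liftBump.continuous
  bound s := by rw [abs_of_nonneg liftBump.nonneg]; exact liftBump.le_one
  supp s hs := liftBump.zero_of_le_dist (by rw [dist_zero_right, Real.norm_eq_abs]; exact hs.le)

lemma liftBump_zero : liftBump (0 : ℝ) = 1 := liftBump.one_of_mem_closedBall (by
  simp [liftBump])

lemma contDiff_liftBump : ContDiff ℝ 1 liftBump := liftBump.contDiff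

lemma exists_profile_deriv : ∃ M, Profile (deriv liftBump) M 2 := by
  have hc : Continuous (deriv liftBump) := contDiff_liftBump.continuous_deriv le_rfl
  have hs : HasCompactSupport (deriv liftBump) := liftBump.hasCompactSupport.deriv
  obtain ⟨M, hM⟩ := hc.bounded_above_of_compact_support hs
  refine ⟨M, hc, hM, fun s hs' => ?_⟩
  have : s ∉ tsupport (liftBump : ℝ → ℝ) := by
    rw [liftBump.tsupport_eq, mem_closedBall_zero_iff, Real.norm_eq_abs, not_le]
    exact hs'
  by_contra h
  exact this (support_deriv_subset h)

lemma l2norm_waveExt_le {ρ : ℝ → ℝ} {M R : ℝ} {q : Hor d → ℂ} (h : Profile ρ M R) (hR : 0 ≤ R)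
    (hqm : StronglyMeasurable q) {g : L2 d} (hq : MemLp q 2 volume) {c : ℝ} (hc : 0 ≤ c)
    (hqg : ∀ ξ, ‖q ξ‖ ≤ c * ‖(𝓕 g : L2 d) ξ‖) :
    l2norm (volume.restrict (lowerHalf d)) (waveExt ρ q) ≤ M * √R * c * ‖g‖ := by
  have hM := h.nonneg
  have h1 := lintegral_waveExt_le h hqm hq
  have h2 : ∫⁻ ξ, ‖q ξ‖ₑ ^ 2 ≤ ENNReal.ofReal (c * ‖g‖) ^ 2 := by
    rw [← eLpNorm_two_le_iff]
    have h3 := eLpNorm_le_mul_eLpNorm_of_ae_le_mul (ae_of_all _ hqg) 2 (μ := volume)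
    refine h3.trans_eq ?_
    rw [ENNReal.ofReal_mul hc, ← Lp.norm_fourier_eq, ofReal_norm, Lp.enorm_def]
  have h4 : eLpNorm (waveExt ρ q) 2 (volume.restrict (lowerHalf d))
      ≤ ENNReal.ofReal (M * √R * c * ‖g‖) := by
    rw [eLpNorm_two_le_iff]
    refine h1.trans ((mul_le_mul_right h2 _).trans_eq ?_)
    rw [← ENNReal.ofReal_pow (by positivity), ← ENNReal.ofReal_pow (by positivity),
      ← ENNReal.ofReal_mul (by positivity)]
    congr 1
    linear_combination (-(M ^ 2 * c ^ 2 * ‖g‖ ^ 2)) * Real.sq_sqrt hR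
  exact ENNReal.toReal_le_of_le_ofReal (by positivity) h4

/-- Continuity at the boundary of the superposition of waves with amplitude `⟨ξ⟩^{1/2} q(ξ)`. -/
lemma hasTrace_waveExt {ρ : ℝ → ℝ} {M R : ℝ} {q : Hor d → ℂ} (h : Profile ρ M R)
    (h0 : ρ 0 = 1) (hqm : StronglyMeasurable q) (hq : MemLp q 2 volume) {f : L2 d}
    (hf : ∀ᵐ ξ, (jw (1 / 2) ξ : ℂ) * q ξ = (𝓕 f : L2 d) ξ) :
    HasTrace (fun _ => 0) (waveExt ρ q) f := by
  have hQ : StronglyMeasurable (𝓕 f : L2 d) := Lp.stronglyMeasurable _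
  have hlim : Tendsto (fun t : ℝ => ∫⁻ ξ, ‖waveSymbol ρ q t ξ - (𝓕 f : L2 d) ξ‖ₑ ^ 2)
      (𝓝[<] 0) (𝓝 0) := by
    have hpt : ∀ᵐ ξ : Hor d, ∀ t, ‖waveSymbol ρ q t ξ - (𝓕 f : L2 d) ξ‖ₑ ^ 2
        = ENNReal.ofReal (|ρ (t * jw 1 ξ) - 1| ^ 2) * ‖(𝓕 f : L2 d) ξ‖ₑ ^ 2 := by
      filter_upwards [hf] with ξ hξ t
      rw [waveSymbol, Complex.ofReal_mul, mul_assoc, hξ, ← sub_one_mul, enorm_mul, mul_pow,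
        ← Complex.ofReal_one, ← Complex.ofReal_sub, ← ofReal_norm, Complex.norm_real,
        Real.norm_eq_abs, ENNReal.ofReal_pow (abs_nonneg _)]
    have hdom := tendsto_lintegral_filter_of_dominated_convergence (μ := volume) (l := 𝓝[<] (0 : ℝ))
      (F := fun t ξ => ‖waveSymbol ρ q t ξ - (𝓕 f : L2 d) ξ‖ₑ ^ 2) (f := fun _ => 0)
      (fun ξ => ENNReal.ofReal ((M + 1) ^ 2) * ‖(𝓕 f : L2 d) ξ‖ₑ ^ 2)
      (Eventually.of_forall fun t =>
        ((stronglyMeasurable_waveSymbol h.cont hqm t).sub hQ).enorm.pow_const 2)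
      (Eventually.of_forall fun t => by
        filter_upwards [hpt] with ξ hξ
        rw [hξ]
        gcongr
        exact (abs_sub _ _).trans (add_le_add (h.bound _) (by simp)))
      (by
        rw [lintegral_const_mul' _ _ ENNReal.ofReal_ne_top, ← Lp_enorm_sq]
        exact ENNReal.mul_ne_top ENNReal.ofReal_ne_top (by simp))
      (by
        filter_upwards [hpt] with ξ hξ
        simp only [hξ]
        have hc : Continuous fun t : ℝ => |ρ (t * jw 1 ξ) - 1| ^ 2 :=
          ((h.cont.comp (continuous_id.mul continuous_const)).sub continuous_const).abs.pow 2
        have h1 := (ENNReal.continuous_ofReal.comp hc).tendsto 0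
        have h2 := ENNReal.Tendsto.mul_const (b := ‖(𝓕 f : L2 d) ξ‖ₑ ^ 2) h1 (Or.inr (by simp))
        have h3 : Tendsto _ (𝓝[<] (0 : ℝ)) _ := h2.mono_left nhdsWithin_le_nhds
        simpa [h0] using h3)
    simpa using hdom
  rw [HasTrace, ENNReal.tendsto_nhds_zero]
  intro c hc
  obtain ⟨δ, hδ, hδ'⟩ : ∃ δ > (0 : ℝ), ∀ t ∈ Set.Ioo (-δ) 0,
      ∫⁻ ξ, ‖waveSymbol ρ q t ξ - (𝓕 f : L2 d) ξ‖ₑ ^ 2 ≤ c := by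
    have h1 := ENNReal.tendsto_nhds_zero.1 hlim c hc
    obtain ⟨l, hl, hl'⟩ := (mem_nhdsLT_iff_exists_Ioo_subset).1 h1
    exact ⟨-l, by simpa using hl, fun t ht => hl' (by simpa using ht)⟩
  filter_upwards [Ioo_mem_nhdsGT hδ] with ε hε
  have hm : Measurable fun z : Hor d × ℝ => ‖waveExt ρ q z - f z.1‖ₑ ^ 2 :=
    ((stronglyMeasurable_waveExt h.cont hqm).sub
      ((Lp.stronglyMeasurable f).comp_measurable measurable_fst)).enorm.pow_const 2
  have e1 : stripBelow (fun _ : Hor d => (0 : ℝ)) ε = {z | z.2 ∈ Set.Ioo (-ε) 0} := by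
    ext z; simp [stripBelow]
  rw [e1, setLIntegral_snd_eq hm]
  refine ENNReal.div_le_of_le_mul ?_
  calc ∫⁻ t in Set.Ioo (-ε) 0, ∫⁻ x, ‖waveExt ρ q (x, t) - f x‖ₑ ^ 2
      ≤ ∫⁻ t in Set.Ioo (-ε) 0, c := by
        refine setLIntegral_mono' measurableSet_Ioo fun t ht => ?_
        rw [lintegral_sub_waveExt h hqm hq ht.2.ne]
        exact hδ' t ⟨by linarith [ht.1, hε.2], ht.2⟩
    _ = c * ENNReal.ofReal ε := by simp

/-- Every function of `H^{1/2}` is the trace of a function of finite energy on the half-space. -/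
lemma exists_lift_lowerHalf (d : ℕ) : ∃ C : ℝ, 0 ≤ C ∧ ∀ g : L2 d, ∃ e E,
    HasFiniteEnergyGrad (lowerHalf d) e E ∧ HasTrace (fun _ => 0) e (toHalf g) ∧
      l2norm (volume.restrict (lowerHalf d)) E ≤ C * ‖g‖ := by
  obtain ⟨M, hM⟩ := exists_profile_deriv
  have hM0 := hM.nonneg
  refine ⟨d * (1 * √2 * (2 * Real.pi)) + M * √2 * 1, by positivity, fun g => ?_⟩
  set Q : Hor d → ℂ := ⇑(𝓕 g : L2 d) with hQdef
  have hQ : StronglyMeasurable Q := Lp.stronglyMeasurable _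
  have hQ2 : MemLp Q 2 volume := Lp.memLp _
  have hcj : ∀ s, StronglyMeasurable fun ξ : Hor d => (jw s ξ : ℂ) := fun s =>
    (Complex.continuous_ofReal.comp (continuous_jw s)).stronglyMeasurable
  have hnj : ∀ s (ξ : Hor d), ‖(jw s ξ : ℂ)‖ = jw s ξ := fun s ξ => by
    rw [Complex.norm_real, Real.norm_of_nonneg (jw_pos _ _).le]
  set q : Hor d → ℂ := fun ξ => (jw (-1) ξ : ℂ) * Q ξ with hqdef
  have hqm : StronglyMeasurable q := (hcj _).mul hQ
  have hqb : ∀ ξ, ‖q ξ‖ ≤ 1 * ‖Q ξ‖ := fun ξ => by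
    rw [hqdef, norm_mul, hnj]
    exact mul_le_mul_of_nonneg_right (jw_le_one (by norm_num) ξ) (norm_nonneg _)
  have hq2 : MemLp q 2 volume := hQ2.of_le_mul hqm.aestronglyMeasurable (ae_of_all _ hqb)
  set qi : Fin d → Hor d → ℂ := fun i ξ => (2 * Real.pi * ξ i * Complex.I) * q ξ with hqidef
  have hqim : ∀ i, StronglyMeasurable (qi i) := fun i => by
    have : Continuous fun ξ : Hor d => (2 * Real.pi * ξ i * Complex.I : ℂ) := by fun_prop
    exact this.stronglyMeasurable.mul hqm
  have hqib : ∀ i ξ, ‖qi i ξ‖ ≤ (2 * Real.pi) * ‖Q ξ‖ := fun i ξ => by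
    have h1 : |ξ i| ≤ jw 1 ξ := (PiLp.norm_apply_le ξ i).trans (norm_le_jw_one ξ)
    have h2 : ‖qi i ξ‖ = 2 * Real.pi * (|ξ i| * jw (-1) ξ) * ‖Q ξ‖ := by
      rw [hqidef, hqdef]
      simp only [norm_mul, hnj, Complex.norm_real, Complex.norm_I, Complex.norm_ofNat,
        Real.norm_eq_abs, abs_of_pos Real.pi_pos]
      ring
    rw [h2]
    have h3 : |ξ i| * jw (-1) ξ ≤ 1 := by
      rw [mul_comm]
      refine le_of_le_of_eq ?_ (jw_neg_mul 1 ξ)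
      exact mul_le_mul_of_nonneg_left h1 (jw_pos _ _).le
    have := Real.pi_pos
    have h4 : 2 * Real.pi * (|ξ i| * jw (-1) ξ) ≤ 2 * Real.pi * 1 := by gcongr
    rw [mul_one] at h4
    gcongr
  have hqi2 : ∀ i, MemLp (qi i) 2 volume := fun i =>
    hQ2.of_le_mul (hqim i).aestronglyMeasurable (ae_of_all _ (hqib i))
  set E : Hor d × ℝ → GradVal d := fun z =>
    (WithLp.toLp 2 fun i => waveExt liftBump (qi i) z, waveExt (deriv liftBump) Q z)
  have hEm : StronglyMeasurable E := by
    refine StronglyMeasurable.prodMk ?_ (stronglyMeasurable_waveExt hM.cont hQ)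
    refine (PiLp.continuous_toLp 2 _).comp_stronglyMeasurable (Measurable.stronglyMeasurable ?_)
    exact measurable_pi_lambda _ fun i =>
      (stronglyMeasurable_waveExt profile_liftBump.cont (hqim i)).measurable
  set μ := volume.restrict (lowerHalf d)
  have hEi : ∀ i, MemLp (fun z => ‖waveExt liftBump (qi i) z‖) 2 μ := fun i =>
    (memLp_waveExt profile_liftBump (hqim i) (hqi2 i)).norm
  have hEt : MemLp (fun z => ‖waveExt (deriv liftBump) Q z‖) 2 μ := (memLp_waveExt hM hQ hQ2).norm
  have hS : MemLp (fun z => ∑ i, ‖waveExt liftBump (qi i) z‖) 2 μ := memLp_finsetSum _ fun i _ => hEi i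
  have hEle : ∀ z, ‖E z‖ ≤ ‖((fun z => ∑ i, ‖waveExt liftBump (qi i) z‖)
      + fun z => ‖waveExt (deriv liftBump) Q z‖) z‖ := fun z => by
    have h1 : 0 ≤ ∑ i, ‖waveExt liftBump (qi i) z‖ := Finset.sum_nonneg fun i _ => norm_nonneg _
    rw [Pi.add_apply, Real.norm_of_nonneg (by positivity), Prod.norm_def]
    refine max_le ((norm_toLp_le_sum _).trans ?_) ?_
    · exact le_add_of_nonneg_right (norm_nonneg _)
    · exact le_add_of_nonneg_left h1
  have hE2 : MemLp E 2 μ := (hS.add hEt).mono hEm.aestronglyMeasurable (ae_of_all _ hEle)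
  refine ⟨waveExt liftBump q, E, ⟨fun i => ?_, ?_, hE2⟩, ?_, ?_⟩
  · refine hasWeakDeriv_waveExt profile_liftBump profile_liftBump hqm (hqim i) hq2 (hqi2 i)
      (contDiff_wave contDiff_liftBump) fun ξ z => ?_
    rw [fderiv_wave_horizontal contDiff_liftBump, hqidef]
    ring
  · refine hasWeakDeriv_waveExt profile_liftBump hM hqm hQ hq2 hQ2
      (contDiff_wave contDiff_liftBump) fun ξ z => ?_
    rw [fderiv_wave_vertical contDiff_liftBump, hqdef]
    have : (jw 1 ξ : ℂ) * (jw (-1) ξ : ℂ) = 1 := by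
      rw [← Complex.ofReal_mul, mul_comm, jw_neg_mul, Complex.ofReal_one]
    linear_combination (wave (deriv liftBump) ξ z * Q ξ) * this
  · refine hasTrace_waveExt profile_liftBump liftBump_zero hqm hq2 ?_
    filter_upwards [fourier_bessel neg_half_nonpos g] with ξ hξ
    rw [toHalf, hξ, hqdef]
    simp only
    rw [← mul_assoc, ← Complex.ofReal_mul, ← jw_add, show (1 / 2 + -1 : ℝ) = -(1 / 2) by norm_num]
  · have h1 : l2norm μ E ≤ l2norm μ (fun z => ∑ i, ‖waveExt liftBump (qi i) z‖)
        + l2norm μ fun z => ‖waveExt (deriv liftBump) Q z‖ := by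
      refine le_trans ?_ (l2norm_add_le hS hEt)
      simpa using l2norm_le_of_le_mul zero_le_one (hS.add hEt)
        (ae_of_all _ fun z => (hEle z).trans_eq (one_mul _).symm)
    have hnorm : ∀ u : Hor d × ℝ → ℂ, l2norm μ (fun z => ‖u z‖) = l2norm μ u := fun u => by
      rw [l2norm, l2norm, eLpNorm_norm]
    have h2 : l2norm μ (fun z => ∑ i, ‖waveExt liftBump (qi i) z‖)
        ≤ d * (1 * √2 * (2 * Real.pi) * ‖g‖) := by
      have h3 : eLpNorm (fun z => ∑ i, ‖waveExt liftBump (qi i) z‖) 2 μ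
          ≤ ∑ i, eLpNorm (fun z => ‖waveExt liftBump (qi i) z‖) 2 μ := by
        have := eLpNorm_sum_le (μ := μ) (p := 2) (s := (Finset.univ : Finset (Fin d)))
          (f := fun i z => ‖waveExt liftBump (qi i) z‖) (fun i _ => (hEi i).1) (by norm_num)
        convert this using 2
        ext z; simp
      have h4 := ENNReal.toReal_mono (ENNReal.sum_ne_top.2 fun i _ => (hEi i).2.ne) h3
      rw [ENNReal.toReal_sum fun i _ => (hEi i).2.ne] at h4
      refine h4.trans ?_
      refine (Finset.sum_le_card_nsmul _ _ (1 * √2 * (2 * Real.pi) * ‖g‖) fun i _ => ?_).trans_eq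
        (by simp)
      have h5 := l2norm_waveExt_le (g := g) profile_liftBump (by norm_num) (hqim i) (hqi2 i)
        (by positivity) (hqib i)
      rw [← hnorm] at h5
      exact h5
    have h6 := l2norm_waveExt_le (g := g) hM (by norm_num) hQ hQ2 zero_le_one
      (fun ξ => (one_mul ‖Q ξ‖).ge)
    rw [hnorm] at h1
    linarith

/-- The shear that flattens the surface `y = η(x)`. -/
lemma vertShear_flatten {η : Hor d → ℝ} {K : ℝ≥0} (hη : LipschitzWith K η) :
    VertShear (fun z : Hor d × ℝ => z.2 - η z.1) (fun z => z.2 + η z.1) := by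
  have hd : ∀ (z : Hor d × ℝ) (c : ℝ), HasLineDerivAt ℝ (fun z : Hor d × ℝ => z.2 + c * η z.1) 1 z
      (0, 1) := fun z c => by
    have : HasDerivAt (fun t : ℝ => z.2 + t + c * η z.1) 1 0 :=
      ((hasDerivAt_id (0 : ℝ)).const_add z.2).add_const _
    simpa [HasLineDerivAt] using this
  have h1 : LipschitzWith (K * 1) fun z : Hor d × ℝ => η z.1 := hη.comp LipschitzWith.prod_fst
  refine ⟨⟨_, LipschitzWith.prod_snd.sub h1⟩, ⟨_, LipschitzWith.prod_snd.add h1⟩, fun z => by simp,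
    fun z => by simp, fun z => ?_, fun z => ?_⟩
  · have := hd z (-1)
    simp only [neg_one_mul, ← sub_eq_add_neg] at this
    exact ⟨by rw [this.lineDeriv]; exact one_pos, this.lineDifferentiableAt⟩
  · have := hd z 1
    simp only [one_mul] at this
    exact ⟨by rw [this.lineDeriv]; exact one_pos, this.lineDifferentiableAt⟩

/-- The constant in the continuity of the lifting. -/
noncomputable def liftConst (d : ℕ) : ℝ := (exists_lift_lowerHalf d).choose

lemma liftConst_nonneg (d : ℕ) : 0 ≤ liftConst d := (exists_lift_lowerHalf d).choose_spec.1

/-- Every function of `H^{1/2}` is the trace of a function of finite energy on the fluid domain. -/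
lemma exists_lift (O : Set (Hor d × ℝ)) {η : Hor d → ℝ} {K : ℝ≥0} (hη : LipschitzWith K η)
    (g : L2 d) : ∃ w W,
    HasFiniteEnergyGrad (fluidDomain O η) w W ∧ HasTrace η w (toHalf g) ∧
      l2norm (volume.restrict (fluidDomain O η)) W
        ≤ (2 + d) * (2 + K) ^ 2 * liftConst d * ‖g‖ := by
  obtain ⟨e, E, hE, ht, hn⟩ := (exists_lift_lowerHalf d).choose_spec.2 g
  have hs := vertShear_flatten hη
  have h1 : LipschitzWith (K * 1) fun z : Hor d × ℝ => η z.1 := hη.comp LipschitzWith.prod_fst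
  have hl : LipschitzWith (1 + K * 1) fun z : Hor d × ℝ => z.2 - η z.1 :=
    LipschitzWith.prod_snd.sub h1
  have hk : LipschitzWith (1 + K * 1) fun z : Hor d × ℝ => z.2 + η z.1 :=
    LipschitzWith.prod_snd.add h1
  have hsub : fluidDomain O η ⊆ shearMap (fun z : Hor d × ℝ => z.2 - η z.1) ⁻¹' lowerHalf d :=
    fun z hz => sub_neg.2 hz.2
  have hG := hE.comp_shear hs isOpen_lowerHalf
  refine ⟨_, _, ⟨fun i => (hG.1 i).mono hsub, hG.2.1.mono hsub,
    hG.2.2.mono_measure (Measure.restrict_mono hsub le_rfl)⟩,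
    ht.comp_shear hs (fun x => by simp), ?_⟩
  have h2 := l2norm_pullGrad_le hs hl hk hE.2.2
  have h3 : l2norm (volume.restrict (fluidDomain O η))
      (pullGrad (fun z : Hor d × ℝ => z.2 - η z.1) E) ≤ l2norm (volume.restrict
        (shearMap (fun z : Hor d × ℝ => z.2 - η z.1) ⁻¹' lowerHalf d)) (pullGrad (fun z : Hor d × ℝ => z.2 - η z.1) E) :=
    ENNReal.toReal_mono hG.2.2.2.ne (eLpNorm_mono_measure _ (Measure.restrict_mono hsub le_rfl))
  refine h3.trans (h2.trans ?_)
  have h4 : 0 ≤ liftConst d * ‖g‖ := mul_nonneg (liftConst_nonneg d) (norm_nonneg _)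
  have hn' : l2norm (volume.restrict (lowerHalf d)) E ≤ liftConst d * ‖g‖ := hn
  have hK := K.2
  push_cast
  calc _ ≤ (1 + ((d : ℝ) + 1) * (1 + K * 1)) * ((1 + (1 + K * 1)) * (liftConst d * ‖g‖)) := by gcongr
    _ ≤ ((2 + d) * (2 + K)) * ((2 + K) * (liftConst d * ‖g‖)) := by
      have : (0 : ℝ) ≤ d := Nat.cast_nonneg _
      have hK' : (0 : ℝ) ≤ K := hK
      refine mul_le_mul (by nlinarith) (mul_le_mul_of_nonneg_right (by linarith) h4) ?_ ?_ <;>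
        positivity
    _ = _ := by ring

end WaterWaves

namespace WaterWaves

variable {d : ℕ}

/-! ### The Dirichlet-Neumann operator -/

/-- The norm of the lifting to a domain below the graph of a `K`-Lipschitz function. -/
noncomputable def liftNorm (d : ℕ) (K : ℝ≥0) : ℝ := (2 + d) * (2 + K) ^ 2 * liftConst d

lemma liftNorm_nonneg (d : ℕ) (K : ℝ≥0) : 0 ≤ liftNorm d K :=
  mul_nonneg (by positivity) (liftConst_nonneg d)

lemma liftNorm_mono (d : ℕ) : Monotone (liftNorm d) := fun K K' hK => by
  have h : (K : ℝ) ≤ K' := hK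
  have := liftConst_nonneg d
  unfold liftNorm
  gcongr

lemma L2.aesm (f : L2 d) : AEStronglyMeasurable f volume := Lp.aestronglyMeasurable f

lemma ae_eq_toHalf_halfDeriv (χ : 𝓢(Hor d, ℂ)) : (χ : Hor d → ℂ) =ᵐ[volume] toHalf (halfDeriv χ) := by
  rw [toHalf_halfDeriv]
  exact (SchwartzMap.coeFn_toLp χ 2 volume).symm

lemma HasTrace.congr_right {η : Hor d → ℝ} {u : Hor d × ℝ → ℂ} {f g : Hor d → ℂ}
    (h : HasTrace η u f) (hfg : f =ᵐ[volume] g) : HasTrace η u g :=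
  h.congr_ae one_pos (ae_eq_refl _) hfg

lemma IsVariationalSolution.sub {O : Set (Hor d × ℝ)} {η : Hor d → ℝ} {f f' : Hor d → ℂ} {h : ℝ}
    {φ φ' : Hor d × ℝ → ℂ} {Φ Φ' : Hor d × ℝ → GradVal d}
    (hs : IsVariationalSolution O η f φ Φ) (hs' : IsVariationalSolution O η f' φ' Φ') (hh : 0 < h)
    (hS : stripBelow η h ⊆ O) (hf : AEStronglyMeasurable f volume) :
    IsVariationalSolution O η (f - f') (φ - φ') (Φ - Φ') := by
  refine ⟨hs.1.sub hs'.1, HasTrace.sub hh (hs.1.aestronglyMeasurable.mono_measure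
    (Measure.restrict_mono (stripBelow_subset_fluidDomain hS) le_rfl)) hf hs.2.1 hs'.2.1,
    fun θ Θ hθ hθ' => ?_⟩
  have h1 := integral_sub (integrable_gradDot hs.1.2.2 hθ.2.2) (integrable_gradDot hs'.1.2.2 hθ.2.2)
  rw [hs.2.2 θ Θ hθ hθ', hs'.2.2 θ Θ hθ hθ', sub_zero] at h1
  rw [← h1]
  congr 1; ext z
  exact gradDot_sub_left _ _ _

/-- `b` represents the weak normal derivative of a potential of gradient `Φ`. -/
def IsFlux (O : Set (Hor d × ℝ)) (η : Hor d → ℝ) (Φ : Hor d × ℝ → GradVal d) (b : L2 d) : Prop :=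
  ∀ (k : L2 d) (w : Hor d × ℝ → ℂ) (W : Hor d × ℝ → GradVal d),
    HasFiniteEnergyGrad (fluidDomain O η) w W → HasTrace η w (toHalf k) →
    pair b k = ∫ z in fluidDomain O η, gradDot (Φ z) (W z)

section

variable {O : Set (Hor d × ℝ)} {η : Hor d → ℝ} {f : Hor d → ℂ} {h : ℝ} {φ : Hor d × ℝ → ℂ}
  {Φ : Hor d × ℝ → GradVal d} {K : ℝ≥0}

lemma exists_flux (hs : IsVariationalSolution O η f φ Φ) (hη : LipschitzWith K η) (hh : 0 < h)
    (hS : stripBelow η h ⊆ O) : ∃ b, IsFlux O η Φ b := by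
  choose w W hW hw hn using exists_lift O hη
  set ℓ : L2 d → ℂ := fun k => ∫ z in fluidDomain O η, gradDot (Φ z) (W k z) with hℓ
  have hm : ∀ k, AEStronglyMeasurable (w k) (volume.restrict (stripBelow η h)) := fun k =>
    (hW k).aestronglyMeasurable.mono_measure
      (Measure.restrict_mono (stripBelow_subset_fluidDomain hS) le_rfl)
  have hadd : ∀ k k', ℓ (k + k') = ℓ k + ℓ k' := fun k k' => by
    have h1 : HasTrace η (w k + w k') (toHalf (k + k')) := by
      refine (HasTrace.add hh (hm k) (L2.aesm _) (hw k) (hw k')).congr_right ?_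
      rw [map_add]
      exact (Lp.coeFn_add _ _).symm
    have h2 := hs.integral_eq hh hS (L2.aesm _) (hW (k + k')) ((hW k).add (hW k')) (hw _) h1
    rw [hℓ]
    simp only
    rw [h2, ← integral_add (integrable_gradDot hs.1.2.2 (hW k).2.2)
      (integrable_gradDot hs.1.2.2 (hW k').2.2)]
    congr 1; ext z
    exact gradDot_add_right _ _ _
  have hsmul : ∀ (c : ℂ) k, ℓ (c • k) = c • ℓ k := fun c k => by
    have h1 : HasTrace η (c • w k) (toHalf (c • k)) := by
      refine ((hw k).smul c).congr_right ?_
      rw [map_smul]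
      exact (Lp.coeFn_smul _ _).symm
    have h2 := hs.integral_eq hh hS (L2.aesm _) (hW (c • k)) ((hW k).smul c) (hw _) h1
    rw [hℓ]
    simp only
    rw [h2, smul_eq_mul, ← integral_const_mul]
    congr 1; ext z
    exact gradDot_smul_right _ _ _
  set ℓ' : L2 d →L[ℂ] ℂ := LinearMap.mkContinuous ⟨⟨ℓ, hadd⟩, hsmul⟩
    ((d + 1) * l2norm (volume.restrict (fluidDomain O η)) Φ * liftNorm d K) fun k => by
      refine (norm_integral_gradDot_le hs.1.2.2 (hW k).2.2).trans ?_
      rw [mul_assoc _ (liftNorm d K)]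
      have := l2norm_nonneg (volume.restrict (fluidDomain O η)) Φ
      gcongr
      exact hn k
  obtain ⟨b, hb⟩ := exists_pair_eq ℓ'
  refine ⟨b, fun k v V hV hv => ?_⟩
  rw [hb k]
  exact hs.integral_eq hh hS (L2.aesm _) (hW k) hV (hw k) hv

lemma IsFlux.isDirichletNeumann {f : L2 d} {b : L2 d} (hb : IsFlux O η Φ b)
    (hs : IsVariationalSolution O η f φ Φ) : IsDirichletNeumann O η f (toNegHalf b) := by
  refine ⟨(memSobolev_neg_half_iff _).2 ⟨b, rfl⟩, φ, Φ, hs, fun χ w W hW hw => ?_⟩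
  rw [toNegHalf_apply]
  exact hb _ _ _ hW (hw.congr_right (ae_eq_toHalf_halfDeriv χ))

lemma IsDirichletNeumann.unique {f : L2 d} {g g' : 𝓢'(Hor d, ℂ)} (hη : LipschitzWith K η)
    (hh : 0 < h) (hS : stripBelow η h ⊆ O) (hg : IsDirichletNeumann O η f g)
    (hg' : IsDirichletNeumann O η f g') : g = g' := by
  obtain ⟨-, φ, Φ, hs, hΦ⟩ := hg
  obtain ⟨-, φ', Φ', hs', hΦ'⟩ := hg'
  ext χ
  obtain ⟨w, W, hW, hw, -⟩ := exists_lift O hη (halfDeriv χ)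
  have hw' := hw.congr_right (ae_eq_toHalf_halfDeriv χ).symm
  rw [hΦ χ w W hW hw', hΦ' χ w W hW hw']
  refine integral_congr_ae ?_
  filter_upwards [hs.unique hs' hh hS (L2.aesm f)] with z hz
  rw [hz]

lemma exists_variationalSolution_toHalf (hO : IsOpen O) (hconn : IsPreconnected O)
    (hη : LipschitzWith K η) (hh : 0 < h) (hS : stripBelow η h ⊆ O) (g : L2 d) :
    ∃ φ Φ, IsVariationalSolution O η (toHalf g) φ Φ := by
  obtain ⟨w, W, hW, hw, -⟩ := exists_lift O hη g
  exact exists_variationalSolution hO hconn hη.continuous hh hS (L2.aesm _) hW hw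

lemma existsUnique_isDirichletNeumann (hO : IsOpen O) (hconn : IsPreconnected O)
    (hη : LipschitzWith K η) (hh : 0 < h) (hS : stripBelow η h ⊆ O) (g : L2 d) :
    ∃! G, IsDirichletNeumann O η (toHalf g) G := by
  obtain ⟨φ, Φ, hs⟩ := exists_variationalSolution_toHalf hO hconn hη hh hS g
  obtain ⟨b, hb⟩ := exists_flux hs hη hh hS
  exact ⟨_, hb.isDirichletNeumann hs, fun g' hg' => hg'.unique hη hh hS (hb.isDirichletNeumann hs)⟩

lemma dirichletNeumann_eq {f : L2 d} {G : 𝓢'(Hor d, ℂ)} (hη : LipschitzWith K η) (hh : 0 < h)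
    (hS : stripBelow η h ⊆ O) (hG : IsDirichletNeumann O η f G) : dirichletNeumann O η f = G := by
  have hex : ∃ g, IsDirichletNeumann O η f g := ⟨G, hG⟩
  rw [dirichletNeumann, dif_pos hex]
  exact hex.choose_spec.unique hη hh hS hG

lemma exists_dirichletNeumann_eq (hO : IsOpen O) (hconn : IsPreconnected O)
    (hη : LipschitzWith K η) (hh : 0 < h) (hS : stripBelow η h ⊆ O) (g : L2 d) :
    ∃ b φ Φ, dirichletNeumann O η (toHalf g) = toNegHalf b ∧
      IsVariationalSolution O η (toHalf g) φ Φ ∧ IsFlux O η Φ b := by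
  obtain ⟨φ, Φ, hs⟩ := exists_variationalSolution_toHalf hO hconn hη hh hS g
  obtain ⟨b, hb⟩ := exists_flux hs hη hh hS
  exact ⟨b, φ, Φ, dirichletNeumann_eq hη hh hS (hb.isDirichletNeumann hs), hs, hb⟩

lemma IsVariationalSolution.l2norm_toHalf_le {g : L2 d}
    (hs : IsVariationalSolution O η (toHalf g) φ Φ) (hη : LipschitzWith K η) (hh : 0 < h)
    (hS : stripBelow η h ⊆ O) :
    l2norm (volume.restrict (fluidDomain O η)) Φ ≤ (d + 1) * (liftNorm d K * ‖g‖) := by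
  obtain ⟨w, W, hW, hw, hn⟩ := exists_lift O hη g
  refine (hs.l2norm_le hh hS (L2.aesm _) hW hw).trans ?_
  gcongr
  exact hn

lemma IsFlux.norm_le {b g : L2 d} (hb : IsFlux O η Φ b)
    (hs : IsVariationalSolution O η (toHalf g) φ Φ) (hη : LipschitzWith K η) (hh : 0 < h)
    (hS : stripBelow η h ⊆ O) : ‖b‖ ≤ (d + 1) ^ 2 * liftNorm d K ^ 2 * ‖g‖ := by
  refine norm_le_of_pair_le fun k => ?_
  obtain ⟨w, W, hW, hw, hn⟩ := exists_lift O hη k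
  rw [hb k w W hW hw]
  have h1 := hs.l2norm_toHalf_le hη hh hS
  have h2 := l2norm_nonneg (volume.restrict (fluidDomain O η)) Φ
  have h3 := l2norm_nonneg (volume.restrict (fluidDomain O η)) W
  have h4 := liftNorm_nonneg d K
  have h5 : l2norm (volume.restrict (fluidDomain O η)) W ≤ liftNorm d K * ‖k‖ := hn
  calc _ ≤ (d + 1) * l2norm (volume.restrict (fluidDomain O η)) Φ
        * l2norm (volume.restrict (fluidDomain O η)) W := norm_integral_gradDot_le hs.1.2.2 hW.2.2
    _ ≤ (d + 1) * ((d + 1) * (liftNorm d K * ‖g‖)) * (liftNorm d K * ‖k‖) := by gcongr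
    _ = _ := by ring

lemma IsFlux.sub {Φ' : Hor d × ℝ → GradVal d} {b b' : L2 d} (hb : IsFlux O η Φ b)
    (hb' : IsFlux O η Φ' b') (hΦ : MemLp Φ 2 (volume.restrict (fluidDomain O η)))
    (hΦ' : MemLp Φ' 2 (volume.restrict (fluidDomain O η))) : IsFlux O η (Φ - Φ') (b - b') := by
  intro k w W hW hw
  rw [pair_sub_left, hb k w W hW hw, hb' k w W hW hw,
    ← integral_sub (integrable_gradDot hΦ hW.2.2) (integrable_gradDot hΦ' hW.2.2)]
  congr 1; ext z
  exact (gradDot_sub_left _ _ _).symm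

/-- The Dirichlet-Neumann operator is Lipschitz from `H^{1/2}` to `H^{-1/2}`. -/
lemma hsENorm_dirichletNeumann_sub_le (hO : IsOpen O) (hconn : IsPreconnected O)
    (hη : LipschitzWith K η) (hh : 0 < h) (hS : stripBelow η h ⊆ O) (g g' : L2 d) :
    hsENorm (-1 / 2) (dirichletNeumann O η (toHalf g) - dirichletNeumann O η (toHalf g'))
      ≤ ENNReal.ofReal ((d + 1) ^ 2 * liftNorm d K ^ 2) * ‖g - g'‖ₑ := by
  obtain ⟨b, φ, Φ, e, hs, hb⟩ := exists_dirichletNeumann_eq hO hconn hη hh hS g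
  obtain ⟨b', φ', Φ', e', hs', hb'⟩ := exists_dirichletNeumann_eq hO hconn hη hh hS g'
  rw [e, e', ← toNegHalf_sub, hsENorm_toNegHalf, ← ofReal_norm, ← ofReal_norm,
    ← ENNReal.ofReal_mul (by positivity)]
  refine ENNReal.ofReal_le_ofReal ?_
  have h1 := hs.sub hs' hh hS (L2.aesm _)
  have h2 : IsVariationalSolution O η (toHalf (g - g')) (φ - φ') (Φ - Φ') := by
    refine ⟨h1.1, h1.2.1.congr_right ?_, h1.2.2⟩
    rw [map_sub]
    exact (Lp.coeFn_sub _ _).symm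
  exact (hb.sub hb' hs.1.2.2 hs'.1.2.2).norm_le h2 hη hh hS

end

/-- The constant in the Lipschitz estimate for the Dirichlet-Neumann operator. -/
noncomputable def shapeConst (d : ℕ) (h : ℝ) (C N : ℝ≥0) : ℝ :=
  (20 * (d + 3) ^ 2 * compConst d * (d + 1) * (1 + C * (1 + N))
    + 2 * (d + 1) ^ 2 * (2 * (1 + C * (1 + N)) + 2 / h)) * liftNorm d N ^ 2

lemma shapeConst_nonneg (d : ℕ) {h : ℝ} (hh : 0 < h) (C N : ℝ≥0) : 0 ≤ shapeConst d h C N := by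
  have := compConst_nonneg d
  unfold shapeConst; positivity

lemma shapeConst_mono (d : ℕ) {h : ℝ} (hh : 0 < h) (C : ℝ≥0) : Monotone (shapeConst d h C) := by
  intro N N' hN
  have h0 := compConst_nonneg d
  have h1 := liftNorm_mono d hN
  have h2 := liftNorm_nonneg d N
  have h3 : (N : ℝ) ≤ N' := hN
  unfold shapeConst
  gcongr

lemma hsENorm_dirichletNeumann_shape_sub_le {O : Set (Hor d × ℝ)} (hO : IsOpen O)
    (hconn : IsPreconnected O) {h : ℝ} (hh : 0 < h) {C : ℝ≥0}
    (hC : LipschitzWith C (vertCutoff hh)) {η₁ η₂ : Hor d → ℝ} (h₁ : MemW1inf η₁)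
    (h₂ : MemW1inf η₂) (hS₁ : stripBelow η₁ h ⊆ O) (hS₂ : stripBelow η₂ h ⊆ O) (g : L2 d) :
    hsENorm (-1 / 2) (dirichletNeumann O η₁ (toHalf g) - dirichletNeumann O η₂ (toHalf g))
      ≤ ENNReal.ofReal (shapeConst d h C (w1infNorm η₁ + w1infNorm η₂))
        * (w1infNorm (η₁ - η₂) : ℝ≥0∞) * ‖g‖ₑ := by
  have hL₁ := h₁.lipschitzWith
  have hL₂ := h₂.lipschitzWith
  obtain ⟨b₁, φ₁, Φ₁, e₁, hs₁, hb₁⟩ := exists_dirichletNeumann_eq hO hconn hL₁ hh hS₁ g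
  obtain ⟨b₂, φ₂, Φ₂, e₂, hs₂, hb₂⟩ := exists_dirichletNeumann_eq hO hconn hL₂ hh hS₂ g
  set N := w1infNorm η₁ + w1infNorm η₂
  set a := w1infNorm (η₁ - η₂)
  have hN₁ : w1infNorm η₁ ≤ N := le_self_add
  have hN₂ : w1infNorm η₂ ≤ N := le_add_self
  have hsc := shapeConst_nonneg d hh C N
  rw [e₁, e₂, ← toNegHalf_sub, hsENorm_toNegHalf, ← ofReal_norm, ← ofReal_norm,
    ← ENNReal.ofReal_coe_nnreal, ← ENNReal.ofReal_mul hsc, ← ENNReal.ofReal_mul (by positivity)]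
  refine ENNReal.ofReal_le_ofReal ?_
  have hcc := compConst_nonneg d
  have hln := liftNorm_nonneg d N
  have hg := norm_nonneg g
  have ha : (0 : ℝ) ≤ a := a.2
  have hN0 : (0 : ℝ) ≤ N := N.2
  have hC0 : (0 : ℝ) ≤ C := C.2
  set δ : ℝ≥0 := a * (1 + C * (1 + w1infNorm η₂)) with hδ
  by_cases hsmall : δ ≤ 1 / 2 ∧ (a : ℝ) ≤ h / 2
  · obtain ⟨l, k, hn, hΩ, hgr⟩ := exists_shear_fluidDomain hh hC h₁ h₂ hS₁ hS₂ hδ hsmall.1 hsmall.2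
    refine norm_le_of_pair_le fun q => ?_
    obtain ⟨w₁, W₁, hW₁, hw₁, -⟩ := exists_lift O hL₁ q
    obtain ⟨w₂, W₂, hW₂, hw₂, hn₂⟩ := exists_lift O hL₂ q
    have h2δ : 2 * δ ≤ 1 := by
      have := mul_le_mul_right hsmall.1 2
      simpa using this
    have key := compare_solutions hn h2δ hO h₁.continuous h₂.continuous hh hS₁ hΩ hgr (L2.aesm _)
      hs₁ hs₂ (L2.aesm _) hW₁ hw₁ hW₂ hw₂
    rw [pair_sub_left, hb₁ q w₁ W₁ hW₁ hw₁, hb₂ q w₂ W₂ hW₂ hw₂]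
    refine key.trans ?_
    have h3 := hs₂.l2norm_toHalf_le hL₂ hh hS₂
    have h4 : l2norm (volume.restrict (fluidDomain O η₂)) W₂ ≤ liftNorm d (w1infNorm η₂) * ‖q‖ := hn₂
    have h5 := liftNorm_mono d hN₂
    have h6 := liftNorm_nonneg d (w1infNorm η₂)
    have h7 := l2norm_nonneg (volume.restrict (fluidDomain O η₂)) Φ₂
    have h8 := l2norm_nonneg (volume.restrict (fluidDomain O η₂)) W₂
    have h9 : ((2 * δ : ℝ≥0) : ℝ) ≤ 2 * (a * (1 + C * (1 + N))) := by
      rw [hδ]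
      push_cast
      have : (w1infNorm η₂ : ℝ) ≤ N := hN₂
      gcongr
    calc _ ≤ 10 * (d + 3) ^ 2 * compConst d * (2 * (a * (1 + C * (1 + N))))
          * ((d + 1) * (liftNorm d N * ‖g‖)) * (liftNorm d N * ‖q‖) := by
            refine mul_le_mul (mul_le_mul (mul_le_mul_of_nonneg_left h9 (by positivity))
              (h3.trans ?_) h7 (by positivity)) (h4.trans ?_) h8 (by positivity)
            · gcongr
            · gcongr
      _ = (20 * (d + 3) ^ 2 * compConst d * (d + 1) * (1 + C * (1 + N))) * liftNorm d N ^ 2 * a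
          * ‖g‖ * ‖q‖ := by ring
      _ ≤ _ := by
          unfold shapeConst
          gcongr
          exact le_add_of_nonneg_right (by positivity)
  · have hbig : 1 ≤ a * (2 * (1 + C * (1 + N)) + 2 / h) := by
      rw [not_and_or, not_le, not_le] at hsmall
      rcases hsmall with h3 | h3
      · have h4 : (1 / 2 : ℝ) < a * (1 + C * (1 + w1infNorm η₂)) := by
          have : ((1 / 2 : ℝ≥0) : ℝ) < δ := h3
          rw [hδ] at this
          push_cast at this
          exact this
        have h5 : (w1infNorm η₂ : ℝ) ≤ N := hN₂
        have h6 : (a : ℝ) * (1 + C * (1 + w1infNorm η₂)) ≤ a * (1 + C * (1 + N)) := by gcongr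
        have h7 : 0 ≤ (a : ℝ) * (2 / h) := by positivity
        linarith
      · have h4 : (1 : ℝ) ≤ a * (2 / h) := by
          rw [← mul_div_assoc, le_div_iff₀ hh]; linarith
        have h5 : 0 ≤ (a : ℝ) * (2 * (1 + C * (1 + N))) := by positivity
        linarith
    have h3 := hb₁.norm_le hs₁ hL₁ hh hS₁
    have h4 := hb₂.norm_le hs₂ hL₂ hh hS₂
    have h5 := liftNorm_mono d hN₁
    have h6 := liftNorm_mono d hN₂
    have h7 := liftNorm_nonneg d (w1infNorm η₁)
    have h8 := liftNorm_nonneg d (w1infNorm η₂)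
    calc ‖b₁ - b₂‖ ≤ ‖b₁‖ + ‖b₂‖ := norm_sub_le _ _
      _ ≤ (d + 1) ^ 2 * liftNorm d N ^ 2 * ‖g‖ + (d + 1) ^ 2 * liftNorm d N ^ 2 * ‖g‖ := by
          refine add_le_add (h3.trans ?_) (h4.trans ?_) <;> gcongr
      _ = (2 * (d + 1) ^ 2 * 1) * liftNorm d N ^ 2 * ‖g‖ := by ring
      _ ≤ (2 * (d + 1) ^ 2 * (a * (2 * (1 + C * (1 + N)) + 2 / h))) * liftNorm d N ^ 2 * ‖g‖ := by
          gcongr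
      _ = (2 * (d + 1) ^ 2 * (2 * (1 + C * (1 + N)) + 2 / h)) * liftNorm d N ^ 2 * a * ‖g‖ := by
          ring
      _ ≤ _ := by
          unfold shapeConst
          gcongr
          exact le_add_of_nonneg_left (by positivity)

end WaterWaves

namespace WaterWaves

variable {d : ℕ}

open scoped FourierTransform RealInnerProductSpace

/-! ### Translations and the Fourier transform -/

lemma integral_mul_fourier (f : L2 d) (χ : 𝓢(Hor d, ℂ)) :
    ∫ x, χ x * (𝓕 f : L2 d) x = ∫ x, (𝓕 χ : 𝓢(Hor d, ℂ)) x * f x := by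
  have e1 := Lp.toTemperedDistribution_apply (𝓕 f : L2 d) χ
  simp only [smul_eq_mul] at e1
  rw [← e1, ← Lp.fourier_toTemperedDistribution_eq, TemperedDistribution.fourier_apply,
    Lp.toTemperedDistribution_apply]
  rfl

lemma integral_mul_fourierInv (f : L2 d) (χ : 𝓢(Hor d, ℂ)) :
    ∫ x, χ x * (𝓕⁻ f : L2 d) x = ∫ x, (𝓕⁻ χ : 𝓢(Hor d, ℂ)) x * f x := by
  have e1 := Lp.toTemperedDistribution_apply (𝓕⁻ f : L2 d) χ
  simp only [smul_eq_mul] at e1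
  rw [← e1, ← Lp.fourierInv_toTemperedDistribution_eq, TemperedDistribution.fourierInv_apply,
    Lp.toTemperedDistribution_apply]
  rfl

lemma fourierInv_translate (χ : 𝓢(Hor d, ℂ)) (v ξ : Hor d) :
    (𝓕⁻ (χ.compSubConstCLM ℂ v) : 𝓢(Hor d, ℂ)) ξ
      = (Real.fourierChar ⟪v, ξ⟫ : ℂ) * (𝓕⁻ χ : 𝓢(Hor d, ℂ)) ξ := by
  rw [SchwartzMap.fourierInv_coe, SchwartzMap.fourierInv_coe, Real.fourierInv_eq, Real.fourierInv_eq,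
    ← integral_const_mul, ← integral_add_right_eq_self _ v]
  congr 1; ext y
  rw [SchwartzMap.compSubConstCLM_apply, add_sub_cancel_right, inner_add_left, AddChar.map_add_eq_mul,
    Circle.smul_def, Circle.smul_def, smul_eq_mul, smul_eq_mul, Circle.coe_mul]
  ring

lemma fourier_translate (χ : 𝓢(Hor d, ℂ)) (v ξ : Hor d) :
    (𝓕 (χ.compSubConstCLM ℂ (-v)) : 𝓢(Hor d, ℂ)) ξ
      = (Real.fourierChar ⟪v, ξ⟫ : ℂ) * (𝓕 χ : 𝓢(Hor d, ℂ)) ξ := by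
  rw [SchwartzMap.fourier_coe, SchwartzMap.fourier_coe, Real.fourier_eq, Real.fourier_eq,
    ← integral_const_mul, ← integral_add_right_eq_self _ (-v)]
  congr 1; ext y
  rw [SchwartzMap.compSubConstCLM_apply, add_sub_cancel_right, inner_add_left, inner_neg_left,
    neg_add, neg_neg, AddChar.map_add_eq_mul,
    Circle.smul_def, Circle.smul_def, smul_eq_mul, smul_eq_mul, Circle.coe_mul]
  ring

lemma continuous_fourierChar_inner (v : Hor d) :
    Continuous fun ξ : Hor d => (Real.fourierChar ⟪v, ξ⟫ : ℂ) :=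
  continuous_subtype_val.comp (Real.continuous_fourierChar.comp (by fun_prop))

lemma translate_ae_eq (f : L2 d) (v : Hor d) : ∃ F : L2 d, (F =ᵐ[volume] fun x => f (x + v)) ∧
    (𝓕 F : L2 d) =ᵐ[volume] fun ξ => (Real.fourierChar ⟪v, ξ⟫ : ℂ) * (𝓕 f : L2 d) ξ := by
  have hm : AEStronglyMeasurable (fun ξ : Hor d => (Real.fourierChar ⟪v, ξ⟫ : ℂ)) volume :=
    (continuous_fourierChar_inner v).aestronglyMeasurable
  have hC : ∀ᵐ ξ : Hor d, ‖(Real.fourierChar ⟪v, ξ⟫ : ℂ)‖ ≤ 1 :=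
    ae_of_all _ fun ξ => (Circle.norm_coe _).le
  refine ⟨𝓕⁻ (mulL2 hm hC (𝓕 f)), ?_, ?_⟩
  · have hqmp := (measurePreserving_add_right (volume : Measure (Hor d)) v)
    have hf : MemLp (fun x => f (x + v)) 2 volume := (Lp.memLp f).comp_measurePreserving hqmp
    refine ae_eq_of_schwartz (L2.locallyIntegrable _) (hf.locallyIntegrable (by norm_num))
      fun χ _ => ?_
    rw [integral_mul_fourierInv]
    have e1 : ∫ x, (𝓕⁻ χ : 𝓢(Hor d, ℂ)) x * mulL2 hm hC (𝓕 f) x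
        = ∫ x, (𝓕⁻ (χ.compSubConstCLM ℂ v) : 𝓢(Hor d, ℂ)) x * (𝓕 f : L2 d) x := by
      refine integral_congr_ae ?_
      filter_upwards [coeFn_mulL2 hm hC (𝓕 f)] with x hx
      rw [hx, fourierInv_translate]
      ring
    rw [e1, ← integral_mul_fourierInv, FourierTransform.fourierInv_fourier_eq,
      ← integral_add_right_eq_self _ v]
    congr 1; ext x
    rw [SchwartzMap.compSubConstCLM_apply, add_sub_cancel_right]
  · rw [FourierTransform.fourier_fourierInv_eq]
    exact coeFn_mulL2 hm hC _

lemma lintegral_translate_sub (f : L2 d) (v : Hor d) :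
    ∫⁻ x, ‖f (x + v) - f x‖ₑ ^ 2
      = ∫⁻ ξ, ‖(Real.fourierChar ⟪v, ξ⟫ : ℂ) - 1‖ₑ ^ 2 * ‖(𝓕 f : L2 d) ξ‖ₑ ^ 2 := by
  obtain ⟨F, hF, hF'⟩ := translate_ae_eq f v
  have e1 : ∫⁻ x, ‖f (x + v) - f x‖ₑ ^ 2 = ‖F - f‖ₑ ^ 2 := by
    rw [Lp_enorm_sq]
    refine lintegral_congr_ae ?_
    filter_upwards [hF, Lp.coeFn_sub F f] with x h1 h2
    rw [h2, Pi.sub_apply, h1]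
  have e2 : (𝓕 (F - f) : L2 d) = 𝓕 F - 𝓕 f := map_sub (Lp.fourierTransformₗᵢ (Hor d) ℂ) _ _
  rw [e1, ← ofReal_norm, ← Lp.norm_fourier_eq, ofReal_norm, e2, Lp_enorm_sq]
  refine lintegral_congr_ae ?_
  filter_upwards [hF', Lp.coeFn_sub (𝓕 F : L2 d) (𝓕 f)] with ξ h1 h2
  rw [h2, Pi.sub_apply, h1, ← sub_one_mul, enorm_mul, mul_pow]

/-- The trilinear form `∫ u f (𝓕 p)` on the Fourier side. -/
lemma enorm_integral_mul_mul_le {u U : Hor d → ℂ} (hU : Integrable U volume)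
    (hu : u =ᵐ[volume] 𝓕⁻ U) (f : L2 d) (p : 𝓢(Hor d, ℂ)) :
    ‖∫ x, u x * f x * (𝓕 p : 𝓢(Hor d, ℂ)) x‖ₑ
      ≤ ∫⁻ η, ∫⁻ ξ, ‖U η‖ₑ * (‖(𝓕 f : L2 d) ξ‖ₑ * ‖p (ξ + η)‖ₑ) := by
  have hfp : Integrable (fun x => f x * (𝓕 p : 𝓢(Hor d, ℂ)) x) volume :=
    MemLp.integrable_mul (Lp.memLp f) ((𝓕 p : 𝓢(Hor d, ℂ)).memLp 2 volume)
  have hint : Integrable (fun w : Hor d × Hor d =>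
      (Real.fourierChar ⟪w.2, w.1⟫ : ℂ) * ((f w.1 * (𝓕 p : 𝓢(Hor d, ℂ)) w.1) * U w.2))
      (volume.prod volume) := by
    refine (hfp.mul_prod hU).bdd_mul (c := 1) ?_ (ae_of_all _ fun w => (Circle.norm_coe _).le)
    exact (continuous_subtype_val.comp (Real.continuous_fourierChar.comp
      (by fun_prop))).aestronglyMeasurable
  have e1 : ∫ x, u x * f x * (𝓕 p : 𝓢(Hor d, ℂ)) x = ∫ x, ∫ η,
      (Real.fourierChar ⟪η, x⟫ : ℂ) * ((f x * (𝓕 p : 𝓢(Hor d, ℂ)) x) * U η) := by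
    refine integral_congr_ae ?_
    filter_upwards [hu] with x hx
    rw [hx, Real.fourierInv_eq, mul_assoc, ← integral_mul_const]
    congr 1; ext η
    rw [Circle.smul_def, smul_eq_mul]
    ring
  have e2 : ∀ η, ∫ x, (Real.fourierChar ⟪η, x⟫ : ℂ) * ((f x * (𝓕 p : 𝓢(Hor d, ℂ)) x) * U η)
      = ∫ ξ, U η * ((𝓕 f : L2 d) ξ * p (ξ + η)) := fun η => by
    have h1 := integral_mul_fourier f (p.compSubConstCLM ℂ (-η))
    rw [integral_const_mul]
    have h2 : ∫ ξ, (𝓕 f : L2 d) ξ * p (ξ + η)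
        = ∫ x, (p.compSubConstCLM ℂ (-η)) x * (𝓕 f : L2 d) x := by
      congr 1; ext ξ
      rw [SchwartzMap.compSubConstCLM_apply, sub_neg_eq_add, mul_comm]
    rw [h2, h1, ← integral_const_mul]
    congr 1; ext x
    rw [fourier_translate]
    ring
  rw [e1, integral_integral_swap hint]
  simp only [e2]
  refine (enorm_integral_le_lintegral_enorm _).trans (lintegral_mono fun η => ?_)
  refine (enorm_integral_le_lintegral_enorm _).trans_eq ?_
  simp only [enorm_mul]

/-! ### Multipliers of `H^{1/2}` -/

/-- Multiplication by `a` is bounded on `H^{1/2}`, with norm at most `M`. -/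
def IsMult (a : Hor d → ℝ) (M : ℝ) : Prop :=
  ∀ g : L2 d, ∃ g' : L2 d, (toHalf g' =ᵐ[volume] fun x => (a x : ℂ) * toHalf g x) ∧
    ‖g'‖ ≤ M * ‖g‖

namespace IsMult

variable {a a' : Hor d → ℝ} {M M' : ℝ}

lemma congr_ae (h : IsMult a M) (haa' : a =ᵐ[volume] a') : IsMult a' M := fun g => by
  obtain ⟨g', h1, h2⟩ := h g
  refine ⟨g', ?_, h2⟩
  filter_upwards [h1, haa'] with x hx hx'
  rw [hx, hx']

lemma mono (h : IsMult a M) (hM : M ≤ M') : IsMult a M' := fun g => by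
  obtain ⟨g', h1, h2⟩ := h g
  exact ⟨g', h1, h2.trans (by gcongr)⟩

lemma one : IsMult (fun _ : Hor d => 1) 1 := fun g => ⟨g, by simp, by simp⟩

lemma add (h : IsMult a M) (h' : IsMult a' M') : IsMult (fun x => a x + a' x) (M + M') := fun g => by
  obtain ⟨g₁, h1, h2⟩ := h g
  obtain ⟨g₂, h3, h4⟩ := h' g
  refine ⟨g₁ + g₂, ?_, (norm_add_le _ _).trans (by rw [add_mul]; gcongr)⟩
  rw [map_add]
  filter_upwards [h1, h3, Lp.coeFn_add (toHalf g₁) (toHalf g₂)] with x e1 e2 e3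
  rw [e3, Pi.add_apply, e1, e2]
  push_cast
  ring

lemma mul (h : IsMult a M) (hM : 0 ≤ M) (h' : IsMult a' M') :
    IsMult (fun x => a x * a' x) (M * M') := fun g => by
  obtain ⟨g₁, h1, h2⟩ := h' g
  obtain ⟨g₂, h3, h4⟩ := h g₁
  refine ⟨g₂, ?_, h4.trans (by rw [mul_assoc]; gcongr)⟩
  filter_upwards [h1, h3] with x e1 e2
  rw [e2, e1]
  push_cast
  ring

lemma sum {ι : Type*} (s : Finset ι) {b : ι → Hor d → ℝ} {N : ι → ℝ}
    (h : ∀ i ∈ s, IsMult (b i) (N i)) : IsMult (fun x => ∑ i ∈ s, b i x) (∑ i ∈ s, N i) := by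
  classical
  induction s using Finset.induction_on with
  | empty =>
    intro g
    refine ⟨0, ?_, by simp⟩
    rw [map_zero]
    filter_upwards [Lp.coeFn_zero ℂ 2 (volume : Measure (Hor d))] with x hx
    simp
  | insert i s hi ih =>
    simp only [Finset.sum_insert hi]
    exact (h i (Finset.mem_insert_self i s)).add
      (ih fun j hj => h j (Finset.mem_insert_of_mem hj))

/-- Multiplication on `H^{1/2}`, transported to `L²`, and its transpose. -/
lemma exists_clm (h : IsMult a M) : ∃ T : L2 d →L[ℂ] L2 d, (∀ g, ‖T g‖ ≤ M * ‖g‖) ∧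
    ∀ g, toHalf (T g) =ᵐ[volume] fun x => (a x : ℂ) * toHalf g x := by
  choose T hT hn using h
  have hu : ∀ g g', (toHalf g' =ᵐ[volume] fun x => (a x : ℂ) * toHalf g x) → T g = g' :=
    fun g g' h => toHalf_injective (Lp.ext ((hT g).trans h.symm))
  have hadd : ∀ g g', T (g + g') = T g + T g' := fun g g' => by
    refine hu _ _ ?_
    rw [map_add, map_add]
    filter_upwards [hT g, hT g', Lp.coeFn_add (toHalf (T g)) (toHalf (T g')),
      Lp.coeFn_add (toHalf g) (toHalf g')] with x e1 e2 e3 e4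
    rw [e3, e4, Pi.add_apply, Pi.add_apply, e1, e2]
    ring
  have hsmul : ∀ (c : ℂ) g, T (c • g) = c • T g := fun c g => by
    refine hu _ _ ?_
    rw [map_smul, map_smul]
    filter_upwards [hT g, Lp.coeFn_smul c (toHalf (T g)), Lp.coeFn_smul c (toHalf g)] with x e1 e2 e3
    rw [e2, e3, Pi.smul_apply, Pi.smul_apply, e1, smul_eq_mul, smul_eq_mul]
    ring
  exact ⟨LinearMap.mkContinuous ⟨⟨T, hadd⟩, hsmul⟩ M hn, hn, hT⟩

end IsMult

/-- `T` is the transpose of the multiplication by `a`: it represents the product of `a` with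
elements of `H^{-1/2}`. -/
def IsDualMult (a : Hor d → ℝ) (T : L2 d → L2 d) : Prop :=
  ∀ b g g', (toHalf g' =ᵐ[volume] fun x => (a x : ℂ) * toHalf g x) → pair (T b) g = pair b g'

lemma IsMult.exists_dual {a : Hor d → ℝ} {M : ℝ} (h : IsMult a M) :
    ∃ T : L2 d → L2 d, IsDualMult a T := by
  obtain ⟨S, -, hS⟩ := h.exists_clm
  obtain ⟨T, hT⟩ := exists_transpose S
  refine ⟨T, fun b g g' hg => ?_⟩
  rw [hT, toHalf_injective (Lp.ext ((hS g).trans hg.symm))]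

section

variable {a : Hor d → ℝ} {M : ℝ} {T : L2 d → L2 d}

lemma IsDualMult.norm_sub_le (hT : IsDualMult a T) (h : IsMult a M) (b b' : L2 d) :
    ‖T b - T b'‖ ≤ M * ‖b - b'‖ := by
  refine norm_le_of_pair_le fun g => ?_
  obtain ⟨g', h1, h2⟩ := h g
  rw [pair_sub_left, hT b g g' h1, hT b' g g' h1, ← pair_sub_left]
  refine (norm_pair_le _ _).trans ?_
  calc ‖b - b'‖ * ‖g'‖ ≤ ‖b - b'‖ * (M * ‖g‖) := by gcongr
    _ = _ := by ring

lemma IsDualMult.isProduct (hT : IsDualMult a T) (h : IsMult a M) (b : L2 d) :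
    IsProduct a (toNegHalf b) (toNegHalf (T b)) := by
  intro χ
  obtain ⟨g', h1, -⟩ := h (halfDeriv χ)
  refine ⟨toHalf g', g', b, ?_, (besselPotential_half_eq_iff _ _).2 rfl,
    (besselPotential_neg_half_eq_iff _ _).2 rfl, ?_⟩
  · filter_upwards [h1, ae_eq_toHalf_halfDeriv χ] with x hx hx'
    rw [hx, hx']
  · rw [toNegHalf_apply, hT b _ g' h1, pair]

lemma IsDualMult.eq_of_isProduct (hT : IsDualMult a T) {b : L2 d} {c : 𝓢'(Hor d, ℂ)}
    (hc : IsProduct a (toNegHalf b) c) : c = toNegHalf (T b) := by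
  ext χ
  obtain ⟨v, v', b', h1, h2, h3, h4⟩ := hc χ
  rw [besselPotential_half_eq_iff] at h2
  rw [besselPotential_neg_half_eq_iff] at h3
  rw [h4, toNegHalf_apply, ← toNegHalf_injective h3, hT b (halfDeriv χ) v', pair]
  rw [← h2]
  filter_upwards [h1, ae_eq_toHalf_halfDeriv χ] with x hx hx'
  rw [hx, hx']

lemma IsDualMult.mulDist_eq (hT : IsDualMult a T) (h : IsMult a M) (b : L2 d) :
    mulDist a (toNegHalf b) = toNegHalf (T b) := by
  have hex : ∃ c, IsProduct a (toNegHalf b) c := ⟨_, hT.isProduct h b⟩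
  rw [mulDist, dif_pos hex]
  exact hT.eq_of_isProduct hex.choose_spec

end

lemma denseRange_toHalf : DenseRange (toHalf : L2 d → L2 d) := by
  have h1 : DenseRange (SchwartzMap.toLpCLM ℂ ℂ 2 (volume : Measure (Hor d))) :=
    SchwartzMap.denseRange_toLpCLM ENNReal.ofNat_ne_top
  refine h1.mono ?_
  rintro _ ⟨χ, rfl⟩
  exact ⟨halfDeriv χ, toHalf_halfDeriv χ⟩

lemma pair_toHalf (f g : L2 d) : pair (toHalf f) g = pair f (toHalf g) := by
  obtain ⟨T, hT⟩ := exists_transpose (toHalf : L2 d →L[ℂ] L2 d)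
  have h1 : toNegHalf (T f) = toNegHalf (toHalf f) := by
    have h2 : toNegHalf (toHalf f) = (f : 𝓢'(Hor d, ℂ)) := (besselPotential_half_eq_iff _ f).2 rfl
    rw [h2]
    ext χ
    rw [toNegHalf_apply, hT, toHalf_halfDeriv, Lp.toTemperedDistribution_apply, pair]
    refine integral_congr_ae ?_
    filter_upwards [SchwartzMap.coeFn_toLp χ 2 volume] with x hx
    rw [hx, smul_eq_mul, mul_comm]
  rw [← toNegHalf_injective h1, hT]

/-- Continuity of the product with respect to both factors. -/
lemma tendsto_dualMult {a : Hor d → ℝ} {an : ℕ → Hor d → ℝ} {M : ℝ} {T : L2 d → L2 d}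
    {Tn : ℕ → L2 d → L2 d} (hT : IsDualMult a T) (hTn : ∀ n, IsDualMult (an n) (Tn n))
    (h : IsMult a M) (hn : ∀ n, IsMult (an n) M) (hM : 0 ≤ M) {ε : ℕ → ℝ}
    (hε : Tendsto ε atTop (𝓝 0)) (haε : ∀ n, ∀ᵐ x, |an n x - a x| ≤ ε n)
    {b : L2 d} {bn : ℕ → L2 d} (hb : Tendsto bn atTop (𝓝 b)) :
    Tendsto (fun n => Tn n (bn n)) atTop (𝓝 (T b)) := by
  have key : ∀ n f, ‖Tn n (toHalf f) - T (toHalf f)‖ ≤ ε n * ‖f‖ := fun n f => by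
    refine norm_le_of_pair_le fun g => ?_
    obtain ⟨g₁, h1, -⟩ := hn n g
    obtain ⟨g₂, h2, -⟩ := h g
    rw [pair_sub_left, hTn n _ g g₁ h1, hT _ g g₂ h2, pair_toHalf, pair_toHalf, ← pair_sub_right]
    refine (norm_pair_le _ _).trans ?_
    have h3 : ‖toHalf g₁ - toHalf g₂‖ ≤ ε n * ‖toHalf g‖ := by
      refine Lp.norm_le_mul_norm_of_ae_le_mul ?_
      filter_upwards [h1, h2, Lp.coeFn_sub (toHalf g₁) (toHalf g₂), haε n] with x e1 e2 e3 e4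
      rw [e3, Pi.sub_apply, e1, e2, ← sub_mul, norm_mul, ← Complex.ofReal_sub, Complex.norm_real,
        Real.norm_eq_abs]
      gcongr
    have h4 : 0 ≤ ε n := by
      obtain ⟨x, hx⟩ := (haε n).exists
      exact (abs_nonneg _).trans hx
    calc _ ≤ ‖f‖ * (ε n * ‖toHalf g‖) := by gcongr
      _ ≤ ‖f‖ * (ε n * ‖g‖) := by gcongr; exact norm_toHalf_le g
      _ = _ := by ring
  rw [Metric.tendsto_atTop]
  intro r hr
  obtain ⟨f, hf⟩ := denseRange_toHalf.exists_dist_lt b (show 0 < r / (4 * (M + 1)) by positivity)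
  rw [dist_eq_norm] at hf
  have h1 : Tendsto (fun n => M * ‖bn n - b‖ + ε n * ‖f‖) atTop (𝓝 (M * ‖b - b‖ + 0 * ‖f‖)) :=
    ((hb.sub_const b).norm.const_mul M).add (hε.mul_const _)
  rw [sub_self, norm_zero, mul_zero, zero_mul, add_zero] at h1
  obtain ⟨N, hN⟩ := eventually_atTop.1 (h1.eventually (gt_mem_nhds (show 0 < r / 2 by positivity)))
  refine ⟨N, fun n hnN => ?_⟩
  have e1 := (hTn n).norm_sub_le (hn n) (bn n) b
  have e2 := (hTn n).norm_sub_le (hn n) b (toHalf f)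
  have e3 := hT.norm_sub_le h (toHalf f) b
  have e4 := key n f
  have e5 := hN n hnN
  rw [norm_sub_rev (toHalf f) b] at e3
  have e6 : M * ‖b - toHalf f‖ ≤ r / 4 := by
    calc M * ‖b - toHalf f‖ ≤ (M + 1) * (r / (4 * (M + 1))) := by gcongr; linarith
      _ = r / 4 := by field_simp
  rw [dist_eq_norm]
  have e7 : Tn n (bn n) - T b = (Tn n (bn n) - Tn n b) + (Tn n b - Tn n (toHalf f))
      + (Tn n (toHalf f) - T (toHalf f)) + (T (toHalf f) - T b) := by abel
  rw [e7]
  refine (norm_add_le _ _).trans_lt ?_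
  have e8 := norm_add_le (Tn n (bn n) - Tn n b + (Tn n b - Tn n (toHalf f)))
    (Tn n (toHalf f) - T (toHalf f))
  have e9 := norm_add_le (Tn n (bn n) - Tn n b) (Tn n b - Tn n (toHalf f))
  linarith

end WaterWaves

namespace WaterWaves

variable {d : ℕ}

open scoped FourierTransform RealInnerProductSpace

/-! ### Sobolev functions are multipliers of `H^{1/2}` -/

lemma memLp_jw {σ : ℝ} (hσ : (d : ℝ) / 2 < σ) : MemLp (jw (-σ) : Hor d → ℝ) 2 volume := by
  rw [memLp_two_iff_integrable_sq (measurable_jw _).aestronglyMeasurable]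
  have h := integrable_rpow_neg_one_add_norm_sq (E := Hor d) (μ := volume) (r := 2 * σ)
    (by rw [finrank_euclideanSpace, Fintype.card_fin]; linarith)
  refine h.congr (ae_of_all _ fun ξ => ?_)
  simp only
  rw [pow_two (jw (-σ) ξ), ← jw_add, jw]
  ring_nf

lemma lintegral_enorm_mul_le {E F : Type*} [NormedAddCommGroup E] [NormedAddCommGroup F]
    {f : Hor d → E} {g : Hor d → F}
    (hf : AEStronglyMeasurable f volume) (hg : AEStronglyMeasurable g volume) :
    ∫⁻ x, ‖f x‖ₑ * ‖g x‖ₑ ≤ eLpNorm f 2 volume * eLpNorm g 2 volume := by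
  have h := ENNReal.lintegral_mul_le_Lp_mul_Lq volume Real.HolderConjugate.two_two hf.enorm hg.enorm
  rw [eLpNorm_eq_lintegral_rpow_enorm_toReal two_ne_zero ENNReal.ofNat_ne_top,
    eLpNorm_eq_lintegral_rpow_enorm_toReal two_ne_zero ENNReal.ofNat_ne_top]
  simpa using h

lemma jw_half_add_le {σ : ℝ} (hσ : 1 / 2 ≤ σ) (ξ η : Hor d) :
    jw (-σ) η * (jw (-(1 / 2)) ξ * jw (1 / 2) (ξ + η)) ≤ 2 * (jw (-σ) η + jw (-σ) ξ) := by
  have hadd : ∀ {a b c : Hor d}, ‖a‖ ≤ ‖c‖ → ‖b‖ ≤ ‖c‖ → jw (1 / 2) (a + b) ≤ 2 * jw (1 / 2) c := by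
    intro a b c ha hb
    have h1 : 1 + ‖a + b‖ ^ 2 ≤ 4 * (1 + ‖c‖ ^ 2) := by
      have h2 : ‖a + b‖ ≤ 2 * ‖c‖ := (norm_add_le _ _).trans (by linarith)
      have h3 : ‖a + b‖ ^ 2 ≤ (2 * ‖c‖) ^ 2 := by gcongr
      linarith
    have h4 : ((4 : ℝ) * (1 + ‖c‖ ^ 2)) ^ ((1 / 2 : ℝ) / 2) ≤ 2 * jw (1 / 2) c := by
      rw [Real.mul_rpow (by norm_num) (by positivity), jw]
      gcongr
      calc (4 : ℝ) ^ ((1 / 2 : ℝ) / 2) ≤ 4 ^ (1 / 2 : ℝ) :=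
            Real.rpow_le_rpow_of_exponent_le (by norm_num) (by norm_num)
        _ = 2 := by
          rw [← Real.sqrt_eq_rpow, show (4 : ℝ) = 2 ^ 2 by norm_num, Real.sqrt_sq (by norm_num)]
    exact (Real.rpow_le_rpow (by positivity) h1 (by norm_num)).trans h4
  have hη := jw_pos (-σ) η
  have hξ := jw_pos (-σ) ξ
  have hξ' := jw_pos (-(1 / 2)) ξ
  rcases le_total ‖η‖ ‖ξ‖ with h | h
  · have h1 : jw (-(1 / 2)) ξ * jw (1 / 2) (ξ + η) ≤ 2 := by
      calc jw (-(1 / 2)) ξ * jw (1 / 2) (ξ + η) ≤ jw (-(1 / 2)) ξ * (2 * jw (1 / 2) ξ) := by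
            gcongr; exact hadd le_rfl h
        _ = 2 := by rw [mul_left_comm, jw_neg_mul, mul_one]
    calc _ ≤ jw (-σ) η * 2 := by gcongr
      _ ≤ _ := by linarith
  · have h1 : jw (1 / 2 - σ) η ≤ jw (1 / 2 - σ) ξ := by
      unfold jw
      exact Real.rpow_le_rpow_of_nonpos (by positivity) (by gcongr) (by linarith)
    calc _ ≤ jw (-σ) η * (jw (-(1 / 2)) ξ * (2 * jw (1 / 2) η)) := by
          gcongr; exact hadd h le_rfl
      _ = 2 * (jw (-(1 / 2)) ξ * jw (1 / 2 - σ) η) := by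
          rw [sub_eq_neg_add, jw_add]; ring
      _ ≤ 2 * (jw (-(1 / 2)) ξ * jw (1 / 2 - σ) ξ) := by gcongr
      _ = 2 * jw (-σ) ξ := by rw [← jw_add]; ring_nf
      _ ≤ _ := by linarith

section

variable {σ : ℝ} {u A : L2 d}

lemma enorm_fourier_eq (hu : (𝓕 u : L2 d) =ᵐ[volume] fun ξ => (jw (-σ) ξ : ℂ) * A ξ) :
    ∀ᵐ ξ, ‖(𝓕 u : L2 d) ξ‖ₑ = ‖jw (-σ) ξ‖ₑ * ‖A ξ‖ₑ := by
  filter_upwards [hu] with ξ hξ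
  rw [hξ, enorm_mul, ← ofReal_norm, Complex.norm_real, ofReal_norm]

lemma lintegral_fourier_le (hu : (𝓕 u : L2 d) =ᵐ[volume] fun ξ => (jw (-σ) ξ : ℂ) * A ξ) :
    ∫⁻ ξ, ‖(𝓕 u : L2 d) ξ‖ₑ ≤ eLpNorm (jw (-σ) : Hor d → ℝ) 2 volume * ‖A‖ₑ := by
  rw [lintegral_congr_ae (enorm_fourier_eq hu), Lp.enorm_def]
  exact lintegral_enorm_mul_le (measurable_jw _).aestronglyMeasurable (L2.aesm A)

lemma integrable_fourier (hσ : (d : ℝ) / 2 < σ)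
    (hu : (𝓕 u : L2 d) =ᵐ[volume] fun ξ => (jw (-σ) ξ : ℂ) * A ξ) :
    Integrable (𝓕 u : L2 d) volume :=
  ⟨L2.aesm _, (lintegral_fourier_le hu).trans_lt
    (ENNReal.mul_lt_top (memLp_jw hσ).2 (by simp))⟩

lemma ae_eq_fourierInv (hσ : (d : ℝ) / 2 < σ)
    (hu : (𝓕 u : L2 d) =ᵐ[volume] fun ξ => (jw (-σ) ξ : ℂ) * A ξ) :
    u =ᵐ[volume] 𝓕⁻ ((𝓕 u : L2 d) : Hor d → ℂ) := by
  have h := fourierInv_toLp_ae_eq (integrable_fourier hσ hu) (Lp.memLp (𝓕 u : L2 d))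
  rwa [Lp.toLp_coeFn, FourierTransform.fourierInv_fourier_eq] at h

/-- The norm in `L²` of the weight `⟨ξ⟩^{-σ}`. -/
noncomputable def weightNorm (d : ℕ) (σ : ℝ) : ℝ := (eLpNorm (jw (-σ) : Hor d → ℝ) 2 volume).toReal

lemma weightNorm_nonneg : 0 ≤ weightNorm d σ := ENNReal.toReal_nonneg

lemma ofReal_weightNorm (hσ : (d : ℝ) / 2 < σ) :
    eLpNorm (jw (-σ) : Hor d → ℝ) 2 volume = ENNReal.ofReal (weightNorm d σ) :=
  (ENNReal.ofReal_toReal (memLp_jw hσ).2.ne).symm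

lemma ae_norm_le_of_sobolev (hσ : (d : ℝ) / 2 < σ)
    (hu : (𝓕 u : L2 d) =ᵐ[volume] fun ξ => (jw (-σ) ξ : ℂ) * A ξ) :
    ∀ᵐ x, ‖u x‖ ≤ weightNorm d σ * ‖A‖ := by
  filter_upwards [ae_eq_fourierInv hσ hu] with x hx
  have h1 : ‖u x‖ₑ ≤ ENNReal.ofReal (weightNorm d σ * ‖A‖) := by
    rw [hx, Real.fourierInv_eq, ENNReal.ofReal_mul weightNorm_nonneg, ← ofReal_weightNorm hσ,
      ofReal_norm]
    refine (enorm_integral_le_lintegral_enorm _).trans ((lintegral_mono fun ξ => ?_).trans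
      (lintegral_fourier_le hu))
    rw [Circle.smul_def, enorm_smul, ← ofReal_norm (E := ℂ), Circle.norm_coe, ENNReal.ofReal_one,
      one_mul]
  rw [← ofReal_norm] at h1
  exact (ENNReal.ofReal_le_ofReal_iff (mul_nonneg weightNorm_nonneg (norm_nonneg _))).1 h1

lemma lintegral_translate_mul_le {f g : Hor d → ℂ} (hf : AEStronglyMeasurable f volume)
    (hg : AEStronglyMeasurable g volume) (η : Hor d) :
    ∫⁻ ξ, ‖f ξ‖ₑ * ‖g (ξ + η)‖ₑ ≤ eLpNorm f 2 volume * eLpNorm g 2 volume := by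
  have hp := measurePreserving_add_right (volume : Measure (Hor d)) η
  refine (lintegral_enorm_mul_le hf (hg.comp_measurePreserving hp)).trans_eq ?_
  rw [← eLpNorm_comp_measurePreserving hg hp]

/-- The estimate of the paraproduct decomposition, for the trilinear form. -/
lemma lintegral_trilinear_le (hσ : (d : ℝ) / 2 < σ) (hσ' : 1 / 2 ≤ σ)
    (hu : (𝓕 u : L2 d) =ᵐ[volume] fun ξ => (jw (-σ) ξ : ℂ) * A ξ) (g : L2 d) {p p₀ : Hor d → ℂ}
    (hp₀ : Continuous p₀) (hp : ∀ ξ, p ξ = (jw (1 / 2) ξ : ℂ) * p₀ ξ) :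
    ∫⁻ η, ∫⁻ ξ, ‖(𝓕 u : L2 d) η‖ₑ * (‖(𝓕 (toHalf g) : L2 d) ξ‖ₑ * ‖p (ξ + η)‖ₑ)
      ≤ ENNReal.ofReal (4 * weightNorm d σ * ‖A‖ * ‖g‖) * eLpNorm p₀ 2 volume := by
  set G : Hor d → ℂ := ⇑(𝓕 g : L2 d) with hG
  have hGm : StronglyMeasurable G := Lp.stronglyMeasurable _
  have hAm : StronglyMeasurable A := Lp.stronglyMeasurable _
  have hjm : Measurable (jw (-σ) : Hor d → ℝ) := measurable_jw _
  have hGn : eLpNorm G 2 volume = ‖g‖ₑ := by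
    rw [hG, ← Lp.enorm_def, ← ofReal_norm, Lp.norm_fourier_eq, ofReal_norm]
  have hpm : Measurable fun w : Hor d × Hor d => ‖p₀ (w.2 + w.1)‖ₑ :=
    (hp₀.comp (continuous_snd.add continuous_fst)).enorm.measurable
  have hpt : ∀ᵐ η, ∀ᵐ ξ, ‖(𝓕 u : L2 d) η‖ₑ * (‖(𝓕 (toHalf g) : L2 d) ξ‖ₑ * ‖p (ξ + η)‖ₑ)
      ≤ 2 * (‖jw (-σ) η‖ₑ * ‖A η‖ₑ * (‖G ξ‖ₑ * ‖p₀ (ξ + η)‖ₑ)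
        + ‖A η‖ₑ * (‖jw (-σ) ξ‖ₑ * ‖G ξ‖ₑ * ‖p₀ (ξ + η)‖ₑ)) := by
    filter_upwards [hu] with η hη
    filter_upwards [fourier_bessel neg_half_nonpos g] with ξ hξ
    rw [hη, toHalf, hξ, hp]
    have hr : ∀ s (ζ : Hor d), ‖(jw s ζ : ℂ)‖ₑ = ENNReal.ofReal (jw s ζ) := fun s ζ => by
      rw [← ofReal_norm, Complex.norm_real, Real.norm_of_nonneg (jw_pos _ _).le]
    have hr' : ∀ s (ζ : Hor d), ‖jw s ζ‖ₑ = ENNReal.ofReal (jw s ζ) := fun s ζ =>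
      Real.enorm_of_nonneg (jw_pos _ _).le
    simp only [enorm_mul, hr, hr']
    have h1 := ENNReal.ofReal_le_ofReal (jw_half_add_le hσ' ξ η)
    rw [ENNReal.ofReal_mul (jw_pos _ _).le, ENNReal.ofReal_mul (jw_pos _ _).le,
      ENNReal.ofReal_mul zero_le_two, ENNReal.ofReal_add (jw_pos _ _).le (jw_pos _ _).le,
      ENNReal.ofReal_ofNat] at h1
    calc _ = (ENNReal.ofReal (jw (-σ) η) * (ENNReal.ofReal (jw (-(1 / 2)) ξ)
          * ENNReal.ofReal (jw (1 / 2) (ξ + η)))) * (‖A η‖ₑ * ‖G ξ‖ₑ * ‖p₀ (ξ + η)‖ₑ) := by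
          rw [hG]; ring
      _ ≤ 2 * (ENNReal.ofReal (jw (-σ) η) + ENNReal.ofReal (jw (-σ) ξ))
          * (‖A η‖ₑ * ‖G ξ‖ₑ * ‖p₀ (ξ + η)‖ₑ) := by gcongr
      _ = _ := by ring
  have hI₁ : ∫⁻ η, ∫⁻ ξ, ‖jw (-σ) η‖ₑ * ‖A η‖ₑ * (‖G ξ‖ₑ * ‖p₀ (ξ + η)‖ₑ)
      ≤ ENNReal.ofReal (weightNorm d σ * ‖A‖ * ‖g‖) * eLpNorm p₀ 2 volume := by
    calc _ ≤ ∫⁻ η, ‖jw (-σ) η‖ₑ * ‖A η‖ₑ * (‖g‖ₑ * eLpNorm p₀ 2 volume) := by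
          refine lintegral_mono fun η => ?_
          have hm : Measurable fun ξ => ‖G ξ‖ₑ * ‖p₀ (ξ + η)‖ₑ :=
            hGm.enorm.mul (hp₀.comp (continuous_id.add continuous_const)).enorm.measurable
          rw [lintegral_const_mul _ hm, ← hGn]
          gcongr
          exact lintegral_translate_mul_le hGm.aestronglyMeasurable hp₀.aestronglyMeasurable η
      _ = (∫⁻ η, ‖jw (-σ) η‖ₑ * ‖A η‖ₑ) * (‖g‖ₑ * eLpNorm p₀ 2 volume) :=
          lintegral_mul_const _ (hjm.enorm.mul hAm.enorm)
      _ ≤ (ENNReal.ofReal (weightNorm d σ) * ‖A‖ₑ) * (‖g‖ₑ * eLpNorm p₀ 2 volume) := by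
          gcongr
          rw [← ofReal_weightNorm hσ, Lp.enorm_def]
          exact lintegral_enorm_mul_le hjm.aestronglyMeasurable hAm.aestronglyMeasurable
      _ = _ := by
          rw [ENNReal.ofReal_mul (mul_nonneg weightNorm_nonneg (norm_nonneg _)),
            ENNReal.ofReal_mul weightNorm_nonneg, ofReal_norm, ofReal_norm, mul_assoc, mul_assoc,
            mul_assoc]
  have hm₂ : Measurable fun w : Hor d × Hor d =>
      ‖A w.1‖ₑ * (‖jw (-σ) w.2‖ₑ * ‖G w.2‖ₑ * ‖p₀ (w.2 + w.1)‖ₑ) :=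
    (hAm.enorm.comp measurable_fst).mul (((hjm.enorm.comp measurable_snd).mul
      (hGm.enorm.comp measurable_snd)).mul hpm)
  have hI₂ : ∫⁻ η, ∫⁻ ξ, ‖A η‖ₑ * (‖jw (-σ) ξ‖ₑ * ‖G ξ‖ₑ * ‖p₀ (ξ + η)‖ₑ)
      ≤ ENNReal.ofReal (weightNorm d σ * ‖A‖ * ‖g‖) * eLpNorm p₀ 2 volume := by
    rw [lintegral_lintegral_swap hm₂.aemeasurable]
    calc _ = ∫⁻ ξ, ∫⁻ η, ‖jw (-σ) ξ‖ₑ * ‖G ξ‖ₑ * (‖A η‖ₑ * ‖p₀ (η + ξ)‖ₑ) := by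
          refine lintegral_congr fun ξ => lintegral_congr fun η => ?_
          rw [add_comm η ξ]; ring
      _ ≤ ∫⁻ ξ, ‖jw (-σ) ξ‖ₑ * ‖G ξ‖ₑ * (‖A‖ₑ * eLpNorm p₀ 2 volume) := by
          refine lintegral_mono fun ξ => ?_
          have hm : Measurable fun η => ‖A η‖ₑ * ‖p₀ (η + ξ)‖ₑ :=
            hAm.enorm.mul (hp₀.comp (continuous_id.add continuous_const)).enorm.measurable
          rw [lintegral_const_mul _ hm, Lp.enorm_def]
          gcongr
          exact lintegral_translate_mul_le hAm.aestronglyMeasurable hp₀.aestronglyMeasurable ξ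
      _ = (∫⁻ ξ, ‖jw (-σ) ξ‖ₑ * ‖G ξ‖ₑ) * (‖A‖ₑ * eLpNorm p₀ 2 volume) :=
          lintegral_mul_const _ (hjm.enorm.mul hGm.enorm)
      _ ≤ (ENNReal.ofReal (weightNorm d σ) * ‖g‖ₑ) * (‖A‖ₑ * eLpNorm p₀ 2 volume) := by
          gcongr
          rw [← ofReal_weightNorm hσ, ← hGn]
          exact lintegral_enorm_mul_le hjm.aestronglyMeasurable hGm.aestronglyMeasurable
      _ = _ := by
          rw [ENNReal.ofReal_mul (mul_nonneg weightNorm_nonneg (norm_nonneg _)),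
            ENNReal.ofReal_mul weightNorm_nonneg, ofReal_norm, ofReal_norm]
          ring
  have hm₁ : Measurable fun w : Hor d × Hor d =>
      ‖jw (-σ) w.1‖ₑ * ‖A w.1‖ₑ * (‖G w.2‖ₑ * ‖p₀ (w.2 + w.1)‖ₑ) :=
    ((hjm.enorm.comp measurable_fst).mul (hAm.enorm.comp measurable_fst)).mul
      ((hGm.enorm.comp measurable_snd).mul hpm)
  calc _ ≤ ∫⁻ η, ∫⁻ ξ, 2 * (‖jw (-σ) η‖ₑ * ‖A η‖ₑ * (‖G ξ‖ₑ * ‖p₀ (ξ + η)‖ₑ)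
        + ‖A η‖ₑ * (‖jw (-σ) ξ‖ₑ * ‖G ξ‖ₑ * ‖p₀ (ξ + η)‖ₑ)) := by
        refine lintegral_mono_ae ?_
        filter_upwards [hpt] with η hη
        exact lintegral_mono_ae hη
    _ = 2 * ((∫⁻ η, ∫⁻ ξ, ‖jw (-σ) η‖ₑ * ‖A η‖ₑ * (‖G ξ‖ₑ * ‖p₀ (ξ + η)‖ₑ))
        + ∫⁻ η, ∫⁻ ξ, ‖A η‖ₑ * (‖jw (-σ) ξ‖ₑ * ‖G ξ‖ₑ * ‖p₀ (ξ + η)‖ₑ)) := by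
        rw [← lintegral_add_left hm₁.lintegral_prod_right', ← lintegral_const_mul' _ _ (by simp)]
        refine lintegral_congr fun η => ?_
        rw [lintegral_const_mul' _ _ (by simp)]
        congr 1
        exact lintegral_add_left (hm₁.comp (measurable_prodMk_left (x := η))) _
    _ ≤ 2 * (ENNReal.ofReal (weightNorm d σ * ‖A‖ * ‖g‖) * eLpNorm p₀ 2 volume
        + ENNReal.ofReal (weightNorm d σ * ‖A‖ * ‖g‖) * eLpNorm p₀ 2 volume) := by
        gcongr
    _ = _ := by
        rw [mul_assoc 4, mul_assoc 4, ENNReal.ofReal_mul (by norm_num : (0 : ℝ) ≤ 4),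
          ENNReal.ofReal_ofNat, ← two_mul, ← mul_assoc, ← mul_assoc]
        norm_num

/-- A function of `H^σ`, `σ > d / 2`, is a multiplier of `H^{1/2}`. -/
lemma isMult_of_sobolev (hσ : (d : ℝ) / 2 < σ) (hσ' : 1 / 2 ≤ σ)
    (hu : (𝓕 u : L2 d) =ᵐ[volume] fun ξ => (jw (-σ) ξ : ℂ) * A ξ) {a : Hor d → ℝ}
    (ha : u =ᵐ[volume] fun x => (a x : ℂ)) : IsMult a (4 * weightNorm d σ * ‖A‖) := by
  intro g
  set C : ℝ := 4 * weightNorm d σ * ‖A‖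
  have hC : 0 ≤ C := by have := weightNorm_nonneg (d := d) (σ := σ); positivity
  set v : L2 d := mulL2 (L2.aesm u) (ae_norm_le_of_sobolev hσ hu) (toHalf g)
  have hv : v =ᵐ[volume] fun x => u x * toHalf g x := coeFn_mulL2 _ _ _
  have hbound : ∀ χ : 𝓢(Hor d, ℂ), ‖toNegHalf v χ‖ ≤ C * ‖g‖ * ‖χ.toLp 2 (volume : Measure (Hor d))‖ := by
    intro χ
    set p₀ : 𝓢(Hor d, ℂ) := 𝓕⁻ χ
    set p : 𝓢(Hor d, ℂ) := SchwartzMap.smulLeftCLM ℂ (fun ξ : Hor d => (jw (1 / 2) ξ : ℂ)) p₀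
    have hp : ∀ ξ, p ξ = (jw (1 / 2) ξ : ℂ) * p₀ ξ := fun ξ =>
      SchwartzMap.smulLeftCLM_apply_apply (hasTemperateGrowth_jw _) p₀ ξ
    have e1 : toNegHalf v χ = ∫ x, u x * toHalf g x * (𝓕 p : 𝓢(Hor d, ℂ)) x := by
      rw [toNegHalf_apply, pair, halfDeriv, fourierMultiplier_jw_eq]
      refine integral_congr_ae ?_
      filter_upwards [hv, SchwartzMap.coeFn_toLp (𝓕 p : 𝓢(Hor d, ℂ)) 2 volume] with x hx hx'
      rw [hx, hx']
    have e2 : eLpNorm p₀ 2 volume = ‖χ.toLp 2 (volume : Measure (Hor d))‖ₑ := by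
      have e3 : (𝓕⁻ χ : 𝓢(Hor d, ℂ)).toLp 2 (volume : Measure (Hor d)) = 𝓕⁻ (χ.toLp 2) :=
        (SchwartzMap.toLp_fourierInv_eq χ).symm
      rw [← ofReal_norm, ← Lp.norm_fourierInv_eq', ← e3, ofReal_norm, Lp.enorm_def]
      exact eLpNorm_congr_ae (SchwartzMap.coeFn_toLp _ 2 volume).symm
    have e4 := (enorm_integral_mul_mul_le (integrable_fourier hσ hu) (ae_eq_fourierInv hσ hu)
      (toHalf g) p).trans (lintegral_trilinear_le hσ hσ' hu g p₀.continuous hp)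
    rw [← e1, e2, ← ofReal_norm, ← ofReal_norm, ← ENNReal.ofReal_mul (by positivity)] at e4
    exact (ENNReal.ofReal_le_ofReal_iff (by positivity)).1 e4
  have hdense : DenseRange (SchwartzMap.toLpCLM ℂ ℂ 2 (volume : Measure (Hor d))) :=
    SchwartzMap.denseRange_toLpCLM ENNReal.ofNat_ne_top
  set ℓ : 𝓢(Hor d, ℂ) →ₗ[ℂ] ℂ :=
    { toFun := fun χ => toNegHalf v χ
      map_add' := fun χ χ' => map_add _ χ χ'
      map_smul' := fun c χ => map_smul _ c χ }
  set e : 𝓢(Hor d, ℂ) →ₗ[ℂ] L2 d := (SchwartzMap.toLpCLM ℂ ℂ 2 (volume : Measure (Hor d)) :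
    𝓢(Hor d, ℂ) →L[ℂ] L2 d).toLinearMap
  have hde : DenseRange e := hdense
  obtain ⟨b, hb⟩ := exists_pair_eq (ℓ.extendOfNorm e)
  have hbv : toNegHalf v = (b : 𝓢'(Hor d, ℂ)) := by
    ext χ
    have h1 : ℓ.extendOfNorm e (e χ) = ℓ χ := LinearMap.extendOfNorm_eq hde ⟨_, hbound⟩ χ
    rw [← hb, pair] at h1
    have h2 : toNegHalf v χ = ℓ χ := rfl
    rw [h2, ← h1, Lp.toTemperedDistribution_apply]
    refine integral_congr_ae ?_
    filter_upwards [SchwartzMap.coeFn_toLp χ 2 volume] with x hx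
    have h3 : (e χ : Hor d → ℂ) x = χ x := hx
    rw [h3, smul_eq_mul, mul_comm]
  have hvb : v = toHalf b := (besselPotential_half_eq_iff v b).1 hbv
  refine ⟨b, ?_, norm_le_of_pair_le fun k => ?_⟩
  · rw [← hvb]
    filter_upwards [hv, ha] with x hx hx'
    rw [hx, hx']
  · rw [hb]
    exact LinearMap.norm_extendOfNorm_apply_le hde _ hbound k

end

end WaterWaves

namespace WaterWaves

variable {d : ℕ}

open scoped FourierTransform RealInnerProductSpace

/-! ### The Gagliardo energy along the coordinate axes -/

/-- The quadratic energy `∑ᵢ ∫₀^∞ ‖f(· + t eᵢ) - f‖² t⁻² dt`. -/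
noncomputable def axisEnergy (f : Hor d → ℂ) : ℝ≥0∞ :=
  ∑ i, ∫⁻ t in Set.Ioi (0 : ℝ), ENNReal.ofReal (t ^ 2)⁻¹ *
    ∫⁻ x, ‖f (x + t • basisVec i) - f x‖ₑ ^ 2

/-- The Fourier symbol of the energy in one direction. -/
noncomputable def axisSymbol (a : ℝ) : ℝ≥0∞ :=
  ∫⁻ t in Set.Ioi (0 : ℝ), ENNReal.ofReal (t ^ 2)⁻¹ * ‖(Real.fourierChar (t * a) : ℂ) - 1‖ₑ ^ 2

lemma norm_fourierChar_sub_one (s : ℝ) :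
    ‖(Real.fourierChar s : ℂ) - 1‖ = 2 * |Real.sin (Real.pi * s)| := by
  rw [Real.fourierChar_apply, mul_comm, Complex.norm_exp_I_mul_ofReal_sub_one, norm_mul,
    Real.norm_eq_abs, Real.norm_eq_abs, abs_two]
  congr 3
  ring

lemma enorm_fourierChar_sub_one_sq (s : ℝ) : ‖(Real.fourierChar s : ℂ) - 1‖ₑ ^ 2
    = ENNReal.ofReal (4 * Real.sin (Real.pi * s) ^ 2) := by
  rw [← ofReal_norm, ← ENNReal.ofReal_pow (norm_nonneg _), norm_fourierChar_sub_one, mul_pow, sq_abs]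
  norm_num

lemma lintegral_Ioi_inv_sq {c : ℝ} (hc : 0 < c) :
    ∫⁻ t in Set.Ioi c, ENNReal.ofReal (t ^ 2)⁻¹ = ENNReal.ofReal c⁻¹ := by
  have h1 := integrableOn_Ioi_rpow_of_lt (a := -2) (by norm_num) hc
  have h2 := integral_Ioi_rpow_of_lt (a := -2) (by norm_num) hc
  have h3 : ∀ t ∈ Set.Ioi c, (t ^ 2)⁻¹ = t ^ (-2 : ℝ) := fun t ht => by
    rw [Real.rpow_neg (hc.trans ht).le, Real.rpow_two]
  rw [setLIntegral_congr_fun measurableSet_Ioi fun t ht => by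
      simp only [h3 t ht]; rfl,
    ← ofReal_integral_eq_lintegral_ofReal h1, h2]
  · congr 1
    rw [show (-2 : ℝ) + 1 = -1 by norm_num, Real.rpow_neg_one]
    ring
  · filter_upwards [ae_restrict_mem measurableSet_Ioi] with t ht
    exact Real.rpow_nonneg (hc.trans ht).le _

lemma axisSymbol_le (a : ℝ) :
    axisSymbol a ≤ ENNReal.ofReal ((4 * Real.pi ^ 2 + 4) * |a|) := by
  rcases eq_or_ne a 0 with rfl | ha
  · simp [axisSymbol]
  have ha' : 0 < |a| := abs_pos.2 ha
  have h0 : 0 < |a|⁻¹ := inv_pos.2 ha'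
  rw [axisSymbol, ← Set.Ioc_union_Ioi_eq_Ioi h0.le]
  refine (lintegral_union_le _ _ _).trans ?_
  have e1 : ∫⁻ t in Set.Ioc 0 |a|⁻¹, ENNReal.ofReal (t ^ 2)⁻¹ *
      ‖(Real.fourierChar (t * a) : ℂ) - 1‖ₑ ^ 2 ≤ ENNReal.ofReal (4 * Real.pi ^ 2 * |a|) := by
    calc _ ≤ ∫⁻ t in Set.Ioc 0 |a|⁻¹, ENNReal.ofReal (4 * Real.pi ^ 2 * a ^ 2) := by
          refine setLIntegral_mono' measurableSet_Ioc fun t ht => ?_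
          have ht0 : t ^ 2 ≠ 0 := by have := ht.1; positivity
          rw [enorm_fourierChar_sub_one_sq, ← ENNReal.ofReal_mul (by positivity)]
          refine ENNReal.ofReal_le_ofReal ?_
          have h1 : Real.sin (Real.pi * (t * a)) ^ 2 ≤ (Real.pi * (t * a)) ^ 2 :=
            sq_le_sq.2 Real.abs_sin_le_abs
          calc (t ^ 2)⁻¹ * (4 * Real.sin (Real.pi * (t * a)) ^ 2)
              ≤ (t ^ 2)⁻¹ * (4 * (Real.pi * (t * a)) ^ 2) := by gcongr
            _ = (t ^ 2)⁻¹ * t ^ 2 * (4 * Real.pi ^ 2 * a ^ 2) := by ring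
            _ = _ := by rw [inv_mul_cancel₀ ht0, one_mul]
      _ = _ := by
          rw [setLIntegral_const, Real.volume_Ioc, sub_zero, ← ENNReal.ofReal_mul (by positivity),
            ← sq_abs a]
          congr 1
          field_simp
  have e2 : ∫⁻ t in Set.Ioi |a|⁻¹, ENNReal.ofReal (t ^ 2)⁻¹ *
      ‖(Real.fourierChar (t * a) : ℂ) - 1‖ₑ ^ 2 ≤ ENNReal.ofReal (4 * |a|) := by
    calc _ ≤ ∫⁻ t in Set.Ioi |a|⁻¹, ENNReal.ofReal (t ^ 2)⁻¹ * ENNReal.ofReal 4 := by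
          refine lintegral_mono fun t => ?_
          rw [enorm_fourierChar_sub_one_sq]
          gcongr
          have := Real.sin_sq_le_one (Real.pi * (t * a))
          linarith
      _ = _ := by
          rw [lintegral_mul_const' _ _ ENNReal.ofReal_ne_top, lintegral_Ioi_inv_sq h0, inv_inv,
            ← ENNReal.ofReal_mul (abs_nonneg _), mul_comm]
  refine (add_le_add e1 e2).trans_eq ?_
  rw [← ENNReal.ofReal_add (by positivity) (by positivity)]
  ring_nf

lemma le_axisSymbol (a : ℝ) : ENNReal.ofReal |a| ≤ axisSymbol a := by
  rcases eq_or_ne a 0 with rfl | ha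
  · simp
  have ha' : 0 < |a| := abs_pos.2 ha
  have h0 : 0 < (2 * |a|)⁻¹ := by positivity
  calc ENNReal.ofReal |a| ≤ ENNReal.ofReal (16 * a ^ 2 * (2 * |a|)⁻¹) := by
        refine ENNReal.ofReal_le_ofReal ?_
        rw [← sq_abs a]
        have : 16 * |a| ^ 2 * (2 * |a|)⁻¹ = 8 * |a| := by field_simp; norm_num
        rw [this]; linarith
    _ = ∫⁻ t in Set.Ioc 0 (2 * |a|)⁻¹, ENNReal.ofReal (16 * a ^ 2) := by
        rw [setLIntegral_const, Real.volume_Ioc, sub_zero, ← ENNReal.ofReal_mul (by positivity)]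
    _ ≤ ∫⁻ t in Set.Ioc 0 (2 * |a|)⁻¹, ENNReal.ofReal (t ^ 2)⁻¹ *
        ‖(Real.fourierChar (t * a) : ℂ) - 1‖ₑ ^ 2 := by
        refine setLIntegral_mono' measurableSet_Ioc fun t ht => ?_
        have ht0 : t ^ 2 ≠ 0 := by have := ht.1; positivity
        rw [enorm_fourierChar_sub_one_sq, ← ENNReal.ofReal_mul (by positivity)]
        refine ENNReal.ofReal_le_ofReal ?_
        have h1 : 2 * (t * |a|) ≤ Real.sin (Real.pi * (t * |a|)) := by
          have h2 : t * |a| ≤ 1 / 2 := by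
            have := mul_le_mul_of_nonneg_right ht.2 ha'.le
            refine this.trans_eq ?_
            field_simp
          have h3 := Real.mul_le_sin (x := Real.pi * (t * |a|))
            (by have := ht.1; positivity) (by nlinarith [Real.pi_pos])
          refine le_trans (le_of_eq ?_) h3
          field_simp
        have h4 : Real.sin (Real.pi * (t * a)) ^ 2 = Real.sin (Real.pi * (t * |a|)) ^ 2 := by
          rcases abs_choice a with h | h <;> rw [h]
          rw [mul_neg, mul_neg, Real.sin_neg, neg_sq]
        have h5 : (2 * (t * |a|)) ^ 2 ≤ Real.sin (Real.pi * (t * |a|)) ^ 2 := by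
          have := ht.1
          gcongr
        rw [h4]
        calc 16 * a ^ 2 = (t ^ 2)⁻¹ * t ^ 2 * (16 * a ^ 2) := by
              rw [inv_mul_cancel₀ ht0, one_mul]
          _ = (t ^ 2)⁻¹ * (4 * (2 * (t * |a|)) ^ 2) := by
              rw [mul_pow, mul_pow, sq_abs]; ring
          _ ≤ _ := by gcongr
    _ ≤ axisSymbol a := lintegral_mono_set Set.Ioc_subset_Ioi_self

lemma axisEnergy_congr_ae {f g : Hor d → ℂ} (h : f =ᵐ[volume] g) : axisEnergy f = axisEnergy g := by
  unfold axisEnergy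
  refine Finset.sum_congr rfl fun i _ => lintegral_congr fun t => ?_
  congr 1
  refine lintegral_congr_ae ?_
  have h2 := (measurePreserving_add_right (volume : Measure (Hor d))
    (t • basisVec i)).quasiMeasurePreserving.ae_eq_comp h
  filter_upwards [h, h2] with x hx hx'
  simp only [Function.comp_apply] at hx'
  rw [hx, hx']

lemma axisEnergy_eq (f : L2 d) :
    axisEnergy f = ∑ i, ∫⁻ ξ : Hor d, axisSymbol (ξ i) * ‖(𝓕 f : L2 d) ξ‖ₑ ^ 2 := by
  unfold axisEnergy
  refine Finset.sum_congr rfl fun i _ => ?_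
  have hF : StronglyMeasurable (𝓕 f : L2 d) := Lp.stronglyMeasurable _
  have hc : Continuous fun w : ℝ × Hor d => (Real.fourierChar (w.1 * w.2 i) : ℂ) - 1 :=
    (continuous_subtype_val.comp (Real.continuous_fourierChar.comp (by fun_prop))).sub
      continuous_const
  have hw : Measurable fun t : ℝ => ENNReal.ofReal (t ^ 2)⁻¹ := by fun_prop
  have hm : Measurable fun w : ℝ × Hor d => ENNReal.ofReal (w.1 ^ 2)⁻¹ *
      (‖(Real.fourierChar (w.1 * w.2 i) : ℂ) - 1‖ₑ ^ 2 * ‖(𝓕 f : L2 d) w.2‖ₑ ^ 2) :=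
    (hw.comp measurable_fst).mul ((hc.enorm.measurable.pow_const 2).mul
      ((hF.enorm.pow_const 2).comp measurable_snd))
  have e1 : ∀ t : ℝ, ENNReal.ofReal (t ^ 2)⁻¹ * ∫⁻ x, ‖f (x + t • basisVec i) - f x‖ₑ ^ 2
      = ∫⁻ ξ : Hor d, ENNReal.ofReal (t ^ 2)⁻¹ *
        (‖(Real.fourierChar (t * ξ i) : ℂ) - 1‖ₑ ^ 2 * ‖(𝓕 f : L2 d) ξ‖ₑ ^ 2) := fun t => by
    rw [lintegral_const_mul' _ _ ENNReal.ofReal_ne_top, lintegral_translate_sub]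
    congr 1
    refine lintegral_congr fun ξ => ?_
    rw [real_inner_smul_left, basisVec, EuclideanSpace.inner_single_left]
    simp
  simp only [e1]
  rw [lintegral_lintegral_swap hm.aemeasurable]
  refine lintegral_congr fun ξ => ?_
  rw [axisSymbol, ← lintegral_mul_const']
  · refine lintegral_congr fun t => ?_
    rw [mul_assoc]
  · simp

/-- The constant in the upper bound for the energy. -/
noncomputable def energyConst (d : ℕ) : ℝ := d * (4 * Real.pi ^ 2 + 4)

lemma energyConst_nonneg (d : ℕ) : 0 ≤ energyConst d := by unfold energyConst; positivity

lemma axisEnergy_toHalf_le (g : L2 d) :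
    axisEnergy (toHalf g) ≤ ENNReal.ofReal (energyConst d) * ‖g‖ₑ ^ 2 := by
  rw [axisEnergy_eq]
  have h1 : ∀ i : Fin d, ∫⁻ ξ : Hor d, axisSymbol (ξ i) * ‖(𝓕 (toHalf g) : L2 d) ξ‖ₑ ^ 2
      ≤ ENNReal.ofReal (4 * Real.pi ^ 2 + 4) * ‖g‖ₑ ^ 2 := fun i => by
    rw [← ofReal_norm g, ← Lp.norm_fourier_eq, ofReal_norm, Lp_enorm_sq,
      ← lintegral_const_mul' _ _ ENNReal.ofReal_ne_top]
    refine lintegral_mono_ae ?_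
    filter_upwards [fourier_bessel neg_half_nonpos g] with ξ hξ
    rw [toHalf, hξ, enorm_mul, mul_pow, ← mul_assoc]
    gcongr
    have h2 : ‖(jw (-(1 / 2)) ξ : ℂ)‖ₑ ^ 2 = ENNReal.ofReal (jw (-1) ξ) := by
      rw [← ofReal_norm, Complex.norm_real, Real.norm_of_nonneg (jw_pos _ _).le,
        ← ENNReal.ofReal_pow (jw_pos _ _).le, sq, ← jw_add]
      norm_num
    rw [h2]
    calc _ ≤ ENNReal.ofReal ((4 * Real.pi ^ 2 + 4) * |ξ i|) * ENNReal.ofReal (jw (-1) ξ) := by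
          gcongr; exact axisSymbol_le _
      _ ≤ _ := by
          rw [← ENNReal.ofReal_mul (by positivity)]
          refine ENNReal.ofReal_le_ofReal ?_
          have h3 : |ξ i| ≤ jw 1 ξ := (PiLp.norm_apply_le ξ i).trans (norm_le_jw_one ξ)
          have h4 := jw_pos (-1) ξ
          calc _ ≤ (4 * Real.pi ^ 2 + 4) * jw 1 ξ * jw (-1) ξ := by gcongr
            _ = _ := by rw [mul_assoc, mul_comm (jw 1 ξ), jw_neg_mul, mul_one]
  refine (Finset.sum_le_sum fun i _ => h1 i).trans_eq ?_
  rw [Finset.sum_const, Finset.card_univ, Fintype.card_fin, nsmul_eq_mul, energyConst,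
    ENNReal.ofReal_mul (by positivity), ENNReal.ofReal_natCast, mul_assoc]

lemma jw_one_le (ξ : Hor d) : jw 1 ξ ≤ 1 + ∑ i, |ξ i| := by
  have h1 : ‖ξ‖ ≤ ∑ i, |ξ i| := by
    have h2 : ξ = ∑ i, ξ i • basisVec i := by
      ext j
      simp [basisVec, Finset.sum_apply, Pi.single_apply]
    calc ‖ξ‖ = ‖∑ i, ξ i • (basisVec i : Hor d)‖ := by rw [← h2]
      _ ≤ ∑ i, ‖ξ i • (basisVec i : Hor d)‖ := norm_sum_le _ _
      _ = _ := by simp [norm_smul, basisVec]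
  have h3 : jw 1 ξ ≤ 1 + ‖ξ‖ := by
    refine le_of_sq_le_sq ?_ (by positivity)
    rw [pow_two (jw 1 ξ), ← jw_add, show (1 : ℝ) + 1 = 2 by norm_num, jw_two]
    nlinarith [norm_nonneg ξ]
  linarith

lemma exists_toHalf_of_axisEnergy (f : L2 d) (h : axisEnergy f < ⊤) :
    ∃ g, f = toHalf g ∧ ‖g‖ₑ ^ 2 ≤ ‖f‖ₑ ^ 2 + axisEnergy f := by
  have hF : StronglyMeasurable (𝓕 f : L2 d) := Lp.stronglyMeasurable _
  set G : Hor d → ℂ := fun ξ => (jw (1 / 2) ξ : ℂ) * (𝓕 f : L2 d) ξ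
  have hGm : AEStronglyMeasurable G volume := (aestronglyMeasurable_jw _).mul (L2.aesm _)
  have hle : ∫⁻ ξ, ‖G ξ‖ₑ ^ 2 ≤ ‖f‖ₑ ^ 2 + axisEnergy f := by
    have h1 : ‖f‖ₑ ^ 2 = ∫⁻ ξ, ‖(𝓕 f : L2 d) ξ‖ₑ ^ 2 := by
      rw [← Lp_enorm_sq, ← ofReal_norm f, ← Lp.norm_fourier_eq, ofReal_norm]
    have h2 : ∀ ξ, ‖G ξ‖ₑ ^ 2 ≤ ‖(𝓕 f : L2 d) ξ‖ₑ ^ 2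
        + ∑ i, axisSymbol (ξ i) * ‖(𝓕 f : L2 d) ξ‖ₑ ^ 2 := fun ξ => by
      have h3 : ‖(jw (1 / 2) ξ : ℂ)‖ₑ ^ 2 = ENNReal.ofReal (jw 1 ξ) := by
        rw [← ofReal_norm, Complex.norm_real, Real.norm_of_nonneg (jw_pos _ _).le,
          ← ENNReal.ofReal_pow (jw_pos _ _).le, sq, ← jw_add]
        norm_num
      rw [enorm_mul, mul_pow, h3, ← Finset.sum_mul, ← one_add_mul]
      gcongr
      refine (ENNReal.ofReal_le_ofReal (jw_one_le ξ)).trans ?_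
      rw [ENNReal.ofReal_add zero_le_one (Finset.sum_nonneg fun i _ => abs_nonneg _),
        ENNReal.ofReal_one, ENNReal.ofReal_sum_of_nonneg fun i _ => abs_nonneg _]
      gcongr
      exact le_axisSymbol _
    refine (lintegral_mono h2).trans ?_
    rw [lintegral_add_left (hF.enorm.pow_const 2), ← h1, axisEnergy_eq,
      lintegral_finsetSum']
    intro i _
    have hm : Measurable axisSymbol := by
      unfold axisSymbol
      have hc : Continuous fun w : ℝ × ℝ => (Real.fourierChar (w.2 * w.1) : ℂ) - 1 :=
        (continuous_subtype_val.comp (Real.continuous_fourierChar.comp (by fun_prop))).sub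
          continuous_const
      have hw : Measurable fun w : ℝ × ℝ => ENNReal.ofReal (w.2 ^ 2)⁻¹ *
          ‖(Real.fourierChar (w.2 * w.1) : ℂ) - 1‖ₑ ^ 2 :=
        (by fun_prop : Measurable fun w : ℝ × ℝ => ENNReal.ofReal (w.2 ^ 2)⁻¹).mul
          (hc.enorm.measurable.pow_const 2)
      exact hw.lintegral_prod_right'
    have hi : Measurable fun ξ : Hor d => ξ i := (by fun_prop : Continuous fun ξ : Hor d => ξ i).measurable
    exact ((hm.comp hi).mul (hF.enorm.pow_const 2)).aemeasurable
  have hG : MemLp G 2 volume := memLp_two_iff.2 ⟨hGm, hle.trans_lt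
    (ENNReal.add_lt_top.2 ⟨by simp, h⟩)⟩
  refine ⟨𝓕⁻ (hG.toLp G), ?_, ?_⟩
  · rw [← besselPotential_half_eq_iff, besselPotential_eq_iff, FourierTransform.fourier_fourierInv_eq]
    exact MemLp.coeFn_toLp hG
  · rw [← ofReal_norm, Lp.norm_fourierInv_eq', ofReal_norm, Lp_enorm_sq]
    refine le_trans (le_of_eq (lintegral_congr_ae ?_)) hle
    filter_upwards [MemLp.coeFn_toLp hG] with ξ hξ
    rw [hξ]

lemma enorm_div_sub_div_sq_le {f f' : ℂ} {q q' : ℝ} (hq : 1 ≤ q) (hq' : 1 ≤ q') :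
    ‖f' / q' - f / q‖ₑ ^ 2 ≤ 8 * ‖f' - f‖ₑ ^ 2 + 2 * ‖(q' : ℂ) * f' - q * f‖ₑ ^ 2 := by
  have h1 : ‖f' / q' - f / q‖ ≤ 2 * ‖f' - f‖ + ‖(q' : ℂ) * f' - q * f‖ := by
    have hq0 : (q : ℂ) ≠ 0 := by exact_mod_cast (by linarith : q ≠ 0)
    have hq0' : (q' : ℂ) ≠ 0 := by exact_mod_cast (by linarith : q' ≠ 0)
    have e : f' / q' - f / q = (f' - f) / q' + (f' - f) / q
        - ((q' : ℂ) * f' - q * f) / (q * q') := by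
      field_simp
      ring
    have hn : ‖(q : ℂ)‖ = q := by rw [Complex.norm_real, Real.norm_of_nonneg (by linarith)]
    have hn' : ‖(q' : ℂ)‖ = q' := by rw [Complex.norm_real, Real.norm_of_nonneg (by linarith)]
    have h2 : ‖(f' - f) / q'‖ ≤ ‖f' - f‖ := by
      rw [norm_div, hn']; exact div_le_self (norm_nonneg _) hq'
    have h3 : ‖(f' - f) / q‖ ≤ ‖f' - f‖ := by
      rw [norm_div, hn]; exact div_le_self (norm_nonneg _) hq
    have h4 : ‖((q' : ℂ) * f' - q * f) / (q * q')‖ ≤ ‖(q' : ℂ) * f' - q * f‖ := by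
      rw [norm_div, norm_mul, hn, hn']; exact div_le_self (norm_nonneg _) (by nlinarith)
    rw [e]
    have h5 := norm_sub_le ((f' - f) / q' + (f' - f) / q) (((q' : ℂ) * f' - q * f) / (q * q'))
    have h6 := norm_add_le ((f' - f) / q') ((f' - f) / q)
    linarith
  have h2 : ‖f' / q' - f / q‖ ^ 2 ≤ 8 * ‖f' - f‖ ^ 2 + 2 * ‖(q' : ℂ) * f' - q * f‖ ^ 2 := by
    have h3 : ‖f' / q' - f / q‖ ^ 2 ≤ (2 * ‖f' - f‖ + ‖(q' : ℂ) * f' - q * f‖) ^ 2 := by gcongr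
    nlinarith [sq_nonneg (2 * ‖f' - f‖ - ‖(q' : ℂ) * f' - q * f‖)]
  have h3 := ENNReal.ofReal_le_ofReal h2
  rw [ENNReal.ofReal_add (by positivity) (by positivity), ENNReal.ofReal_mul (by norm_num),
    ENNReal.ofReal_mul (by norm_num), ENNReal.ofReal_pow (norm_nonneg _),
    ENNReal.ofReal_pow (norm_nonneg _), ENNReal.ofReal_pow (norm_nonneg _), ofReal_norm,
    ofReal_norm, ofReal_norm, ENNReal.ofReal_ofNat, ENNReal.ofReal_ofNat] at h3
  exact h3

lemma axisEnergy_div_le {f : Hor d → ℂ} {q : Hor d → ℝ} (hf : Measurable f)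
    (hq : ∀ x, 1 ≤ q x) :
    axisEnergy (fun x => f x / q x) ≤ 8 * axisEnergy f + 2 * axisEnergy fun x => (q x : ℂ) * f x := by
  have hm : ∀ {f : Hor d → ℂ}, Measurable f → ∀ i, Measurable fun w : ℝ × Hor d =>
      ‖f (w.2 + w.1 • basisVec i) - f w.2‖ₑ ^ 2 := fun hf i =>
    ((hf.comp (by fun_prop : Measurable fun w : ℝ × Hor d => w.2 + w.1 • (basisVec i : Hor d))).sub
      (hf.comp measurable_snd)).enorm.pow_const 2
  have hw : Measurable fun t : ℝ => ENNReal.ofReal (t ^ 2)⁻¹ := by fun_prop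
  unfold axisEnergy
  rw [Finset.mul_sum, Finset.mul_sum, ← Finset.sum_add_distrib]
  refine Finset.sum_le_sum fun i _ => ?_
  have hin : ∀ t : ℝ, ∫⁻ x, ‖f (x + t • basisVec i) / q (x + t • basisVec i) - f x / q x‖ₑ ^ 2
      ≤ 8 * (∫⁻ x, ‖f (x + t • basisVec i) - f x‖ₑ ^ 2)
        + 2 * ∫⁻ x, ‖(q (x + t • basisVec i) : ℂ) * f (x + t • basisVec i) - q x * f x‖ₑ ^ 2 :=
    fun t => by
      rw [← lintegral_const_mul' _ _ (by simp), ← lintegral_const_mul' _ _ (by simp)]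
      refine le_of_le_of_eq (lintegral_mono fun x => enorm_div_sub_div_sq_le (hq _) (hq _))
        (lintegral_add_left (((hm hf i).comp (measurable_prodMk_left (x := t))).const_mul 8) _)
  rw [← lintegral_const_mul' _ _ (by simp), ← lintegral_const_mul' _ _ (by simp)]
  refine le_of_le_of_eq (lintegral_mono fun t => ?_)
    (lintegral_add_left ((hw.mul (hm hf i).lintegral_prod_right').const_mul 8) _)
  refine (mul_le_mul_right (hin t) _).trans_eq ?_
  simp only [Pi.mul_apply]
  ring

/-- The inverse of a multiplier that is bounded from below is a multiplier. -/
lemma IsMult.inv {q : Hor d → ℝ} {M : ℝ} (h : IsMult q M) (hM : 0 ≤ M)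
    (hqm : Measurable q) (hq : ∀ x, 1 ≤ q x) :
    IsMult (fun x => 1 / q x) (1 + (8 + 2 * M ^ 2) * energyConst d) := by
  intro g
  obtain ⟨g₁, h1, h2⟩ := h g
  have hE := energyConst_nonneg d
  have hrm : AEStronglyMeasurable (fun x => ((1 / q x : ℝ) : ℂ)) volume :=
    Complex.continuous_ofReal.comp_aestronglyMeasurable
      (hqm.const_div 1).aestronglyMeasurable
  have hr1 : ∀ᵐ x, ‖((1 / q x : ℝ) : ℂ)‖ ≤ 1 := ae_of_all _ fun x => by
    have := hq x
    rw [Complex.norm_real, Real.norm_of_nonneg (by positivity), div_le_one (by linarith)]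
    exact this
  set y : L2 d := mulL2 hrm hr1 (toHalf g)
  have hy : y =ᵐ[volume] fun x => ((1 / q x : ℝ) : ℂ) * toHalf g x := coeFn_mulL2 _ _ _
  have hy' : y =ᵐ[volume] fun x => toHalf g x / q x := by
    filter_upwards [hy] with x hx
    rw [hx]
    push_cast
    ring
  have hyn : ‖y‖ ≤ ‖g‖ := by
    have := norm_mulL2_le hrm hr1 (toHalf g)
    rw [one_mul] at this
    exact this.trans (norm_toHalf_le g)
  have e8 : ∀ r : ℝ, 8 * ENNReal.ofReal r = ENNReal.ofReal (8 * r) := fun r => by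
    rw [ENNReal.ofReal_mul (by norm_num), ENNReal.ofReal_ofNat]
  have e2 : ∀ r : ℝ, 2 * ENNReal.ofReal r = ENNReal.ofReal (2 * r) := fun r => by
    rw [ENNReal.ofReal_mul (by norm_num), ENNReal.ofReal_ofNat]
  have hyE : axisEnergy y ≤ ENNReal.ofReal ((8 + 2 * M ^ 2) * energyConst d * ‖g‖ ^ 2) := by
    rw [axisEnergy_congr_ae hy']
    refine (axisEnergy_div_le (Lp.stronglyMeasurable _).measurable hq).trans ?_
    rw [← axisEnergy_congr_ae h1]
    calc _ ≤ 8 * (ENNReal.ofReal (energyConst d) * ‖g‖ₑ ^ 2)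
          + 2 * (ENNReal.ofReal (energyConst d) * ‖g₁‖ₑ ^ 2) := by
          gcongr <;> exact axisEnergy_toHalf_le _
      _ ≤ 8 * (ENNReal.ofReal (energyConst d) * ‖g‖ₑ ^ 2)
          + 2 * (ENNReal.ofReal (energyConst d) * (ENNReal.ofReal (M * ‖g‖)) ^ 2) := by
          gcongr
          rw [← ofReal_norm]
          exact ENNReal.ofReal_le_ofReal h2
      _ = _ := by
          rw [← ofReal_norm, ← ENNReal.ofReal_pow (norm_nonneg _), ← ENNReal.ofReal_pow (by positivity),
            ← ENNReal.ofReal_mul hE, ← ENNReal.ofReal_mul hE, e8, e2,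
            ← ENNReal.ofReal_add (by positivity) (by positivity)]
          congr 1
          ring
  obtain ⟨k, hk, hkn⟩ := exists_toHalf_of_axisEnergy y (hyE.trans_lt ENNReal.ofReal_lt_top)
  refine ⟨k, hk ▸ hy, ?_⟩
  have h3 : ‖k‖ₑ ^ 2 ≤ ENNReal.ofReal (‖g‖ ^ 2 + (8 + 2 * M ^ 2) * energyConst d * ‖g‖ ^ 2) := by
    refine hkn.trans ?_
    rw [ENNReal.ofReal_add (by positivity) (by positivity), ← ofReal_norm,
      ← ENNReal.ofReal_pow (norm_nonneg _)]
    gcongr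
  rw [← ofReal_norm, ← ENNReal.ofReal_pow (norm_nonneg _),
    ENNReal.ofReal_le_ofReal_iff (by positivity)] at h3
  set K := (8 + 2 * M ^ 2) * energyConst d
  have hK : 0 ≤ K := by positivity
  refine le_of_sq_le_sq (h3.trans ?_) (by positivity)
  nlinarith [sq_nonneg ‖g‖, mul_nonneg hK (sq_nonneg ‖g‖), mul_nonneg (mul_nonneg hK hK) (sq_nonneg ‖g‖)]

end WaterWaves

namespace WaterWaves

variable {d : ℕ}

open scoped FourierTransform RealInnerProductSpace

/-! ### Derivatives -/

/-- The symbol `2 i π ξᵢ ⟨ξ⟩⁻¹`. -/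
noncomputable def rieszSymbol (i : Fin d) (ξ : Hor d) : ℂ :=
  2 * Real.pi * Complex.I * ξ i * jw (-1) ξ

lemma aestronglyMeasurable_rieszSymbol (i : Fin d) :
    AEStronglyMeasurable (rieszSymbol i : Hor d → ℂ) volume := by
  have h1 : Continuous fun ξ : Hor d => (2 * Real.pi * Complex.I * ξ i : ℂ) := by fun_prop
  exact (h1.mul (Complex.continuous_ofReal.comp (continuous_jw (-1)))).aestronglyMeasurable

lemma norm_rieszSymbol_le (i : Fin d) : ∀ᵐ ξ : Hor d, ‖rieszSymbol i ξ‖ ≤ 2 * Real.pi :=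
  ae_of_all _ fun ξ => by
    have h1 : |ξ i| ≤ jw 1 ξ := (PiLp.norm_apply_le ξ i).trans (norm_le_jw_one ξ)
    have h2 : |ξ i| * jw (-1) ξ ≤ 1 := by
      rw [mul_comm]
      refine le_of_le_of_eq ?_ (jw_neg_mul 1 ξ)
      exact mul_le_mul_of_nonneg_left h1 (jw_pos _ _).le
    have h3 : ‖rieszSymbol i ξ‖ = 2 * Real.pi * (|ξ i| * jw (-1) ξ) := by
      rw [rieszSymbol]
      simp only [norm_mul, Complex.norm_real, Complex.norm_I, Complex.norm_ofNat,
        Real.norm_eq_abs, abs_of_pos Real.pi_pos, abs_of_pos (jw_pos (-1) ξ)]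
      ring
    rw [h3]
    have := Real.pi_pos
    nlinarith

/-- The operator `∂ᵢ ⟨D⟩⁻¹` on `L²`. -/
noncomputable def rieszOp (i : Fin d) (g : L2 d) : L2 d :=
  𝓕⁻ (mulL2 (aestronglyMeasurable_rieszSymbol i) (norm_rieszSymbol_le i) (𝓕 g))

lemma fourier_rieszOp (i : Fin d) (g : L2 d) :
    (𝓕 (rieszOp i g) : L2 d) =ᵐ[volume] fun ξ => rieszSymbol i ξ * (𝓕 g : L2 d) ξ := by
  rw [rieszOp, FourierTransform.fourier_fourierInv_eq]
  exact coeFn_mulL2 _ _ _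

lemma norm_rieszOp_le (i : Fin d) (g : L2 d) : ‖rieszOp i g‖ ≤ 2 * Real.pi * ‖g‖ := by
  rw [rieszOp, Lp.norm_fourierInv_eq', ← Lp.norm_fourier_eq g]
  exact norm_mulL2_le _ _ _

lemma continuous_rieszOp (i : Fin d) : Continuous (rieszOp i : L2 d → L2 d) :=
  (Lp.fourierTransformₗᵢ (Hor d) ℂ).symm.continuous.comp
    ((mulL2 (aestronglyMeasurable_rieszSymbol i) (norm_rieszSymbol_le i)).continuous.comp
      (Lp.fourierTransformₗᵢ (Hor d) ℂ).continuous)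

lemma fourier_lineDeriv_apply (v : L2 d) (i : Fin d) (χ : 𝓢(Hor d, ℂ)) :
    (𝓕 (distD v i) : 𝓢'(Hor d, ℂ)) χ
      = ∫ ξ, χ ξ * ((2 * Real.pi * Complex.I * ξ i) * (𝓕 v : L2 d) ξ) := by
  have htg : (fun ξ : Hor d => ((inner ℝ ξ (basisVec i) : ℝ) : ℂ)).HasTemperateGrowth := by fun_prop
  have h1 : (𝓕 (distD v i) : 𝓢'(Hor d, ℂ)) χ = (2 * Real.pi * Complex.I) *
      ((𝓕 v : L2 d) : 𝓢'(Hor d, ℂ)) (SchwartzMap.smulLeftCLM ℂ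
        (fun ξ : Hor d => ((inner ℝ ξ (basisVec i) : ℝ) : ℂ)) χ) := by
    rw [distD, TemperedDistribution.fourier_lineDerivOp_eq, Lp.fourier_toTemperedDistribution_eq]
    rfl
  rw [h1, Lp.toTemperedDistribution_apply, ← integral_const_mul]
  congr 1; ext ξ
  rw [SchwartzMap.smulLeftCLM_apply_apply htg, basisVec, EuclideanSpace.inner_single_right]
  simp only [smul_eq_mul, conj_trivial, one_mul]
  ring

lemma fourier_injective {T T' : 𝓢'(Hor d, ℂ)} (h : (𝓕 T : 𝓢'(Hor d, ℂ)) = 𝓕 T') : T = T' := by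
  have := congrArg (fun S : 𝓢'(Hor d, ℂ) => 𝓕⁻ S) h
  rwa [FourierTransform.fourierInv_fourier_eq, FourierTransform.fourierInv_fourier_eq] at this

/-- The distributional derivative maps `H^{1/2}` to `H^{-1/2}`. -/
lemma distD_toHalf (g : L2 d) (i : Fin d) : distD (toHalf g) i = toNegHalf (rieszOp i g) := by
  apply fourier_injective
  ext χ
  rw [fourier_lineDeriv_apply, toNegHalf, fourier_besselPotential_eq_smulLeftCLM_fourier_apply,
    Lp.fourier_toTemperedDistribution_eq, smulLeftCLM_jw_apply]
  refine integral_congr_ae ?_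
  filter_upwards [fourier_bessel neg_half_nonpos g, fourier_rieszOp i g] with ξ h1 h2
  rw [toHalf, h1, h2, rieszSymbol]
  have h3 : (jw (-(1 / 2)) ξ : ℂ) = (jw (1 / 2) ξ : ℂ) * (jw (-1) ξ : ℂ) := by
    rw [← Complex.ofReal_mul, ← jw_add]; norm_num
  rw [h3]
  ring

lemma abs_partialD_le {η : Hor d → ℝ} {K : ℝ≥0} (hη : LipschitzWith K η) (i : Fin d) (x : Hor d) :
    |partialD η i x| ≤ K := by
  have h1 := (fderiv ℝ η x).le_opNorm (basisVec i)
  have h2 := norm_fderiv_le_of_lipschitz ℝ hη (x₀ := x)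
  have h3 : ‖(basisVec i : Hor d)‖ = 1 := by simp [basisVec]
  rw [h3, mul_one, Real.norm_eq_abs] at h1
  exact h1.trans h2

lemma measurable_partialD (η : Hor d → ℝ) (i : Fin d) : Measurable (partialD η i) :=
  measurable_fderiv_apply_const ℝ η (basisVec i)

/-- The almost everywhere gradient of a Lipschitz function is its distributional gradient. -/
lemma ae_eq_partialD {η : Hor d → ℝ} {K : ℝ≥0} (hη : LipschitzWith K η) {v u : L2 d} {i : Fin d}
    (hv : v =ᵐ[volume] fun x => (η x : ℂ)) (hu : distD v i = (u : 𝓢'(Hor d, ℂ))) :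
    u =ᵐ[volume] fun x => (partialD η i x : ℂ) := by
  have hloc : LocallyIntegrable (fun x => (partialD η i x : ℂ)) volume := by
    refine (locallyIntegrable_const (K : ℝ)).mono
      (Complex.measurable_ofReal.comp (measurable_partialD η i)).aestronglyMeasurable
      (ae_of_all _ fun x => ?_)
    rw [Complex.norm_real, Real.norm_eq_abs]
    exact (abs_partialD_le hη i x).trans (le_abs_self _)
  refine ae_eq_of_integral_contDiff_smul_eq (L2.locallyIntegrable u) hloc fun g hg hgc => ?_
  have hg₁ : HasCompactSupport (Complex.ofRealCLM ∘ g) := hgc.comp_left rfl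
  have hg₂ : ContDiff ℝ ((⊤ : ℕ∞) : WithTop ℕ∞) (Complex.ofRealCLM ∘ g) := by fun_prop
  set χ : 𝓢(Hor d, ℂ) := hg₁.toSchwartzMap hg₂
  have hχ : ∀ x, χ x = (g x : ℂ) := fun x => rfl
  have hdχ : ∀ x, (∂_{basisVec i} χ : 𝓢(Hor d, ℂ)) x =
      ((lineDeriv ℝ g x (basisVec i) : ℝ) : ℂ) := fun x => by
    have hgd : DifferentiableAt ℝ g x := hg.differentiable (by simp) x
    rw [SchwartzMap.lineDerivOp_apply_eq_fderiv, hgd.lineDeriv_eq_fderiv]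
    exact congrArg (fun L => L (basisVec i)) ((Complex.ofRealCLM.hasFDerivAt.comp x
      hgd.hasFDerivAt).fderiv)
  have e1 := congrArg (fun T : 𝓢'(Hor d, ℂ) => T χ) hu
  simp only [distD, TemperedDistribution.lineDerivOp_apply_apply, Lp.toTemperedDistribution_apply] at e1
  have e2 : ∫ x, g x • u x = ∫ x, χ x • u x := by
    congr 1
  rw [e2, ← e1]
  obtain ⟨D, hD⟩ := ContDiff.lipschitzWith_of_hasCompactSupport hgc (hg.of_le (by simp) :
    ContDiff ℝ 1 g) one_ne_zero
  have e3 := hη.integral_lineDeriv_mul_eq (μ := volume) hD hgc (basisVec i)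
  have e4 : ∫ x, (-(∂_{basisVec i} χ : 𝓢(Hor d, ℂ))) x • v x
      = ((∫ x, lineDeriv ℝ g x (-basisVec i) * η x : ℝ) : ℂ) := by
    rw [← integral_complex_ofReal]
    refine integral_congr_ae ?_
    filter_upwards [hv] with x hx
    rw [hx, neg_apply, hdχ, lineDeriv_neg, smul_eq_mul]
    push_cast
    ring
  rw [e4, ← e3, ← integral_complex_ofReal]
  refine integral_congr_ae ?_
  filter_upwards [hη.ae_differentiableAt (μ := volume)] with x hx
  rw [hx.lineDeriv_eq_fderiv, Complex.real_smul, ← Complex.ofReal_mul, partialD, mul_comm]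

/-- The gradient of a Lipschitz function of `H^{s + 1/2}` is of class `H^{s - 1/2}`. -/
lemma exists_sobolev_partialD {s : ℝ} (hs : 1 / 2 ≤ s) {η : Hor d → ℝ} {K : ℝ≥0}
    (hη : LipschitzWith K η) {C : ℝ≥0} (hC : hsENormFun (s + 1 / 2) η ≤ C) (i : Fin d) :
    ∃ u A : L2 d, ((𝓕 u : L2 d) =ᵐ[volume] fun ξ => (jw (-(s - 1 / 2)) ξ : ℂ) * A ξ) ∧
      (u =ᵐ[volume] fun x => (partialD η i x : ℂ)) ∧ ‖A‖ ≤ 2 * Real.pi * (C + 1) := by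
  have h1 : hsENormFun (s + 1 / 2) η < (C + 1 : ℝ≥0) :=
    hC.trans_lt (by exact_mod_cast lt_add_one C)
  rw [hsENormFun, iInf_lt_iff] at h1
  obtain ⟨v, h1⟩ := h1
  rw [iInf_lt_iff] at h1
  obtain ⟨hv, h1⟩ := h1
  obtain ⟨g, hg⟩ := memSobolev_of_hsENorm_lt_top (h1.trans ENNReal.coe_lt_top)
  rw [hsENorm_of_eq hg] at h1
  have hgn : ‖g‖ ≤ C + 1 := by
    rw [enorm_eq_nnnorm] at h1
    exact_mod_cast h1.le
  rw [besselPotential_eq_iff] at hg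
  have hs' : -(s - 1 / 2) ≤ 0 := by linarith
  refine ⟨bessel hs' (rieszOp i g), 𝓕 (rieszOp i g), fourier_bessel hs' _,
    ae_eq_partialD hη hv ?_, ?_⟩
  · apply fourier_injective
    ext χ
    rw [fourier_lineDeriv_apply, Lp.fourier_toTemperedDistribution_eq,
      Lp.toTemperedDistribution_apply]
    refine integral_congr_ae ?_
    filter_upwards [fourier_bessel hs' (rieszOp i g), fourier_rieszOp i g, hg] with ξ e1 e2 e3
    rw [e1, e2, e3, rieszSymbol, smul_eq_mul]
    have e4 : (jw (-(s - 1 / 2)) ξ : ℂ) * ((jw (-1) ξ : ℂ) * (jw (s + 1 / 2) ξ : ℂ)) = 1 := by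
      rw [← Complex.ofReal_mul, ← Complex.ofReal_mul, ← jw_add, ← jw_add,
        show -(s - 1 / 2) + (-1 + (s + 1 / 2)) = 0 by ring, jw_zero, Complex.ofReal_one]
    linear_combination (-(χ ξ) * (2 * Real.pi * Complex.I * ξ i) * (𝓕 v : L2 d) ξ) * e4
  · rw [Lp.norm_fourier_eq]
    refine (norm_rieszOp_le i g).trans ?_
    have := Real.pi_pos
    gcongr

/-- Uniform bounds on the multipliers given by the slope. -/
lemma exists_isMult_slope (d : ℕ) {s : ℝ} (hs : 1 / 2 + (d : ℝ) / 2 < s) (hd : 1 ≤ d) (C : ℝ≥0) :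
    ∃ M : ℝ, 0 ≤ M ∧ ∀ (η : Hor d → ℝ) (K : ℝ≥0), LipschitzWith K η →
      hsENormFun (s + 1 / 2) η ≤ C → (∀ i, IsMult (partialD η i) M) ∧ IsMult (slopeWeight η) M := by
  have hd' : (1 : ℝ) ≤ d := by exact_mod_cast hd
  set M₁ : ℝ := 4 * weightNorm d (s - 1 / 2) * (2 * Real.pi * (C + 1)) with hM₁
  have hw := weightNorm_nonneg (d := d) (σ := s - 1 / 2)
  have hC := C.2
  have hπ := Real.pi_pos
  have hM₁0 : 0 ≤ M₁ := by positivity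
  set M₂ : ℝ := 1 + ∑ _i : Fin d, M₁ * M₁ with hM₂
  have hM₂0 : 0 ≤ M₂ := add_nonneg zero_le_one (Finset.sum_nonneg fun _ _ => by positivity)
  set M₃ : ℝ := 1 + (8 + 2 * M₂ ^ 2) * energyConst d
  have hM₃0 : 0 ≤ M₃ := by have := energyConst_nonneg d; positivity
  refine ⟨M₁ + M₃, by positivity, fun η K hη hηC => ?_⟩
  have h1 : ∀ i, IsMult (partialD η i) M₁ := fun i => by
    obtain ⟨u, A, hu, hup, hA⟩ := exists_sobolev_partialD (by linarith) hη hηC i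
    refine (isMult_of_sobolev (by linarith) (by linarith) hu hup).mono ?_
    exact mul_le_mul_of_nonneg_left hA (by positivity)
  refine ⟨fun i => (h1 i).mono (by linarith), ?_⟩
  have h2 : IsMult (fun x => 1 + ∑ i, partialD η i x * partialD η i x) M₂ :=
    IsMult.one.add (IsMult.sum _ fun i _ => (h1 i).mul hM₁0 (h1 i))
  have h3 : Measurable fun x => 1 + ∑ i, partialD η i x * partialD η i x :=
    measurable_const.add (Finset.measurable_sum _ fun i _ =>
      (measurable_partialD η i).mul (measurable_partialD η i))
  have h4 := (h2.inv hM₂0 h3 fun x => le_add_of_nonneg_right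
    (Finset.sum_nonneg fun i _ => mul_self_nonneg _)).mono (show M₃ ≤ M₁ + M₃ by linarith)
  refine h4.congr_ae (ae_of_all _ fun x => ?_)
  simp only [slopeWeight, pow_two]

lemma ae_abs_partialD_sub_le {η η' : Hor d → ℝ} (h : MemW1inf η) (h' : MemW1inf η') :
    ∀ᵐ x, ∀ i, |partialD η' i x - partialD η i x| ≤ w1infNorm (η' - η) := by
  filter_upwards [h.lipschitzWith.ae_differentiableAt (μ := volume),
    h'.lipschitzWith.ae_differentiableAt (μ := volume)] with x hx hx' i
  have h1 := abs_partialD_le (h'.sub h).lipschitzWith i x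
  rwa [partialD, fderiv_sub hx' hx] at h1

lemma abs_slopeWeight_sub_le {η η' : Hor d → ℝ} {x : Hor d} {ε : ℝ}
    (h : ∀ i, |partialD η' i x - partialD η i x| ≤ ε) :
    |slopeWeight η' x - slopeWeight η x| ≤ d * ε := by
  unfold slopeWeight
  set p := fun i => partialD η i x with hp
  set p' := fun i => partialD η' i x with hp'
  set q := 1 + ∑ i, p i ^ 2 with hq
  set q' := 1 + ∑ i, p' i ^ 2 with hq'
  have hq1 : ∀ i, 1 + p i ^ 2 ≤ q := fun i => by
    have := Finset.single_le_sum (fun j _ => sq_nonneg (p j)) (Finset.mem_univ i)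
    linarith
  have hq1' : ∀ i, 1 + p' i ^ 2 ≤ q' := fun i => by
    have := Finset.single_le_sum (fun j _ => sq_nonneg (p' j)) (Finset.mem_univ i)
    linarith
  have hq0 : 1 ≤ q := le_add_of_nonneg_right (Finset.sum_nonneg fun i _ => sq_nonneg _)
  have hq0' : 1 ≤ q' := le_add_of_nonneg_right (Finset.sum_nonneg fun i _ => sq_nonneg _)
  have hqq : 0 < q' * q := by positivity
  have e1 : 1 / q' - 1 / q = (q - q') / (q' * q) := by field_simp
  change |1 / q' - 1 / q| ≤ _
  rw [e1, abs_div, abs_of_pos hqq, div_le_iff₀ hqq]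
  have e2 : q - q' = ∑ i, (p i - p' i) * (p i + p' i) := by
    rw [hq, hq', add_sub_add_left_eq_sub, ← Finset.sum_sub_distrib]
    exact Finset.sum_congr rfl fun i _ => by ring
  rw [e2]
  refine (Finset.abs_sum_le_sum_abs _ _).trans ?_
  have e3 : ∀ i ∈ Finset.univ, |(p i - p' i) * (p i + p' i)| ≤ ε * (q' * q) := fun i _ => by
    rw [abs_mul, abs_sub_comm]
    have h1 : |p i + p' i| ≤ q' * q := by
      have h2 := hq1 i
      have h3 := hq1' i
      have h4 : |p i + p' i| ≤ (1 + p i ^ 2) / 2 + (1 + p' i ^ 2) / 2 :=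
        abs_le.2 ⟨by nlinarith [sq_nonneg (1 + p i), sq_nonneg (1 + p' i)],
          by nlinarith [sq_nonneg (1 - p i), sq_nonneg (1 - p' i)]⟩
      nlinarith
    exact mul_le_mul (h i) h1 (abs_nonneg _) ((abs_nonneg _).trans (h i))
  refine (Finset.sum_le_card_nsmul _ _ _ e3).trans_eq ?_
  rw [Finset.card_univ, Fintype.card_fin, nsmul_eq_mul, mul_assoc]

end WaterWaves

namespace WaterWaves

variable {d : ℕ}

lemma w1infNorm_le {η : Hor d → ℝ} {K : ℝ≥0} (hb : ∀ᵐ x, |η x| ≤ K) (hη : LipschitzWith K η) :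
    w1infNorm η ≤ K + K := by
  have h1 : eLpNorm η ⊤ volume ≤ K := by
    rw [eLpNorm_exponent_top]
    refine (eLpNormEssSup_le_of_ae_nnnorm_bound (C := K) ?_)
    filter_upwards [hb] with x hx
    exact_mod_cast hx
  have h2 : eLpNorm (fun x => fderiv ℝ η x) ⊤ volume ≤ K := by
    rw [eLpNorm_exponent_top]
    exact eLpNormEssSup_le_of_ae_nnnorm_bound (C := K)
      (ae_of_all _ fun x => norm_fderiv_le_of_lipschitz ℝ hη)
  exact ENNReal.toNNReal_mono (ENNReal.coe_ne_top (r := K + K)) (by push_cast; exact add_le_add h1 h2)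

lemma MemW1inf.lipschitzWith_add {η η' : Hor d → ℝ} (h : MemW1inf η) (h' : MemW1inf η') :
    LipschitzWith (w1infNorm η + w1infNorm (η' - η)) η' := by
  have h1 := h.lipschitzWith.add (h'.sub h).lipschitzWith
  simpa using h1

lemma tendsto_hsENorm_toNegHalf {x : L2 d} {xn : ℕ → L2 d} (h : Tendsto xn atTop (𝓝 x)) :
    Tendsto (fun n => hsENorm (-1 / 2) (toNegHalf (xn n) - toNegHalf x)) atTop (𝓝 0) := by
  simp_rw [← toNegHalf_sub, hsENorm_toNegHalf]
  have := (h.sub_const x).enorm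
  simpa using this

/-- Continuity of the Dirichlet-Neumann operator with respect to the domain and to the data. -/
lemma tendsto_dirichletNeumann {O : Set (Hor d × ℝ)} (hO : IsOpen O) (hconn : IsPreconnected O)
    {h : ℝ} (hh : 0 < h) {η : Hor d → ℝ} {ηn : ℕ → Hor d → ℝ} (hη : MemW1inf η)
    (hηn : ∀ n, MemW1inf (ηn n)) (hS : stripBelow η h ⊆ O) (hSn : ∀ n, stripBelow (ηn n) h ⊆ O)
    (hlim : Tendsto (fun n => w1infNorm (ηn n - η)) atTop (𝓝 0)) {g : L2 d} {gn : ℕ → L2 d}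
    (hg : Tendsto gn atTop (𝓝 g)) {b : L2 d} {bn : ℕ → L2 d}
    (hb : dirichletNeumann O η (toHalf g) = toNegHalf b)
    (hbn : ∀ n, dirichletNeumann O (ηn n) (toHalf (gn n)) = toNegHalf (bn n)) :
    Tendsto bn atTop (𝓝 b) := by
  obtain ⟨C, hC⟩ := exists_lipschitz_vertCutoff hh
  choose b' φ' Φ' hb' _ using fun n =>
    exists_dirichletNeumann_eq hO hconn (hηn n).lipschitzWith hh (hSn n) g
  set K : ℝ≥0 := w1infNorm η + 1
  set c₁ : ℝ≥0∞ := ENNReal.ofReal ((d + 1) ^ 2 * liftNorm d K ^ 2)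
  set c₂ : ℝ≥0∞ := ENNReal.ofReal (shapeConst d h C (K + K + w1infNorm η))
  have key : ∀ᶠ n in atTop, edist (bn n) b
      ≤ c₁ * ‖gn n - g‖ₑ + c₂ * (w1infNorm (ηn n - η) : ℝ≥0∞) * ‖g‖ₑ := by
    filter_upwards [hlim.eventually_le_const zero_lt_one] with n hn
    have hK : w1infNorm η + w1infNorm (ηn n - η) ≤ K := add_le_add le_rfl hn
    have hL : LipschitzWith K (ηn n) := (hη.lipschitzWith_add (hηn n)).weaken hK
    have hN : w1infNorm (ηn n) ≤ K + K := by
      refine w1infNorm_le (ae_of_all _ fun x => ?_) hL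
      have h1 := hη.abs_le x
      have h2 := ((hηn n).sub hη).abs_le x
      have h3 : ((w1infNorm η + w1infNorm (ηn n - η) : ℝ≥0) : ℝ) ≤ K := hK
      have h4 := abs_add_le (η x) ((ηn n - η) x)
      rw [Pi.sub_apply, add_sub_cancel] at h4
      push_cast at h3
      rw [Pi.sub_apply] at h2
      linarith
    have e1 := hsENorm_dirichletNeumann_sub_le hO hconn hL hh (hSn n) (gn n) g
    have e2 := hsENorm_dirichletNeumann_shape_sub_le hO hconn hh hC (hηn n) hη (hSn n) hS g
    rw [hbn, hb', ← toNegHalf_sub, hsENorm_toNegHalf, ← edist_eq_enorm_sub] at e1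
    rw [hb, hb', ← toNegHalf_sub, hsENorm_toNegHalf, ← edist_eq_enorm_sub] at e2
    refine (edist_triangle _ (b' n) _).trans (add_le_add e1 (e2.trans ?_))
    gcongr
    exact ENNReal.ofReal_le_ofReal (shapeConst_mono d hh C (by gcongr))
  rw [tendsto_iff_edist_tendsto_0]
  refine tendsto_of_tendsto_of_tendsto_of_le_of_le' tendsto_const_nhds ?_
    (Eventually.of_forall fun _ => bot_le) key
  have t1 : Tendsto (fun n => ‖gn n - g‖ₑ) atTop (𝓝 0) := by
    simpa using (hg.sub_const g).enorm
  have t2 : Tendsto (fun n => (w1infNorm (ηn n - η) : ℝ≥0∞)) atTop (𝓝 0) :=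
    ENNReal.tendsto_coe.2 hlim
  have t3 := (ENNReal.Tendsto.const_mul t1 (Or.inr (ENNReal.ofReal_ne_top : c₁ ≠ ⊤))).add
    (ENNReal.Tendsto.mul_const (ENNReal.Tendsto.const_mul t2
      (Or.inr (ENNReal.ofReal_ne_top : c₂ ≠ ⊤))) (Or.inr (enorm_ne_top : ‖g‖ₑ ≠ ⊤)))
  simpa using t3

section

variable {O : Set (Hor d × ℝ)} {η : Hor d → ℝ} {g b : L2 d} {M : ℝ} {T : Fin d → L2 d → L2 d}
  {S : L2 d → L2 d}

/-- `(1 + |D|²)^{-1/4}` applied to the numerator of `B(η)ψ`. -/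
noncomputable def numerRep (T : Fin d → L2 d → L2 d) (g b : L2 d) : L2 d :=
  b + ∑ i, T i (rieszOp i g)

lemma numerB_eq (hT : ∀ i, IsDualMult (partialD η i) (T i)) (h : ∀ i, IsMult (partialD η i) M)
    (hb : dirichletNeumann O η (toHalf g) = toNegHalf b) :
    numerB O η (toHalf g) = toNegHalf (numerRep T g b) := by
  rw [numerB, hb, numerRep, toNegHalf_add, toNegHalf_sum]
  simp_rw [distD_toHalf, (hT _).mulDist_eq (h _)]

lemma traceB_eq (hT : ∀ i, IsDualMult (partialD η i) (T i)) (h : ∀ i, IsMult (partialD η i) M)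
    (hS : IsDualMult (slopeWeight η) S) (h' : IsMult (slopeWeight η) M)
    (hb : dirichletNeumann O η (toHalf g) = toNegHalf b) :
    traceB O η (toHalf g) = toNegHalf (S (numerRep T g b)) := by
  rw [traceB, numerB_eq hT h hb, hS.mulDist_eq h']

lemma traceV_eq (hT : ∀ i, IsDualMult (partialD η i) (T i)) (h : ∀ i, IsMult (partialD η i) M)
    (hS : IsDualMult (slopeWeight η) S) (h' : IsMult (slopeWeight η) M)
    (hb : dirichletNeumann O η (toHalf g) = toNegHalf b) (i : Fin d) :
    traceV O η (toHalf g) i = toNegHalf (rieszOp i g - T i (S (numerRep T g b))) := by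
  rw [traceV, traceB_eq hT h hS h' hb, (hT i).mulDist_eq (h i), distD_toHalf, toNegHalf_sub]

lemma productsExist (hT : ∀ i, IsDualMult (partialD η i) (T i))
    (h : ∀ i, IsMult (partialD η i) M) (hS : IsDualMult (slopeWeight η) S)
    (h' : IsMult (slopeWeight η) M) (hb : dirichletNeumann O η (toHalf g) = toNegHalf b) :
    ProductsExist O η (toHalf g) := by
  refine ⟨fun i => ?_, ?_, fun i => ?_⟩
  · rw [distD_toHalf]
    exact ⟨_, (hT i).isProduct (h i) _⟩
  · rw [numerB_eq hT h hb]
    exact ⟨_, hS.isProduct h' _⟩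
  · rw [traceB_eq hT h hS h' hb]
    exact ⟨_, (hT i).isProduct (h i) _⟩

end

lemma exists_toHalf_of_hsENorm_lt_top {s : ℝ} (hs : 1 / 2 ≤ s) {ψ : L2 d}
    (h : hsENorm s (ψ : 𝓢'(Hor d, ℂ)) < ⊤) : ∃ g, ψ = toHalf g :=
  (memSobolev_half_iff ψ).1 ((memSobolev_of_hsENorm_lt_top h).mono hs)

lemma hsENorm_toHalf_sub (g g' : L2 d) :
    hsENorm (1 / 2) ((toHalf g : 𝓢'(Hor d, ℂ)) - (toHalf g' : 𝓢'(Hor d, ℂ))) = ‖g - g'‖ₑ := by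
  rw [← hsENorm_toHalf, map_sub, ← Lp.toTemperedDistributionCLM_apply,
    ← Lp.toTemperedDistributionCLM_apply, ← Lp.toTemperedDistributionCLM_apply, map_sub]

/-- Passing to the limit in the traces of the velocity. -/
lemma tendsto_traces (hd : 1 ≤ d) {O : Set (Hor d × ℝ)} (hO : IsOpen O) (hconn : IsPreconnected O)
    {h : ℝ} (hh : 0 < h) {s : ℝ} (hs : 1 / 2 + (d : ℝ) / 2 < s) {η : Hor d → ℝ} {ψ : L2 d}
    {ηn : ℕ → Hor d → ℝ} {ψn : ℕ → L2 d} (hη : MemW1inf η) (hηn : ∀ n, MemW1inf (ηn n))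
    (hS : stripBelow η h ⊆ O) (hSn : ∀ n, stripBelow (ηn n) h ⊆ O)
    (hηs : hsENormFun (s + 1 / 2) η < ⊤) (hψs : hsENorm (s + 1 / 2) (ψ : 𝓢'(Hor d, ℂ)) < ⊤)
    (hηns : ∃ C : ℝ≥0, ∀ n, hsENormFun (s + 1 / 2) (ηn n) ≤ C)
    (hψns : ∀ n, hsENorm (s + 1 / 2) (ψn n : 𝓢'(Hor d, ℂ)) < ⊤)
    (hlim : Tendsto (fun n => w1infNorm (ηn n - η)) atTop (𝓝 0))
    (hψ : Tendsto (fun n => hsENorm (1 / 2) ((ψn n : 𝓢'(Hor d, ℂ)) - (ψ : 𝓢'(Hor d, ℂ))))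
      atTop (𝓝 0)) :
    ProductsExist O η ψ ∧ (∀ n, ProductsExist O (ηn n) (ψn n)) ∧
    Tendsto (fun n => hsENorm (-1 / 2)
      (dirichletNeumann O (ηn n) (ψn n) - dirichletNeumann O η ψ)) atTop (𝓝 0) ∧
    Tendsto (fun n => hsENorm (-1 / 2) (traceB O (ηn n) (ψn n) - traceB O η ψ)) atTop (𝓝 0) ∧
    ∀ i, Tendsto (fun n => hsENorm (-1 / 2) (traceV O (ηn n) (ψn n) i - traceV O η ψ i))
      atTop (𝓝 0) := by
  have hs' : (1 : ℝ) / 2 ≤ s + 1 / 2 := by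
    have : (0 : ℝ) ≤ d := by positivity
    linarith
  obtain ⟨g, rfl⟩ := exists_toHalf_of_hsENorm_lt_top hs' hψs
  choose gn hgn using fun n => exists_toHalf_of_hsENorm_lt_top hs' (hψns n)
  obtain rfl : ψn = fun n => toHalf (gn n) := funext hgn
  have hg : Tendsto gn atTop (𝓝 g) := by
    rw [tendsto_iff_edist_tendsto_0]
    simpa only [edist_eq_enorm_sub, hsENorm_toHalf_sub] using hψ
  obtain ⟨Cs, hCs⟩ := hηns
  obtain ⟨M, hM, hmult⟩ := exists_isMult_slope d hs hd ((hsENormFun (s + 1 / 2) η).toNNReal + Cs)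
  obtain ⟨hD, hW⟩ := hmult η _ hη.lipschitzWith (by
    push_cast
    rw [ENNReal.coe_toNNReal hηs.ne]
    exact le_self_add)
  have hmultn := fun n => hmult (ηn n) _ (hηn n).lipschitzWith ((hCs n).trans (by
    push_cast
    exact le_add_self))
  choose T hT using fun i => (hD i).exists_dual
  obtain ⟨S, hSd⟩ := hW.exists_dual
  choose Tn hTn using fun n i => ((hmultn n).1 i).exists_dual
  choose Sn hSdn using fun n => (hmultn n).2.exists_dual
  obtain ⟨b, -, -, hb, -⟩ := exists_dirichletNeumann_eq hO hconn hη.lipschitzWith hh hS g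
  choose bn _ _ hbn _ using fun n =>
    exists_dirichletNeumann_eq hO hconn (hηn n).lipschitzWith hh (hSn n) (gn n)
  have hlim' : Tendsto (fun n => (w1infNorm (ηn n - η) : ℝ)) atTop (𝓝 0) := by
    exact NNReal.tendsto_coe.2 hlim
  have hlimd : Tendsto (fun n => (d : ℝ) * w1infNorm (ηn n - η)) atTop (𝓝 0) := by
    simpa using hlim'.const_mul (d : ℝ)
  have hae := fun n => ae_abs_partialD_sub_le hη (hηn n)
  have tb : Tendsto bn atTop (𝓝 b) :=
    tendsto_dirichletNeumann hO hconn hh hη hηn hS hSn hlim hg hb hbn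
  have tr : ∀ i, Tendsto (fun n => rieszOp i (gn n)) atTop (𝓝 (rieszOp i g)) := fun i =>
    ((continuous_rieszOp i).tendsto g).comp hg
  have tT : ∀ i {x : L2 d} {xn : ℕ → L2 d}, Tendsto xn atTop (𝓝 x) →
      Tendsto (fun n => Tn n i (xn n)) atTop (𝓝 (T i x)) := fun i x xn hx =>
    tendsto_dualMult (hT i) (fun n => hTn n i) (hD i) (fun n => (hmultn n).1 i) hM hlim'
      (fun n => (hae n).mono fun x hx => hx i) hx
  have tN : Tendsto (fun n => numerRep (Tn n) (gn n) (bn n)) atTop (𝓝 (numerRep T g b)) :=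
    tb.add (tendsto_finsetSum _ fun i _ => tT i (tr i))
  have tS : Tendsto (fun n => Sn n (numerRep (Tn n) (gn n) (bn n))) atTop
      (𝓝 (S (numerRep T g b))) :=
    tendsto_dualMult hSd hSdn hW (fun n => (hmultn n).2) hM hlimd
      (fun n => (hae n).mono fun x hx => abs_slopeWeight_sub_le hx) tN
  refine ⟨productsExist hT hD hSd hW hb,
    fun n => productsExist (hTn n) (hmultn n).1 (hSdn n) (hmultn n).2 (hbn n), ?_, ?_, fun i => ?_⟩
  · simp_rw [hb, hbn]
    exact tendsto_hsENorm_toNegHalf tb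
  · simp_rw [traceB_eq hT hD hSd hW hb,
      fun n => traceB_eq (hTn n) (hmultn n).1 (hSdn n) (hmultn n).2 (hbn n)]
    exact tendsto_hsENorm_toNegHalf tS
  · simp_rw [traceV_eq hT hD hSd hW hb i,
      fun n => traceV_eq (hTn n) (hmultn n).1 (hSdn n) (hmultn n).2 (hbn n) i]
    exact tendsto_hsENorm_toNegHalf ((tr i).sub (tT i tS))

end WaterWaves

theorem proposition5 (d : ℕ) (hd : 1 ≤ d) (O : Set (Hor d × ℝ)) (hO : IsOpen O)
    (hconn : IsConnected O) (h : ℝ) (hh : 0 < h) :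
    -- the operators are well defined
    (∀ (η : Hor d → ℝ) (f : L2 d), MemW1inf η → stripBelow η h ⊆ O →
      MemSobolev (1 / 2) 2 (f : 𝓢'(Hor d, ℂ)) → ∃! g, IsDirichletNeumann O η f g) ∧
    -- the Lipschitz estimate
    (∃ F : ℝ≥0 → ℝ≥0, Monotone F ∧
      ∀ (η₁ η₂ : Hor d → ℝ) (f : L2 d), MemW1inf η₁ → MemW1inf η₂ →
        stripBelow η₁ h ⊆ O → stripBelow η₂ h ⊆ O →
        MemSobolev (1 / 2) 2 (f : 𝓢'(Hor d, ℂ)) →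
        hsENorm (-1 / 2) (dirichletNeumann O η₁ f - dirichletNeumann O η₂ f) ≤
          (F (w1infNorm η₁ + w1infNorm η₂) : ℝ≥0∞) * (w1infNorm (η₁ - η₂) : ℝ≥0∞) *
            hsENorm (1 / 2) (f : 𝓢'(Hor d, ℂ))) ∧
    -- passing to the limit
    (∀ (s : ℝ), 1 / 2 + (d : ℝ) / 2 < s →
      ∀ (η : Hor d → ℝ) (ψ : L2 d) (ηn : ℕ → Hor d → ℝ) (ψn : ℕ → L2 d),
        MemW1inf η → (∀ n, MemW1inf (ηn n)) →
        stripBelow η h ⊆ O → (∀ n, stripBelow (ηn n) h ⊆ O) →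
        hsENormFun (s + 1 / 2) η < ⊤ → hsENorm (s + 1 / 2) (ψ : 𝓢'(Hor d, ℂ)) < ⊤ →
        (∃ C : ℝ≥0, ∀ n, hsENormFun (s + 1 / 2) (ηn n) ≤ C) →
        (∃ C : ℝ≥0, ∀ n, hsENorm (s + 1 / 2) (ψn n : 𝓢'(Hor d, ℂ)) ≤ C) →
        Tendsto (fun n => w1infNorm (ηn n - η)) atTop (𝓝 0) →
        Tendsto (fun n => hsENorm (1 / 2) ((ψn n : 𝓢'(Hor d, ℂ)) - (ψ : 𝓢'(Hor d, ℂ))))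
          atTop (𝓝 0) →
        ProductsExist O η ψ ∧ (∀ n, ProductsExist O (ηn n) (ψn n)) ∧
        Tendsto (fun n => hsENorm (-1 / 2)
          (dirichletNeumann O (ηn n) (ψn n) - dirichletNeumann O η ψ)) atTop (𝓝 0) ∧
        Tendsto (fun n => hsENorm (-1 / 2) (traceB O (ηn n) (ψn n) - traceB O η ψ))
          atTop (𝓝 0) ∧
        ∀ i, Tendsto (fun n => hsENorm (-1 / 2)
          (traceV O (ηn n) (ψn n) i - traceV O η ψ i)) atTop (𝓝 0)) := by
  have hc := hconn.isPreconnected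
  refine ⟨fun η f hη hS hf => ?_, ?_, ?_⟩
  · obtain ⟨g, rfl⟩ := (memSobolev_half_iff f).1 hf
    exact existsUnique_isDirichletNeumann hO hc hη.lipschitzWith hh hS g
  · obtain ⟨C, hC⟩ := exists_lipschitz_vertCutoff hh
    refine ⟨fun N => (shapeConst d h C N).toNNReal,
      fun _ _ hN => Real.toNNReal_mono (shapeConst_mono d hh C hN), ?_⟩
    intro η₁ η₂ f h₁ h₂ hS₁ hS₂ hf
    obtain ⟨g, rfl⟩ := (memSobolev_half_iff f).1 hf
    rw [hsENorm_toHalf]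
    exact hsENorm_dirichletNeumann_shape_sub_le hO hc hh hC h₁ h₂ hS₁ hS₂ g
  · rintro s hs η ψ ηn ψn hη hηn hS hSn hηs hψs hηns ⟨Cψ, hCψ⟩ hlim hψ
    exact tendsto_traces hd hO hc hh hs hη hηn hS hSn hηs hψs hηns
      (fun n => (hCψ n).trans_lt ENNReal.coe_lt_top) hlim hψ
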